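/- **Setting.** Let $(M,\omega)$ be a compact connected symplectic manifold of dimension $2n$ and $(L,\nabla)$ a prequantization bundle: a Hermitian line bundle with a Hermitian connection of curvature $\frac1i\omega$. Let $\mathcal J$ be the set of smooth almost complex structures $j$ with $\omega(j\cdot,j\cdot)=\omega$ and $\omega(v,jv)>0$ for $v\ne0$. For $j\in\mathcal J$ let $\Lambda^{n,0}_jT^*M$ be the line bundle of $j$-complex linear $n$-forms, with the scalar product $\langle\alpha,\beta\rangle=i^{n(2-n)}\,\alpha\wedge\bar\beta/\omega^{\wedge n}$. For $j_a,j_b\in\mathcal J$ let $\Psi_{j_a,j_b}:\Lambda^{n,0}_{j_a}T^*M\to\Lambda^{n,0}_{j_b}T^*M$ be the isomorphism defined by $\Psi_{j_a,j_b}(\alpha)\wedge\bar\beta=\alpha\wedge\bar\beta$ for all $\alpha,\beta\in\Lambda^{n,0}_{j_a}T^*M$. Let $(\delta_j,\varphi_j)_{j\in\mathcal J}$ be a smooth family of half-form bundles: $\delta_j=\delta$ is a fixed complex line bundle and $\varphi_j:\delta^{2}\to\Lambda^{n,0}_jT^*M$ is an isomorphism of line bundles depending smoothly on $j$; $\delta_j$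 has the metric for which $\varphi_j$ is an isometry. A half-form bundle morphism $\Psi:\delta_{j_a}\to\delta_{j_b}$ is a line bundle morphism with $\varphi_{j_b}\circ\Psi^{2}=\Psi_{j_a,j_b}\circ\varphi_{j_a}$. Let $k\ge1$ be an integer. Put $\mathcal P_{k,j}=C^\infty(M,L^k\otimes\delta_j)$, with the scalar product given by the metrics of $L$ and $\delta_j$ and the Liouville measure. For $j$ integrable, let $\mathcal Q_{k,j}\subset\mathcal P_{k,j}$ be the subspace of holomorphic sections, and $\Pi_{k,j}$ the orthogonal projection onto $\mathcal Q_{k,j}$. On the bundle of the spaces $\mathcal P_{k,j}$ one has the connection $\nabla^{\mathcal P}$: along a smooth curve $t\mapsto j_t$ in $\mathcal J$, $(\nabla^{\mathcal P}_{\partial_t}s)_{t}=\frac{d}{dr}\big|_{r=t}\Psi_r^{-1}s_r$, where $\Psi_r:\delta_{j_t}\to\delta_{j_r}$ is the continuous family of half-form bundle morphisms with $\Psi_t=\mathrm{id}$. Where the $\mathcal Q_{k,j}$ form a smooth finite rank subbundle, they carry the connection $\nabla^{\mathcal Q}=\Pi_k\circ\nabla^{\mathcal P}$. Let $f\in C^\infty(M,\mathbb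 R)$, let $X$ be its Hamiltonian vector field, $\omega(X,\cdot)=-df$, with flow $\phi_t$, and let $\Phi_t=\exp(tf):L\to L$ be the lift $\Phi_t\xi=e^{-itf(x)}\mathcal T_t\xi$ ($\xi\in L_x$) of $\phi_t$, where $\mathcal T_t$ is the parallel transport of $L$ along the flow. Let $j_0\in\mathcal J$ and $j_t=\phi_t^*j_0$. Let $U_t:C^\infty(M,L^k\otimes\delta_{j_0})\to C^\infty(M,L^k\otimes\delta_{j_t})$ be the pull-back by $\Phi_t$ on the factor $L^k$ (that is, $(\Phi_t^*\alpha)(x)=\Phi_t^{-1}(\alpha(\phi_t(x)))$) and, on half-forms, by the lift $\phi_t^*:(\delta_{j_0})_{\phi_t(x)}\to(\delta_{j_t})_x$ with $\varphi_{j_t}((\phi_t^*\beta)^2)=\phi_t^*(\varphi_{j_0}(\beta^2))$ which is continuous in $(t,x)$ and equal to the identity at $t=0$. Let $$\operatorname{Op}_k(f)=f+\tfrac1{ik}\bigl(\nabla^{L^k}_X\otimes\mathrm{id}+\mathrm{id}\otimes D_X\bigr)\quad\text{on }\mathcal P_{k,j_0},$$ where $D_X$ acts on the sections of $\delta_{j_0}$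 and is determined by $p_{j_0}\mathcal L_X\varphi_{j_0}(\beta^2)=2\varphi_{j_0}(\beta\otimes D_X\beta)$, with $p_{j_0}$ the projection of $\Lambda^nT^*M\otimes\mathbb C$ onto $\Lambda^{n,0}_{j_0}T^*M$ whose kernel is the sum of the forms of the other types. For $j_0$ integrable let $\mathcal Q_k(f)=\Pi_{k,j_0}\operatorname{Op}_k(f)$ on $\mathcal Q_{k,j_0}$. **Statement.** 1. The parallel transport $\mathcal T^{\mathcal P}_t:\mathcal P_{k,j_0}\to\mathcal P_{k,j_t}$ along $t\mapsto j_t$, $t\in\mathbb R$, for the connection $\nabla^{\mathcal P}$ exists, is unique and bijective. For each $s_0\in\mathcal P_{k,j_0}$ one has $U_ts_0\in\mathcal P_{k,j_t}$, and $P_t=(\mathcal T^{\mathcal P}_t)^{-1}\circ U_t$ is such that $P_ts_0$ is smooth in $(t,x)$ and $$\frac1{ik}\frac{d}{dt}P_ts_0=\operatorname{Op}_k(f)\,P_ts_0\qquad(t\in\mathbb R).$$ 2. Assume that $j_0$ is integrable and that the spaces $\mathcal Q_{k,j_t}$, $t\in\mathbb R$, form a smooth subbundle of finite rank of the bundle of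 the $\mathcal P_{k,j_t}$ over the curve $t\mapsto j_t$. Then the parallel transport $\mathcal T^{\mathcal Q}_t:\mathcal Q_{k,j_0}\to\mathcal Q_{k,j_t}$ along $t\mapsto j_t$ for the connection $\nabla^{\mathcal Q}$ exists, is unique and bijective. For each $s_0\in\mathcal Q_{k,j_0}$ one has $U_ts_0\in\mathcal Q_{k,j_t}$, and $P^{\mathcal Q}_t=(\mathcal T^{\mathcal Q}_t)^{-1}\circ U_t$ is such that $P^{\mathcal Q}_ts_0$ is smooth in $(t,x)$ and $$\frac1{ik}\frac{d}{dt}P^{\mathcal Q}_ts_0=\mathcal Q_k(f)\,P^{\mathcal Q}_ts_0\qquad(t\in\mathbb R).$$ -/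

import Mathlib

open Bundle Set MeasureTheory
open scoped Manifold ContDiff Topology TensorProduct InnerProductSpace ComplexConjugate

noncomputable section

namespace HalfFormQuantization

/-! ### Tangent vectors, forms and almost complex structures

All manifolds are smooth, real, of dimension `2n`, modelled on `ℝⁿ ⊕ ℝⁿ`. -/

/-- The model space `ℝ²ⁿ = ℝⁿ ⊕ ℝⁿ`. -/
abbrev Model (n : ℕ) : Type := EuclideanSpace ℝ (Fin n ⊕ Fin n)

/-- The tangent space `T_x M`. -/
abbrev Tan (n : ℕ) {M : Type*} [TopologicalSpace M] [ChartedSpace (Model n) M] (x : M) : Type :=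
  TangentSpace 𝓘(ℝ, Model n) x

/-- The space `Λⁿ T_x^*M ⊗ ℂ` of complex valued alternating `n`-forms on `T_x M`. -/
abbrev NForm (n : ℕ) {M : Type*} [TopologicalSpace M] [ChartedSpace (Model n) M] (x : M) : Type :=
  Tan n x [⋀^Fin n]→L[ℝ] ℂ

/-- Fields of endomorphisms of the tangent bundle (almost complex structures are among them). -/
abbrev EndField (n : ℕ) (M : Type*) [TopologicalSpace M] [ChartedSpace (Model n) M] : Type _ :=
  ∀ x : M, Tan n x →L[ℝ] Tan n x

section Geometry

variable {n : ℕ} {M : Type*} [TopologicalSpace M] [ChartedSpace (Model n) M]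

/-- Smooth vector fields. -/
def SmoothVF [IsManifold 𝓘(ℝ, Model n) ∞ M] (X : ∀ x : M, Tan n x) : Prop :=
  ContMDiff 𝓘(ℝ, Model n) 𝓘(ℝ, Model n).tangent ∞
    (fun x => (⟨x, X x⟩ : TangentBundle 𝓘(ℝ, Model n) M))

/-- `dg_x(v)` for a complex valued function `g`. -/
def dC (g : M → ℂ) (x : M) (v : Tan n x) : ℂ := mvfderiv 𝓘(ℝ, Model n) g x v

/-- `df_x` for a real valued function `f`. -/
def dR (f : M → ℝ) (x : M) : Tan n x →L[ℝ] ℝ := mvfderiv 𝓘(ℝ, Model n) f x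

/-- A symplectic form: a smooth, alternating, nondegenerate and closed bilinear form. -/
structure IsSymplectic [IsManifold 𝓘(ℝ, Model n) ∞ M]
    (Ω : ∀ x : M, Tan n x →L[ℝ] Tan n x →L[ℝ] ℝ) : Prop where
  smooth : ContMDiff 𝓘(ℝ, Model n)
    (𝓘(ℝ, Model n).prod 𝓘(ℝ, Model n →L[ℝ] Model n →L[ℝ] ℝ)) ∞
    (fun x => TotalSpace.mk' (Model n →L[ℝ] Model n →L[ℝ] ℝ)
      (E := fun x : M => Tan n x →L[ℝ] Tan n x →L[ℝ] ℝ) x (Ω x))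
  alternating : ∀ x v, Ω x v v = 0
  nondegenerate : ∀ x v, (∀ w, Ω x v w = 0) → v = 0
  closed : ∀ X Y Z : (∀ x : M, Tan n x), SmoothVF X → SmoothVF Y → SmoothVF Z → ∀ x,
    dR (fun y => Ω y (Y y) (Z y)) x (X x) - dR (fun y => Ω y (X y) (Z y)) x (Y x)
      + dR (fun y => Ω y (X y) (Y y)) x (Z x)
      - Ω x (VectorField.mlieBracket 𝓘(ℝ, Model n) X Y x) (Z x)
      + Ω x (VectorField.mlieBracket 𝓘(ℝ, Model n) X Z x) (Y x)
      - Ω x (VectorField.mlieBracket 𝓘(ℝ, Model n) Y Z x) (X x) = 0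

/-- The Hamiltonian vector field `X` of `f`, with the convention `Ω(X, ·) = -df`. -/
def hamVF (Ω : ∀ x : M, Tan n x →L[ℝ] Tan n x →L[ℝ] ℝ) (f : M → ℝ) (x : M) : Tan n x :=
  (Ω x).inverse (-(dR f x))

/-- `φ` is the (global, smooth) flow of the vector field `X`. -/
structure IsFlow (X : ∀ x : M, Tan n x) (φ : ℝ → M → M) : Prop where
  smooth : ContMDiff (𝓘(ℝ, ℝ).prod 𝓘(ℝ, Model n)) 𝓘(ℝ, Model n) ∞ (fun p : ℝ × M => φ p.1 p.2)
  zero : ∀ x, φ 0 x = x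
  integralCurve : ∀ x, IsMIntegralCurve (I := 𝓘(ℝ, Model n)) (fun t => φ t x) X

/-- The space `𝒥` of smooth almost complex structures which are compatible with `Ω` and
positive. -/
structure IsCompatible [IsManifold 𝓘(ℝ, Model n) ∞ M]
    (Ω : ∀ x : M, Tan n x →L[ℝ] Tan n x →L[ℝ] ℝ) (j : EndField n M) : Prop where
  smooth : ContMDiff 𝓘(ℝ, Model n) (𝓘(ℝ, Model n).prod 𝓘(ℝ, Model n →L[ℝ] Model n)) ∞
    (fun x => TotalSpace.mk' (Model n →L[ℝ] Model n) (E := fun x : M => Tan n x →L[ℝ] Tan n x)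
      x (j x))
  sq : ∀ x v, j x (j x v) = -v
  compatible : ∀ x v w, Ω x (j x v) (j x w) = Ω x v w
  positive : ∀ x v, v ≠ 0 → 0 < Ω x v (j x v)

/-- Smooth curves in `𝒥`. -/
structure IsSmoothCurve [IsManifold 𝓘(ℝ, Model n) ∞ M]
    (Ω : ∀ x : M, Tan n x →L[ℝ] Tan n x →L[ℝ] ℝ) (c : ℝ → EndField n M) : Prop where
  compatible : ∀ t, IsCompatible Ω (c t)
  smooth : ContMDiff (𝓘(ℝ, ℝ).prod 𝓘(ℝ, Model n))
    (𝓘(ℝ, Model n).prod 𝓘(ℝ, Model n →L[ℝ] Model n)) ∞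
    (fun p : ℝ × M => TotalSpace.mk' (Model n →L[ℝ] Model n)
      (E := fun x : M => Tan n x →L[ℝ] Tan n x) p.2 (c p.1 p.2))

/-- The pull-back `φ^* j = (dφ)⁻¹ ∘ j ∘ dφ` of `j` by a diffeomorphism `φ`. -/
def pullbackEnd (φ : M → M) (j : EndField n M) : EndField n M := fun x =>
  (mfderiv 𝓘(ℝ, Model n) 𝓘(ℝ, Model n) φ x).inverse ∘L
    j (φ x) ∘L mfderiv 𝓘(ℝ, Model n) 𝓘(ℝ, Model n) φ x

/-- The line `Λ_j^{n,0} T_x^*M` of `n`-forms which are complex linear in each variable with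
respect to `j`. -/
def Lam (j : EndField n M) (x : M) : Submodule ℂ (NForm n x) where
  carrier := {α | ∀ (v : Fin n → Tan n x) (i : Fin n),
    α (Function.update v i (j x (v i))) = Complex.I * α v}
  add_mem' := by
    intro α β hα hβ v i
    simp only [ContinuousAlternatingMap.add_apply, hα v i, hβ v i, mul_add]
  zero_mem' := by
    intro v i
    simp
  smul_mem' := by
    intro c α hα v i
    simp only [ContinuousAlternatingMap.smul_apply, hα v i, smul_eq_mul]
    ring

/-- `α ∧ β̄`, for two complex valued `n`-forms at `x`; it is a `2n`-form. -/
def wedgeConj {x : M} (α β : NForm n x) : Tan n x [⋀^Fin n ⊕ Fin n]→ₗ[ℝ] ℂ :=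
  (LinearMap.mul' ℝ ℂ).compAlternatingMap
    (α.toAlternatingMap.domCoprod
      (Complex.conjAe.toLinearMap.compAlternatingMap β.toAlternatingMap))

/-- `α' = Ψ_{j_a, j_b}(α)`: here `α ∈ Λ_{j_a}^{n,0}`, `α' ∈ Λ_{j_b}^{n,0}` and
`α' ∧ β̄ = α ∧ β̄` for every `β ∈ Λ_{j_a}^{n,0}`. -/
def IsPsi (ja jb : EndField n M) {x : M} (α α' : NForm n x) : Prop :=
  α ∈ Lam ja x ∧ α' ∈ Lam jb x ∧ ∀ β ∈ Lam ja x, wedgeConj α' β = wedgeConj α β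

/-- The value at `(v₁, …, vₙ, vₙ₊₁, …, v₂ₙ)` of the `2n`-form `Ω^{∧n} = Ω ∧ ⋯ ∧ Ω`; the first `n`
vectors carry the indices `inl i`, the last `n` ones the indices `inr i`. The sum is `2ⁿ` times the
value of `Ω^{∧n}` at `(v₁, vₙ₊₁, v₂, vₙ₊₂, …)`, whence the sign. -/
def omegaPow (Ω : ∀ x : M, Tan n x →L[ℝ] Tan n x →L[ℝ] ℝ) {x : M}
    (v : Fin n ⊕ Fin n → Tan n x) : ℝ :=
  (-1) ^ (n * (n - 1) / 2) * (1 / 2) ^ n *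
    ∑ s : Equiv.Perm (Fin n ⊕ Fin n), ((Equiv.Perm.sign s : ℤ) : ℝ) *
      ∏ i : Fin n, Ω x (v (s (Sum.inl i))) (v (s (Sum.inr i)))

/-- The standard basis of `T_x M = ℝⁿ ⊕ ℝⁿ`. -/
def stdBasis (x : M) (a : Fin n ⊕ Fin n) : Tan n x := (EuclideanSpace.single a 1 : Model n)

/-- The scalar product `i^{n(2-n)} (α ∧ β̄) / Ω^{∧n}` of `α, β ∈ Λ_j^{n,0} T_x^*M`. The quotient of
the two `2n`-forms is computed on a basis. -/
def formInner (Ω : ∀ x : M, Tan n x →L[ℝ] Tan n x →L[ℝ] ℝ) {x : M} (α β : NForm n x) : ℂ :=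
  Complex.I ^ ((n : ℤ) * (2 - n)) * wedgeConj α β (stdBasis x) / (omegaPow Ω (stdBasis x) : ℂ)

/-- The projection `p_j` of `Λⁿ T_x^*M ⊗ ℂ` onto `Λ_j^{n,0} T_x^*M` with kernel the sum of the
spaces of forms of type `(n-1,1), …, (0,n)`: the value of `p_j α` at `(v₁, …, vₙ)` is the value of
the complex multilinear extension of `α` at the `(1,0)`-parts `½ (v_l - i j v_l)`. The form `α` is
given by its values. -/
def projN0 (j : EndField n M) {x : M} (α : (Fin n → Tan n x) → ℂ) (v : Fin n → Tan n x) : ℂ :=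
  (1 / 2) ^ n * ∑ S : Finset (Fin n), (-Complex.I) ^ S.card *
    α (fun i => if i ∈ S then j x (v i) else v i)

/-- The Lie derivative `d/dt|_{t=0} φ_t^* α` of a field of `n`-forms along the vector field with
flow `φ`. -/
def lieDeriv (φ : ℝ → M → M) (α : ∀ x : M, NForm n x) (x : M) (v : Fin n → Tan n x) : ℂ :=
  deriv (fun t => α (φ t x)
    (fun i => mfderiv 𝓘(ℝ, Model n) 𝓘(ℝ, Model n) (φ t) x (v i))) 0

/-- `g` is a `j`-holomorphic function on the open set `U`. -/
def HolFun (j : EndField n M) (U : Set M) (g : M → ℂ) : Prop :=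
  ContMDiffOn 𝓘(ℝ, Model n) 𝓘(ℝ, ℂ) ∞ g U ∧
    ∀ x ∈ U, ∀ v : Tan n x, dC g x (j x v) = Complex.I * dC g x v

/-- `z = (z₁, …, zₙ)` is a system of local `j`-holomorphic coordinates on the open set `U`: the
`z_i` are holomorphic and `dz : T_x M → ℂⁿ` is injective at each `x ∈ U`. -/
def HolCoord (j : EndField n M) (U : Set M) (z : Fin n → M → ℂ) : Prop :=
  (∀ i, HolFun j U (z i)) ∧ ∀ x ∈ U, ∀ v : Tan n x, (∀ i, dC (z i) x v = 0) → v = 0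

/-- `j` is integrable: there are local holomorphic coordinates around each point. -/
def IsIntegrable (j : EndField n M) : Prop :=
  ∀ x : M, ∃ (U : Set M) (z : Fin n → M → ℂ), IsOpen U ∧ x ∈ U ∧ HolCoord j U z

/-- The Liouville measure, given by `Ω^{∧n} / n!`. In a chart its density with respect to the
Lebesgue measure is the square root of the determinant of the matrix of `Ω`; the measures obtained
from the charts agree on overlaps and are glued by taking their supremum. -/
def liouville [MeasurableSpace M] (Ω : ∀ x : M, Tan n x →L[ℝ] Tan n x →L[ℝ] ℝ) : Measure M :=
  ⨆ x₀ : M, Measure.map (extChartAt 𝓘(ℝ, Model n) x₀).symm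
    (((volume : Measure (Model n)).restrict (extChartAt 𝓘(ℝ, Model n) x₀).target).withDensity
      (fun y => ENNReal.ofReal (Real.sqrt |Matrix.det (Matrix.of fun a b : Fin n ⊕ Fin n =>
        Ω ((extChartAt 𝓘(ℝ, Model n) x₀).symm y)
          (mfderiv 𝓘(ℝ, Model n) 𝓘(ℝ, Model n) (extChartAt 𝓘(ℝ, Model n) x₀).symm y
            (EuclideanSpace.single a 1 : Model n))
          (mfderiv 𝓘(ℝ, Model n) 𝓘(ℝ, Model n) (extChartAt 𝓘(ℝ, Model n) x₀).symm y
            (EuclideanSpace.single b 1 : Model n)))|)))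

end Geometry

/-! ### Hermitian line bundles with connection

`L` is a smooth complex line bundle whose fibres carry Hermitian scalar products. -/

section Prequantum

variable {n : ℕ} {M : Type*} [TopologicalSpace M] [ChartedSpace (Model n) M]
  (L : M → Type*) [TopologicalSpace (TotalSpace ℂ L)]

/-- A section of a complex line bundle is smooth on `U`. -/
def SmoothSecOn [∀ x, TopologicalSpace (L x)] [FiberBundle ℂ L] (U : Set M) (s : ∀ x, L x) :
    Prop :=
  ContMDiffOn 𝓘(ℝ, Model n) (𝓘(ℝ, Model n).prod 𝓘(ℝ, ℂ)) ∞
    (fun x => TotalSpace.mk' ℂ x (s x)) U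

variable {L} [∀ x, NormedAddCommGroup (L x)] [∀ x, InnerProductSpace ℂ (L x)] [FiberBundle ℂ L]

/-- `(L, ∇)` is a prequantization bundle of `(M, Ω)`: the scalar product of `L` is smooth, the
connection `∇` is complex linear and compatible with the scalar product, and its curvature is
`(1/i) Ω`. -/
structure IsPrequantization [IsManifold 𝓘(ℝ, Model n) ∞ M]
    (Ω : ∀ x : M, Tan n x →L[ℝ] Tan n x →L[ℝ] ℝ)
    (nab : CovariantDerivative 𝓘(ℝ, Model n) ℂ L) : Prop where
  smooth_inner : ∀ s t : (∀ x, L x), SmoothSecOn (n := n) L univ s →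
    SmoothSecOn (n := n) L univ t →
    ContMDiff 𝓘(ℝ, Model n) 𝓘(ℝ, ℂ) ∞ (fun x => ⟪s x, t x⟫_ℂ)
  complex_linear : ∀ s : (∀ x, L x), SmoothSecOn (n := n) L univ s → ∀ x v,
    nab (fun y => Complex.I • s y) x v = Complex.I • nab s x v
  metric : ∀ s t : (∀ x, L x), SmoothSecOn (n := n) L univ s → SmoothSecOn (n := n) L univ t →
    ∀ x v, dC (n := n) (fun y => ⟪s y, t y⟫_ℂ) x v = ⟪nab s x v, t x⟫_ℂ + ⟪s x, nab t x v⟫_ℂ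
  curvature : ∀ (X Y : ∀ x : M, Tan n x) (s : ∀ x, L x), SmoothVF X → SmoothVF Y →
    SmoothSecOn (n := n) L univ s → ∀ x,
    nab (fun y => nab s y (Y y)) x (X x) - nab (fun y => nab s y (X y)) x (Y x)
      - nab s x (VectorField.mlieBracket 𝓘(ℝ, Model n) X Y x)
      = ((1 / Complex.I) * (Ω x (X x) (Y x) : ℂ)) • s x

/-- The section `ξ` of `L` along the curve `γ` is parallel. As the connection is Hermitian, this
means `d/dt ⟪s(γ(t)), ξ(t)⟫ = ⟪(∇_{γ'} s)(γ(t)), ξ(t)⟫` for every smooth section `s` of `L`. -/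
def IsParallelAlong (nab : CovariantDerivative 𝓘(ℝ, Model n) ℂ L) (γ : ℝ → M)
    (ξ : ∀ t, L (γ t)) : Prop :=
  ∀ s : (∀ x, L x), SmoothSecOn (n := n) L univ s → ∀ t,
    HasDerivAt (fun t => ⟪s (γ t), ξ t⟫_ℂ)
      ⟪nab s (γ t) (mfderiv 𝓘(ℝ, ℝ) 𝓘(ℝ, Model n) γ t (1 : ℝ)), ξ t⟫_ℂ t

/-- `Φ_t = exp(t f)`: the automorphisms of the prequantization bundle which cover the Hamiltonian
flow `φ` of `f` and are given by `Φ_t ξ = e^{-itf(x)} 𝒯_t ξ` for `ξ ∈ L_x`, where `𝒯_t` is the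
parallel transport along the flow. -/
structure IsExp (nab : CovariantDerivative 𝓘(ℝ, Model n) ℂ L) (f : M → ℝ) (φ : ℝ → M → M)
    (Φ : ∀ t x, L x ≃ₗ[ℂ] L (φ t x)) : Prop where
  zero : ∀ (s : ∀ x, L x) (x : M), Φ 0 x (s x) = s (φ 0 x)
  parallel : ∀ (x : M) (ξ : L x), IsParallelAlong (n := n) nab (fun t => φ t x)
    (fun t => Complex.exp (Complex.I * t * f x) • Φ t x ξ)

/-- `s` is a holomorphic section of `L` on the open set `U`; the holomorphic structure of `L` is
given by the `(0,1)`-part of the connection. -/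
def HolSecL (nab : CovariantDerivative 𝓘(ℝ, Model n) ℂ L) (j : EndField n M) (U : Set M)
    (s : ∀ x, L x) : Prop :=
  SmoothSecOn (n := n) L U s ∧
    ∀ x ∈ U, ∀ v : Tan n x, nab s x (j x v) = Complex.I • nab s x v

end Prequantum

/-! ### Half-form bundles -/

section HalfForm

variable {n : ℕ} {M : Type*} [TopologicalSpace M] [ChartedSpace (Model n) M]
  [IsManifold 𝓘(ℝ, Model n) ∞ M] (Ω : ∀ x : M, Tan n x →L[ℝ] Tan n x →L[ℝ] ℝ)
  (δ : M → Type*) [TopologicalSpace (TotalSpace ℂ δ)] [∀ x, AddCommGroup (δ x)]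
  [∀ x, Module ℂ (δ x)] [∀ x, TopologicalSpace (δ x)] [FiberBundle ℂ δ]

/-- A smooth family of half-form bundles `(δ_j, φ_j)`, `j ∈ 𝒥`. The line bundles `δ_j` are all equal
to `δ`, and `φ_j : δ² → Λ_j^{n,0} T^*M` is an isomorphism of line bundles over the identity
of `M`, depending smoothly on the point of `M` and on `j`. The value of the map `form` at a `j` which
is not in `𝒥` is irrelevant. -/
structure HalfFormFamily where
  form : EndField n M → ∀ x : M, (δ x ⊗[ℂ] δ x) →ₗ[ℂ] NForm n x
  injective : ∀ j, IsCompatible Ω j → ∀ x, Function.Injective (form j x)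
  range_eq : ∀ j, IsCompatible Ω j → ∀ x, LinearMap.range (form j x) = Lam j x
  smooth : ∀ c : ℝ → EndField n M, IsSmoothCurve Ω c →
    ∀ (u w : ∀ x, δ x) (Y : Fin n → ∀ x : M, Tan n x), SmoothSecOn (n := n) δ univ u →
      SmoothSecOn (n := n) δ univ w → (∀ i, SmoothVF (Y i)) →
      ContMDiff (𝓘(ℝ, ℝ).prod 𝓘(ℝ, Model n)) 𝓘(ℝ, ℂ) ∞
        (fun p : ℝ × M => form (c p.1) p.2 (u p.2 ⊗ₜ[ℂ] w p.2) (fun i => Y i p.2))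

variable {Ω δ} (H : HalfFormFamily Ω δ)

/-- The multiplication by the function `ψ` is a half-form bundle morphism
`(j_a, δ, φ_{j_a}) → (j_b, δ, φ_{j_b})`, i.e. `φ_{j_b} ∘ ψ² = Ψ_{j_a, j_b} ∘ φ_{j_a}`. -/
def IsMorphism (ja jb : EndField n M) (ψ : M → ℂ) : Prop :=
  ∀ (x : M) (q : δ x ⊗[ℂ] δ x), IsPsi ja jb (H.form ja x q) ((ψ x) ^ 2 • H.form jb x q)

/-- The lift of the flow `φ` to the half-form bundles: the maps
`θ_t = φ_t^* : (δ_{j₀})_{φ_t(x)} → (δ_{φ_t^* j₀})_x` whose square corresponds to the pull-back of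
forms `φ_t^* : Λ_{j₀}^{n,0} T^*_{φ_t(x)}M → Λ_{φ_t^* j₀}^{n,0} T^*_x M`, chosen continuous and equal
to the identity at `t = 0`. -/
structure IsHalfFormLift (φ : ℝ → M → M) (j₀ : EndField n M)
    (θ : ∀ t x, δ (φ t x) →ₗ[ℂ] δ x) : Prop where
  zero : ∀ (u : ∀ x, δ x) (x : M), θ 0 x (u (φ 0 x)) = u x
  square : ∀ t x (u : δ (φ t x)) (v : Fin n → Tan n x),
    H.form (pullbackEnd (φ t) j₀) x (θ t x u ⊗ₜ[ℂ] θ t x u) v =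
      H.form j₀ (φ t x) (u ⊗ₜ[ℂ] u)
        (fun i => mfderiv 𝓘(ℝ, Model n) 𝓘(ℝ, Model n) (φ t) x (v i))
  continuous : ∀ u : (∀ x, δ x), SmoothSecOn (n := n) δ univ u →
    Continuous (fun p : ℝ × M => TotalSpace.mk' ℂ (E := δ) p.2 (θ p.1 p.2 (u (φ p.1 p.2))))

/-- `b = (D_X β)(x)`, where `φ` is the flow of `X` and `β` is a section of `δ_j` with `β(x) ≠ 0`,
i.e. `p_j ℒ_X φ_j(β²) = 2 φ_j(β ⊗ D_X β)` at `x`. -/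
def IsDX (φ : ℝ → M → M) (j : EndField n M) (β : ∀ x, δ x) (x : M) (b : δ x) : Prop :=
  β x ≠ 0 ∧ ∀ v : Fin n → Tan n x,
    projN0 j (lieDeriv φ (fun y => H.form j y (β y ⊗ₜ[ℂ] β y)) x) v =
      2 * H.form j x (β x ⊗ₜ[ℂ] b) v

/-- `β` is a holomorphic section of `δ_j` on the open set `U`: the `(n,0)`-form `φ_j(β²)` is locally
equal to `h dz₁ ∧ ⋯ ∧ dzₙ` with `z` holomorphic coordinates and `h` a holomorphic function. -/
def HolSecDelta (j : EndField n M) (U : Set M) (β : ∀ x, δ x) : Prop :=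
  SmoothSecOn (n := n) δ U β ∧
    ∀ x ∈ U, ∃ (W : Set M) (z : Fin n → M → ℂ) (h : M → ℂ), IsOpen W ∧ x ∈ W ∧ HolCoord j W z ∧
      HolFun j W h ∧ ∀ y ∈ W, ∀ v : Fin n → Tan n y,
        H.form j y (β y ⊗ₜ[ℂ] β y) v =
          h y * Matrix.det (Matrix.of fun a b : Fin n => dC (z a) y (v b))

end HalfForm

/-! ### Prequantum and quantum spaces -/

section Quantum

variable {n : ℕ} {M : Type*} [TopologicalSpace M] [ChartedSpace (Model n) M]
  [IsManifold 𝓘(ℝ, Model n) ∞ M] {Ω : ∀ x : M, Tan n x →L[ℝ] Tan n x →L[ℝ] ℝ}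
  {L : M → Type*} [TopologicalSpace (TotalSpace ℂ L)] [∀ x, NormedAddCommGroup (L x)]
  [∀ x, InnerProductSpace ℂ (L x)] [FiberBundle ℂ L] [VectorBundle ℂ ℂ L]
  {δ : M → Type*} [TopologicalSpace (TotalSpace ℂ δ)] [∀ x, AddCommGroup (δ x)]
  [∀ x, Module ℂ (δ x)] [∀ x, TopologicalSpace (δ x)] [FiberBundle ℂ δ] [VectorBundle ℂ ℂ δ]

variable (L δ) in
/-- The sections (of any regularity) of `L^k ⊗ δ`. -/
abbrev Sec (k : ℕ) : Type _ := ∀ x : M, (⨂[ℂ]^k (L x)) ⊗[ℂ] (δ x)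

/-- The power `u^{⊗k} ∈ L_x^k` of `u ∈ L_x`. -/
def tpow (k : ℕ) {x : M} (u : L x) : ⨂[ℂ]^k (L x) := PiTensorProduct.tprod ℂ (fun _ : Fin k => u)

/-- The derivative `∇_v (s^{⊗k})` at `x`, given by the Leibniz rule from `u = s(x)` and
`u' = (∇_v s)(x)`. -/
def tpowDeriv (k : ℕ) {x : M} (u u' : L x) : ⨂[ℂ]^k (L x) :=
  ∑ i : Fin k, PiTensorProduct.tprod ℂ (Function.update (fun _ : Fin k => u) i u')

/-- The coordinate on the fibre of `L^k ⊗ δ` at `x` induced by the preferred trivializations of `L`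
and `δ` at `x₀`. -/
def coef (k : ℕ) (x₀ x : M) : ((⨂[ℂ]^k (L x)) ⊗[ℂ] (δ x)) →ₗ[ℂ] ℂ :=
  LinearMap.mul' ℂ ℂ ∘ₗ TensorProduct.map
    (PiTensorProduct.lift ((MultilinearMap.mkPiAlgebra ℂ (Fin k) ℂ).compLinearMap
      (fun _ => (trivializationAt ℂ L x₀).linearMapAt ℂ x)))
    ((trivializationAt ℂ δ x₀).linearMapAt ℂ x)

/-- The value at `x` of the local frame of `L` given by the preferred trivialization at `x`. -/
def frameAt (E : M → Type*) [TopologicalSpace (TotalSpace ℂ E)] [∀ x, AddCommGroup (E x)]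
    [∀ x, Module ℂ (E x)] [∀ x, TopologicalSpace (E x)] [FiberBundle ℂ E] (x : M) : E x :=
  (trivializationAt ℂ E x).symm x 1

/-- The family `s_t`, `t ∈ S`, of sections of `L^k ⊗ δ` is smooth in `(t, x)`. -/
def SmoothFamilyOn {k : ℕ} (S : Set ℝ) (s : ℝ → Sec L δ k) : Prop :=
  ∀ t₀ ∈ S, ∀ x₀ : M, ContMDiffAt (𝓘(ℝ, ℝ).prod 𝓘(ℝ, Model n)) 𝓘(ℝ, ℂ) ∞
    (fun p : ℝ × M => coef k x₀ p.2 (s p.1 p.2)) (t₀, x₀)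

/-- The derivative of the family of sections `s` at time `t` is `s'`, i.e. in each fibre
`d/dt s_t(x) = s'(x)`. (A vector valued function on `ℝ` is differentiated by applying the linear
forms of its finite dimensional target.) -/
def HasTimeDeriv {k : ℕ} (s : ℝ → Sec L δ k) (s' : Sec L δ k) (t : ℝ) : Prop :=
  ∀ (x : M) (l : ((⨂[ℂ]^k (L x)) ⊗[ℂ] (δ x)) →ₗ[ℂ] ℂ),
    HasDerivAt (fun r => l (s r x)) (l (s' x)) t

variable (n L δ) in
/-- The prequantum space: the smooth sections of `L^k ⊗ δ_j`. As `δ_j = δ`, it does not depend on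
`j` as a vector space. -/
def preQ (k : ℕ) : Set (Sec L δ k) :=
  {s | ∀ x₀ : M, ContMDiffAt 𝓘(ℝ, Model n) 𝓘(ℝ, ℂ) ∞ (fun x => coef k x₀ x (s x)) x₀}

variable (nab : CovariantDerivative 𝓘(ℝ, Model n) ℂ L) (H : HalfFormFamily Ω δ)

/-- The quantum space: the holomorphic sections of `L^k ⊗ δ_j`. They are the sections which are
locally of the form `g s^k ⊗ β` with `s` and `β` nowhere vanishing holomorphic sections of `L`
and `δ_j`, and `g` a holomorphic function. -/
def quant (k : ℕ) (j : EndField n M) : Set (Sec L δ k) :=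
  {s | s ∈ preQ n L δ k ∧ ∀ x : M, ∃ (U : Set M) (a : ∀ x, L x) (β : ∀ x, δ x) (g : M → ℂ),
    IsOpen U ∧ x ∈ U ∧ HolSecL nab j U a ∧ HolSecDelta H j U β ∧ HolFun j U g ∧
    (∀ y ∈ U, a y ≠ 0 ∧ β y ≠ 0) ∧ ∀ y ∈ U, s y = g y • (tpow k (a y) ⊗ₜ[ℂ] β y)}

/-- The pointwise scalar product of `L^k ⊗ δ_j`. The Hermitian structure of `δ_j` is the one for
which `φ_j` is an isometry, so `‖β‖⁴ = ⟨φ_j(β²), φ_j(β²)⟩`. The scalar product is computed with the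
coordinates of both vectors in a frame of the line. -/
def fibreInner {k : ℕ} (j : EndField n M) (x : M) (s t : (⨂[ℂ]^k (L x)) ⊗[ℂ] (δ x)) : ℂ :=
  coef k x x s * conj (coef k x x t) * ((‖frameAt L x‖ ^ (2 * k) : ℝ) : ℂ) *
    ((Real.sqrt (formInner Ω (H.form j x (frameAt δ x ⊗ₜ[ℂ] frameAt δ x))
      (H.form j x (frameAt δ x ⊗ₜ[ℂ] frameAt δ x))).re : ℝ) : ℂ)

/-- The scalar product of sections of `L^k ⊗ δ_j`, with respect to the Liouville measure. -/
def secInner [MeasurableSpace M] {k : ℕ} (j : EndField n M) (s t : Sec L δ k) : ℂ :=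
  ∫ x, fibreInner H j x (s x) (t x) ∂(liouville Ω)

/-- `q = Π_{k,j} s`: the section `q` is the orthogonal projection of `s` onto the quantum space. -/
def IsProj [MeasurableSpace M] {k : ℕ} (j : EndField n M) (s q : Sec L δ k) : Prop :=
  q ∈ quant nab H k j ∧ ∀ r ∈ quant nab H k j, secInner H j (s - q) r = 0

/-- `s' = Op_k(f) s` in the prequantum space at `j`, where
`Op_k(f) = f + (1/ik) (∇_X^{L^k} ⊗ Id + Id ⊗ D_X)` with `X` the Hamiltonian vector field of `f` and
`φ` its flow. Near each point `s` is written as `g a^k ⊗ β` with a function `g` and sections `a`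
of `L` and `β` of `δ_j`, to which the Leibniz rule is applied. -/
def IsOp {k : ℕ} (f : M → ℝ) (φ : ℝ → M → M) (j : EndField n M) (s s' : Sec L δ k) : Prop :=
  ∀ x : M, ∃ (U : Set M) (a : ∀ x, L x) (β : ∀ x, δ x) (g : M → ℂ) (b : δ x),
    IsOpen U ∧ x ∈ U ∧ SmoothSecOn (n := n) L U a ∧ SmoothSecOn (n := n) δ U β ∧
    ContMDiffOn 𝓘(ℝ, Model n) 𝓘(ℝ, ℂ) ∞ g U ∧
    (∀ y ∈ U, s y = g y • (tpow k (a y) ⊗ₜ[ℂ] β y)) ∧ IsDX H φ j β x b ∧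
    s' x = (f x : ℂ) • s x + (1 / (Complex.I * k)) •
      (dC g x (hamVF Ω f x) • (tpow k (a x) ⊗ₜ[ℂ] β x)
        + g x • (tpowDeriv k (a x) (nab a x (hamVF Ω f x)) ⊗ₜ[ℂ] β x)
        + g x • (tpow k (a x) ⊗ₜ[ℂ] b))

/-- The action `U_t` of `exp(t f)`, from the sections of `L^k ⊗ δ_{j₀}` to those of
`L^k ⊗ δ_{φ_t^* j₀}`: the pull-back by `Φ_t` on the factor `L^k` and by the flow on the half-forms. -/
def action {k : ℕ} {φ : ℝ → M → M} (Φ : ∀ t x, L x ≃ₗ[ℂ] L (φ t x))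
    (θ : ∀ t x, δ (φ t x) →ₗ[ℂ] δ x) (t : ℝ) (s : Sec L δ k) : Sec L δ k := fun x =>
  TensorProduct.map (PiTensorProduct.map fun _ : Fin k => (Φ t x).symm.toLinearMap) (θ t x)
    (s (φ t x))

/-- `s' = ∇_{∂_t} s` at time `t`, for a family `s_r` of elements of the prequantum spaces at `c_r`,
`r ∈ ℝ`, where `c` is a curve of `𝒥`: the derivative at `r = t` of `ψ_r⁻¹ s_r`, with `ψ_r` the
continuous family of half-form bundle morphisms from `δ_{c_t}` to `δ_{c_r}` starting at the
identity. -/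
def HasCovDerivP {k : ℕ} (c : ℝ → EndField n M) (s : ℝ → Sec L δ k) (s' : Sec L δ k) (t : ℝ) :
    Prop :=
  ∃ ψ : ℝ → M → ℂ, Continuous (fun p : ℝ × M => ψ p.1 p.2) ∧ (∀ x, ψ t x = 1) ∧
    (∀ r, IsMorphism H (c t) (c r) (ψ r)) ∧ HasTimeDeriv (fun r x => (ψ r x)⁻¹ • s r x) s' t

/-- `s' = ∇_{∂_t} s` at time `t` for the connection `Π_k ∘ ∇` of the bundle of quantum spaces. -/
def HasCovDerivQ [MeasurableSpace M] {k : ℕ} (c : ℝ → EndField n M) (s : ℝ → Sec L δ k)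
    (s' : Sec L δ k) (t : ℝ) : Prop :=
  ∃ w : Sec L δ k, HasCovDerivP H c s w t ∧ IsProj nab H (c t) w s'

/-- Parallel sections of the bundle of prequantum spaces along the curve `c`. -/
def IsParallelP {k : ℕ} (c : ℝ → EndField n M) (s : ℝ → Sec L δ k) : Prop :=
  SmoothFamilyOn (n := n) univ s ∧ ∀ t, HasCovDerivP H c s 0 t

/-- Parallel sections of the bundle of quantum spaces along the curve `c`. -/
def IsParallelQ [MeasurableSpace M] {k : ℕ} (c : ℝ → EndField n M) (s : ℝ → Sec L δ k) : Prop :=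
  SmoothFamilyOn (n := n) univ s ∧ (∀ t, s t ∈ quant nab H k (c t)) ∧
    ∀ t, HasCovDerivQ nab H c s 0 t

/-- `T_t : V_0 → V_t` is the parallel transport along a curve, for a bundle with fibres `V_t` over
the curve whose parallel sections are given by `par`. -/
def IsParallelTransport {k : ℕ} (V : ℝ → Set (Sec L δ k)) (par : (ℝ → Sec L δ k) → Prop)
    (T : ∀ t, V 0 ≃ V t) : Prop :=
  ∀ s₀ : V 0, par (fun t => (T t s₀ : Sec L δ k)) ∧ (T 0 s₀ : Sec L δ k) = s₀

/-- The quantum spaces at `c_t`, `t ∈ ℝ`, form a smooth vector bundle of finite rank over the curve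
`c`, a subbundle of the bundle of prequantum spaces: locally they have a smooth frame. -/
def IsSubbundle (k : ℕ) (c : ℝ → EndField n M) : Prop :=
  ∀ t₀ : ℝ, ∃ (ε : ℝ) (d : ℕ) (e : Fin d → ℝ → Sec L δ k), 0 < ε ∧
    (∀ i, SmoothFamilyOn (n := n) (Ioo (t₀ - ε) (t₀ + ε)) (e i)) ∧
    ∀ t ∈ Ioo (t₀ - ε) (t₀ + ε), LinearIndependent ℂ (fun i => e i t) ∧
      (Submodule.span ℂ (range fun i => e i t) : Set (Sec L δ k)) = quant nab H k (c t)

end Quantum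

end HalfFormQuantization

end

open HalfFormQuantization

open Bundle Set MeasureTheory
open scoped Manifold ContDiff Topology TensorProduct InnerProductSpace ComplexConjugate

noncomputable section

set_option linter.unusedSectionVars false

namespace HalfFormQuantization

/-! ### Calculus -/

/-! Along a curve of complex structures the half-form part of the connection is scalar. Write p_a
for the projection onto the (n, 0)-forms of j_a. Since δ² is identified with both lines of forms,
p_a ∘ φ_{j_b} = κ φ_{j_a} for a function κ (`kappa`). The product α ∧ β̄ with β of type (n, 0) for
j_a depends only on p_a α (`wedge_congr_typeProj`), so Ψ_{j_a, j_b} is the inverse of p_a on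
Λ_{j_b}, and multiplication by ψ is a half-form morphism exactly when ψ² κ = 1 (`isMorphism_iff`).
Hence ∇_{∂_t} s = ∂_t s + ½ κ' s (`hasCovDerivP_iff`), parallel transport is multiplication by m_t =
exp(-½ ∫ κ'), and P_t = m_t⁻¹ U_t (`evolution`) is the pull-back by Φ_t on L^k tensored with m_t⁻¹
φ_t^* on half-forms (`halfPull`).

On L the derivative of Φ_t^* e is Φ_t^*(∇_X e + i f e). The lift preserves the connection
(`IsExp.nab_pull`): by Cartan's formula and the curvature, the connection form of the pulled back
frame and the pull-back of the connection form have the same time derivative. So the derivative is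
(∇_X + i f) Φ_t^* e; the k factors i f, divided by i k, give the term f of the operator. On
half-forms one differentiates squares at time 0: φ_t^* contributes the Lie derivative, and the
derivative of m_t² cancels that of κ, which leaves D_X (`IsHalfFormLift.isDX_of_hasDerivAt`). The
corrected lifts form a one-parameter group (`IsHalfFormLift.halfPull_add`), because their squares
satisfy the same differential equation and the remaining sign is continuous in time; this moves the
computation from time 0 to every time. The product rule yields the Schrödinger equation on the
prequantum space.

For the quantum spaces, Ω is preserved because it is the curvature of a preserved connection
(`IsExp.omega_mfderiv`). Hence the Liouville measure and the pointwise scalar products are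
preserved, and U_t is unitary (`secInner_action`). It maps holomorphic sections to holomorphic
sections, and constancy of the rank makes it onto (`exists_action_frame`). If e_i is a basis of the
quantum space at j₀ and σ_i is the derivative of P_t e_i at 0, the group law of P_t shows that ∑ c_i
U_t e_i has covariant derivative U_t(∑ c_i σ_i + c_i' e_i). By unitarity the projection may be taken
at j₀, and the parallel equation becomes c' = -A c with a constant matrix A, the compression of i k
Op_k(f) (`hasCovDerivQ_zero_iff`). So parallel transport is U_t exp(-t A) in these coordinates, and
the quantum evolution is exp(t A). -/

theorem hasFDerivAt_parametric_intervalIntegral {P G : Type} [NormedAddCommGroup P] [NormedSpace ℝ P]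
    [FiniteDimensional ℝ P] [NormedAddCommGroup G] [NormedSpace ℝ G] {F : P × ℝ → G}
    (hF : ContDiff ℝ 1 F) (p : P) :
    HasFDerivAt (fun p => ∫ s in (0:ℝ)..1, F (p, s))
      (∫ s in (0:ℝ)..1, (fderiv ℝ F (p, s)).comp (ContinuousLinearMap.inl ℝ P ℝ)) p := by
  have hF' : Continuous fun q : P × ℝ => (fderiv ℝ F q).comp (ContinuousLinearMap.inl ℝ P ℝ) :=
    (hF.continuous_fderiv one_ne_zero).clm_comp continuous_const
  obtain ⟨C, hC⟩ := ((isCompact_closedBall p 1).prod (isCompact_Icc (a := (0:ℝ)) (b := 1))).exists_bound_of_continuousOn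
    hF'.continuousOn
  refine intervalIntegral.hasFDerivAt_integral_of_dominated_of_fderiv_le (𝕜 := ℝ)
    (s := Metric.closedBall p 1) (bound := fun _ => C)
    (F' := fun p s => (fderiv ℝ F (p, s)).comp (ContinuousLinearMap.inl ℝ P ℝ))
    (Metric.closedBall_mem_nhds p one_pos) ?_ ?_ ?_ ?_ ?_ ?_
  · exact Filter.Eventually.of_forall fun x =>
      (hF.continuous.comp (by fun_prop : Continuous fun s : ℝ => (x, s))).aestronglyMeasurable
  · exact (hF.continuous.comp (by fun_prop : Continuous fun s : ℝ => (p, s))).intervalIntegrable _ _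
  · exact (hF'.comp (by fun_prop : Continuous fun s : ℝ => (p, s))).aestronglyMeasurable
  · refine Filter.Eventually.of_forall fun t ht x hx => hC (x, t) ⟨hx, ?_⟩
    rw [uIoc_of_le zero_le_one] at ht
    exact ⟨ht.1.le, ht.2⟩
  · exact intervalIntegrable_const
  · refine Filter.Eventually.of_forall fun t _ x _ => ?_
    have h1 : HasFDerivAt F (fderiv ℝ F (x, t)) (x, t) :=
      (hF.differentiable one_ne_zero _).hasFDerivAt
    have h2 : HasFDerivAt (fun x : P => (x, t)) (ContinuousLinearMap.inl ℝ P ℝ) x :=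
      hasFDerivAt_prodMk_left x t
    exact h1.comp x h2

/-- The derivative of the integral is the integral of a partial derivative, an integrand of the same
kind with values in linear maps; so the induction on `m` has to leave the target space `G` free. -/
theorem contDiff_nat_parametric_intervalIntegral {P : Type} [NormedAddCommGroup P] [NormedSpace ℝ P]
    [FiniteDimensional ℝ P] (m : ℕ) : ∀ {G : Type} [NormedAddCommGroup G] [NormedSpace ℝ G]
    {F : P × ℝ → G}, ContDiff ℝ ∞ F → ContDiff ℝ m (fun p => ∫ s in (0:ℝ)..1, F (p, s)) := by
  induction m with
  | zero =>
    intro G _ _ F hF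
    refine contDiff_zero.2 (intervalIntegral.continuous_parametric_intervalIntegral_of_continuous'
      (f := fun p s => F (p, s)) hF.continuous 0 1)
  | succ m ih =>
    intro G _ _ F hF
    refine (contDiff_succ_iff_hasFDerivAt (𝕜 := ℝ) (n := m)).2 ⟨_, ?_,
      hasFDerivAt_parametric_intervalIntegral (hF.of_le (by exact_mod_cast le_top))⟩
    exact ih ((hF.fderiv_right (by norm_num)).clm_comp contDiff_const)

/-- A substitution proportional to the endpoint turns the moving endpoint into a parameter of an
integral over `[0, 1]`. -/
theorem contDiff_parametric_primitive {E : Type} [NormedAddCommGroup E] [NormedSpace ℝ E]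
    [FiniteDimensional ℝ E] {F : ℝ × E → ℂ} (hF : ContDiff ℝ ∞ F) :
    ContDiff ℝ ∞ (fun p : ℝ × E => ∫ s in (0:ℝ)..p.1, F (s, p.2)) := by
  have h : ∀ p : ℝ × E, ∫ s in (0:ℝ)..p.1, F (s, p.2)
      = ∫ s in (0:ℝ)..1, (fun q : (ℝ × E) × ℝ => (q.1.1 : ℂ) * F (q.2 * q.1.1, q.1.2)) (p, s) := by
    intro p
    have := intervalIntegral.smul_integral_comp_mul_right (a := 0) (b := 1)
      (fun s => F (s, p.2)) p.1
    simp only [zero_mul, one_mul] at this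
    rw [← this]
    simp
  rw [funext h]
  refine contDiff_infty.2 fun m => contDiff_nat_parametric_intervalIntegral m
    (F := fun q : (ℝ × E) × ℝ => (q.1.1 : ℂ) * F (q.2 * q.1.1, q.1.2)) ?_
  have : ContDiff ℝ ∞ fun q : (ℝ × E) × ℝ => (q.1.1 : ℂ) :=
    Complex.ofRealCLM.contDiff.comp (contDiff_fst.fst)
  exact this.mul (hF.comp (by fun_prop))

section Manifold
variable {n : ℕ} {M : Type*} [TopologicalSpace M] [ChartedSpace (Model n) M]

/-- The scalar differential equations below that depend on a point of `M` are solved by such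
primitives. Time cannot be localised, since the integral starts at 0, but space can: the integral at
`x` only uses the values of `F` over `x`. -/
theorem contMDiff_parametric_primitive [IsManifold 𝓘(ℝ, Model n) ∞ M] {F : ℝ × M → ℂ}
    (hF : ContMDiff (𝓘(ℝ, ℝ).prod 𝓘(ℝ, Model n)) 𝓘(ℝ, ℂ) ∞ F) :
    ContMDiff (𝓘(ℝ, ℝ).prod 𝓘(ℝ, Model n)) 𝓘(ℝ, ℂ) ∞
      (fun p : ℝ × M => ∫ s in (0:ℝ)..p.1, F (s, p.2)) := by
  rintro ⟨t₀, x₀⟩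
  set e := extChartAt 𝓘(ℝ, Model n) x₀ with he
  have hT : e.target ∈ 𝓝 (e x₀) := extChartAt_target_mem_nhds x₀
  obtain ⟨r, hr, hball⟩ := Metric.nhds_basis_closedBall.mem_iff.1 hT
  let b : ContDiffBump (e x₀) := ⟨r / 2, r, half_pos hr, half_lt_self hr⟩
  -- The bump function makes the integrand smooth on the whole model space; at points where it is 1
  -- the integral is unchanged.
  let F' : ℝ × Model n → ℂ := fun p => (b p.2 : ℂ) * F (p.1, e.symm p.2)
  have hF' : ContDiff ℝ ∞ F' := by
    rw [contDiff_iff_contDiffAt]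
    rintro ⟨t, z⟩
    by_cases hz : z ∈ e.target
    · have h1 : ContMDiffAt (𝓘(ℝ, ℝ).prod 𝓘(ℝ, Model n)) 𝓘(ℝ, ℂ) ∞
          (fun p : ℝ × Model n => F (p.1, e.symm p.2)) (t, z) := by
        refine (hF.contMDiffAt (x := (t, e.symm z))).comp (t, z) ?_
        refine contMDiffAt_fst.prodMk ?_
        exact ((contMDiffOn_extChartAt_symm x₀).contMDiffAt
          ((isOpen_extChartAt_target x₀).mem_nhds hz)).comp (t, z) contMDiffAt_snd
      rw [← modelWithCornersSelf_prod, chartedSpaceSelf_prod] at h1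
      have h2 : ContDiffAt ℝ ∞ (fun p : ℝ × Model n => (b p.2 : ℂ)) (t, z) :=
        Complex.ofRealCLM.contDiff.contDiffAt.comp _ (b.contDiff.contDiffAt.comp (t, z) contDiffAt_snd)
      exact h2.mul h1.contDiffAt
    · have : (fun p : ℝ × Model n => F' p) =ᶠ[𝓝 (t, z)] fun _ => 0 := by
        have hz' : z ∉ Metric.closedBall (e x₀) r := fun h => hz (hball h)
        have : {p : ℝ × Model n | p.2 ∉ Metric.closedBall (e x₀) r} ∈ 𝓝 (t, z) :=
          (Metric.isClosed_closedBall.isOpen_compl.preimage continuous_snd).mem_nhds hz'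
        filter_upwards [this] with p hp
        have : b p.2 = 0 := by
          rw [← Function.notMem_support, b.support_eq]
          exact fun h => hp (Metric.ball_subset_closedBall h)
        simp [F', this]
      exact contDiffAt_const.congr_of_eventuallyEq this
  have hG : ContMDiff (𝓘(ℝ, ℝ).prod 𝓘(ℝ, Model n)) 𝓘(ℝ, ℂ) ∞
      (fun p : ℝ × Model n => ∫ s in (0:ℝ)..p.1, F' (s, p.2)) := by
    rw [← modelWithCornersSelf_prod, chartedSpaceSelf_prod]
    exact (contDiff_parametric_primitive hF').contMDiff
  have hG' : ContMDiffAt (𝓘(ℝ, ℝ).prod 𝓘(ℝ, Model n)) 𝓘(ℝ, ℂ) ∞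
      (fun p : ℝ × M => ∫ s in (0:ℝ)..p.1, F' (s, e p.2)) (t₀, x₀) := by
    refine (hG.contMDiffAt (x := (t₀, e x₀))).comp (t₀, x₀)
      (f := fun p : ℝ × M => ((p.1, e p.2) : ℝ × Model n)) ?_
    exact contMDiffAt_fst.prodMk (contMDiffAt_extChartAt.comp (t₀, x₀) contMDiffAt_snd)
  refine hG'.congr_of_eventuallyEq ?_
  have h1 : {p : ℝ × M | p.2 ∈ e.source ∩ e ⁻¹' Metric.ball (e x₀) (r/2)} ∈ 𝓝 (t₀, x₀) := by
    refine continuous_snd.continuousAt.preimage_mem_nhds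
      (Filter.inter_mem (extChartAt_source_mem_nhds x₀) ?_)
    exact (continuousAt_extChartAt x₀).preimage_mem_nhds (Metric.ball_mem_nhds _ (half_pos hr))
  filter_upwards [h1] with p hp
  have : b (e p.2) = 1 := b.one_of_mem_closedBall (Metric.ball_subset_closedBall hp.2)
  simp [F', this, e.left_inv hp.1]

end Manifold

/-! ### Smoothness at a point for complex valued functions -/

section Param
variable {E' H' N : Type*} [NormedAddCommGroup E'] [NormedSpace ℝ E'] [TopologicalSpace H']
  {J : ModelWithCorners ℝ E' H'} [TopologicalSpace N] [ChartedSpace H' N]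

/-- The partial derivative of a smooth function on `ℝ × N` in the real direction is smooth. -/
theorem ContMDiffAt.deriv_fst [IsManifold J ∞ N] {F : ℝ × N → ℂ} {g : N → ℝ} {x : N}
    (hF : ContMDiffAt (𝓘(ℝ, ℝ).prod J) 𝓘(ℝ, ℂ) ∞ F (g x, x)) (hg : ContMDiffAt J 𝓘(ℝ, ℝ) ∞ g x) :
    ContMDiffAt J 𝓘(ℝ, ℂ) ∞ (fun y => deriv (fun r => F (r, y)) (g y)) x := by
  have h := ContMDiffAt.mfderiv_apply (I := 𝓘(ℝ, ℝ)) (I' := 𝓘(ℝ, ℂ)) (n := ∞) (m := ∞)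
    (J := J) (N := N) (J' := J) (x₀ := x) (fun y r => F (r, y)) g (fun y => y) (fun _ => (1:ℝ))
    (by exact ContMDiffAt.comp (x, g x) (f := fun p : N × ℝ => (p.2, p.1)) hF (contMDiffAt_snd.prodMk contMDiffAt_fst))
    hg contMDiffAt_id contMDiffAt_const (by simp)
  refine h.congr_of_eventuallyEq (Filter.Eventually.of_forall fun y => ?_)
  simp [inTangentCoordinates_model_space, mfderiv_eq_fderiv]

theorem ContMDiff.deriv_fst' [IsManifold J ∞ N] {F : ℝ × N → ℂ}
    (hF : ContMDiff (𝓘(ℝ, ℝ).prod J) 𝓘(ℝ, ℂ) ∞ F) :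
    ContMDiff (𝓘(ℝ, ℝ).prod J) 𝓘(ℝ, ℂ) ∞ (fun p : ℝ × N => deriv (fun r => F (r, p.2)) p.1) := by
  intro p
  exact ContMDiffAt.deriv_fst (J := 𝓘(ℝ, ℝ).prod J) (N := ℝ × N)
    (F := fun q : ℝ × (ℝ × N) => F (q.1, q.2.2)) (g := Prod.fst) (x := p)
    ((hF.contMDiffAt (x := (p.1, p.2))).comp (p.1, p) (contMDiffAt_fst.prodMk (contMDiffAt_snd.comp _ contMDiffAt_snd)))
    contMDiffAt_fst

theorem ContMDiffAt.cmul {f g : N → ℂ} {x : N} (hf : ContMDiffAt J 𝓘(ℝ, ℂ) ∞ f x)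
    (hg : ContMDiffAt J 𝓘(ℝ, ℂ) ∞ g x) : ContMDiffAt J 𝓘(ℝ, ℂ) ∞ (fun y => f y * g y) x :=
  ((contDiff_fst.mul contDiff_snd : ContDiff ℝ ∞ fun p : ℂ × ℂ => p.1 * p.2).contMDiff.contMDiffAt
    (x := (f x, g x))).comp x (hf.prodMk_space hg)

theorem ContMDiffAt.cinv {f : N → ℂ} {x : N} (hf : ContMDiffAt J 𝓘(ℝ, ℂ) ∞ f x) (h : f x ≠ 0) :
    ContMDiffAt J 𝓘(ℝ, ℂ) ∞ (fun y => (f y)⁻¹) x :=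
  ContMDiffAt.comp (I' := 𝓘(ℝ, ℂ)) x (g := fun z : ℂ => z⁻¹) (contDiffAt_inv ℝ h).contMDiffAt hf

theorem ContMDiffAt.cdiv {f g : N → ℂ} {x : N} (hf : ContMDiffAt J 𝓘(ℝ, ℂ) ∞ f x)
    (hg : ContMDiffAt J 𝓘(ℝ, ℂ) ∞ g x) (h : g x ≠ 0) :
    ContMDiffAt J 𝓘(ℝ, ℂ) ∞ (fun y => f y / g y) x := by
  simp only [div_eq_mul_inv]
  exact ContMDiffAt.cmul hf (ContMDiffAt.cinv hg h)

theorem ContMDiffAt.cpow_nat {f : N → ℂ} {x : N} (hf : ContMDiffAt J 𝓘(ℝ, ℂ) ∞ f x) (k : ℕ) :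
    ContMDiffAt J 𝓘(ℝ, ℂ) ∞ (fun y => f y ^ k) x :=
  ContMDiffAt.comp (I' := 𝓘(ℝ, ℂ)) x (g := fun z : ℂ => z ^ k)
    (contDiff_id.pow k).contMDiff.contMDiffAt hf

theorem ContMDiffAt.cexp' {f : N → ℂ} {x : N} (hf : ContMDiffAt J 𝓘(ℝ, ℂ) ∞ f x) :
    ContMDiffAt J 𝓘(ℝ, ℂ) ∞ (fun y => Complex.exp (f y)) x :=
  ContMDiffAt.comp (I' := 𝓘(ℝ, ℂ)) x (g := fun z : ℂ => Complex.exp z)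
    (Complex.contDiff_exp (𝕜 := ℝ)).contMDiff.contMDiffAt hf

theorem ContMDiffAt.ofRealC {f : N → ℝ} {x : N} (hf : ContMDiffAt J 𝓘(ℝ, ℝ) ∞ f x) :
    ContMDiffAt J 𝓘(ℝ, ℂ) ∞ (fun y => (f y : ℂ)) x :=
  Complex.ofRealCLM.contDiff.contMDiff.contMDiffAt.comp x hf

/-- Half-forms bring in square roots, and the data only guarantee their continuity. Near `x` the
quotient `c y / c x` has positive real part, so `c y` is recovered from its square through the
principal logarithm. -/
theorem contMDiffAt_of_sq {c : N → ℂ} {x : N} (hc : ContinuousAt c x) (h0 : c x ≠ 0)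
    (h2 : ContMDiffAt J 𝓘(ℝ, ℂ) ∞ (fun y => c y ^ 2) x) : ContMDiffAt J 𝓘(ℝ, ℂ) ∞ c x := by
  have h3 : ContMDiffAt J 𝓘(ℝ, ℂ) ∞ (fun y => c x * Complex.exp (Complex.log (c y ^ 2 / (c x) ^ 2) / 2)) x := by
    have hlog : ContDiffAt ℝ ∞ (fun z : ℂ => c x * Complex.exp (Complex.log (z / (c x)^2) / 2)) (c x ^ 2) := by
      have h4 : ContDiffAt ℂ ∞ (fun z : ℂ => c x * Complex.exp (Complex.log (z / (c x)^2) / 2)) (c x ^ 2) := by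
        have : ContDiffAt ℂ ∞ (fun z : ℂ => Complex.log (z / (c x)^2)) (c x ^ 2) := by
          refine ContDiffAt.comp (𝕜 := ℂ) (c x ^ 2) (g := Complex.log) (f := fun z => z / (c x)^2) ?_ (by fun_prop)
          refine Complex.contDiffAt_log ?_
          rw [div_self (pow_ne_zero 2 h0)]; simp
        exact contDiffAt_const.mul ((this.div_const 2).cexp)
      exact h4.restrict_scalars ℝ
    exact ContMDiffAt.comp (I' := 𝓘(ℝ, ℂ)) x (g := fun z : ℂ => c x * Complex.exp (Complex.log (z / (c x)^2) / 2)) (f := fun y => c y ^ 2) hlog.contMDiffAt h2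
  refine h3.congr_of_eventuallyEq ?_
  have h5 : Filter.Tendsto (fun y => (c y / c x)) (𝓝 x) (𝓝 1) := by
    have := hc.tendsto.div_const (c x); rwa [div_self h0] at this
  have h6 : {z : ℂ | 0 < z.re} ∈ 𝓝 (1:ℂ) :=
    (isOpen_lt continuous_const Complex.continuous_re).mem_nhds (by simp)
  filter_upwards [h5 h6] with y hy
  have hy' : 0 < (c y / c x).re := hy
  rw [← div_pow]
  -- An argument smaller than `π / 2` in absolute value can be doubled within the principal branch.
  have ha : |(c y / c x).arg| < Real.pi / 2 := Complex.abs_arg_lt_pi_div_two_iff.2 (Or.inl hy')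
  have hne : c y / c x ≠ 0 := by intro h; rw [h] at hy'; simp at hy'
  have : Complex.log ((c y / c x) ^ 2) = 2 * Complex.log (c y / c x) := by
    rw [sq, Complex.log_mul hne hne ⟨by have := (abs_lt.1 ha).1; linarith,
      by have := (abs_lt.1 ha).2; linarith⟩, two_mul]
  rw [this, mul_div_cancel_left₀ _ two_ne_zero, Complex.exp_log hne]
  field_simp

end Param

/-! ### Alternating forms of type `(n, 0)` -/

/-- The vectors `v` with `J` applied to the entries whose index belongs to `S`. -/
def twist {V : Type*} {ι : Type*} [DecidableEq ι] (J : V → V) (S : Finset ι) (v : ι → V) : ι → V :=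
  fun i => if i ∈ S then J (v i) else v i

theorem twist_empty {V ι : Type*} [DecidableEq ι] (J : V → V) (v : ι → V) :
    twist J ∅ v = v := by
  ext i; simp [twist]

theorem twist_insert_update {V : Type*} {J : V → V} {ι : Type*} [DecidableEq ι] (S : Finset ι) {a : ι} (ha : a ∉ S)
    (v : ι → V) : twist J (insert a S) v = Function.update (twist J S v) a (J (twist J S v a)) := by
  ext i
  by_cases hi : i = a
  · subst hi; simp [twist, ha]
  · simp [twist, hi]

section Algebra
variable {n : ℕ} {V : Type*} [AddCommGroup V] [Module ℝ V]

/-- The form `α` is complex linear in each variable. -/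
def IsN0 (J : V → V) (α : V [⋀^Fin n]→ₗ[ℝ] ℂ) : Prop :=
  ∀ (v : Fin n → V) (i : Fin n), α (Function.update v i (J (v i))) = Complex.I * α v

/-- The complex multilinear extension of `α` at the vectors `½ (v - i J v)`. -/
def typeProj (J : V → V) (α : (Fin n → V) → ℂ) (v : Fin n → V) : ℂ :=
  (1 / 2) ^ n * ∑ S : Finset (Fin n), (-Complex.I) ^ S.card * α (twist J S v)

/-- The wedge product `α ∧ β̄`. -/
def wedge (α β : V [⋀^Fin n]→ₗ[ℝ] ℂ) : V [⋀^Fin n ⊕ Fin n]→ₗ[ℝ] ℂ :=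
  (LinearMap.mul' ℝ ℂ).compAlternatingMap
    (α.domCoprod (Complex.conjAe.toLinearMap.compAlternatingMap β))

/-- The product of alternating maps is a sum over classes of permutations (shuffles). After
multiplication by `n! * n!` it becomes a sum over all permutations, whose terms can be treated one
at a time. -/
theorem factorial_mul_wedge (α β : V [⋀^Fin n]→ₗ[ℝ] ℂ) (w : Fin n ⊕ Fin n → V) :
    ((n.factorial * n.factorial : ℕ) : ℂ) * wedge α β w =
      ∑ σ : Equiv.Perm (Fin n ⊕ Fin n), ((Equiv.Perm.sign σ : ℤ) : ℂ) *
        (α (fun i => w (σ (Sum.inl i))) * conj (β (fun i => w (σ (Sum.inr i))))) := by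
  have h := MultilinearMap.domCoprod_alternization_eq α
    (Complex.conjAe.toLinearMap.compAlternatingMap β)
  have h2 := congrArg (fun η => LinearMap.mul' ℝ ℂ (η w)) h
  simp only [Fintype.card_fin, AlternatingMap.smul_apply, map_nsmul] at h2
  rw [wedge, LinearMap.compAlternatingMap_apply, ← nsmul_eq_mul, ← h2,
    MultilinearMap.alternatization_apply, map_sum]
  refine Finset.sum_congr rfl fun σ _ => ?_
  rcases Int.units_eq_one_or (Equiv.Perm.sign σ) with hs | hs <;>
    simp [hs, MultilinearMap.domDomCongr_apply, MultilinearMap.domCoprod_apply]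

theorem wedge_smul_left (c : ℂ) (α β : V [⋀^Fin n]→ₗ[ℝ] ℂ) (w : Fin n ⊕ Fin n → V) :
    wedge (c • α) β w = c * wedge α β w := by
  have h : ((n.factorial * n.factorial : ℕ) : ℂ) ≠ 0 := by
    exact_mod_cast Nat.mul_ne_zero n.factorial_ne_zero n.factorial_ne_zero
  apply mul_left_cancel₀ h
  rw [mul_left_comm, factorial_mul_wedge, factorial_mul_wedge, Finset.mul_sum]
  exact Finset.sum_congr rfl fun σ _ => by simp only [AlternatingMap.smul_apply, smul_eq_mul]; ring

theorem wedge_smul_right (c : ℂ) (α β : V [⋀^Fin n]→ₗ[ℝ] ℂ) (w : Fin n ⊕ Fin n → V) :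
    wedge α (c • β) w = conj c * wedge α β w := by
  have h : ((n.factorial * n.factorial : ℕ) : ℂ) ≠ 0 := by
    exact_mod_cast Nat.mul_ne_zero n.factorial_ne_zero n.factorial_ne_zero
  apply mul_left_cancel₀ h
  rw [mul_left_comm, factorial_mul_wedge, factorial_mul_wedge, Finset.mul_sum]
  exact Finset.sum_congr rfl fun σ _ => by
    simp only [AlternatingMap.smul_apply, smul_eq_mul, map_mul]; ring

variable {J : V → V}

/-- The factor `c` is left free because the lemma serves twice: with `I` for `J` itself, and with
`-I` for the map `-K` in `typeProj_eq_map`. -/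
theorem map_twist {α : V [⋀^Fin n]→ₗ[ℝ] ℂ} {c : ℂ}
    (hα : ∀ (v : Fin n → V) (i : Fin n), α (Function.update v i (J (v i))) = c * α v)
    (S : Finset (Fin n)) (v : Fin n → V) : α (twist J S v) = c ^ S.card * α v := by
  induction S using Finset.induction_on with
  | empty => simp [twist_empty]
  | insert a S ha ih =>
    rw [twist_insert_update S ha, hα, ih, Finset.card_insert_of_notMem ha]
    ring

theorem IsN0.map_twist {α : V [⋀^Fin n]→ₗ[ℝ] ℂ} (hα : IsN0 J α) (S : Finset (Fin n))
    (v : Fin n → V) : α (twist J S v) = Complex.I ^ S.card * α v :=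
  HalfFormQuantization.map_twist hα S v

/-- All `2 ^ n` terms of the sum equal `α v`, because `(-I) * I = 1`. -/
theorem IsN0.typeProj_eq {α : V [⋀^Fin n]→ₗ[ℝ] ℂ} (hα : IsN0 J α) (v : Fin n → V) :
    typeProj J α v = α v := by
  have : ∀ S : Finset (Fin n), (-Complex.I) ^ S.card * α (twist J S v) = α v := by
    intro S
    rw [hα.map_twist, ← mul_assoc, ← mul_pow]
    simp
  rw [typeProj, Finset.sum_congr rfl fun S _ => this S, Finset.sum_const, Finset.card_univ,
    Fintype.card_finset, Fintype.card_fin, nsmul_eq_mul, ← mul_assoc]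
  push_cast
  rw [← mul_pow]
  simp

/-- The complex multilinear extension of a `2n`-form at the vectors `w - i J w`, for the first `n`
vectors, and `w + i J w`, for the last `n` ones. -/
def biType (J : V → V) (η : (Fin n ⊕ Fin n → V) → ℂ) (w : Fin n ⊕ Fin n → V) : ℂ :=
  ∑ S : Finset (Fin n), ∑ T : Finset (Fin n), (-Complex.I) ^ S.card * Complex.I ^ T.card *
    η (Sum.elim (twist J S (fun i => w (Sum.inl i))) (twist J T (fun i => w (Sum.inr i))))

theorem biType_sum {ι : Type*} (s : Finset ι) (F : ι → (Fin n ⊕ Fin n → V) → ℂ)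
    (w : Fin n ⊕ Fin n → V) : biType J (fun w => ∑ i ∈ s, F i w) w = ∑ i ∈ s, biType J (F i) w := by
  simp only [biType, Finset.mul_sum]
  rw [Finset.sum_comm]
  refine (Finset.sum_congr rfl fun S _ => Finset.sum_comm).trans ?_
  rw [Finset.sum_comm]
  refine (Finset.sum_congr rfl fun i _ => Finset.sum_comm).trans ?_
  rfl

theorem biType_add_mul (c : ℂ) (F G : (Fin n ⊕ Fin n → V) → ℂ) (w : Fin n ⊕ Fin n → V) :
    biType J (fun w => F w + c * G w) w = biType J F w + c * biType J G w := by
  simp only [biType, Finset.mul_sum, ← Finset.sum_add_distrib]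
  refine Finset.sum_congr rfl fun S _ => Finset.sum_congr rfl fun T _ => by ring

theorem biType_mul (c : ℂ) (F : (Fin n ⊕ Fin n → V) → ℂ) (w : Fin n ⊕ Fin n → V) :
    biType J (fun w => c * F w) w = c * biType J F w := by
  simp only [biType, Finset.mul_sum]
  refine Finset.sum_congr rfl fun S _ => Finset.sum_congr rfl fun T _ => by ring

/-- Such a permutation feeds a vector of type `w - i J w` to the conjugate of an (n, 0)-form, which
kills it. In the sum, adding `l` to `S` multiplies the term by `-I` from the coefficient and by
`conj I = -I` from the form, so the terms for `S` and `insert l S` cancel. -/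
theorem biType_term_eq_zero (α : V [⋀^Fin n]→ₗ[ℝ] ℂ) {β : V [⋀^Fin n]→ₗ[ℝ] ℂ} (hβ : IsN0 J β)
    (σ : Equiv.Perm (Fin n ⊕ Fin n)) {i l : Fin n} (hil : σ (Sum.inr i) = Sum.inl l)
    (w : Fin n ⊕ Fin n → V) :
    biType J (fun w => α (fun i => w (σ (Sum.inl i))) * conj (β (fun i => w (σ (Sum.inr i))))) w
      = 0 := by
  rw [biType, Finset.sum_comm]
  refine Finset.sum_eq_zero fun T _ => ?_
  have key : ∀ S : Finset (Fin n), l ∉ S →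
      (-Complex.I) ^ (insert l S).card * Complex.I ^ T.card *
        (α (fun i => Sum.elim (twist J (insert l S) fun i => w (Sum.inl i))
          (twist J T fun i => w (Sum.inr i)) (σ (Sum.inl i))) *
        conj (β (fun i => Sum.elim (twist J (insert l S) fun i => w (Sum.inl i))
          (twist J T fun i => w (Sum.inr i)) (σ (Sum.inr i)))))
      = - ((-Complex.I) ^ S.card * Complex.I ^ T.card *
        (α (fun i => Sum.elim (twist J S fun i => w (Sum.inl i))
          (twist J T fun i => w (Sum.inr i)) (σ (Sum.inl i))) *
        conj (β (fun i => Sum.elim (twist J S fun i => w (Sum.inl i))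
          (twist J T fun i => w (Sum.inr i)) (σ (Sum.inr i)))))) := by
    intro S hl
    have h1 : (fun k => Sum.elim (twist J (insert l S) fun i => w (Sum.inl i))
          (twist J T fun i => w (Sum.inr i)) (σ (Sum.inl k))) =
        (fun k => Sum.elim (twist J S fun i => w (Sum.inl i))
          (twist J T fun i => w (Sum.inr i)) (σ (Sum.inl k))) := by
      ext k
      rw [twist_insert_update S hl, Sum.elim_update_left, Function.update_of_ne]
      rw [← hil]
      exact fun h => by simpa using σ.injective h
    have h2 : (fun k => Sum.elim (twist J (insert l S) fun i => w (Sum.inl i))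
          (twist J T fun i => w (Sum.inr i)) (σ (Sum.inr k))) =
        Function.update (fun k => Sum.elim (twist J S fun i => w (Sum.inl i))
          (twist J T fun i => w (Sum.inr i)) (σ (Sum.inr k))) i
          (J (Sum.elim (twist J S fun i => w (Sum.inl i))
          (twist J T fun i => w (Sum.inr i)) (σ (Sum.inr i)))) := by
      ext k
      by_cases hk : k = i
      · subst hk
        rw [twist_insert_update S hl, Sum.elim_update_left]
        simp [hil]
      · rw [twist_insert_update S hl, Sum.elim_update_left, Function.update_of_ne,
          Function.update_of_ne hk]
        rw [← hil]
        exact fun h => hk (by simpa using σ.injective h)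
    rw [h1, h2, hβ, Finset.card_insert_of_notMem hl, map_mul, Complex.conj_I, pow_succ]
    linear_combination (-Complex.I) ^ S.card * Complex.I ^ T.card * (α (fun i => Sum.elim (twist J S fun i => w (Sum.inl i))
          (twist J T fun i => w (Sum.inr i)) (σ (Sum.inl i))) *
        conj (β (fun i => Sum.elim (twist J S fun i => w (Sum.inl i))
          (twist J T fun i => w (Sum.inr i)) (σ (Sum.inr i))))) * Complex.I_mul_I
  refine Finset.sum_involution (fun S _ => if l ∈ S then S.erase l else insert l S) ?_ ?_ ?_ ?_
  · intro S _
    by_cases h : l ∈ S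
    · rw [if_pos h]
      have := key (S.erase l) (Finset.notMem_erase l S)
      rw [Finset.insert_erase h] at this
      rw [this]; ring
    · rw [if_neg h, key S h]; ring
  · intro S _ _
    by_cases h : l ∈ S
    · rw [if_pos h]; exact fun h' => by rw [← h'] at h; simp at h
    · rw [if_neg h]; exact fun h' => h (by rw [← h']; simp)
  · simp
  · intro S _
    by_cases h : l ∈ S <;> simp [h]

/-- The signs of the two block permutations come out of `α` and `β` and cancel the sign in front.
The sum over `T` has `2 ^ n` equal terms and the sum over `S` is `2 ^ n` times `typeProj`, whence `4
^ n`. -/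
theorem biType_term_sumCongr (α : V [⋀^Fin n]→ₗ[ℝ] ℂ) {β : V [⋀^Fin n]→ₗ[ℝ] ℂ} (hβ : IsN0 J β)
    (σ₁ σ₂ : Equiv.Perm (Fin n)) (w : Fin n ⊕ Fin n → V) :
    ((Equiv.Perm.sign (Equiv.Perm.sumCongr σ₁ σ₂) : ℤ) : ℂ) *
    biType J (fun w => α (fun i => w (Equiv.Perm.sumCongr σ₁ σ₂ (Sum.inl i))) *
      conj (β (fun i => w (Equiv.Perm.sumCongr σ₁ σ₂ (Sum.inr i))))) w
      = 4 ^ n * (typeProj J α (fun i => w (Sum.inl i)) * conj (β (fun i => w (Sum.inr i)))) := by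
  have h1 : ∀ S T : Finset (Fin n), (-Complex.I) ^ S.card * Complex.I ^ T.card *
      (α (fun i => Sum.elim (twist J S (fun i => w (Sum.inl i))) (twist J T (fun i => w (Sum.inr i)))
          (Equiv.Perm.sumCongr σ₁ σ₂ (Sum.inl i))) *
      conj (β (fun i => Sum.elim (twist J S (fun i => w (Sum.inl i))) (twist J T (fun i => w (Sum.inr i)))
        (Equiv.Perm.sumCongr σ₁ σ₂ (Sum.inr i)))))
      = ((Equiv.Perm.sign (Equiv.Perm.sumCongr σ₁ σ₂) : ℤ) : ℂ) *
        ((-Complex.I) ^ S.card * α (twist J S (fun i => w (Sum.inl i))) *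
          conj (β (fun i => w (Sum.inr i)))) := by
    intro S T
    have ha : α (fun i => Sum.elim (twist J S (fun i => w (Sum.inl i))) (twist J T (fun i => w (Sum.inr i)))
          (Equiv.Perm.sumCongr σ₁ σ₂ (Sum.inl i))) =
          ((Equiv.Perm.sign σ₁ : ℤ) : ℂ) * α (twist J S (fun i => w (Sum.inl i))) := by
      have := α.map_perm (twist J S (fun i => w (Sum.inl i))) σ₁
      rw [show (fun i => Sum.elim (twist J S (fun i => w (Sum.inl i))) (twist J T (fun i => w (Sum.inr i)))
          (Equiv.Perm.sumCongr σ₁ σ₂ (Sum.inl i))) = (twist J S (fun i => w (Sum.inl i))) ∘ σ₁ from rfl, this]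
      rcases Int.units_eq_one_or (Equiv.Perm.sign σ₁) with hs | hs <;> simp [hs]
    have hb : β (fun i => Sum.elim (twist J S (fun i => w (Sum.inl i))) (twist J T (fun i => w (Sum.inr i)))
          (Equiv.Perm.sumCongr σ₁ σ₂ (Sum.inr i))) =
          ((Equiv.Perm.sign σ₂ : ℤ) : ℂ) * (Complex.I ^ T.card * β (fun i => w (Sum.inr i))) := by
      have := β.map_perm (twist J T (fun i => w (Sum.inr i))) σ₂
      rw [show (fun i => Sum.elim (twist J S (fun i => w (Sum.inl i))) (twist J T (fun i => w (Sum.inr i)))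
          (Equiv.Perm.sumCongr σ₁ σ₂ (Sum.inr i))) = (twist J T (fun i => w (Sum.inr i))) ∘ σ₂ from rfl, this,
          ← hβ.map_twist]
      rcases Int.units_eq_one_or (Equiv.Perm.sign σ₂) with hs | hs <;> simp [hs]
    rw [ha, hb, Equiv.Perm.sign_sumCongr]
    have h2 : Complex.I ^ T.card * (-Complex.I) ^ T.card = 1 := by rw [← mul_pow]; simp
    simp only [map_mul, map_pow, Complex.conj_I, map_intCast, Units.val_mul, Int.cast_mul]
    linear_combination ((Equiv.Perm.sign σ₁ : ℤ) : ℂ) * ((Equiv.Perm.sign σ₂ : ℤ) : ℂ) *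
      (-Complex.I) ^ S.card * α (twist J S (fun i => w (Sum.inl i))) *
          conj (β (fun i => w (Sum.inr i))) * h2
  have hsq : ((Equiv.Perm.sign (Equiv.Perm.sumCongr σ₁ σ₂) : ℤ) : ℂ) *
      ((Equiv.Perm.sign (Equiv.Perm.sumCongr σ₁ σ₂) : ℤ) : ℂ) = 1 := by
    rcases Int.units_eq_one_or (Equiv.Perm.sign (Equiv.Perm.sumCongr σ₁ σ₂)) with hs | hs <;> simp [hs]
  simp only [biType, h1]
  simp only [Finset.sum_const, Finset.card_univ, Fintype.card_finset, Fintype.card_fin,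
    ← Finset.mul_sum, ← Finset.sum_mul, nsmul_eq_mul, typeProj]
  rw [← mul_assoc, show (4:ℂ) = 2 * 2 by norm_num, mul_pow]
  have h3 : (2:ℂ)^n * (1/2)^n = 1 := by rw [← mul_pow]; simp
  push_cast
  have h4 : ∀ X Y s: ℂ, s * s = 1 → s * 2^n * (s * (X * Y)) = 2^n*2^n*((1/2)^n*X*Y) := by
    intro X Y s hs
    linear_combination 2^n * X*Y * hs - 2^n*X*Y* h3
  exact h4 _ _ _ hsq

/-- Up to a positive factor, the component of `α ∧ β̄` for `β` of type `(n, 0)` is `p α ∧ β̄`. -/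
theorem exists_biType_wedge (n : ℕ) : ∃ N : ℝ, 0 < N ∧ ∀ (V : Type _) [AddCommGroup V] [Module ℝ V] (J : V → V)
    (α β : V [⋀^Fin n]→ₗ[ℝ] ℂ), IsN0 J β → ∀ w : Fin n ⊕ Fin n → V,
    biType J (wedge α β) w =
      N * (typeProj J α (fun i => w (Sum.inl i)) * conj (β (fun i => w (Sum.inr i)))) := by
  classical
  set B : Finset (Equiv.Perm (Fin n ⊕ Fin n)) :=
    Finset.univ.filter fun σ => ∃ σ₁ σ₂, σ = Equiv.Perm.sumCongr σ₁ σ₂ with hB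
  have hB0 : 0 < B.card := Finset.card_pos.2 ⟨1, by
    rw [hB, Finset.mem_filter]; exact ⟨Finset.mem_univ _, 1, 1, by simp⟩⟩
  have hf : (0:ℝ) < ((n.factorial * n.factorial : ℕ) : ℝ) := by
    exact_mod_cast Nat.mul_pos n.factorial_pos n.factorial_pos
  -- There are `n! * n!` block permutations, so this constant is `4 ^ n`; only its positivity
  -- matters, and they are not counted.
  refine ⟨B.card * 4 ^ n / ((n.factorial * n.factorial : ℕ) : ℝ), by positivity, ?_⟩
  intro V _ _ J α β hβ w
  have hf' : ((n.factorial * n.factorial : ℕ) : ℂ) ≠ 0 := by exact_mod_cast hf.ne'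
  apply mul_left_cancel₀ hf'
  rw [← biType_mul, funext (factorial_mul_wedge α β), biType_sum]
  simp_rw [biType_mul]
  rw [← Finset.sum_subset (Finset.subset_univ B)]
  · rw [Finset.sum_congr rfl (g := fun _ => 4 ^ n * (typeProj J α (fun i => w (Sum.inl i)) *
      conj (β (fun i => w (Sum.inr i)))))]
    · rw [Finset.sum_const, nsmul_eq_mul]
      push_cast at hf' ⊢
      field_simp
      rw [mul_div_assoc, div_self (left_ne_zero_of_mul hf'), mul_one]
    · intro σ hσ
      rw [hB, Finset.mem_filter] at hσ
      obtain ⟨-, σ₁, σ₂, rfl⟩ := hσ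
      exact biType_term_sumCongr α hβ σ₁ σ₂ w
  · intro σ _ hσ
    -- A permutation that maps the second block into itself maps it onto itself by finiteness, hence
    -- preserves the first block as well.
    have : ∃ i l, σ (Sum.inr i) = Sum.inl l := by
      by_contra! hcon
      apply hσ
      have h1 : Set.MapsTo σ (Set.range Sum.inr) (Set.range Sum.inr) := by
        rintro _ ⟨i, rfl⟩
        rcases h : σ (Sum.inr i) with l | l
        · exact absurd h (hcon i l)
        · exact ⟨l, rfl⟩
      have h2 : Set.MapsTo σ (Set.range Sum.inl) (Set.range Sum.inl) := by
        have h3 : Set.BijOn σ (Set.range Sum.inr) (Set.range Sum.inr) := by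
          exact ((Set.finite_range _).injOn_iff_bijOn_of_mapsTo h1).1 σ.injective.injOn
        rintro _ ⟨i, rfl⟩
        rcases h : σ (Sum.inl i) with l | l
        · exact ⟨l, rfl⟩
        · obtain ⟨_, ⟨k, rfl⟩, hk⟩ := h3.surjOn ⟨l, rfl⟩
          rw [← h] at hk
          simpa using σ.injective hk
      obtain ⟨⟨σ₁, σ₂⟩, h⟩ := Equiv.Perm.mem_sumCongrHom_range_of_perm_mapsTo_inl h2
      rw [hB, Finset.mem_filter]
      exact ⟨Finset.mem_univ _, σ₁, σ₂, h.symm⟩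
    obtain ⟨i, l, hil⟩ := this
    rw [biType_term_eq_zero α hβ σ hil, mul_zero]

/-- Forms of top degree make up a line: the number of arguments is the dimension, so one value on a
basis determines the form. -/
theorem AlternatingMap.eq_mul_of_basis {ι : Type*} [Fintype ι] [DecidableEq ι]
    (η η₀ : V [⋀^ι]→ₗ[ℝ] ℂ) (b : Module.Basis ι ℝ V) (c : ℂ) (h : η b = c * η₀ b) (w : ι → V) :
    η w = c * η₀ w := by
  have : η = c • η₀ := by
    refine Module.Basis.ext_alternating b fun v hv => ?_
    let σ : Equiv.Perm ι := Equiv.ofBijective v (Finite.injective_iff_bijective.1 hv)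
    have h1 : (fun i => b (v i)) = b ∘ σ := rfl
    rw [h1, η.map_perm, AlternatingMap.smul_apply, η₀.map_perm, h, smul_comm, smul_eq_mul]
  rw [this, AlternatingMap.smul_apply, smul_eq_mul]

theorem AlternatingMap.eq_zero_of_basis {ι : Type*} [Fintype ι] [DecidableEq ι]
    (η : V [⋀^ι]→ₗ[ℝ] ℂ) (b : Module.Basis ι ℝ V) (h : η b = 0) : η = 0 := by
  ext w
  rw [AlternatingMap.eq_mul_of_basis η η b 0 (by rw [h]; simp), zero_mul, AlternatingMap.zero_apply]

theorem exists_apply_ne_zero {α : V [⋀^Fin n]→ₗ[ℝ] ℂ} (h : α ≠ 0) : ∃ v, α v ≠ 0 := by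
  by_contra! hcon
  exact h (by ext v; exact hcon v)

/-- At a pair `(v, v')` with `α v` and `β v'` nonzero, the component selected by `biType` is a
nonzero multiple of `α v * conj (β v')`. -/
theorem wedge_ne_zero {α β : V [⋀^Fin n]→ₗ[ℝ] ℂ} (hα : IsN0 J α) (hβ : IsN0 J β) (h0 : α ≠ 0)
    (h0' : β ≠ 0) : wedge α β ≠ 0 := by
  intro h
  obtain ⟨N, hN, hw⟩ := exists_biType_wedge n
  obtain ⟨v, hv⟩ := exists_apply_ne_zero h0
  obtain ⟨v', hv'⟩ := exists_apply_ne_zero h0'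
  have := hw V J α β hβ (Sum.elim v v')
  rw [h, hα.typeProj_eq] at this
  simp only [Sum.elim_inl, Sum.elim_inr, biType, AlternatingMap.zero_apply, mul_zero,
    Finset.sum_const_zero] at this
  have h2 : conj (β v') ≠ 0 := by simpa using hv'
  exact (mul_ne_zero (by exact_mod_cast hN.ne') (mul_ne_zero hv h2)) this.symm

/-- This makes the isomorphisms `Ψ` computable. The difference of the two products is `c` times `β ∧
β̄`, because forms of top degree make up a line. Applying `biType`, which only sees the projections,
gives `c * N * |β v|² = 0`. -/
theorem wedge_congr_typeProj (b : Module.Basis (Fin n ⊕ Fin n) ℝ V) {α α' β : V [⋀^Fin n]→ₗ[ℝ] ℂ}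
    (hβ : IsN0 J β) (h : ∀ v, typeProj J α v = typeProj J α' v) : wedge α β = wedge α' β := by
  by_cases hb : β = 0
  · have : ∀ γ : V [⋀^Fin n]→ₗ[ℝ] ℂ, wedge γ 0 = 0 := fun γ => by
      ext w
      have := wedge_smul_right 0 γ 0 w
      simpa using this
    rw [hb, this, this]
  obtain ⟨N, hN, hw⟩ := exists_biType_wedge n
  have h1 := wedge_ne_zero hβ hβ hb hb
  have h2 : wedge β β b ≠ 0 := fun h => h1 (AlternatingMap.eq_zero_of_basis _ b h)
  set c := (wedge α β b - wedge α' β b) / wedge β β b with hc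
  have h3 : ∀ w, wedge α β w = wedge α' β w + c * wedge β β w := by
    intro w
    have := AlternatingMap.eq_mul_of_basis (wedge α β - wedge α' β) (wedge β β) b c
      (by rw [AlternatingMap.sub_apply, hc, div_mul_cancel₀ _ h2]) w
    rw [AlternatingMap.sub_apply] at this
    linear_combination this
  obtain ⟨v, hv⟩ := exists_apply_ne_zero hb
  have h4 := hw V J α β hβ (Sum.elim v v)
  rw [funext h3, biType_add_mul, hw V J α' β hβ, hw V J β β hβ] at h4
  simp only [Sum.elim_inl, Sum.elim_inr, h, hβ.typeProj_eq] at h4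
  have h5 : c * (N * (β v * conj (β v))) = 0 := by linear_combination h4
  have h6 : conj (β v) ≠ 0 := by simpa using hv
  have h7 : c = 0 := by
    rcases mul_eq_zero.1 h5 with h | h
    · exact h
    · exact absurd h (mul_ne_zero (by exact_mod_cast hN.ne') (mul_ne_zero hv h6))
  ext w
  rw [h3, h7]
  ring

/-- Expanding `α` at the vectors `v - K (J v)` by multilinearity, each entry `-K (J v)` gives a
factor `-I` once `K` is taken out. So the projection from the (n, 0)-forms of one structure to those
of another is, up to a constant, the pull-back by a linear map. -/
theorem typeProj_eq_map {K : V →ₗ[ℝ] V} {α : V [⋀^Fin n]→ₗ[ℝ] ℂ} (hα : IsN0 K α)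
    (v : Fin n → V) : typeProj J α v = (1 / 2) ^ n * α (fun i => v i - K (J (v i))) := by
  have h1 : (fun i => v i - K (J (v i))) = (fun i => -K (J (v i))) + v := by
    ext i; simp [sub_eq_neg_add]
  have h2 := α.toMultilinearMap.map_add_univ (fun i => -K (J (v i))) v
  simp only [AlternatingMap.coe_multilinearMap] at h2
  rw [h1, h2, typeProj]
  congr 1
  refine Finset.sum_congr rfl fun S _ => ?_
  have h3 : S.piecewise (fun i => -K (J (v i))) v = twist (fun u => -K u) S (twist J S v) := by
    ext i
    by_cases hi : i ∈ S <;> simp [twist, hi]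
  rw [h3, map_twist (J := fun u => -K u) (c := -Complex.I)]
  intro u i
  have := α.map_update_smul u i (-1 : ℝ) (K (u i))
  rw [neg_one_smul, neg_one_smul, hα] at this
  rw [this]
  ring

end Algebra

/-! ### Positivity of the scalar product of forms of type (n, 0) -/

section Positivity
variable {n : ℕ} {V : Type*} [AddCommGroup V] [Module ℝ V]

/-- The pairing of a symplectic basis. -/
def stdPair (a b : Fin n ⊕ Fin n) : ℝ :=
  match a, b with
  | Sum.inl i, Sum.inr j => if i = j then 1 else 0
  | Sum.inr i, Sum.inl j => if i = j then -1 else 0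
  | _, _ => 0

theorem stdPair_swap (a b : Fin n ⊕ Fin n) : stdPair b a = -stdPair a b := by
  rcases a with i | i <;> rcases b with j | j <;> simp [stdPair, eq_comm] <;> split_ifs <;> simp

theorem eq_swap_of_stdPair_ne_zero {a b : Fin n ⊕ Fin n} (h : stdPair a b ≠ 0) : b = a.swap := by
  rcases a with i | i <;> rcases b with j | j <;> simp [stdPair] at h ⊢ <;> exact h.symm

/-- Such a permutation permutes the pairs `{inl i, inr i}` and flips `m` of them. Undoing a flip
changes both the sign of `s` and the sign of one factor. Without flips the two blocks undergo the
same permutation, so the sign is a square and every factor is 1. -/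
theorem sign_mul_prod_stdPair (m : ℕ) : ∀ s : Equiv.Perm (Fin n ⊕ Fin n),
    (∀ i, s (Sum.inr i) = (s (Sum.inl i)).swap) →
    (Finset.univ.filter fun i => (s (Sum.inl i)).isRight).card = m →
    ((Equiv.Perm.sign s : ℤ) : ℝ) * ∏ i, stdPair (s (Sum.inl i)) (s (Sum.inr i)) = 1 := by
  induction m with
  | zero =>
    intro s hs hm
    rw [Finset.card_eq_zero, Finset.filter_eq_empty_iff] at hm
    have h1 : ∀ i, ∃ j, s (Sum.inl i) = Sum.inl j := fun i => by
      have := hm (Finset.mem_univ i)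
      rcases h : s (Sum.inl i) with j | j
      · exact ⟨j, rfl⟩
      · simp [h] at this
    obtain ⟨⟨σ₁, σ₂⟩, h⟩ := Equiv.Perm.mem_sumCongrHom_range_of_perm_mapsTo_inl
      (σ := s) (by rintro _ ⟨i, rfl⟩; obtain ⟨j, hj⟩ := h1 i; exact ⟨j, hj.symm⟩)
    have h' : s = Equiv.Perm.sumCongr σ₁ σ₂ := h.symm
    have h2 : σ₁ = σ₂ := by
      ext i
      have := hs i
      rw [h'] at this
      simp only [Equiv.Perm.sumCongr_apply, Sum.map_inl, Sum.map_inr, Sum.swap_inl] at this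
      exact congrArg Fin.val (Sum.inr.inj this).symm
    subst h2
    rw [h', Equiv.Perm.sign_sumCongr]
    simp [stdPair]
  | succ m ih =>
    intro s hs hm
    obtain ⟨i₀, hi₀⟩ : (Finset.univ.filter fun i => (s (Sum.inl i)).isRight).Nonempty := by
      rw [← Finset.card_pos, hm]; exact m.succ_pos
    have hi₀' : (s (Sum.inl i₀)).isRight := (Finset.mem_filter.1 hi₀).2
    set s' := s * Equiv.swap (Sum.inl i₀) (Sum.inr i₀) with hs'
    have e1 : ∀ i, i ≠ i₀ → s' (Sum.inl i) = s (Sum.inl i) := fun i hi => by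
      rw [hs', Equiv.Perm.mul_apply, Equiv.swap_apply_of_ne_of_ne (by simpa using hi) (by simp)]
    have e2 : ∀ i, i ≠ i₀ → s' (Sum.inr i) = s (Sum.inr i) := fun i hi => by
      rw [hs', Equiv.Perm.mul_apply, Equiv.swap_apply_of_ne_of_ne (by simp) (by simpa using hi)]
    have e3 : s' (Sum.inl i₀) = s (Sum.inr i₀) := by simp [hs']
    have e4 : s' (Sum.inr i₀) = s (Sum.inl i₀) := by simp [hs']
    have h1 := ih s' (fun i => by
      by_cases hi : i = i₀
      · subst hi; rw [e3, e4, hs i, Sum.swap_swap]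
      · rw [e1 i hi, e2 i hi, hs i]) (by
      have : (Finset.univ.filter fun i => (s' (Sum.inl i)).isRight) =
          (Finset.univ.filter fun i => (s (Sum.inl i)).isRight).erase i₀ := by
        ext i
        by_cases hi : i = i₀
        · subst hi
          simp only [Finset.mem_filter, Finset.mem_univ, true_and, e3, hs, Finset.mem_erase,
            ne_eq, not_true_eq_false, false_and, iff_false]
          rcases h : s (Sum.inl i) with j | j
          · simp [h] at hi₀'
          · simp
        · simp [hi, e1 i hi]
      rw [this, Finset.card_erase_of_mem hi₀, hm]; rfl)
    have h2 : ∏ i ∈ Finset.univ.erase i₀, stdPair (s (Sum.inl i)) (s (Sum.inr i)) =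
        ∏ i ∈ Finset.univ.erase i₀, stdPair (s' (Sum.inl i)) (s' (Sum.inr i)) :=
      Finset.prod_congr rfl fun i hi => by
        rw [e1 i (Finset.ne_of_mem_erase hi), e2 i (Finset.ne_of_mem_erase hi)]
    rw [← h1, hs', Equiv.Perm.sign_mul, Equiv.Perm.sign_swap (by simp), ← hs',
      ← Finset.mul_prod_erase _ _ (Finset.mem_univ i₀),
      ← Finset.mul_prod_erase _ (fun i => stdPair (s' (Sum.inl i)) (s' (Sum.inr i))) (Finset.mem_univ i₀),
      e3, e4, stdPair_swap (s (Sum.inl i₀)), h2]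
    push_cast
    ring

/-- Every term is 0 or 1 and the identity contributes 1; the exact value is not needed. -/
theorem sum_sign_mul_prod_stdPair_pos : 0 < ∑ s : Equiv.Perm (Fin n ⊕ Fin n),
    ((Equiv.Perm.sign s : ℤ) : ℝ) * ∏ i, stdPair (s (Sum.inl i)) (s (Sum.inr i)) := by
  have h : ∀ s : Equiv.Perm (Fin n ⊕ Fin n),
      ((Equiv.Perm.sign s : ℤ) : ℝ) * ∏ i, stdPair (s (Sum.inl i)) (s (Sum.inr i)) = 1 ∨
      ((Equiv.Perm.sign s : ℤ) : ℝ) * ∏ i, stdPair (s (Sum.inl i)) (s (Sum.inr i)) = 0 := by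
    intro s
    by_cases hs : ∃ i, stdPair (s (Sum.inl i)) (s (Sum.inr i)) = 0
    · obtain ⟨i, hi⟩ := hs
      right
      rw [Finset.prod_eq_zero (Finset.mem_univ i) hi, mul_zero]
    · push Not at hs
      left
      exact sign_mul_prod_stdPair _ s (fun i => eq_swap_of_stdPair_ne_zero (hs i)) rfl
  refine Finset.sum_pos' (fun s _ => ?_) ⟨1, Finset.mem_univ _, ?_⟩
  · rcases h s with h | h <;> rw [h]
    exact zero_le_one
  · simp [stdPair]

/-- The multilinear form `∏ B(v_i, v_{n+i})`. -/
def pairProd (B : V →ₗ[ℝ] V →ₗ[ℝ] ℝ) : MultilinearMap ℝ (fun _ : Fin n ⊕ Fin n => V) ℂ where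
  toFun v := ∏ i : Fin n, (B (v (Sum.inl i)) (v (Sum.inr i)) : ℂ)
  map_update_add' := by
    intro _ v a x y
    have key : ∀ z, ∏ i : Fin n, (B (Function.update v a z (Sum.inl i)) (Function.update v a z (Sum.inr i)) : ℂ)
        = (∏ i ∈ Finset.univ.erase (a.elim id id), (B (v (Sum.inl i)) (v (Sum.inr i)) : ℂ)) *
          (B (Function.update v a z (Sum.inl (a.elim id id))) (Function.update v a z (Sum.inr (a.elim id id))) : ℂ) := by
      intro z
      rw [← Finset.prod_erase_mul _ _ (Finset.mem_univ (a.elim id id))]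
      congr 1
      refine Finset.prod_congr rfl fun i hi => ?_
      have := Finset.ne_of_mem_erase hi
      rcases a with j | j <;> simp at this <;> simp [this]
    rw [key, key, key, ← mul_add]
    congr 1
    rcases a with j | j <;> simp
  map_update_smul' := by
    intro _ v a c x
    have key : ∀ z, ∏ i : Fin n, (B (Function.update v a z (Sum.inl i)) (Function.update v a z (Sum.inr i)) : ℂ)
        = (∏ i ∈ Finset.univ.erase (a.elim id id), (B (v (Sum.inl i)) (v (Sum.inr i)) : ℂ)) *
          (B (Function.update v a z (Sum.inl (a.elim id id))) (Function.update v a z (Sum.inr (a.elim id id))) : ℂ) := by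
      intro z
      rw [← Finset.prod_erase_mul _ _ (Finset.mem_univ (a.elim id id))]
      congr 1
      refine Finset.prod_congr rfl fun i hi => ?_
      have := Finset.ne_of_mem_erase hi
      rcases a with j | j <;> simp at this <;> simp [this]
    rw [key, key]
    rcases a with j | j <;> simp <;> ring

/-- The `2n`-form `B ∧ ⋯ ∧ B`. -/
def formPow (n : ℕ) (B : V →ₗ[ℝ] V →ₗ[ℝ] ℝ) (v : Fin n ⊕ Fin n → V) : ℝ :=
  (-1) ^ (n * (n - 1) / 2) * (1 / 2) ^ n *
    ∑ s : Equiv.Perm (Fin n ⊕ Fin n), ((Equiv.Perm.sign s : ℤ) : ℝ) *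
      ∏ i : Fin n, B (v (s (Sum.inl i))) (v (s (Sum.inr i)))

/-- This exhibits `formPow` as an alternating form, which can then be compared with other forms of
top degree. -/
theorem alternatization_pairProd (B : V →ₗ[ℝ] V →ₗ[ℝ] ℝ) (v : Fin n ⊕ Fin n → V) :
    (formPow n B v : ℂ) = ((-1) ^ (n * (n - 1) / 2) * (1 / 2) ^ n) *
      MultilinearMap.alternatization (pairProd B) v := by
  rw [formPow, MultilinearMap.alternatization_apply]
  push_cast
  congr 1
  refine Finset.sum_congr rfl fun s _ => ?_
  rw [MultilinearMap.domDomCongr_apply]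
  rcases Int.units_eq_one_or (Equiv.Perm.sign s) with hs | hs <;> simp [hs, pairProd]

/-- Gram–Schmidt for the Hermitian structure: below the full dimension, the conditions `B (e i) v =
0` and `B (e i) (J v) = 0` have a nonzero solution, which is then rescaled by means of `B v (J v) >
0`. -/
theorem exists_unitary (B : V →ₗ[ℝ] V →ₗ[ℝ] ℝ) (J : V →ₗ[ℝ] V) [FiniteDimensional ℝ V]
    (hJ : ∀ v, J (J v) = -v) (hB : ∀ v, B v v = 0) (hc : ∀ v w, B (J v) (J w) = B v w)
    (hpos : ∀ v, v ≠ 0 → 0 < B v (J v)) (m : ℕ) (hm : 2 * m ≤ Module.finrank ℝ V) :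
    ∃ e : Fin m → V, (∀ i j, B (e i) (e j) = 0) ∧
      ∀ i j, B (e i) (J (e j)) = if i = j then 1 else 0 := by
  have hanti : ∀ v w, B w v = -B v w := fun v w => by
    have := hB (v + w)
    simp only [map_add, LinearMap.add_apply, hB] at this
    linarith
  have hsym : ∀ v w, B w (J v) = B v (J w) := fun v w => by
    have := hc w (J v)
    rw [hJ, map_neg, hanti v] at this
    linarith [hanti v (J w)]
  induction m with
  | zero => exact ⟨fun i => i.elim0, fun i => i.elim0, fun i => i.elim0⟩
  | succ m ih =>
    obtain ⟨e, h1, h2⟩ := ih (by omega)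
    let φ : V →ₗ[ℝ] (Fin m → ℝ) × (Fin m → ℝ) :=
      (LinearMap.pi fun i => B (e i)).prod (LinearMap.pi fun i => (B (e i)).comp J)
    have hker : LinearMap.ker φ ≠ ⊥ := by
      refine LinearMap.ker_ne_bot_of_finrank_lt ?_
      simp
      omega
    obtain ⟨v, hv, hv0⟩ := Submodule.exists_mem_ne_zero_of_ne_bot hker
    have hv' : φ v = 0 := hv
    have ha : ∀ i, B (e i) v = 0 := fun i => congrFun (congrArg Prod.fst hv') i
    have hb : ∀ i, B (e i) (J v) = 0 := fun i => congrFun (congrArg Prod.snd hv') i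
    have hp := hpos v hv0
    set c := (Real.sqrt (B v (J v)))⁻¹ with hcdef
    have hcc : c * (c * B v (J v)) = 1 := by
      rw [← mul_assoc, hcdef, ← mul_inv, Real.mul_self_sqrt hp.le, inv_mul_cancel₀ hp.ne']
    refine ⟨Fin.snoc e (c • v), ?_, ?_⟩
    · intro i j
      refine Fin.lastCases ?_ (fun i => ?_) i <;> refine Fin.lastCases ?_ (fun j => ?_) j <;>
        simp [hB, h1, ha, hanti (e _) v]
    · intro i j
      refine Fin.lastCases ?_ (fun i => ?_) i <;> refine Fin.lastCases ?_ (fun j => ?_) j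
      · simp [hcc]
      · have : B v (J (e j)) = 0 := by rw [hsym (e j) v, hb]
        have h3 : (Fin.last m) ≠ j.castSucc := (Fin.castSucc_lt_last j).ne'
        simp [this, h3]
      · have h3 : i.castSucc ≠ (Fin.last m) := (Fin.castSucc_lt_last i).ne
        simp [hb, h3]
      · simp [h2]

/-- The value of `biType` of an alternating form at `(e, e)`. -/
theorem biType_diag (J : V → V) (η : V [⋀^Fin n ⊕ Fin n]→ₗ[ℝ] ℂ) (e : Fin n → V) :
    biType J η (Sum.elim e e) = (2 * Complex.I) ^ n * η (Sum.elim e (fun i => J (e i))) := by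
  -- If `T` is not the complement of `S`, some index carries the same vector, `e i` or `J (e i)`, in
  -- both blocks.
  have h1 : ∀ S T : Finset (Fin n), T ≠ Sᶜ → η (Sum.elim (twist J S e) (twist J T e)) = 0 := by
    intro S T hST
    have : ∃ i, i ∈ S ↔ i ∈ T := by
      by_contra! h
      apply hST
      ext i
      rw [Finset.mem_compl]
      have := h i
      tauto
    obtain ⟨i, hi⟩ := this
    refine η.map_eq_zero_of_eq _ (i := Sum.inl i) (j := Sum.inr i) ?_ (by simp)
    simp [twist, hi]
  have h2 : ∀ S : Finset (Fin n), η (Sum.elim (twist J S e) (twist J Sᶜ e)) =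
      (-1) ^ S.card * η (Sum.elim e (fun i => J (e i))) := by
    intro S
    induction S using Finset.induction_on with
    | empty =>
      rw [twist_empty]
      have : twist J (∅ : Finset (Fin n))ᶜ e = fun i => J (e i) := by ext i; simp [twist]
      rw [this]; simp
    | insert a S ha ih =>
      have : Sum.elim (twist J (insert a S) e) (twist J (insert a S)ᶜ e) =
          Sum.elim (twist J S e) (twist J Sᶜ e) ∘ Equiv.swap (Sum.inl a) (Sum.inr a) := by
        ext k
        rcases k with k | k <;> by_cases hk : k = a
        · subst hk; simp [twist, ha]
        · rw [Function.comp_apply, Equiv.swap_apply_of_ne_of_ne (by simpa using hk) (by simp)]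
          simp [twist, hk]
        · subst hk; simp [twist, ha]
        · rw [Function.comp_apply, Equiv.swap_apply_of_ne_of_ne (by simp) (by simpa using hk)]
          simp [twist, hk]
      rw [this, η.map_swap _ (by simp), ih, Finset.card_insert_of_notMem ha]
      ring
  have h3 : ∀ S : Finset (Fin n), ∑ T : Finset (Fin n), (-Complex.I) ^ S.card * Complex.I ^ T.card *
      η (Sum.elim (twist J S e) (twist J T e)) = Complex.I ^ n * η (Sum.elim e (fun i => J (e i))) := by
    intro S
    rw [Finset.sum_eq_single Sᶜ (fun T _ hT => by rw [h1 S T hT, mul_zero]) (by simp), h2,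
      Finset.card_compl, Fintype.card_fin]
    have h4 : Complex.I ^ n = Complex.I ^ S.card * Complex.I ^ (n - S.card) := by
      rw [← pow_add, Nat.add_sub_cancel' (by simpa using Finset.card_le_univ S)]
    have h5 : (-Complex.I) ^ S.card = (-1) ^ S.card * Complex.I ^ S.card := by
      rw [← mul_pow]; simp
    have h6 : ((-1 : ℂ)) ^ S.card * (-1) ^ S.card = 1 := by rw [← mul_pow]; simp
    rw [h4, h5]
    linear_combination Complex.I ^ S.card * Complex.I ^ (n - S.card) * η (Sum.elim e (fun i => J (e i))) * h6
  simp only [biType, Sum.elim_inl, Sum.elim_inr]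
  rw [Finset.sum_congr rfl fun S _ => h3 S, Finset.sum_const, Finset.card_univ,
    Fintype.card_finset, Fintype.card_fin, nsmul_eq_mul]
  push_cast
  ring

/-- The left side is the normalisation of the scalar product of forms; the right side combines the
factor of `biType_diag` with the constant of `formPow`. Their equality is what makes that scalar
product positive. -/
theorem I_zpow_mul (n : ℕ) : Complex.I ^ ((n : ℤ) * (2 - n)) =
    (2 * Complex.I) ^ n * ((1 / 2) ^ n * (-1) ^ (n * (n - 1) / 2)) := by
  have h1 : (2 * Complex.I) ^ n * ((1 / 2) ^ n * (-1) ^ (n * (n - 1) / 2)) =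
      Complex.I ^ n * (-1) ^ (n * (n - 1) / 2) := by
    rw [← mul_assoc, ← mul_pow]
    congr 2
    ring
  have h2 : ((-1 : ℂ)) ^ (n * (n - 1) / 2) = Complex.I ^ (-((n * (n - 1) : ℕ) : ℤ)) := by
    have h3 : n * (n - 1) = 2 * (n * (n - 1) / 2) :=
      (Nat.mul_div_cancel' (Nat.even_mul_pred_self n).two_dvd).symm
    rw [h3, zpow_neg, zpow_natCast, pow_mul, Complex.I_sq]
    rcases neg_one_pow_eq_or ℂ (n * (n - 1) / 2) with h | h <;>
      simp [h]
  rw [h1, h2, ← zpow_natCast, ← zpow_add₀ Complex.I_ne_zero]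
  congr 1
  rcases n with _ | n
  · simp
  · rw [Nat.add_sub_cancel]
    push_cast
    ring

/-- Positivity of the scalar product of forms of type `(n, 0)`. -/
theorem wedge_self_div_formPow_pos (B : V →ₗ[ℝ] V →ₗ[ℝ] ℝ) (J : V →ₗ[ℝ] V) [FiniteDimensional ℝ V]
    (hJ : ∀ v, J (J v) = -v) (hB : ∀ v, B v v = 0) (hc : ∀ v w, B (J v) (J w) = B v w)
    (hpos : ∀ v, v ≠ 0 → 0 < B v (J v)) (b : Module.Basis (Fin n ⊕ Fin n) ℝ V)
    {α : V [⋀^Fin n]→ₗ[ℝ] ℂ} (hα : IsN0 J α) (h0 : α ≠ 0) :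
    ∃ r : ℝ, 0 < r ∧
      Complex.I ^ ((n : ℤ) * (2 - n)) * wedge α α b / (formPow n B b : ℂ) = r := by
  -- On the family `(e, J e)` both forms of top degree are explicit: `formPow` is a nonzero constant
  -- times a positive sum, and `α ∧ ᾱ` is given by `biType_diag`.
  obtain ⟨e, he1, he2⟩ := exists_unitary B J hJ hB hc hpos n
    (by rw [Module.finrank_eq_card_basis b]; simp; omega)
  set w := Sum.elim e (fun i => J (e i)) with hw
  set s := ∑ s : Equiv.Perm (Fin n ⊕ Fin n),
    ((Equiv.Perm.sign s : ℤ) : ℝ) * ∏ i, stdPair (s (Sum.inl i)) (s (Sum.inr i)) with hs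
  have hs0 : 0 < s := sum_sign_mul_prod_stdPair_pos
  have hpair : ∀ a c, B (w a) (w c) = stdPair a c := by
    intro a c
    rcases a with i | i <;> rcases c with j | j
    · simp [hw, stdPair, he1]
    · simp [hw, stdPair, he2]
    · have : B (J (e i)) (e j) = - B (e i) (J (e j)) := by
        rw [← hc (e i) (J (e j)), hJ, map_neg, neg_neg]
      simp only [hw, stdPair, Sum.elim_inl, Sum.elim_inr, this, he2]
      split_ifs <;> simp
    · simp [hw, stdPair, hc, he1]
  set c₀ : ℂ := (-1) ^ (n * (n - 1) / 2) * (1 / 2) ^ n with hc₀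
  have hc₀0 : c₀ ≠ 0 := by
    apply mul_ne_zero <;> apply pow_ne_zero <;> norm_num
  have hpw : (formPow n B w : ℂ) = c₀ * s := by
    rw [formPow, hs]
    simp only [hpair]
    push_cast
    rfl
  obtain ⟨N, hN, hbi⟩ := exists_biType_wedge n
  have h1 := hbi V J α α hα (Sum.elim e e)
  rw [biType_diag, hα.typeProj_eq] at h1
  simp only [Sum.elim_inl, Sum.elim_inr] at h1
  rw [Complex.mul_conj] at h1
  have hpb : (formPow n B b : ℂ) ≠ 0 := by
    intro h
    rw [alternatization_pairProd] at h
    have h2 := (mul_eq_zero.1 h).resolve_left hc₀0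
    have h3 := AlternatingMap.eq_zero_of_basis _ b h2
    have h4 := alternatization_pairProd B w
    rw [h3, hpw, AlternatingMap.zero_apply, mul_zero] at h4
    exact (mul_ne_zero hc₀0 (by exact_mod_cast hs0.ne')) h4
  -- The two forms of top degree have a constant ratio, so it may be read on `w` instead of `b`.
  have hprop : wedge α α w = wedge α α b / (formPow n B b : ℂ) * (c₀ * s) := by
    rw [← hpw, alternatization_pairProd B w, ← mul_assoc]
    refine AlternatingMap.eq_mul_of_basis _ _ b _ ?_ w
    rw [mul_assoc, ← alternatization_pairProd, div_mul_cancel₀ _ hpb]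
  have hae : α e ≠ 0 := by
    intro hae
    rw [hae] at h1
    have h5 : wedge α α w = 0 := by
      simp only [Complex.normSq_zero, Complex.ofReal_zero, mul_zero, mul_eq_zero] at h1
      exact h1.resolve_left (pow_ne_zero n (by simp))
    rw [hprop] at h5
    have h6 := (mul_eq_zero.1 h5).resolve_right (mul_ne_zero hc₀0 (by exact_mod_cast hs0.ne'))
    have h7 := (div_eq_zero_iff.1 h6).resolve_right hpb
    exact wedge_ne_zero hα hα h0 h0 (AlternatingMap.eq_zero_of_basis _ b h7)
  refine ⟨N * Complex.normSq (α e) / s, by have := Complex.normSq_pos.2 hae; positivity, ?_⟩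
  rw [hprop] at h1
  have hs' : (s : ℂ) ≠ 0 := by exact_mod_cast hs0.ne'
  push_cast
  rw [mul_div_assoc, eq_div_iff hs', ← h1, I_zpow_mul]
  ring

end Positivity

/-! ### Line bundles and vector fields -/

section LineBundle
variable {n : ℕ} {M : Type*} [TopologicalSpace M] [ChartedSpace (Model n) M]
  {E : M → Type*} [TopologicalSpace (TotalSpace ℂ E)] [∀ x, AddCommGroup (E x)]
  [∀ x, Module ℂ (E x)] [∀ x, TopologicalSpace (E x)] [FiberBundle ℂ E] [VectorBundle ℂ ℂ E]

variable (E) in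
/-- The coordinate on the fibre at `x` given by the preferred trivialization at `x₀`. -/
abbrev lcoord (x₀ x : M) : E x →ₗ[ℂ] ℂ := (trivializationAt ℂ E x₀).linearMapAt ℂ x

variable (E) in
/-- The domain of the preferred trivialization at `x₀`. -/
abbrev dom (x₀ : M) : Set M := (trivializationAt ℂ E x₀).baseSet

variable (E) in
/-- The local frame given by the preferred trivialization at `x₀`. -/
def frame (x₀ x : M) : E x := (trivializationAt ℂ E x₀).symm x 1

theorem mem_dom (x : M) : x ∈ dom E x := FiberBundle.mem_baseSet_trivializationAt' x

theorem dom_mem_nhds (x : M) : dom E x ∈ 𝓝 x :=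
  (trivializationAt ℂ E x).open_baseSet.mem_nhds (mem_dom x)

theorem lcoord_apply {x₀ x : M} (hx : x ∈ dom E x₀) (u : E x) :
    lcoord E x₀ x u = (trivializationAt ℂ E x₀ ⟨x, u⟩).2 := by
  rw [lcoord, Trivialization.coe_linearMapAt_of_mem _ hx]

theorem lcoord_injective {x₀ x : M} (hx : x ∈ dom E x₀) :
    Function.Injective (lcoord E x₀ x) := by
  rw [lcoord, Trivialization.linearMapAt_def_of_mem _ hx]
  exact LinearEquiv.injective _

theorem lcoord_frame {x₀ x : M} (hx : x ∈ dom E x₀) : lcoord E x₀ x (frame E x₀ x) = 1 := by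
  rw [lcoord_apply hx, frame, Trivialization.apply_mk_symm _ hx]

theorem lcoord_ne_zero {x₀ x : M} (hx : x ∈ dom E x₀) {u : E x} (hu : u ≠ 0) :
    lcoord E x₀ x u ≠ 0 := fun h => hu (lcoord_injective hx (by rw [h, map_zero]))

theorem frame_ne_zero {x₀ x : M} (hx : x ∈ dom E x₀) : frame E x₀ x ≠ 0 := fun h => by
  have := lcoord_frame (E := E) hx
  rw [h, map_zero] at this
  exact zero_ne_one this

theorem eq_lcoord_smul_frame {x₀ x : M} (hx : x ∈ dom E x₀) (u : E x) :
    u = lcoord E x₀ x u • frame E x₀ x :=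
  lcoord_injective hx (by rw [map_smul, lcoord_frame hx, smul_eq_mul, mul_one])

theorem exists_eq_smul {x : M} {e : E x} (he : e ≠ 0) (u : E x) : ∃ c : ℂ, u = c • e :=
  ⟨lcoord E x x u / lcoord E x x e, lcoord_injective (mem_dom x) (by
    rw [map_smul, smul_eq_mul, div_mul_cancel₀ _ (lcoord_ne_zero (mem_dom x) he)])⟩

theorem exists_eq_smul_tmul {x : M} {e : E x} (he : e ≠ 0) (q : E x ⊗[ℂ] E x) :
    ∃ c : ℂ, q = c • (e ⊗ₜ[ℂ] e) := by
  induction q using TensorProduct.induction_on with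
  | zero => exact ⟨0, by simp⟩
  | tmul u v =>
    obtain ⟨a, rfl⟩ := exists_eq_smul he u
    obtain ⟨b, rfl⟩ := exists_eq_smul he v
    exact ⟨b * a, by rw [TensorProduct.smul_tmul_smul, mul_comm]⟩
  | add q q' h h' =>
    obtain ⟨a, rfl⟩ := h
    obtain ⟨b, rfl⟩ := h'
    exact ⟨a + b, by rw [add_smul]⟩

theorem tmul_self_ne_zero {x : M} {e : E x} (he : e ≠ 0) : e ⊗ₜ[ℂ] e ≠ 0 := by
  intro h
  have h2 := congrArg (LinearMap.mul' ℂ ℂ ∘ₗ TensorProduct.map (lcoord E x x) (lcoord E x x)) h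
  simp only [LinearMap.comp_apply, TensorProduct.map_tmul, LinearMap.mul'_apply, map_zero,
    mul_self_eq_zero] at h2
  exact lcoord_ne_zero (mem_dom x) he h2

section Smooth
variable [VectorBundle ℝ ℂ E] [ContMDiffVectorBundle ∞ ℂ E 𝓘(ℝ, Model n)]

variable (n) in
/-- A section of a line bundle is smooth at a point. -/
abbrev SmoothSecAt (s : ∀ x, E x) (x : M) : Prop :=
  ContMDiffAt 𝓘(ℝ, Model n) (𝓘(ℝ, Model n).prod 𝓘(ℝ, ℂ)) ∞ (fun x => TotalSpace.mk' ℂ x (s x)) x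

theorem smoothSecAt_iff {s : ∀ x, E x} {x₀ x : M} (hx : x ∈ dom E x₀) :
    SmoothSecAt n s x ↔ ContMDiffAt 𝓘(ℝ, Model n) 𝓘(ℝ, ℂ) ∞ (fun y => lcoord E x₀ y (s y)) x := by
  rw [SmoothSecAt, Trivialization.contMDiffAt_section_iff (trivializationAt ℂ E x₀) hx]
  refine Filter.EventuallyEq.contMDiffAt_iff ?_
  filter_upwards [(trivializationAt ℂ E x₀).open_baseSet.mem_nhds hx] with y hy
  rw [lcoord_apply hy]

/-- A family of points in the fibres is smooth if its coordinate is. -/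
theorem contMDiffAt_mk_iff {E' H' N : Type*} [NormedAddCommGroup E'] [NormedSpace ℝ E']
    [TopologicalSpace H'] {J : ModelWithCorners ℝ E' H'} [TopologicalSpace N] [ChartedSpace H' N]
    {b : N → M} {u : ∀ p : N, E (b p)} {p : N} {x₀ : M} (hx : b p ∈ dom E x₀)
    (hb : ContMDiffAt J 𝓘(ℝ, Model n) ∞ b p) :
    ContMDiffAt J (𝓘(ℝ, Model n).prod 𝓘(ℝ, ℂ)) ∞ (fun q => TotalSpace.mk' ℂ (E := E) (b q) (u q)) p ↔
      ContMDiffAt J 𝓘(ℝ, ℂ) ∞ (fun q => lcoord E x₀ (b q) (u q)) p := by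
  rw [Trivialization.contMDiffAt_iff (e := trivializationAt ℂ E x₀) (by rwa [Trivialization.mem_source])]
  refine (and_iff_right hb).trans (Filter.EventuallyEq.contMDiffAt_iff ?_)
  filter_upwards [hb.continuousAt ((trivializationAt ℂ E x₀).open_baseSet.mem_nhds hx)] with y hy
  rw [lcoord_apply hy]

theorem SmoothSecOn.smoothSecAt {U : Set M} {s : ∀ x, E x} (hs : SmoothSecOn (n := n) E U s)
    (hU : IsOpen U) {x : M} (hx : x ∈ U) : SmoothSecAt n s x :=
  (hs x hx).contMDiffAt (hU.mem_nhds hx)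

theorem smoothSecOn_of_at {U : Set M} {s : ∀ x, E x} (hs : ∀ x ∈ U, SmoothSecAt n s x) :
    SmoothSecOn (n := n) E U s := fun x hx => (hs x hx).contMDiffWithinAt

theorem smoothSecOn_frame (x₀ : M) : SmoothSecOn (n := n) E (dom E x₀) (frame E x₀) := by
  refine smoothSecOn_of_at fun x hx => (smoothSecAt_iff hx).2 ?_
  refine (contMDiffAt_const (c := (1:ℂ))).congr_of_eventuallyEq ?_
  filter_upwards [(trivializationAt ℂ E x₀).open_baseSet.mem_nhds hx] with y hy
  rw [lcoord_frame hy]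

theorem SmoothSecAt.smul {s : ∀ x, E x} {x : M} (hs : SmoothSecAt n s x) {g : M → ℂ}
    (hg : ContMDiffAt 𝓘(ℝ, Model n) 𝓘(ℝ, ℂ) ∞ g x) : SmoothSecAt n (fun y => g y • s y) x := by
  rw [smoothSecAt_iff (mem_dom x)] at hs ⊢
  simp only [map_smul, smul_eq_mul]
  exact ContMDiffAt.cmul hg hs

theorem SmoothSecAt.congr {s s' : ∀ x, E x} {x : M} (hs : SmoothSecAt n s x)
    (h : ∀ᶠ y in 𝓝 x, s' y = s y) : SmoothSecAt n s' x :=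
  hs.congr_of_eventuallyEq (h.mono fun y hy => by simp only [hy])

/-- The assumptions on the connection, on parallel transport and on the half-form family only speak
of globally smooth sections. A bump function replaces a local section by a global one with the same
germ. -/
theorem exists_smoothSec_eq [T2Space M] [IsManifold 𝓘(ℝ, Model n) ∞ M] {U : Set M} {s : ∀ x, E x}
    (hs : SmoothSecOn (n := n) E U s) (hU : IsOpen U) {x : M} (hx : x ∈ U) :
    ∃ s' : ∀ x, E x, SmoothSecOn (n := n) E univ s' ∧ ∀ᶠ y in 𝓝 x, s' y = s y := by
  obtain ⟨ρ, -, hρ⟩ := (SmoothBumpFunction.nhds_basis_tsupport (I := 𝓘(ℝ, Model n)) x).mem_iff.1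
    (hU.mem_nhds hx)
  refine ⟨fun y => (ρ y : ℂ) • s y, smoothSecOn_of_at fun y _ => ?_, ?_⟩
  · by_cases hy : y ∈ tsupport ρ
    · exact (hs.smoothSecAt hU (hρ hy)).smul
        (ContMDiffAt.ofRealC ρ.contMDiffAt)
    · rw [smoothSecAt_iff (mem_dom y)]
      refine (contMDiffAt_const (c := (0:ℂ))).congr_of_eventuallyEq ?_
      filter_upwards [(isClosed_tsupport ρ).isOpen_compl.mem_nhds hy] with z hz
      rw [image_eq_zero_of_notMem_tsupport hz]
      simp
  · filter_upwards [ρ.eventuallyEq_one] with y hy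
    rw [hy]
    simp

theorem exists_smoothSec_eq_frame [T2Space M] [IsManifold 𝓘(ℝ, Model n) ∞ M] (x : M) :
    ∃ s : ∀ x, E x, SmoothSecOn (n := n) E univ s ∧ (∀ᶠ y in 𝓝 x, s y = frame E x y) ∧
      s x ≠ 0 := by
  obtain ⟨s, h1, h2⟩ := exists_smoothSec_eq (smoothSecOn_frame (n := n) (E := E) x)
    (trivializationAt ℂ E x).open_baseSet (mem_dom x)
  exact ⟨s, h1, h2, by rw [h2.self_of_nhds]; exact frame_ne_zero (mem_dom x)⟩

/-- Sections which do not vanish are locally frames. -/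
theorem SmoothSecAt.eventually_ne_zero {s : ∀ x, E x} {x : M} (hs : SmoothSecAt n s x)
    (h : s x ≠ 0) : ∀ᶠ y in 𝓝 x, s y ≠ 0 := by
  have h1 := ((smoothSecAt_iff (mem_dom x)).1 hs).continuousAt.eventually_ne
    (lcoord_ne_zero (mem_dom x) h)
  exact h1.mono fun y hy h0 => hy (by rw [h0, map_zero])

end Smooth
end LineBundle

/-! ### Global vector fields, local frames and evaluation of forms -/

section VectorFields
variable {n : ℕ} {M : Type*} [TopologicalSpace M] [ChartedSpace (Model n) M]
  [IsManifold 𝓘(ℝ, Model n) ∞ M]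

theorem exists_smoothVF_eq [T2Space M] {U : Set M} {X : ∀ x : M, Tan n x}
    (hX : ContMDiffOn 𝓘(ℝ, Model n) 𝓘(ℝ, Model n).tangent ∞
      (fun x => (⟨x, X x⟩ : TangentBundle 𝓘(ℝ, Model n) M)) U) (hU : IsOpen U) {x : M} (hx : x ∈ U) :
    ∃ X' : ∀ x : M, Tan n x, SmoothVF X' ∧ ∀ᶠ y in 𝓝 x, X' y = X y := by
  obtain ⟨ρ, -, hρ⟩ := (SmoothBumpFunction.nhds_basis_tsupport (I := 𝓘(ℝ, Model n)) x).mem_iff.1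
    (hU.mem_nhds hx)
  refine ⟨fun y => ρ y • X y, ?_, ?_⟩
  · exact ContMDiffOn.smul_section_of_tsupport (V := fun x : M => Tan n x) ρ.contMDiff.contMDiffOn hU hρ hX
  · filter_upwards [ρ.eventuallyEq_one] with y hy
    rw [hy]
    simp

/-- A smooth local frame of vector fields, extended to the manifold. -/
theorem exists_local_frame [T2Space M] (x : M) : ∃ X : (Fin n ⊕ Fin n) → ∀ x : M, Tan n x, (∀ a, SmoothVF (X a)) ∧
    ∀ᶠ y in 𝓝 x, ∀ v : Tan n y, v = ∑ a, (show Model n from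
      ((trivializationAt (Model n) (TangentSpace 𝓘(ℝ, Model n) : M → Type _) x) ⟨y, v⟩).2) a • X a y := by
  set e := trivializationAt (Model n) (TangentSpace 𝓘(ℝ, Model n) : M → Type _) x with he
  let b := (EuclideanSpace.basisFun (Fin n ⊕ Fin n) ℝ).toBasis
  have h1 : ∀ a, ∃ X' : ∀ x : M, Tan n x, SmoothVF X' ∧ ∀ᶠ y in 𝓝 x, X' y = e.localFrame b a y :=
    fun a => exists_smoothVF_eq (e.contMDiffOn_localFrame_baseSet ∞ b a) e.open_baseSet
      (FiberBundle.mem_baseSet_trivializationAt' x)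
  choose X hX hXe using h1
  refine ⟨X, hX, ?_⟩
  filter_upwards [Filter.eventually_all.2 hXe, e.open_baseSet.mem_nhds
    (FiberBundle.mem_baseSet_trivializationAt' x)] with y hy hye v
  have h2 := (e.basisAt b hye).sum_repr v
  conv_lhs => rw [← h2]
  refine Finset.sum_congr rfl fun a _ => ?_
  rw [hy a, e.localFrame_apply_of_mem_baseSet b hye]
  congr 1

/-- Evaluation of a family of forms on families of vectors is smooth if this holds for vector
fields. -/
theorem contMDiffAt_form_apply [T2Space M] {E' H' N : Type*} [NormedAddCommGroup E']
    [NormedSpace ℝ E']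
    [TopologicalSpace H'] {J : ModelWithCorners ℝ E' H'} [TopologicalSpace N] [ChartedSpace H' N]
    {b : N → M} {α : ∀ p, NForm n (b p)} {p₀ : N}
    (hα : ∀ Y : Fin n → ∀ x : M, Tan n x, (∀ i, SmoothVF (Y i)) →
      ContMDiffAt J 𝓘(ℝ, ℂ) ∞ (fun p => α p (fun i => Y i (b p))) p₀)
    {V : Fin n → ∀ p, Tan n (b p)} (hV : ∀ i, ContMDiffAt J 𝓘(ℝ, Model n).tangent ∞
      (fun p => (⟨b p, V i p⟩ : TangentBundle 𝓘(ℝ, Model n) M)) p₀) (hb : ContinuousAt b p₀) :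
    ContMDiffAt J 𝓘(ℝ, ℂ) ∞ (fun p => α p (fun i => V i p)) p₀ := by
  set e := trivializationAt (Model n) (TangentSpace 𝓘(ℝ, Model n) : M → Type _) (b p₀) with he
  obtain ⟨X, hX, hXe⟩ := exists_local_frame (n := n) (b p₀)
  have hc : ∀ i a, ContMDiffAt J 𝓘(ℝ, ℝ) ∞ (fun p => (show Model n from (e ⟨b p, V i p⟩).2) a) p₀ := by
    intro i a
    have h1 := ((Trivialization.contMDiffAt_iff (e := e) (by
      rw [Trivialization.mem_source]; exact FiberBundle.mem_baseSet_trivializationAt' _)).1 (hV i)).2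
    have h2 : ContMDiff 𝓘(ℝ, Model n) 𝓘(ℝ, ℝ) ∞ (fun z : Model n => z a) :=
      (EuclideanSpace.proj a : Model n →L[ℝ] ℝ).contDiff.contMDiff
    exact h2.contMDiffAt.comp p₀ h1
  -- The value of the form is expanded multilinearly in the frame; `g` selects a frame vector for
  -- each argument.
  have h3 : ContMDiffAt J 𝓘(ℝ, ℂ) ∞ (fun p => ∑ g : Fin n → Fin n ⊕ Fin n,
      ((∏ i, (show Model n from (e ⟨b p, V i p⟩).2) (g i) : ℝ) : ℂ) *
        α p (fun i => X (g i) (b p))) p₀ := by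
    refine contMDiffAt_finsetSum fun g _ => ?_
    exact ContMDiffAt.cmul (ContMDiffAt.ofRealC (contMDiffAt_finsetProd fun i _ => hc i (g i)))
      (hα (fun i => X (g i)) fun i => hX _)
  refine h3.congr_of_eventuallyEq ?_
  filter_upwards [hb.eventually hXe] with p hp
  have h4 : (fun i => V i p) = fun i => ∑ a, (show Model n from (e ⟨b p, V i p⟩).2) a • X a (b p) := by
    ext1 i; exact hp (V i p)
  have h5 := (α p).toMultilinearMap.map_sum (fun i a => (show Model n from (e ⟨b p, V i p⟩).2) a • X a (b p))
  conv_lhs => rw [h4]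
  refine h5.trans (Finset.sum_congr rfl fun g _ => ?_)
  have h6 := (α p).toMultilinearMap.map_smul_univ (fun i => (show Model n from (e ⟨b p, V i p⟩).2) (g i)) (fun i => X (g i) (b p))
  refine h6.trans ?_
  rw [Complex.real_smul]
  rfl

end VectorFields

/-! ### Sections of `L^k ⊗ δ` -/

section Sections
variable {n : ℕ} {M : Type*} [TopologicalSpace M] [ChartedSpace (Model n) M]
  {L : M → Type*} [TopologicalSpace (TotalSpace ℂ L)] [∀ x, NormedAddCommGroup (L x)]
  [∀ x, InnerProductSpace ℂ (L x)] [FiberBundle ℂ L] [VectorBundle ℂ ℂ L]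
  {δ : M → Type*} [TopologicalSpace (TotalSpace ℂ δ)] [∀ x, AddCommGroup (δ x)]
  [∀ x, Module ℂ (δ x)] [∀ x, TopologicalSpace (δ x)] [FiberBundle ℂ δ] [VectorBundle ℂ ℂ δ]
  {k : ℕ}

theorem coef_tmul (x₀ x : M) (a : L x) (β : δ x) :
    coef k x₀ x (tpow k a ⊗ₜ[ℂ] β) = lcoord L x₀ x a ^ k * lcoord δ x₀ x β := by
  simp [coef, tpow, lcoord, PiTensorProduct.lift.tprod]

theorem tpow_smul {x : M} (c : ℂ) (a : L x) : tpow k (c • a) = c ^ k • tpow k a := by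
  have := (PiTensorProduct.tprod ℂ (s := fun _ : Fin k => L x)).map_smul_univ (fun _ => c) (fun _ => a)
  simpa [tpow] using this

theorem exists_eq_smul_tpow {x : M} {a : L x} (ha : a ≠ 0) (z : ⨂[ℂ]^k (L x)) :
    ∃ c : ℂ, z = c • tpow k a := by
  induction z using PiTensorProduct.induction_on with
  | smul_tprod r u =>
    choose c hc using fun i => exists_eq_smul ha (u i)
    refine ⟨r * ∏ i, c i, ?_⟩
    have := (PiTensorProduct.tprod ℂ (s := fun _ : Fin k => L x)).map_smul_univ c (fun _ => a)
    rw [mul_smul, tpow, ← this, funext hc]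
  | add z z' h h' =>
    obtain ⟨c, rfl⟩ := h
    obtain ⟨c', rfl⟩ := h'
    exact ⟨c + c', by rw [add_smul]⟩

theorem exists_eq_smul_tpow_tmul {x : M} {a : L x} (ha : a ≠ 0) {β : δ x} (hβ : β ≠ 0)
    (z : (⨂[ℂ]^k (L x)) ⊗[ℂ] (δ x)) : ∃ c : ℂ, z = c • (tpow k a ⊗ₜ[ℂ] β) := by
  induction z using TensorProduct.induction_on with
  | zero => exact ⟨0, by simp⟩
  | tmul u v =>
    obtain ⟨c, rfl⟩ := exists_eq_smul_tpow ha u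
    obtain ⟨c', rfl⟩ := exists_eq_smul hβ v
    exact ⟨c' * c, by rw [TensorProduct.smul_tmul_smul, mul_comm]⟩
  | add q q' h h' =>
    obtain ⟨c, rfl⟩ := h
    obtain ⟨c', rfl⟩ := h'
    exact ⟨c + c', by rw [add_smul]⟩

theorem coef_tmul_ne_zero {x₀ x : M} (hx : x ∈ dom L x₀) (hx' : x ∈ dom δ x₀) {a : L x}
    (ha : a ≠ 0) {β : δ x} (hβ : β ≠ 0) : coef k x₀ x (tpow k a ⊗ₜ[ℂ] β) ≠ 0 := by
  rw [coef_tmul]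
  exact mul_ne_zero (pow_ne_zero k (lcoord_ne_zero hx ha)) (lcoord_ne_zero hx' hβ)

theorem eq_coef_smul {x₀ x : M} (hx : x ∈ dom L x₀) (hx' : x ∈ dom δ x₀) {a : L x}
    (ha : a ≠ 0) {β : δ x} (hβ : β ≠ 0) (z : (⨂[ℂ]^k (L x)) ⊗[ℂ] (δ x)) :
    z = (coef k x₀ x z / (lcoord L x₀ x a ^ k * lcoord δ x₀ x β)) • (tpow k a ⊗ₜ[ℂ] β) := by
  obtain ⟨c, rfl⟩ := exists_eq_smul_tpow_tmul ha hβ z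
  have := coef_tmul_ne_zero (k := k) hx hx' ha hβ
  rw [map_smul, ← coef_tmul, smul_eq_mul, mul_div_cancel_right₀ _ this]

theorem coef_injective {x₀ x : M} (hx : x ∈ dom L x₀) (hx' : x ∈ dom δ x₀) :
    Function.Injective (coef (L := L) (δ := δ) k x₀ x) := by
  intro z z' h
  rw [eq_coef_smul hx hx' (frame_ne_zero hx) (frame_ne_zero hx') z, h,
    ← eq_coef_smul hx hx' (frame_ne_zero hx) (frame_ne_zero hx') z']

theorem smul_tmul_injective {x : M} {a : L x} (ha : a ≠ 0) {β : δ x} (hβ : β ≠ 0) {c c' : ℂ}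
    (h : c • (tpow k a ⊗ₜ[ℂ] β) = c' • (tpow k a ⊗ₜ[ℂ] β)) : c = c' := by
  have h2 := congrArg (coef k x x) h
  rw [map_smul, map_smul, smul_eq_mul, smul_eq_mul] at h2
  exact mul_right_cancel₀ (coef_tmul_ne_zero (mem_dom x) (mem_dom x) ha hβ) h2

section Param
variable {E' H' N : Type*} [NormedAddCommGroup E'] [NormedSpace ℝ E']
  [TopologicalSpace H'] {J : ModelWithCorners ℝ E' H'} [TopologicalSpace N] [ChartedSpace H' N]
  {b : N → M}

theorem contMDiffAt_coef {s : ∀ p, (⨂[ℂ]^k (L (b p))) ⊗[ℂ] (δ (b p))} {p₀ : N} {x₀ : M}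
    {g : N → ℂ} {a : ∀ p, L (b p)} {β : ∀ p, δ (b p)} (hg : ContMDiffAt J 𝓘(ℝ, ℂ) ∞ g p₀)
    (ha : ContMDiffAt J 𝓘(ℝ, ℂ) ∞ (fun p => lcoord L x₀ (b p) (a p)) p₀)
    (hβ : ContMDiffAt J 𝓘(ℝ, ℂ) ∞ (fun p => lcoord δ x₀ (b p) (β p)) p₀)
    (hs : ∀ᶠ p in 𝓝 p₀, s p = g p • (tpow k (a p) ⊗ₜ[ℂ] β p)) :
    ContMDiffAt J 𝓘(ℝ, ℂ) ∞ (fun p => coef k x₀ (b p) (s p)) p₀ := by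
  refine (ContMDiffAt.cmul hg (ContMDiffAt.cmul (ContMDiffAt.cpow_nat ha k) hβ)).congr_of_eventuallyEq ?_
  filter_upwards [hs] with p hp
  rw [hp, map_smul, coef_tmul, smul_eq_mul]

/-- The coefficient of a section with respect to local frames is smooth. -/
theorem contMDiffAt_coef_div {s : ∀ p, (⨂[ℂ]^k (L (b p))) ⊗[ℂ] (δ (b p))} {p₀ : N} {x₀ : M}
    {a : ∀ p, L (b p)} {β : ∀ p, δ (b p)} (hx : b p₀ ∈ dom L x₀) (hx' : b p₀ ∈ dom δ x₀)
    (ha : ContMDiffAt J 𝓘(ℝ, ℂ) ∞ (fun p => lcoord L x₀ (b p) (a p)) p₀) (ha0 : a p₀ ≠ 0)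
    (hβ : ContMDiffAt J 𝓘(ℝ, ℂ) ∞ (fun p => lcoord δ x₀ (b p) (β p)) p₀) (hβ0 : β p₀ ≠ 0)
    (hs : ContMDiffAt J 𝓘(ℝ, ℂ) ∞ (fun p => coef k x₀ (b p) (s p)) p₀) :
    ContMDiffAt J 𝓘(ℝ, ℂ) ∞ (fun p => coef k x₀ (b p) (s p) /
      (lcoord L x₀ (b p) (a p) ^ k * lcoord δ x₀ (b p) (β p))) p₀ :=
  ContMDiffAt.cdiv hs (ContMDiffAt.cmul (ContMDiffAt.cpow_nat ha k) hβ)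
    (mul_ne_zero (pow_ne_zero k (lcoord_ne_zero hx ha0)) (lcoord_ne_zero hx' hβ0))

/-- Smoothness does not depend on the trivialization. -/
theorem contMDiffAt_coef_change [VectorBundle ℝ ℂ L] [ContMDiffVectorBundle ∞ ℂ L 𝓘(ℝ, Model n)]
    [VectorBundle ℝ ℂ δ] [ContMDiffVectorBundle ∞ ℂ δ 𝓘(ℝ, Model n)]
    {s : ∀ p, (⨂[ℂ]^k (L (b p))) ⊗[ℂ] (δ (b p))} {p₀ : N} {x₀ x₁ : M}
    (hb : ContMDiffAt J 𝓘(ℝ, Model n) ∞ b p₀)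
    (hx : b p₀ ∈ dom L x₀) (hx' : b p₀ ∈ dom δ x₀) (hx1 : b p₀ ∈ dom L x₁) (hx1' : b p₀ ∈ dom δ x₁)
    (hs : ContMDiffAt J 𝓘(ℝ, ℂ) ∞ (fun p => coef k x₀ (b p) (s p)) p₀) :
    ContMDiffAt J 𝓘(ℝ, ℂ) ∞ (fun p => coef k x₁ (b p) (s p)) p₀ := by
  have hL := fun x (h : b p₀ ∈ dom L x) => ((smoothSecAt_iff h).1 ((smoothSecOn_frame (n := n) (E := L) x₀).smoothSecAt
    (trivializationAt ℂ L x₀).open_baseSet hx)).comp p₀ hb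
  have hδ := fun x (h : b p₀ ∈ dom δ x) => ((smoothSecAt_iff h).1 ((smoothSecOn_frame (n := n) (E := δ) x₀).smoothSecAt
    (trivializationAt ℂ δ x₀).open_baseSet hx')).comp p₀ hb
  refine contMDiffAt_coef (contMDiffAt_coef_div hx hx' (hL x₀ hx) (frame_ne_zero hx) (hδ x₀ hx')
    (frame_ne_zero hx') hs) (hL x₁ hx1) (hδ x₁ hx1') ?_
  filter_upwards [hb.continuousAt ((trivializationAt ℂ L x₀).open_baseSet.mem_nhds hx),
    hb.continuousAt ((trivializationAt ℂ δ x₀).open_baseSet.mem_nhds hx')] with p h1 h2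
  exact eq_coef_smul h1 h2 (frame_ne_zero h1) (frame_ne_zero h2) _

end Param

/-- The derivative of a family of multiples of a fixed section. -/
theorem hasTimeDeriv_of_smul {s : ℝ → Sec L δ k} {s' : Sec L δ k} {t : ℝ}
    (h : ∀ x, ∃ (z : (⨂[ℂ]^k (L x)) ⊗[ℂ] (δ x)) (g : ℝ → ℂ) (g' : ℂ), HasDerivAt g g' t ∧
      (∀ᶠ r in 𝓝 t, s r x = g r • z) ∧ s' x = g' • z) : HasTimeDeriv s s' t := by
  intro x l
  obtain ⟨z, g, g', h1, h2, h3⟩ := h x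
  rw [h3, map_smul, smul_eq_mul]
  refine (h1.mul_const (l z)).congr_of_eventuallyEq ?_
  filter_upwards [h2] with r hr
  rw [hr, map_smul, smul_eq_mul]

theorem HasTimeDeriv.coef {s : ℝ → Sec L δ k} {s' : Sec L δ k} {t : ℝ} (h : HasTimeDeriv s s' t)
    (x₀ x : M) : HasDerivAt (fun r => coef k x₀ x (s r x)) (coef k x₀ x (s' x)) t :=
  h x (HalfFormQuantization.coef k x₀ x)

theorem HasTimeDeriv.unique {s : ℝ → Sec L δ k} {s' s'' : Sec L δ k} {t : ℝ}
    (h : HasTimeDeriv s s' t) (h' : HasTimeDeriv s s'' t) : s' = s'' := by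
  ext1 x
  exact coef_injective (mem_dom x) (mem_dom x) ((h.coef x x).unique (h'.coef x x))

end Sections

/-! ### The isomorphisms `Ψ` -/

section Psi
variable {n : ℕ} {M : Type*} [TopologicalSpace M] [ChartedSpace (Model n) M]

theorem mem_Lam_iff {j : EndField n M} {x : M} {α : NForm n x} :
    α ∈ Lam j x ↔ IsN0 (j x) α.toAlternatingMap := Iff.rfl

theorem wedgeConj_eq {x : M} (α β : NForm n x) :
    wedgeConj α β = wedge α.toAlternatingMap β.toAlternatingMap := rfl

/-- The standard basis of the tangent space. -/
def tanBasis (x : M) : Module.Basis (Fin n ⊕ Fin n) ℝ (Tan n x) :=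
  (EuclideanSpace.basisFun (Fin n ⊕ Fin n) ℝ).toBasis

theorem tanBasis_coe (x : M) : ⇑(tanBasis (n := n) x) = stdBasis x := by
  ext1 a
  exact (congrFun (OrthonormalBasis.coe_toBasis (EuclideanSpace.basisFun (Fin n ⊕ Fin n) ℝ)) a).trans
    (EuclideanSpace.basisFun_apply _ _ a)

instance (x : M) : FiniteDimensional ℝ (Tan n x) :=
  inferInstanceAs (FiniteDimensional ℝ (Model n))

/-- The endomorphism `1 - j_b j_a`. -/
def twistEnd (ja jb : EndField n M) (x : M) : Tan n x →L[ℝ] Tan n x :=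
  ContinuousLinearMap.id ℝ _ - jb x ∘L ja x

theorem twistEnd_apply (ja jb : EndField n M) (x : M) (v : Tan n x) :
    twistEnd ja jb x v = v - jb x (ja x v) := rfl

theorem projN0_eq {ja jb : EndField n M} {x : M} {α : NForm n x} (hα : α ∈ Lam jb x)
    (v : Fin n → Tan n x) : projN0 ja α v = (1 / 2) ^ n * α (fun i => twistEnd ja jb x (v i)) :=
  typeProj_eq_map (α := α.toAlternatingMap) (K := (jb x).toLinearMap) (J := ja x) hα v

theorem projN0_self {j : EndField n M} {x : M} {α : NForm n x} (hα : α ∈ Lam j x)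
    (v : Fin n → Tan n x) : projN0 j α v = α v := 
  IsN0.typeProj_eq (α := α.toAlternatingMap) (J := j x) hα v

/-- The projection of a form of type `(n, 0)` for `j_b` to the forms of type `(n, 0)` for `j_a`. -/
def projForm (ja jb : EndField n M) {x : M} (α : NForm n x) : NForm n x :=
  ((1 / 2 : ℂ) ^ n) • α.compContinuousLinearMap (twistEnd ja jb x)

theorem projForm_apply (ja jb : EndField n M) {x : M} (α : NForm n x) (v : Fin n → Tan n x) :
    projForm ja jb α v = (1 / 2) ^ n * α (fun i => twistEnd ja jb x (v i)) := rfl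

variable [IsManifold 𝓘(ℝ, Model n) ∞ M] {Ω : ∀ x : M, Tan n x →L[ℝ] Tan n x →L[ℝ] ℝ}
  {ja jb : EndField n M}

/-- Both sides equal `j_a v + j_b v`. -/
theorem twistEnd_comp (hja : IsCompatible Ω ja) (hjb : IsCompatible Ω jb) (x : M) (v : Tan n x) :
    twistEnd ja jb x (ja x v) = jb x (twistEnd ja jb x v) := by
  rw [twistEnd_apply, twistEnd_apply, map_sub, hja.sq, hjb.sq, map_neg]
  abel

/-- If `v = j_b (j_a v)` then `j_b v = -j_a v`, and `Ω(v, j_a v)` and `Ω(v, j_b v)` would have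
opposite signs. It is the positivity of both structures that makes the projections between their
lines of forms invertible. -/
theorem twistEnd_injective (hja : IsCompatible Ω ja) (hjb : IsCompatible Ω jb) (x : M) :
    Function.Injective (twistEnd ja jb x) := by
  rw [injective_iff_map_eq_zero]
  intro v hv
  by_contra h0
  rw [twistEnd_apply, sub_eq_zero] at hv
  have h1 : jb x v = -ja x v := by
    conv_lhs => rw [hv]
    exact hjb.sq _ _
  have h2 := hjb.positive x v h0
  rw [h1, map_neg] at h2
  linarith [hja.positive x v h0]

theorem twistEnd_surjective (hja : IsCompatible Ω ja) (hjb : IsCompatible Ω jb) (x : M) :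
    Function.Surjective (twistEnd ja jb x) :=
  LinearMap.surjective_of_injective (f := (twistEnd ja jb x).toLinearMap)
    (twistEnd_injective hja hjb x)

theorem projForm_mem (hja : IsCompatible Ω ja) (hjb : IsCompatible Ω jb) {x : M} {α : NForm n x}
    (hα : α ∈ Lam jb x) : projForm ja jb α ∈ Lam ja x := by
  intro v i
  have h : (fun l => twistEnd ja jb x (Function.update v i (ja x (v i)) l)) =
      Function.update (fun l => twistEnd ja jb x (v l)) i (jb x (twistEnd ja jb x (v i))) := by
    ext1 l
    by_cases hl : l = i
    · subst hl; simp [twistEnd_comp hja hjb]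
    · simp [hl]
  rw [projForm_apply, projForm_apply, h, hα (fun l => twistEnd ja jb x (v l)) i]
  ring

theorem projForm_eq_zero (hja : IsCompatible Ω ja) (hjb : IsCompatible Ω jb) {x : M} {α : NForm n x}
    (h : projForm ja jb α = 0) : α = 0 := by
  ext v
  choose w hw using fun i => twistEnd_surjective hja hjb x (v i)
  have := congrArg (fun η : NForm n x => η w) h
  simp only [projForm_apply, hw, ContinuousAlternatingMap.coe_zero, Pi.zero_apply, mul_eq_zero] at this
  exact this.resolve_left (pow_ne_zero _ (by norm_num))

theorem wedgeConj_projN0 {x : M} {α α' β : NForm n x} (hβ : β ∈ Lam ja x)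
    (h : ∀ v, projN0 ja α v = projN0 ja α' v) : wedgeConj α β = wedgeConj α' β :=
  wedge_congr_typeProj (tanBasis x) (J := ja x) hβ h

variable {δ : M → Type*} [TopologicalSpace (TotalSpace ℂ δ)] [∀ x, AddCommGroup (δ x)]
  [∀ x, Module ℂ (δ x)] [∀ x, TopologicalSpace (δ x)] [FiberBundle ℂ δ] [VectorBundle ℂ ℂ δ]
  (H : HalfFormFamily Ω δ)

theorem HalfFormFamily.mem_Lam (hja : IsCompatible Ω ja) (x : M) (q : δ x ⊗[ℂ] δ x) :
    H.form ja x q ∈ Lam ja x := by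
  rw [← H.range_eq ja hja x]
  exact LinearMap.mem_range_self _ _

theorem HalfFormFamily.ne_zero (hja : IsCompatible Ω ja) {x : M} {e : δ x} (he : e ≠ 0) :
    H.form ja x (e ⊗ₜ[ℂ] e) ≠ 0 := fun h =>
  tmul_self_ne_zero he (H.injective ja hja x (by rw [h, map_zero]))

theorem HalfFormFamily.exists_eq_mul (hja : IsCompatible Ω ja) {x : M} {e : δ x} (he : e ≠ 0)
    {α : NForm n x} (hα : α ∈ Lam ja x) : ∃ c : ℂ, α = c • H.form ja x (e ⊗ₜ[ℂ] e) := by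
  rw [← H.range_eq ja hja x] at hα
  obtain ⟨q, rfl⟩ := hα
  obtain ⟨c, rfl⟩ := exists_eq_smul_tmul he q
  exact ⟨c, by rw [map_smul]⟩

/-- The isomorphism from `δ²` to the line of `j_a`, and the one to the line of `j_b` followed by the
projection, are isomorphisms between the same two lines, hence proportional. -/
theorem exists_kappa (hja : IsCompatible Ω ja) (hjb : IsCompatible Ω jb) (x : M) :
    ∃ c : ℂ, c ≠ 0 ∧ ∀ q v, projN0 ja (H.form jb x q) v = c * H.form ja x q v := by
  have he := frame_ne_zero (mem_dom (E := δ) x)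
  set e := frame δ x x
  obtain ⟨c, hc⟩ := H.exists_eq_mul hja he (projForm_mem hja hjb (H.mem_Lam hjb x (e ⊗ₜ[ℂ] e)))
  refine ⟨c, ?_, fun q v => ?_⟩
  · rintro rfl
    rw [zero_smul ℂ (H.form ja x (e ⊗ₜ[ℂ] e))] at hc
    exact H.ne_zero hjb he (projForm_eq_zero hja hjb hc)
  · obtain ⟨d, rfl⟩ := exists_eq_smul_tmul he q
    have := congrArg (fun η : NForm n x => η v) hc
    simp only [projForm_apply, ContinuousAlternatingMap.smul_apply, smul_eq_mul] at this
    rw [projN0_eq (H.mem_Lam hjb x _)]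
    simp only [map_smul, ContinuousAlternatingMap.smul_apply, smul_eq_mul]
    linear_combination d * this

open Classical in
/-- The factor by which the projections `Λ_{j_b} → Λ_{j_a}` differ from the identity of `δ²`. -/
def kappa (ja jb : EndField n M) (x : M) : ℂ :=
  if h : ∃ c : ℂ, c ≠ 0 ∧ ∀ q v, projN0 ja (H.form jb x q) v = c * H.form ja x q v then h.choose
  else 0

theorem kappa_ne_zero (hja : IsCompatible Ω ja) (hjb : IsCompatible Ω jb) (x : M) :
    kappa H ja jb x ≠ 0 := by
  rw [kappa, dif_pos (exists_kappa H hja hjb x)]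
  exact (exists_kappa H hja hjb x).choose_spec.1

theorem projN0_form (hja : IsCompatible Ω ja) (hjb : IsCompatible Ω jb) (x : M) (q : δ x ⊗[ℂ] δ x)
    (v : Fin n → Tan n x) : projN0 ja (H.form jb x q) v = kappa H ja jb x * H.form ja x q v := by
  rw [kappa, dif_pos (exists_kappa H hja hjb x)]
  exact (exists_kappa H hja hjb x).choose_spec.2 q v

theorem HalfFormFamily.exists_apply_ne_zero (hja : IsCompatible Ω ja) {x : M} {e : δ x} (he : e ≠ 0) :
    ∃ v, H.form ja x (e ⊗ₜ[ℂ] e) v ≠ 0 := by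
  by_contra! h
  exact H.ne_zero hja he (by ext v; exact h v)

theorem kappa_self (hja : IsCompatible Ω ja) (x : M) : kappa H ja ja x = 1 := by
  obtain ⟨v, hv⟩ := H.exists_apply_ne_zero hja (frame_ne_zero (mem_dom (E := δ) x))
  have := projN0_form H hja hja x (frame δ x x ⊗ₜ[ℂ] frame δ x x) v
  rw [projN0_self (H.mem_Lam hja x _)] at this
  exact mul_right_cancel₀ hv (by rw [← this, one_mul])

/-- Pairing with (n, 0)-forms of `j_a` only sees the projection to their line, so `Ψ` is the inverse
of this projection on the line of `j_b`. The condition on `ψ` thereby becomes scalar. -/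
theorem isMorphism_iff (hja : IsCompatible Ω ja) (hjb : IsCompatible Ω jb) {ψ : M → ℂ} :
    IsMorphism H ja jb ψ ↔ ∀ x, ψ x ^ 2 * kappa H ja jb x = 1 := by
  have key : ∀ x q v, projN0 ja (ψ x ^ 2 • H.form jb x q) v =
      projN0 ja ((ψ x ^ 2 * kappa H ja jb x) • H.form ja x q) v := by
    intro x q v
    rw [← map_smul, ← map_smul, projN0_form H hja hjb, projN0_self (H.mem_Lam hja x _), map_smul,
      map_smul, ContinuousAlternatingMap.smul_apply, ContinuousAlternatingMap.smul_apply, smul_eq_mul,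
      smul_eq_mul]
    ring
  constructor
  · intro h x
    have he := frame_ne_zero (mem_dom (E := δ) x)
    set q := frame δ x x ⊗ₜ[ℂ] frame δ x x
    have h1 := (h x q).2.2 (H.form ja x q) (H.mem_Lam hja x q)
    rw [wedgeConj_projN0 (H.mem_Lam hja x q) (key x q)] at h1
    have h2 := wedge_ne_zero (α := (H.form ja x q).toAlternatingMap) (β := (H.form ja x q).toAlternatingMap) (J := ja x) (H.mem_Lam hja x q) (H.mem_Lam hja x q)
      (fun h => H.ne_zero hja he (ContinuousAlternatingMap.toAlternatingMap_injective h))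
      (fun h => H.ne_zero hja he (ContinuousAlternatingMap.toAlternatingMap_injective h))
    have h3 : wedgeConj (H.form ja x q) (H.form ja x q) (stdBasis x) ≠ 0 := by
      intro h4
      rw [← tanBasis_coe] at h4
      exact h2 (AlternatingMap.eq_zero_of_basis _ _ h4)
    have h4 := congrArg (fun η => η (stdBasis x)) h1
    have h5 := wedge_smul_left (ψ x ^ 2 * kappa H ja jb x) (H.form ja x q).toAlternatingMap
      (H.form ja x q).toAlternatingMap (stdBasis x)
    exact mul_right_cancel₀ h3 ((h5.symm.trans h4).trans (one_mul _).symm)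
  · intro h x q
    refine ⟨H.mem_Lam hja x q, Submodule.smul_mem _ _ (H.mem_Lam hjb x q), fun β hβ => ?_⟩
    rw [wedgeConj_projN0 hβ (key x q), h x, one_smul]

end Psi

/-! ### Calculus of complex valued functions -/

section Calculus
variable {n : ℕ} {M : Type*} [TopologicalSpace M] [ChartedSpace (Model n) M]

theorem dC_mul {g h : M → ℂ} {x : M} (hg : MDifferentiableAt 𝓘(ℝ, Model n) 𝓘(ℝ, ℂ) g x)
    (hh : MDifferentiableAt 𝓘(ℝ, Model n) 𝓘(ℝ, ℂ) h x) (v : Tan n x) :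
    dC (fun y => g y * h y) x v = g x * dC h x v + dC g x v * h x := by
  have := (hg.hasMFDerivAt.mul' hh.hasMFDerivAt).mfderiv
  exact congrArg (fun l : Tan n x →L[ℝ] ℂ => l v) this

theorem dC_congr {g h : M → ℂ} {x : M} (H : ∀ᶠ y in 𝓝 x, g y = h y) (v : Tan n x) :
    dC g x v = dC h x v := by
  have : mfderiv 𝓘(ℝ, Model n) 𝓘(ℝ, ℂ) g x = mfderiv 𝓘(ℝ, Model n) 𝓘(ℝ, ℂ) h x :=
    Filter.EventuallyEq.mfderiv_eq H
  exact congrArg (fun l : Tan n x →L[ℝ] ℂ => l v) this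

theorem dC_const (c : ℂ) (x : M) (v : Tan n x) : dC (fun _ => c) x v = 0 :=
  congrArg (fun l : Tan n x →L[ℝ] ℂ => l v) (mvfderiv_const c)

theorem dC_add {g h : M → ℂ} {x : M} (hg : MDifferentiableAt 𝓘(ℝ, Model n) 𝓘(ℝ, ℂ) g x)
    (hh : MDifferentiableAt 𝓘(ℝ, Model n) 𝓘(ℝ, ℂ) h x) (v : Tan n x) :
    dC (fun y => g y + h y) x v = dC g x v + dC h x v :=
  congrArg (fun l : Tan n x →L[ℝ] ℂ => l v) (mvfderiv_add hg hh)

theorem dC_ofReal {g : M → ℝ} {x : M} (hg : MDifferentiableAt 𝓘(ℝ, Model n) 𝓘(ℝ, ℝ) g x)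
    (v : Tan n x) : dC (fun y => (g y : ℂ)) x v = (dR g x v : ℂ) := by
  have h1 : HasMFDerivAt 𝓘(ℝ, ℝ) 𝓘(ℝ, ℂ) (fun r : ℝ => (r : ℂ)) (g x) Complex.ofRealCLM :=
    Complex.ofRealCLM.hasFDerivAt.hasMFDerivAt
  exact congrArg (fun l : Tan n x →L[ℝ] ℂ => l v) (h1.comp x hg.hasMFDerivAt).mfderiv

/-- The chain rule. -/
theorem dC_comp {F : M → M} {g : M → ℂ} {x : M}
    (hg : MDifferentiableAt 𝓘(ℝ, Model n) 𝓘(ℝ, ℂ) g (F x))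
    (hF : MDifferentiableAt 𝓘(ℝ, Model n) 𝓘(ℝ, Model n) F x) (v : Tan n x) :
    dC (fun y => g (F y)) x v = dC g (F x) (mfderiv 𝓘(ℝ, Model n) 𝓘(ℝ, Model n) F x v) :=
  congrArg (fun l : Tan n x →L[ℝ] ℂ => l v) (mfderiv_comp x hg hF)

theorem hasDerivAt_dC_comp {γ : ℝ → M} {g : M → ℂ} {t : ℝ} {v : Tan n (γ t)}
    (hg : MDifferentiableAt 𝓘(ℝ, Model n) 𝓘(ℝ, ℂ) g (γ t))
    (hγ : HasMFDerivAt 𝓘(ℝ, ℝ) 𝓘(ℝ, Model n) γ t ((1 : ℝ →L[ℝ] ℝ).smulRight v)) :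
    HasDerivAt (fun s => g (γ s)) (dC g (γ t) v) t := by
  have h : HasFDerivAt (g ∘ γ) ((show Model n →L[ℝ] ℂ from mfderiv 𝓘(ℝ, Model n) 𝓘(ℝ, ℂ) g (γ t)).comp
    ((1 : ℝ →L[ℝ] ℝ).smulRight (show Model n from v))) t := (hg.hasMFDerivAt.comp t hγ).hasFDerivAt
  have h2 : ((1 : ℝ →L[ℝ] ℝ).smulRight (show Model n from v)) 1 = v := one_smul ℝ (show Model n from v)
  have h3 := h.hasDerivAt
  rw [ContinuousLinearMap.comp_apply, h2] at h3
  exact h3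

theorem hasDerivAt_dR_comp {γ : ℝ → M} {g : M → ℝ} {t : ℝ} {v : Tan n (γ t)}
    (hg : MDifferentiableAt 𝓘(ℝ, Model n) 𝓘(ℝ, ℝ) g (γ t))
    (hγ : HasMFDerivAt 𝓘(ℝ, ℝ) 𝓘(ℝ, Model n) γ t ((1 : ℝ →L[ℝ] ℝ).smulRight v)) :
    HasDerivAt (fun s => g (γ s)) (dR g (γ t) v) t := by
  have h : HasFDerivAt (g ∘ γ) ((show Model n →L[ℝ] ℝ from mfderiv 𝓘(ℝ, Model n) 𝓘(ℝ, ℝ) g (γ t)).comp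
    ((1 : ℝ →L[ℝ] ℝ).smulRight (show Model n from v))) t := (hg.hasMFDerivAt.comp t hγ).hasFDerivAt
  have h2 : ((1 : ℝ →L[ℝ] ℝ).smulRight (show Model n from v)) 1 = v := one_smul ℝ (show Model n from v)
  have h3 := h.hasDerivAt
  rw [ContinuousLinearMap.comp_apply, h2] at h3
  exact h3

end Calculus

/-! ### Flows -/

section Flow
variable {n : ℕ} {M : Type*} [TopologicalSpace M] [ChartedSpace (Model n) M]
  {X : ∀ x : M, Tan n x} {φ : ℝ → M → M}

/-- The differential of the time `t` map of a flow. -/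
abbrev dφ (φ : ℝ → M → M) (t : ℝ) (x : M) : Tan n x →L[ℝ] Tan n (φ t x) :=
  mfderiv 𝓘(ℝ, Model n) 𝓘(ℝ, Model n) (φ t) x

theorem IsFlow.contMDiff_map (h : IsFlow X φ) (t : ℝ) :
    ContMDiff 𝓘(ℝ, Model n) 𝓘(ℝ, Model n) ∞ (φ t) :=
  h.smooth.comp (contMDiff_const.prodMk contMDiff_id)

theorem IsFlow.mdifferentiableAt (h : IsFlow X φ) (t : ℝ) (x : M) :
    MDifferentiableAt 𝓘(ℝ, Model n) 𝓘(ℝ, Model n) (φ t) x :=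
  (h.contMDiff_map t).mdifferentiableAt (by simp)

theorem IsFlow.continuous (h : IsFlow X φ) : Continuous (fun p : ℝ × M => φ p.1 p.2) :=
  h.smooth.continuous

theorem IsFlow.hasMFDerivAt (h : IsFlow X φ) (x : M) (t : ℝ) :
    HasMFDerivAt 𝓘(ℝ, ℝ) 𝓘(ℝ, Model n) (fun t => φ t x) t
      ((1 : ℝ →L[ℝ] ℝ).smulRight (X (φ t x))) := h.integralCurve x t

theorem IsFlow.mfderiv_apply_one (h : IsFlow X φ) (x : M) (t : ℝ) :
    mfderiv 𝓘(ℝ, ℝ) 𝓘(ℝ, Model n) (fun t => φ t x) t (1 : ℝ) = X (φ t x) := by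
  rw [(h.hasMFDerivAt x t).mfderiv]
  exact one_smul ℝ (X (φ t x))

variable [IsManifold 𝓘(ℝ, Model n) ∞ M]

/-- The differential of the flow, applied to a smooth family of vectors, is smooth. -/
theorem IsFlow.contMDiffAt_mfderiv (h : IsFlow X φ) {E' H' N : Type*} [NormedAddCommGroup E']
    [NormedSpace ℝ E'] [TopologicalSpace H'] {J : ModelWithCorners ℝ E' H'} [TopologicalSpace N]
    [ChartedSpace H' N] {τ : N → ℝ} {b : N → M} {V : ∀ p, Tan n (b p)} {p₀ : N}
    (hτ : ContMDiffAt J 𝓘(ℝ, ℝ) ∞ τ p₀)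
    (hV : ContMDiffAt J 𝓘(ℝ, Model n).tangent ∞
      (fun p => (⟨b p, V p⟩ : TangentBundle 𝓘(ℝ, Model n) M)) p₀) :
    ContMDiffAt J 𝓘(ℝ, Model n).tangent ∞ (fun p => (⟨φ (τ p) (b p), dφ φ (τ p) (b p) (V p)⟩ :
      TangentBundle 𝓘(ℝ, Model n) M)) p₀ := by
  have h0 : ContMDiff 𝓘(ℝ, ℝ) 𝓘(ℝ, ℝ).tangent ∞
      (fun t : ℝ => (⟨t, (0 : ℝ)⟩ : TangentBundle 𝓘(ℝ, ℝ) ℝ)) :=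
    Bundle.contMDiff_zeroSection ℝ (fun t : ℝ => TangentSpace 𝓘(ℝ, ℝ) t)
  have h1 : ContMDiffAt J ((𝓘(ℝ, ℝ).prod 𝓘(ℝ, Model n)).tangent) ∞
      (fun p => (⟨(τ p, b p), (0, V p)⟩ : TangentBundle (𝓘(ℝ, ℝ).prod 𝓘(ℝ, Model n)) (ℝ × M))) p₀ :=
    (contMDiff_equivTangentBundleProd_symm (n := ∞) (I := 𝓘(ℝ, ℝ)) (M := ℝ) (I' := 𝓘(ℝ, Model n))
      (M' := M)).contMDiffAt.comp p₀ ((h0.contMDiffAt.comp p₀ hτ).prodMk hV)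
  have h2 := ((h.smooth.contMDiff_tangentMap (m := ∞) (by simp)).contMDiffAt).comp p₀ h1
  refine h2.congr_of_eventuallyEq (Filter.Eventually.of_forall fun p => ?_)
  change _ = (⟨φ (τ p) (b p), mfderiv (𝓘(ℝ, ℝ).prod 𝓘(ℝ, Model n)) 𝓘(ℝ, Model n)
    (fun p : ℝ × M => φ p.1 p.2) (τ p, b p) (0, V p)⟩ : TangentBundle 𝓘(ℝ, Model n) M)
  have := mfderiv_prod_eq_add_apply (v := ((0, V p) : ℝ × Model n))
    (h.smooth.mdifferentiableAt (x := (τ p, b p)) (by simp))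
  have h3 : mfderiv 𝓘(ℝ, ℝ) 𝓘(ℝ, Model n) (fun z => φ z (b p)) (τ p) (0 : ℝ) = 0 :=
    map_zero (mfderiv 𝓘(ℝ, ℝ) 𝓘(ℝ, Model n) (fun z => φ z (b p)) (τ p))
  exact congrArg (fun w : Tan n (φ (τ p) (b p)) => (⟨φ (τ p) (b p), w⟩ : TangentBundle 𝓘(ℝ, Model n) M))
    (this.trans ((congrArg (fun w : Tan n (φ (τ p) (b p)) => w + dφ φ (τ p) (b p) (V p)) h3).trans
      (zero_add (dφ φ (τ p) (b p) (V p))))).symm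

/-- The vector field of a smooth flow is smooth. -/
theorem IsFlow.smoothVF (h : IsFlow X φ) : SmoothVF X := by
  -- `X` is the image of the unit vector in the time direction, at time 0, under the differential of
  -- `(t, x) ↦ φ t x`.
  have h1 : ContMDiff 𝓘(ℝ, Model n) ((𝓘(ℝ, ℝ).prod 𝓘(ℝ, Model n)).tangent) ∞
      (fun x => (⟨(0, x), ((1 : ℝ), (0 : Model n))⟩ : TangentBundle (𝓘(ℝ, ℝ).prod 𝓘(ℝ, Model n)) (ℝ × M))) :=
    (contMDiff_equivTangentBundleProd_symm (n := ∞) (I := 𝓘(ℝ, ℝ)) (M := ℝ) (I' := 𝓘(ℝ, Model n))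
      (M' := M)).comp ((contMDiff_const (c := (⟨0, (1:ℝ)⟩ : TangentBundle 𝓘(ℝ, ℝ) ℝ))).prodMk
        (Bundle.contMDiff_zeroSection ℝ (TangentSpace 𝓘(ℝ, Model n) : M → Type _)))
  have h2 := (h.smooth.contMDiff_tangentMap (m := ∞) (by simp)).comp h1
  refine (contMDiff_congr fun x => ?_).1 h2
  change (⟨φ 0 x, mfderiv (𝓘(ℝ, ℝ).prod 𝓘(ℝ, Model n)) 𝓘(ℝ, Model n)
    (fun p : ℝ × M => φ p.1 p.2) (0, x) ((1 : ℝ), (0 : Model n))⟩ : TangentBundle 𝓘(ℝ, Model n) M) = _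
  have := mfderiv_prod_eq_add_apply (v := (((1 : ℝ), (0 : Model n)) : ℝ × Model n))
    (h.smooth.mdifferentiableAt (x := ((0 : ℝ), x)) (by simp))
  have h3 : mfderiv (𝓘(ℝ, ℝ).prod 𝓘(ℝ, Model n)) 𝓘(ℝ, Model n)
    (fun p : ℝ × M => φ p.1 p.2) (0, x) ((1 : ℝ), (0 : Model n)) = X (φ 0 x) := by
    refine this.trans ?_
    have h4 : mfderiv 𝓘(ℝ, Model n) 𝓘(ℝ, Model n) (fun z => φ 0 z) x (0 : Model n) = 0 :=
      map_zero (dφ φ 0 x)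
    refine (congrArg₂ (· + ·) (h.mfderiv_apply_one x 0) h4).trans ?_
    exact add_zero (X (φ 0 x))
  rw [h3, h.zero]

/-- Both sides are integral curves of `X` in the variable `s` with the same value at `s = 0`, and on
a Hausdorff manifold these are unique. -/
theorem IsFlow.add [T2Space M] (h : IsFlow X φ) (s t : ℝ) (x : M) :
    φ (s + t) x = φ s (φ t x) := by
  have h1 := isMIntegralCurve_Ioo_eq_of_contMDiff_boundaryless (t₀ := 0)
    (h.smoothVF.of_le (by simp)) ((h.integralCurve x).comp_add t) (h.integralCurve (φ t x))
    (by simp [h.zero])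
  exact congrFun h1 s

theorem IsFlow.neg_apply [T2Space M] (h : IsFlow X φ) (t : ℝ) (x : M) : φ (-t) (φ t x) = x := by
  rw [← h.add, neg_add_cancel, h.zero]

theorem IsFlow.apply_neg [T2Space M] (h : IsFlow X φ) (t : ℝ) (x : M) : φ t (φ (-t) x) = x := by
  rw [← h.add, add_neg_cancel, h.zero]

/-- The two sides live in tangent spaces at points that are equal but not definitionally so. Every
tangent space being the model space, they are compared there; the transport lemmas below use the
same device. -/
theorem IsFlow.mfderiv_comp [T2Space M] (h : IsFlow X φ) (s t : ℝ) (x : M) (v : Tan n x) :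
    (show Model n from dφ φ (s + t) x v) = dφ φ s (φ t x) (dφ φ t x v) := by
  have h1 : φ (s + t) = φ s ∘ φ t := funext fun x => h.add s t x
  have h2 := _root_.mfderiv_comp x (h.mdifferentiableAt s (φ t x)) (h.mdifferentiableAt t x)
  rw [← h1] at h2
  exact congrArg (fun l : Model n →L[ℝ] Model n => l v) h2

theorem IsFlow.mfderiv_zero (h : IsFlow X φ) (x : M) (v : Tan n x) :
    (show Model n from dφ φ 0 x v) = v := by
  have h1 : φ 0 = id := funext h.zero
  have h2 : mfderiv 𝓘(ℝ, Model n) 𝓘(ℝ, Model n) (id : M → M) x = ContinuousLinearMap.id ℝ _ :=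
    mfderiv_id
  rw [← h1] at h2
  exact congrArg (fun l : Model n →L[ℝ] Model n => l v) h2

theorem IsFlow.mfderiv_isInvertible [T2Space M] (h : IsFlow X φ) (t : ℝ) (x : M) :
    (dφ (n := n) φ t x).IsInvertible := by
  refine ContinuousLinearMap.IsInvertible.of_inverse (g := (show Tan n (φ t x) →L[ℝ] Tan n x from dφ φ (-t) (φ t x))) ?_ ?_
  all_goals ext1 v
  · have h1 := h.mfderiv_comp t (-t) (φ t x) v
    have h2 := h.mfderiv_zero (φ t x) v
    rw [← add_neg_cancel t] at h2
    rw [h.neg_apply] at h1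
    exact h1.symm.trans h2
  · have h1 := h.mfderiv_comp (-t) t x v
    have h2 := h.mfderiv_zero x v
    rw [← neg_add_cancel t] at h2
    exact h1.symm.trans h2

/-- The flow preserves its vector field. -/
theorem IsFlow.mfderiv_apply_self [T2Space M] (h : IsFlow X φ) (t : ℝ) (x : M) :
    dφ φ t x (X x) = X (φ t x) := by
  have h1 : (fun s => φ (s + t) x) = fun s => φ t (φ s x) := by
    ext1 s
    rw [add_comm, h.add]
  have h2 := ((h.integralCurve x).comp_add t 0).mfderiv
  have h0 := h.hasMFDerivAt x 0
  rw [show ((fun t => φ t x) ∘ fun s => s + t) = fun s => φ t (φ s x) from h1] at h2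
  have h3 := (((h.mdifferentiableAt t (φ 0 x)).hasMFDerivAt).comp (0 : ℝ) h0).mfderiv
  have h5 : (show Model n from dφ φ t (φ 0 x) ((1 : ℝ) • X (φ 0 x))) = (1 : ℝ) • (show Model n from X (φ t (φ 0 x))) :=
    congrArg (fun l : ℝ →L[ℝ] Model n => l 1) (h3.symm.trans h2)
  rw [one_smul, one_smul, h.zero] at h5
  exact h5

end Flow

/-! ### The Hamiltonian flow -/

section Hamiltonian
variable {n : ℕ} {M : Type*} [TopologicalSpace M] [ChartedSpace (Model n) M]
  [IsManifold 𝓘(ℝ, Model n) ∞ M] {Ω : ∀ x : M, Tan n x →L[ℝ] Tan n x →L[ℝ] ℝ} {f : M → ℝ}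
  {φ : ℝ → M → M}

instance (x : M) : T2Space (Tan n x) := inferInstanceAs (T2Space (Model n))

/-- `hamVF` is defined through `inverse`, which is zero on maps that are not invertible.
Nondegeneracy gives injectivity, and a tangent space has the dimension of its dual. -/
theorem IsSymplectic.isInvertible (hΩ : IsSymplectic Ω) (x : M) : (Ω x).IsInvertible := by
  have hinj : Function.Injective (Ω x) := by
    rw [injective_iff_map_eq_zero]
    intro v hv
    exact hΩ.nondegenerate x v fun w => by rw [hv]; rfl
  have hdim : Module.finrank ℝ (Tan n x) = Module.finrank ℝ (Tan n x →L[ℝ] ℝ) := by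
    rw [← LinearMap.toContinuousLinearMap.finrank_eq, ]
    exact (Subspace.dual_finrank_eq (K := ℝ) (V := Model n)).symm
  have : FiniteDimensional ℝ (Tan n x →L[ℝ] ℝ) :=
    LinearMap.toContinuousLinearMap.finiteDimensional (V := Tan n x →ₗ[ℝ] ℝ)
  let e := LinearEquiv.ofInjectiveOfFinrankEq (Ω x).toLinearMap hinj hdim
  exact ⟨e.toContinuousLinearEquiv, by ext1 v; rfl⟩

theorem IsSymplectic.hamVF_apply (hΩ : IsSymplectic Ω) (x : M) (v : Tan n x) :
    Ω x (hamVF Ω f x) v = -dR f x v := by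
  rw [hamVF, (hΩ.isInvertible x).self_apply_inverse]
  rfl

/-- Along the flow the derivative of `f` is `-Ω(X, X) = 0`. -/
theorem IsFlow.hamiltonian_eq (hΩ : IsSymplectic Ω) (hf : ContMDiff 𝓘(ℝ, Model n) 𝓘(ℝ, ℝ) ∞ f)
    (hφ : IsFlow (hamVF Ω f) φ) (t : ℝ) (x : M) : f (φ t x) = f x := by
  have h : ∀ t, HasDerivAt (fun s => f (φ s x)) 0 t := fun t => by
    convert hasDerivAt_dR_comp (hf.mdifferentiableAt (by simp)) (hφ.hasMFDerivAt x t) using 1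
    have := hΩ.hamVF_apply (f := f) (φ t x) (hamVF Ω f (φ t x))
    rw [hΩ.alternating] at this
    linarith
  have h2 := is_const_of_deriv_eq_zero (fun t => (h t).differentiableAt) (fun t => (h t).deriv) t 0
  simpa [hφ.zero] using h2

end Hamiltonian

/-! ### Vector fields, functions and forms of degree one -/

section Bracket
variable {n : ℕ} {M : Type*} [TopologicalSpace M] [ChartedSpace (Model n) M]

theorem dC_extChartAt_symm {u : M → ℂ} {x : M} {z : Model n}
    (hψ : MDifferentiableWithinAt 𝓘(ℝ, Model n) 𝓘(ℝ, Model n) (extChartAt 𝓘(ℝ, Model n) x).symm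
      (range 𝓘(ℝ, Model n)) z)
    (hu : MDifferentiableAt 𝓘(ℝ, Model n) 𝓘(ℝ, ℂ) u ((extChartAt 𝓘(ℝ, Model n) x).symm z))
    (w : Model n) :
    fderiv ℝ (u ∘ (extChartAt 𝓘(ℝ, Model n) x).symm) z w =
      dC u ((extChartAt 𝓘(ℝ, Model n) x).symm z)
        (mfderivWithin 𝓘(ℝ, Model n) 𝓘(ℝ, Model n) (extChartAt 𝓘(ℝ, Model n) x).symm
          (range 𝓘(ℝ, Model n)) z w) := by
  have h1 := mfderiv_comp_mfderivWithin z hu hψ (by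
    rw [ModelWithCorners.range_eq_univ]; exact uniqueMDiffWithinAt_univ _)
  rw [ModelWithCorners.range_eq_univ, mfderivWithin_univ] at h1
  rw [← mfderiv_eq_fderiv]
  rw [ModelWithCorners.range_eq_univ]
  exact congrArg (fun l : Model n →L[ℝ] ℂ => l w) h1

variable [IsManifold 𝓘(ℝ, Model n) ∞ M]

theorem contMDiffAt_dC_apply {E' H' N : Type*} [NormedAddCommGroup E']
    [NormedSpace ℝ E'] [TopologicalSpace H'] {J : ModelWithCorners ℝ E' H'} [TopologicalSpace N]
    [ChartedSpace H' N] {u : M → ℂ} (hu : ContMDiff 𝓘(ℝ, Model n) 𝓘(ℝ, ℂ) ∞ u) {b : N → M}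
    {V : ∀ p, Tan n (b p)} {p₀ : N} (hV : ContMDiffAt J 𝓘(ℝ, Model n).tangent ∞
      (fun p => (⟨b p, V p⟩ : TangentBundle 𝓘(ℝ, Model n) M)) p₀) :
    ContMDiffAt J 𝓘(ℝ, ℂ) ∞ (fun p => dC u (b p) (V p)) p₀ :=
  ((contMDiff_snd_tangentBundle_modelSpace ℂ 𝓘(ℝ, ℂ)).comp
    (hu.contMDiff_tangentMap (m := ∞) (by simp))).contMDiffAt.comp p₀ hV

theorem SmoothVF.contMDiff_dC {X : ∀ x : M, Tan n x} (hX : SmoothVF X) {u : M → ℂ}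
    (hu : ContMDiff 𝓘(ℝ, Model n) 𝓘(ℝ, ℂ) ∞ u) :
    ContMDiff 𝓘(ℝ, Model n) 𝓘(ℝ, ℂ) ∞ (fun y => dC u y (X y)) :=
  fun x => contMDiffAt_dC_apply hu (hX x)

/-- Locally defined smooth functions have global extensions near each point. -/
theorem exists_contMDiff_eq [T2Space M] {U : Set M} {g : M → ℂ}
    (hg : ContMDiffOn 𝓘(ℝ, Model n) 𝓘(ℝ, ℂ) ∞ g U) (hU : IsOpen U) {x : M} (hx : x ∈ U) :
    ∃ g' : M → ℂ, ContMDiff 𝓘(ℝ, Model n) 𝓘(ℝ, ℂ) ∞ g' ∧ ∀ᶠ y in 𝓝 x, g' y = g y := by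
  obtain ⟨ρ, -, hρ⟩ := (SmoothBumpFunction.nhds_basis_tsupport (I := 𝓘(ℝ, Model n)) x).mem_iff.1
    (hU.mem_nhds hx)
  refine ⟨fun y => (ρ y : ℂ) * g y, fun y => ?_, ?_⟩
  · by_cases hy : y ∈ tsupport ρ
    · exact ContMDiffAt.cmul (ContMDiffAt.ofRealC ρ.contMDiffAt)
        ((hg y (hρ hy)).contMDiffAt (hU.mem_nhds (hρ hy)))
    · refine (contMDiffAt_const (c := (0:ℂ))).congr_of_eventuallyEq ?_
      filter_upwards [(isClosed_tsupport ρ).isOpen_compl.mem_nhds hy] with z hz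
      rw [image_eq_zero_of_notMem_tsupport hz]
      simp
  · filter_upwards [ρ.eventuallyEq_one] with y hy
    rw [hy]
    simp

/-- The Lie bracket is the commutator of derivations. -/
theorem dC_mlieBracket {X Y : ∀ x : M, Tan n x} (hX : SmoothVF X) (hY : SmoothVF Y) {u : M → ℂ}
    (hu : ContMDiff 𝓘(ℝ, Model n) 𝓘(ℝ, ℂ) ∞ u) (x : M) :
    dC u x (VectorField.mlieBracket 𝓘(ℝ, Model n) X Y x) =
      dC (fun y => dC u y (Y y)) x (X x) - dC (fun y => dC u y (X y)) x (Y x) := by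
  have : IsManifold 𝓘(ℝ, Model n) 1 M := IsManifold.of_le (n := ∞) (by simp)
  have : IsManifold 𝓘(ℝ, Model n) 2 M := IsManifold.of_le (n := ∞) (by exact WithTop.coe_le_coe.2 (le_top : (2 : ℕ∞) ≤ ⊤))
  set e := extChartAt 𝓘(ℝ, Model n) x with he
  have hr : range 𝓘(ℝ, Model n) ∈ 𝓝 (e x) := by
    rw [ModelWithCorners.range_eq_univ]; exact Filter.univ_mem
  let V : (∀ x : M, Tan n x) → Model n → Model n := fun Z =>
    VectorField.mpullbackWithin 𝓘(ℝ, Model n) 𝓘(ℝ, Model n) e.symm Z (range 𝓘(ℝ, Model n))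
  have hxe : e x ∈ e.target := mem_extChartAt_target x
  have hinv : e.symm (e x) = x := extChartAt_to_inv x
  have hd : ∀ Z, SmoothVF Z → DifferentiableAt ℝ (V Z) (e x) := fun Z hZ => by
    have := MDifferentiableWithinAt.differentiableWithinAt_mpullbackWithin_vectorField
      (s := univ) (x := x) ((hZ.mdifferentiableAt (by simp)).mdifferentiableWithinAt)
    exact this.differentiableAt (by rw [preimage_univ, univ_inter]; exact hr)
  -- The field `V Z` acts on functions in the chart as `Z` acts on the manifold, so the claim
  -- reduces to the commutator formula in a vector space.
  have key : ∀ Z (g : M → ℂ) (z : Model n), z ∈ e.target →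
      MDifferentiableAt 𝓘(ℝ, Model n) 𝓘(ℝ, ℂ) g (e.symm z) →
      fderiv ℝ (g ∘ e.symm) z (V Z z) = dC g (e.symm z) (Z (e.symm z)) := by
    intro Z g z hz hg
    refine (dC_extChartAt_symm (mdifferentiableWithinAt_extChartAt_symm hz) hg (V Z z)).trans ?_
    exact congrArg (fun v => dC g (e.symm z) v) ((isInvertible_mfderivWithin_extChartAt_symm hz).self_apply_inverse _)
  have hsm : ContDiffAt ℝ ∞ (u ∘ e.symm) (e x) := by
    rw [← contMDiffAt_iff_contDiffAt]
    refine hu.contMDiffAt.comp _ ?_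
    have := contMDiffWithinAt_extChartAt_symm_range (I := 𝓘(ℝ, Model n)) (n := ∞) x hxe
    rwa [ModelWithCorners.range_eq_univ, contMDiffWithinAt_univ] at this
  have hB := VectorField.fderiv_apply_lieBracket hsm (by rw [minSmoothness_of_isRCLikeNormedField]; exact WithTop.coe_le_coe.2 (le_top : (2 : ℕ∞) ≤ ⊤)) (hd Y hY) (hd X hX)
  have hstep : ∀ Z W, SmoothVF Z → SmoothVF W →
      fderiv ℝ (fun z => fderiv ℝ (u ∘ e.symm) z (V Z z)) (e x) (V W (e x)) =
        dC (fun y => dC u y (Z y)) x (W x) := by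
    intro Z W hZ hW
    have h1 : (fun z => fderiv ℝ (u ∘ e.symm) z (V Z z)) =ᶠ[𝓝 (e x)]
        (fun y => dC u y (Z y)) ∘ e.symm := by
      filter_upwards [extChartAt_target_mem_nhds (I := 𝓘(ℝ, Model n)) x] with z hz
      exact key Z u z hz (hu.mdifferentiableAt (by simp))
    rw [h1.fderiv_eq, key W _ _ hxe (by
      rw [hinv]; exact (hZ.contMDiff_dC hu).mdifferentiableAt (by simp)), hinv]
  rw [hstep Y X hY hX, hstep X Y hX hY] at hB
  rw [← hB]
  have h2 : dC u x (VectorField.mlieBracket 𝓘(ℝ, Model n) X Y x) =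
      dC ((u ∘ e.symm) ∘ e) x (VectorField.mlieBracket 𝓘(ℝ, Model n) X Y x) := by
    refine dC_congr ?_ _
    filter_upwards [extChartAt_source_mem_nhds (I := 𝓘(ℝ, Model n)) x] with y hy
    exact congrArg u (e.left_inv hy).symm
  have h3 := mfderiv_comp x (hsm.contMDiffAt.mdifferentiableAt (by simp))
    (mdifferentiableAt_extChartAt (I := 𝓘(ℝ, Model n)) (mem_chart_source _ x))
  rw [h2]
  have h4 : VectorField.mlieBracket 𝓘(ℝ, Model n) X Y x =
      (mfderiv 𝓘(ℝ, Model n) 𝓘(ℝ, Model n) e x).inverse (VectorField.lieBracket ℝ (V X) (V Y) (e x)) :=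
    congrArg (fun w : Model n => (mfderiv 𝓘(ℝ, Model n) 𝓘(ℝ, Model n) e x).inverse w)
      (VectorField.lieBracketWithin_of_mem_nhds (V := V X) (W := V Y)
        (by rw [preimage_univ, univ_inter]; exact hr))
  have h5 : mfderiv 𝓘(ℝ, Model n) 𝓘(ℝ, Model n) e x (VectorField.mlieBracket 𝓘(ℝ, Model n) X Y x) =
      VectorField.lieBracket ℝ (V X) (V Y) (e x) := by
    rw [h4]
    exact (isInvertible_mfderiv_extChartAt (mem_extChartAt_source x)).self_apply_inverse _
  refine (congrArg (fun l : Model n →L[ℝ] ℂ => l (VectorField.mlieBracket 𝓘(ℝ, Model n) X Y x)) h3).trans ?_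
  refine (congrArg (fun v => mfderiv 𝓘(ℝ, Model n) 𝓘(ℝ, ℂ) (u ∘ e.symm) (e x) v) h5).trans ?_
  rw [mfderiv_eq_fderiv]
  rfl

end Bracket

/-! ### The connection of the prequantization bundle -/

section Connection
variable {n : ℕ} {M : Type*} [TopologicalSpace M] [ChartedSpace (Model n) M]
  [IsManifold 𝓘(ℝ, Model n) ∞ M] {Ω : ∀ x : M, Tan n x →L[ℝ] Tan n x →L[ℝ] ℝ}
  {L : M → Type*} [TopologicalSpace (TotalSpace ℂ L)] [∀ x, NormedAddCommGroup (L x)]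
  [∀ x, InnerProductSpace ℂ (L x)] [FiberBundle ℂ L] [VectorBundle ℂ ℂ L] [VectorBundle ℝ ℂ L]
  [ContMDiffVectorBundle ∞ ℂ L 𝓘(ℝ, Model n)]
  {nab : CovariantDerivative 𝓘(ℝ, Model n) ℂ L}

theorem SmoothSecAt.mdifferentiableAt {s : ∀ x, L x} {x : M} (hs : SmoothSecAt n s x) :
    MDifferentiableAt 𝓘(ℝ, Model n) (𝓘(ℝ, Model n).prod 𝓘(ℝ, ℂ)) (fun y => TotalSpace.mk' ℂ y (s y)) x :=
  ContMDiffAt.mdifferentiableAt hs (by simp)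

theorem nab_congr {s s' : ∀ x, L x} {x : M} (hs : SmoothSecAt n s x)
    (h : ∀ᶠ y in 𝓝 x, s' y = s y) : nab s' x = nab s x :=
  (nab.isCovariantDerivativeOnUniv.congr_of_eventuallyEq hs.mdifferentiableAt
    (hs.congr h).mdifferentiableAt Filter.univ_mem (h.mono fun _ hy => hy.symm)).symm

theorem SmoothSecOn.at {s : ∀ x, L x} (hs : SmoothSecOn (n := n) L univ s) (x : M) :
    SmoothSecAt n s x := hs.smoothSecAt isOpen_univ (mem_univ x)

/-- The covariant derivative comes with a Leibniz rule for real functions only. The complex rule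
follows by splitting `g` into real and imaginary parts, since `∇` commutes with `I`. -/
theorem nab_smul (hL : IsPrequantization Ω nab) {e : ∀ x, L x} (he : SmoothSecOn (n := n) L univ e)
    {g : M → ℂ} {x : M} (hg : MDifferentiableAt 𝓘(ℝ, Model n) 𝓘(ℝ, ℂ) g x) (v : Tan n x) :
    nab (fun y => g y • e y) x v = g x • nab e x v + dC g x v • e x := by
  have hre : MDifferentiableAt 𝓘(ℝ, Model n) 𝓘(ℝ, ℝ) (fun y => (g y).re) x :=
    MDifferentiableAt.comp (g := fun z : ℂ => z.re) x
      (Complex.reCLM.differentiableAt.mdifferentiableAt) hg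
  have him : MDifferentiableAt 𝓘(ℝ, Model n) 𝓘(ℝ, ℝ) (fun y => (g y).im) x :=
    MDifferentiableAt.comp (g := fun z : ℂ => z.im) x
      (Complex.imCLM.differentiableAt.mdifferentiableAt) hg
  have hIe : SmoothSecAt n (fun y => Complex.I • e y) x :=
    SmoothSecAt.smul (he.at x) contMDiffAt_const
  have h0 : (fun y => g y • e y) = (fun y => (g y).re) • e + (fun y => (g y).im) • fun y => Complex.I • e y := by
    ext1 y
    change g y • e y = (g y).re • e y + (g y).im • Complex.I • e y
    rw [← Complex.coe_smul, ← Complex.coe_smul, smul_smul, ← add_smul, Complex.re_add_im]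
  have hd : ∀ {r : M → ℝ} {s : ∀ x, L x}, MDifferentiableAt 𝓘(ℝ, Model n) 𝓘(ℝ, ℝ) r x →
      SmoothSecAt n s x → MDifferentiableAt 𝓘(ℝ, Model n) (𝓘(ℝ, Model n).prod 𝓘(ℝ, ℂ))
        (fun y => TotalSpace.mk' ℂ y ((r • s) y)) x := fun hr hs =>
    MDifferentiableAt.smul_section hr hs.mdifferentiableAt
  have hcov := nab.isCovariantDerivativeOnUniv
  have h1 := hcov.add (hd hre (he.at x)) (hd him hIe)
  rw [← h0, hcov.leibniz (he.at x).mdifferentiableAt hre, hcov.leibniz hIe.mdifferentiableAt him] at h1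
  have h2 : dC g x v = (dR (fun y => (g y).re) x v : ℂ) + Complex.I * (dR (fun y => (g y).im) x v : ℂ) := by
    rw [← dC_ofReal hre, ← dC_ofReal him]
    have h3 : MDifferentiableAt 𝓘(ℝ, Model n) 𝓘(ℝ, ℂ) (fun y => ((g y).re : ℂ)) x :=
      MDifferentiableAt.comp (g := fun z : ℝ => (z : ℂ)) x
        (Complex.ofRealCLM.differentiableAt.mdifferentiableAt) hre
    have h4 : MDifferentiableAt 𝓘(ℝ, Model n) 𝓘(ℝ, ℂ) (fun y => ((g y).im : ℂ)) x :=
      MDifferentiableAt.comp (g := fun z : ℝ => (z : ℂ)) x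
        (Complex.ofRealCLM.differentiableAt.mdifferentiableAt) him
    have h5 := dC_mul (mdifferentiableAt_const (c := Complex.I)) h4 v
    rw [dC_const, zero_mul, add_zero] at h5
    rw [← h5, ← dC_add (h := fun y => Complex.I * ((g y).im : ℂ)) h3 (MDifferentiableAt.comp (g := fun z : ℂ => Complex.I * z) x
      ((differentiableAt_id.const_mul Complex.I).mdifferentiableAt) h4)]
    refine dC_congr (Filter.Eventually.of_forall fun y => ?_) v
    rw [mul_comm, Complex.re_add_im]
  refine (congrArg (fun l : Tan n x →L[ℝ] L x => l v) h1).trans ?_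
  change (g x).re • nab e x v + dR (fun y => (g y).re) x v • e x + ((g x).im • nab (fun y => Complex.I • e y) x v +
    dR (fun y => (g y).im) x v • Complex.I • e x) = _
  rw [hL.complex_linear e he, h2]
  simp only [← Complex.coe_smul]
  conv_rhs => rw [← Complex.re_add_im (g x)]
  module

/-- The connection form of `e`: `∇ e = (connForm e) e`. -/
def connForm (nab : CovariantDerivative 𝓘(ℝ, Model n) ℂ L) (e : ∀ x, L x) (x : M) (v : Tan n x) : ℂ :=
  ⟪e x, nab e x v⟫_ℂ / ⟪e x, e x⟫_ℂ

theorem nab_eq {e : ∀ x, L x} {x : M} (he : e x ≠ 0) (v : Tan n x) :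
    nab e x v = connForm nab e x v • e x := by
  obtain ⟨c, hc⟩ := exists_eq_smul he (nab e x v)
  have h0 : ⟪e x, e x⟫_ℂ ≠ 0 := inner_self_ne_zero.2 he
  rw [connForm, hc, inner_smul_right, mul_div_cancel_right₀ _ h0]

theorem connForm_eq_of {e : ∀ x, L x} {x : M} (he : e x ≠ 0) {v : Tan n x} {c : ℂ}
    (h : nab e x v = c • e x) : connForm nab e x v = c := by
  rw [nab_eq he] at h
  exact smul_left_injective ℂ he h

variable [CovariantDerivative.ContMDiffCovariantDerivative nab ∞]

theorem contMDiffAt_nab {E' H' N : Type*} [NormedAddCommGroup E']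
    [NormedSpace ℝ E'] [TopologicalSpace H'] {J : ModelWithCorners ℝ E' H'} [TopologicalSpace N]
    [ChartedSpace H' N] {e : ∀ x, L x} (he : SmoothSecOn (n := n) L univ e) {b : N → M}
    {V : ∀ p, Tan n (b p)} {p₀ : N} (hV : ContMDiffAt J 𝓘(ℝ, Model n).tangent ∞
      (fun p => (⟨b p, V p⟩ : TangentBundle 𝓘(ℝ, Model n) M)) p₀) :
    ContMDiffAt J (𝓘(ℝ, Model n).prod 𝓘(ℝ, ℂ)) ∞
      (fun p => TotalSpace.mk' ℂ (E := L) (b p) (nab e (b p) (V p))) p₀ := by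
  have hb : ContMDiffAt J 𝓘(ℝ, Model n) ∞ b p₀ :=
    ((Bundle.contMDiff_proj (TangentSpace 𝓘(ℝ, Model n) : M → Type _)).contMDiffAt).comp p₀ hV
  have h1 := (CovariantDerivative.ContMDiffCovariantDerivative.contMDiff (cov := nab) (k := ∞)).contMDiff
    (σ := e) (by rw [show (∞ : ℕ∞ω) + 1 = ∞ from rfl]; exact he)
  have h2 := ((h1 (b p₀) (mem_univ _)).contMDiffAt Filter.univ_mem).comp p₀ hb
  exact ContMDiffAt.clm_bundle_apply (F₁ := Model n) (F₂ := ℂ) h2 hV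

theorem contMDiffAt_connForm {E' H' N : Type*} [NormedAddCommGroup E']
    [NormedSpace ℝ E'] [TopologicalSpace H'] {J : ModelWithCorners ℝ E' H'} [TopologicalSpace N]
    [ChartedSpace H' N] {e : ∀ x, L x} (he : SmoothSecOn (n := n) L univ e) {b : N → M}
    {V : ∀ p, Tan n (b p)} {p₀ : N} (hV : ContMDiffAt J 𝓘(ℝ, Model n).tangent ∞
      (fun p => (⟨b p, V p⟩ : TangentBundle 𝓘(ℝ, Model n) M)) p₀) (h0 : e (b p₀) ≠ 0) :
    ContMDiffAt J 𝓘(ℝ, ℂ) ∞ (fun p => connForm nab e (b p) (V p)) p₀ := by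
  have hb : ContMDiffAt J 𝓘(ℝ, Model n) ∞ b p₀ :=
    ((Bundle.contMDiff_proj (TangentSpace 𝓘(ℝ, Model n) : M → Type _)).contMDiffAt).comp p₀ hV
  have h1 := (contMDiffAt_mk_iff (mem_dom (b p₀)) hb).1 (contMDiffAt_nab (nab := nab) he hV)
  have h2 := ((smoothSecAt_iff (mem_dom (b p₀))).1 (he.at (b p₀))).comp p₀ hb
  refine (ContMDiffAt.cdiv h1 h2 (lcoord_ne_zero (mem_dom _) h0)).congr_of_eventuallyEq ?_
  filter_upwards [hb.continuousAt.eventually ((he.at (b p₀)).eventually_ne_zero h0),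
    hb.continuousAt.eventually (dom_mem_nhds (E := L) (b p₀))] with p hp hp'
  change _ = lcoord L (b p₀) (b p) (nab e (b p) (V p)) / lcoord L (b p₀) (b p) (e (b p))
  rw [nab_eq hp, map_smul, smul_eq_mul, mul_div_cancel_right₀ _ (lcoord_ne_zero hp' hp)]

/-- The curvature in terms of the connection form. -/
theorem connForm_curvature (hL : IsPrequantization Ω nab) {e : ∀ x, L x}
    (he : SmoothSecOn (n := n) L univ e) {X Y : ∀ x : M, Tan n x} (hX : SmoothVF X)
    (hY : SmoothVF Y) {x : M} (h0 : e x ≠ 0) :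
    dC (fun y => connForm nab e y (Y y)) x (X x) - dC (fun y => connForm nab e y (X y)) x (Y x)
      - connForm nab e x (VectorField.mlieBracket 𝓘(ℝ, Model n) X Y x)
      = (1 / Complex.I) * (Ω x (X x) (Y x) : ℂ) := by
  -- The product of the two values of the connection form is symmetric in `Z` and `W` and drops out
  -- of the curvature.
  have key : ∀ {Z W : ∀ x : M, Tan n x}, SmoothVF Z → SmoothVF W →
      nab (fun y => nab e y (Z y)) x (W x) = (connForm nab e x (Z x) * connForm nab e x (W x) +
        dC (fun y => connForm nab e y (Z y)) x (W x)) • e x := by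
    intro Z W hZ hW
    have hs := contMDiffAt_connForm (nab := nab) he (hZ x) h0
    have h1 : nab (fun y => nab e y (Z y)) x = nab (fun y => connForm nab e y (Z y) • e y) x := by
      refine nab_congr (SmoothSecAt.smul (he.at x) hs) ?_
      filter_upwards [(he.at x).eventually_ne_zero h0] with y hy
      exact nab_eq hy _
    rw [h1, nab_smul hL he (hs.mdifferentiableAt (by simp)), nab_eq h0 (W x)]
    module
  have h2 := hL.curvature X Y e hX hY he x
  rw [key hY hX, key hX hY, nab_eq h0 (VectorField.mlieBracket 𝓘(ℝ, Model n) X Y x)] at h2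
  rw [← sub_smul, ← sub_smul] at h2
  have h3 := smul_left_injective ℂ h0 h2
  rw [← h3]
  ring

end Connection

/-! ### The lift of the flow to the prequantization bundle -/

section Lift
variable {n : ℕ} {M : Type*} [TopologicalSpace M] [ChartedSpace (Model n) M]
  [IsManifold 𝓘(ℝ, Model n) ∞ M] [T2Space M] {Ω : ∀ x : M, Tan n x →L[ℝ] Tan n x →L[ℝ] ℝ}
  {L : M → Type*} [TopologicalSpace (TotalSpace ℂ L)] [∀ x, NormedAddCommGroup (L x)]
  [∀ x, InnerProductSpace ℂ (L x)] [FiberBundle ℂ L] [VectorBundle ℂ ℂ L] [VectorBundle ℝ ℂ L]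
  [ContMDiffVectorBundle ∞ ℂ L 𝓘(ℝ, Model n)]
  {nab : CovariantDerivative 𝓘(ℝ, Model n) ℂ L}
  {f : M → ℝ} {φ : ℝ → M → M} {Φ : ∀ t x, L x ≃ₗ[ℂ] L (φ t x)}

/-- The pull-back of sections of `L`. -/
def pull (Φ : ∀ t x, L x ≃ₗ[ℂ] L (φ t x)) (t : ℝ) (s : ∀ x, L x) : ∀ x, L x :=
  fun x => (Φ t x).symm (s (φ t x))

/-- The operator `∇_X + i f`. -/
def prequantOp (nab : CovariantDerivative 𝓘(ℝ, Model n) ℂ L) (X : ∀ x : M, Tan n x) (f : M → ℝ)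
    (e : ∀ x, L x) : ∀ x, L x := fun y => nab e y (X y) + (Complex.I * f y) • e y

theorem IsExp.hasDerivAt_inner (hφ : IsFlow (hamVF Ω f) φ) (hΦ : IsExp nab f φ Φ) {e : ∀ x, L x}
    (he : SmoothSecOn (n := n) L univ e) (x : M) (ξ : L x) (t : ℝ) :
    HasDerivAt (fun t => ⟪e (φ t x), Complex.exp (Complex.I * t * f x) • Φ t x ξ⟫_ℂ)
      ⟪nab e (φ t x) (hamVF Ω f (φ t x)), Complex.exp (Complex.I * t * f x) • Φ t x ξ⟫_ℂ t := by
  have := hΦ.parallel x ξ e he t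
  rwa [hφ.mfderiv_apply_one] at this

theorem norm_exp_smul {x : M} (t r : ℝ) (u : L x) :
    ‖Complex.exp (Complex.I * t * r) • u‖ = ‖u‖ := by
  rw [norm_smul, mul_assoc, mul_comm, ← Complex.ofReal_mul, Complex.norm_exp_I_mul_ofReal, mul_one]

/-- In a frame `e` along the trajectory, `|Φ_t ξ|²` is `|⟨e, G⟩|² / ⟨e, e⟩`, where `G` is the
parallel section. Parallelism of `G` and compatibility of `∇` with the metric give numerator and
denominator the same logarithmic derivative, `conj h + h`. -/
theorem IsExp.hasDerivAt_inner_self (hL : IsPrequantization Ω nab) (hφ : IsFlow (hamVF Ω f) φ)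
    (hΦ : IsExp nab f φ Φ) (x : M) (ξ : L x) (t : ℝ) :
    HasDerivAt (fun t => ⟪Φ t x ξ, Φ t x ξ⟫_ℂ) 0 t := by
  obtain ⟨e, he, -, h0⟩ := exists_smoothSec_eq_frame (n := n) (E := L) (φ t x)
  set G := fun t : ℝ => Complex.exp (Complex.I * t * f x) • Φ t x ξ with hG
  set h := connForm nab e (φ t x) (hamVF Ω f (φ t x)) with hh
  have h1 : HasDerivAt (fun t => ⟪e (φ t x), G t⟫_ℂ) (conj h * ⟪e (φ t x), G t⟫_ℂ) t := by
    have := hΦ.hasDerivAt_inner hφ he x ξ t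
    rwa [nab_eq h0, inner_smul_left] at this
  have h2 : HasDerivAt (fun t => ⟪e (φ t x), e (φ t x)⟫_ℂ) ((conj h + h) * ⟪e (φ t x), e (φ t x)⟫_ℂ) t := by
    have := hasDerivAt_dC_comp ((hL.smooth_inner e e he he).mdifferentiableAt (by simp) (x := φ t x))
      (hφ.hasMFDerivAt x t)
    rwa [hL.metric e e he he, nab_eq h0, inner_smul_left, inner_smul_right, ← add_mul] at this
  have h3 : ∀ᶠ s in 𝓝 t, e (φ s x) ≠ 0 :=
    (hφ.hasMFDerivAt x t).continuousAt.eventually ((he.at (φ t x)).eventually_ne_zero h0)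
  have hE : ⟪e (φ t x), e (φ t x)⟫_ℂ ≠ 0 := inner_self_ne_zero.2 h0
  have h4 := ((h1.star).mul h1).div h2 hE
  have h5 : HasDerivAt (fun s => star ⟪e (φ s x), G s⟫_ℂ * ⟪e (φ s x), G s⟫_ℂ / ⟪e (φ s x), e (φ s x)⟫_ℂ) 0 t := by
    refine HasDerivAt.congr_deriv h4 ?_
    rw [div_eq_zero_iff]
    left
    simp only [Pi.mul_apply]
    simp only [← starRingEnd_apply, map_mul, Complex.conj_conj]
    ring
  refine h5.congr_of_eventuallyEq ?_
  filter_upwards [h3] with s hs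
  obtain ⟨c, hc⟩ := exists_eq_smul hs (G s)
  have hE : ⟪e (φ s x), e (φ s x)⟫_ℂ ≠ 0 := inner_self_ne_zero.2 hs
  have h6 : ⟪Φ s x ξ, Φ s x ξ⟫_ℂ = ⟪G s, G s⟫_ℂ := by
    rw [inner_self_eq_norm_sq_to_K, inner_self_eq_norm_sq_to_K, hG]
    simp only
    rw [norm_exp_smul]
  rw [h6, hc, inner_smul_right, inner_smul_right, inner_smul_left]
  simp only [← starRingEnd_apply, map_mul, inner_conj_symm]
  field_simp

theorem IsExp.inner_map (hL : IsPrequantization Ω nab) (hφ : IsFlow (hamVF Ω f) φ)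
    (hΦ : IsExp nab f φ Φ) (t : ℝ) (x : M) (ξ η : L x) : ⟪Φ t x ξ, Φ t x η⟫_ℂ = ⟪ξ, η⟫_ℂ := by
  classical
  have h1 : ⟪Φ t x ξ, Φ t x ξ⟫_ℂ = ⟪ξ, ξ⟫_ℂ := by
    have h2 := is_const_of_deriv_eq_zero
      (fun t => (hΦ.hasDerivAt_inner_self hL hφ x ξ t).differentiableAt)
      (fun t => (hΦ.hasDerivAt_inner_self hL hφ x ξ t).deriv) t 0
    -- The condition at time 0 is stated for sections; this one takes the value `ξ` at `x`.
    have h3 := hΦ.zero (Function.update 0 x ξ) x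
    rw [Function.update_self] at h3
    rw [h2, h3]
    have h4 := congrArg (fun y => ⟪(Function.update 0 x ξ : ∀ x, L x) y, (Function.update 0 x ξ : ∀ x, L x) y⟫_ℂ) (hφ.zero x)
    simpa using h4
  by_cases h0 : ξ = 0
  · rw [h0, map_zero, inner_zero_left, inner_zero_left]
  · obtain ⟨c, rfl⟩ := exists_eq_smul h0 η
    rw [map_smul, inner_smul_right, inner_smul_right, h1]

/-- The assumption on `Φ` differentiates pairings with `Φ_t ξ`, not the inverse maps that define the
pull-back. Unitarity expresses the latter through the former. -/
theorem IsExp.inner_symm (hL : IsPrequantization Ω nab) (hφ : IsFlow (hamVF Ω f) φ)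
    (hΦ : IsExp nab f φ Φ) (t : ℝ) (x : M) (ξ : L x) (u : L (φ t x)) :
    ⟪ξ, (Φ t x).symm u⟫_ℂ = Complex.exp (Complex.I * t * f x) *
      conj ⟪u, Complex.exp (Complex.I * t * f x) • Φ t x ξ⟫_ℂ := by
  have h1 := hΦ.inner_map hL hφ t x ξ ((Φ t x).symm u)
  rw [LinearEquiv.apply_symm_apply] at h1
  rw [← h1, inner_smul_right, map_mul, inner_conj_symm, ← mul_assoc, Complex.mul_conj,
    Complex.normSq_eq_norm_sq, mul_assoc, mul_comm Complex.I, ← Complex.ofReal_mul,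
    Complex.norm_exp_ofReal_mul_I]
  simp

theorem eq_of_inner_eq {x : M} {ξ : L x} (hξ : ξ ≠ 0) {u v : L x} (h : ⟪ξ, u⟫_ℂ = ⟪ξ, v⟫_ℂ) :
    u = v := by
  obtain ⟨c, rfl⟩ := exists_eq_smul hξ u
  obtain ⟨d, rfl⟩ := exists_eq_smul hξ v
  rw [inner_smul_right, inner_smul_right] at h
  rw [mul_right_cancel₀ (inner_self_ne_zero.2 hξ) h]

/-- The time derivative of the pull-back of a section. -/
theorem IsExp.hasDerivAt_pull (hΩ : IsSymplectic Ω) (hf : ContMDiff 𝓘(ℝ, Model n) 𝓘(ℝ, ℝ) ∞ f)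
    (hL : IsPrequantization Ω nab) (hφ : IsFlow (hamVF Ω f) φ)
    (hΦ : IsExp nab f φ Φ) {e : ∀ x, L x} (he : SmoothSecOn (n := n) L univ e) (x : M)
    (l : L x →ₗ[ℂ] ℂ) (t : ℝ) :
    HasDerivAt (fun t => l (pull Φ t e x)) (l (pull Φ t (prequantOp nab (hamVF Ω f) f e) x)) t := by
  have hξ := frame_ne_zero (mem_dom (E := L) x)
  set ξ := frame L x x
  -- On a line every linear form is a multiple of the pairing with a nonzero vector.
  have h1 : ∀ u, l u = l ξ / ⟪ξ, ξ⟫_ℂ * ⟪ξ, u⟫_ℂ := by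
    intro u
    obtain ⟨c, rfl⟩ := exists_eq_smul hξ u
    have := inner_self_ne_zero (𝕜 := ℂ).2 hξ
    rw [map_smul, inner_smul_right, smul_eq_mul]
    field_simp
  simp_rw [h1 (pull Φ _ _ x)]
  refine HasDerivAt.const_mul _ ?_
  have h2 : HasDerivAt (fun t : ℝ => Complex.exp (Complex.I * t * f x))
      (Complex.I * f x * Complex.exp (Complex.I * t * f x)) t := by
    have h3 : HasDerivAt (fun t : ℝ => Complex.I * t * f x) (Complex.I * 1 * f x) t :=
      (((hasDerivAt_id t).ofReal_comp).const_mul Complex.I).mul_const _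
    convert h3.cexp using 1
    ring
  have h3 := h2.mul ((hΦ.hasDerivAt_inner hφ he x ξ t).star)
  refine (h3.congr_deriv ?_).congr_of_eventuallyEq
    (Filter.Eventually.of_forall fun s => hΦ.inner_symm hL hφ s x ξ (e (φ s x)))
  simp only [pull, prequantOp, map_add, map_smul, inner_add_right, inner_smul_right,
    hΦ.inner_symm hL hφ, ← starRingEnd_apply, hφ.hamiltonian_eq hΩ hf]
  ring

/-- Two sections differ locally by a smooth function. -/
theorem exists_eventually_eq_smul {E : M → Type*} [TopologicalSpace (TotalSpace ℂ E)]
    [∀ x, AddCommGroup (E x)] [∀ x, Module ℂ (E x)] [∀ x, TopologicalSpace (E x)]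
    [FiberBundle ℂ E] [VectorBundle ℂ ℂ E] [VectorBundle ℝ ℂ E]
    [ContMDiffVectorBundle ∞ ℂ E 𝓘(ℝ, Model n)] {e s : ∀ x, E x} {x : M}
    (he : SmoothSecAt n e x) (h0 : e x ≠ 0) (hs : SmoothSecAt n s x) :
    ∃ g : M → ℂ, ContMDiffAt 𝓘(ℝ, Model n) 𝓘(ℝ, ℂ) ∞ g x ∧ ∀ᶠ y in 𝓝 x, s y = g y • e y := by
  refine ⟨fun y => lcoord E x y (s y) / lcoord E x y (e y), ContMDiffAt.cdiv
    ((smoothSecAt_iff (mem_dom x)).1 hs) ((smoothSecAt_iff (mem_dom x)).1 he)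
    (lcoord_ne_zero (mem_dom x) h0), ?_⟩
  filter_upwards [he.eventually_ne_zero h0, dom_mem_nhds (E := E) x] with y hy hy'
  obtain ⟨c, hc⟩ := exists_eq_smul hy (s y)
  rw [hc, map_smul, smul_eq_mul, mul_div_cancel_right₀ _ (lcoord_ne_zero hy' hy)]

variable [CovariantDerivative.ContMDiffCovariantDerivative nab ∞]

/-- As long as a trajectory stays where the frame `e` does not vanish, the pull-back of `e` solves a
scalar equation `y' = F y`, so its values at two times differ by the exponential of an integral.
This formula controls the dependence on `x`, about which the assumptions on `Φ` say nothing. -/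
theorem IsExp.exists_pull_eq (hΩ : IsSymplectic Ω) (hf : ContMDiff 𝓘(ℝ, Model n) 𝓘(ℝ, ℝ) ∞ f)
    (hL : IsPrequantization Ω nab) (hφ : IsFlow (hamVF Ω f) φ) (hΦ : IsExp nab f φ Φ)
    (t₁ : ℝ) (x₀ : M) : ∃ (e : ∀ x, L x) (F : ℝ × M → ℂ) (ε : ℝ), 0 < ε ∧
      SmoothSecOn (n := n) L univ e ∧ ContMDiff (𝓘(ℝ, ℝ).prod 𝓘(ℝ, Model n)) 𝓘(ℝ, ℂ) ∞ F ∧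
      (∀ᶠ x in 𝓝 x₀, ∀ t ∈ Ioo (t₁ - ε) (t₁ + ε), e (φ t x) ≠ 0 ∧
        F (t, x) = connForm nab e (φ t x) (hamVF Ω f (φ t x)) + Complex.I * f x ∧
        ∀ t' ∈ Ioo (t₁ - ε) (t₁ + ε), pull Φ t e x =
          Complex.exp ((∫ s in (0:ℝ)..t, F (s, x)) - ∫ s in (0:ℝ)..t', F (s, x)) • pull Φ t' e x) := by
  obtain ⟨e, he, -, h0⟩ := exists_smoothSec_eq_frame (n := n) (E := L) (φ t₁ x₀)
  obtain ⟨U, hUs, hU, hxU⟩ := mem_nhds_iff.1 ((he.at (φ t₁ x₀)).eventually_ne_zero h0)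
  have hh : ContMDiffOn 𝓘(ℝ, Model n) 𝓘(ℝ, ℂ) ∞ (fun y => connForm nab e y (hamVF Ω f y)) U :=
    fun y hy => (contMDiffAt_connForm he (hφ.smoothVF y) (hUs hy)).contMDiffWithinAt
  obtain ⟨g, hg, hgh⟩ := exists_contMDiff_eq hh hU hxU
  have hev := (hφ.continuous.continuousAt (x := (t₁, x₀))).eventually (hgh.and (hU.mem_nhds hxU))
  rw [nhds_prod_eq, Filter.eventually_prod_iff] at hev
  obtain ⟨p, hp, q, hq, hpq⟩ := hev
  obtain ⟨ε, hε, hεp⟩ := Metric.eventually_nhds_iff_ball.1 hp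
  have hF : ContMDiff (𝓘(ℝ, ℝ).prod 𝓘(ℝ, Model n)) 𝓘(ℝ, ℂ) ∞
      (fun p : ℝ × M => g (φ p.1 p.2) + Complex.I * f p.2) := fun p =>
    ContMDiffAt.add ((hg.comp hφ.smooth) p) (ContMDiffAt.cmul contMDiffAt_const
      (ContMDiffAt.ofRealC ((hf.comp contMDiff_snd) p)))
  refine ⟨e, _, ε, hε, he, hF, ?_⟩
  filter_upwards [hq] with x hx
  have hI : ∀ t ∈ Ioo (t₁ - ε) (t₁ + ε), g (φ t x) = connForm nab e (φ t x) (hamVF Ω f (φ t x)) ∧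
      e (φ t x) ≠ 0 := fun t ht => by
    have := hpq (hεp t (by rwa [Real.ball_eq_Ioo])) hx
    exact ⟨this.1, hUs this.2⟩
  intro t ht
  refine ⟨(hI t ht).2, by rw [← (hI t ht).1], fun t' ht' => ?_⟩
  have hξ := frame_ne_zero (mem_dom (E := L) x)
  set ξ := frame L x x
  have hc : Continuous (fun s => g (φ s x) + Complex.I * f x) :=
    hF.continuous.comp (Continuous.prodMk_left x)
  -- Integrating factor: a coordinate of the pull-back times `exp (-∫ F)` is constant on the
  -- interval.
  have hd : ∀ s ∈ Ioo (t₁ - ε) (t₁ + ε), HasDerivAt (fun s => innerₛₗ ℂ ξ (pull Φ s e x) *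
      Complex.exp (-∫ r in (0:ℝ)..s, (g (φ r x) + Complex.I * f x))) 0 s := by
    intro s hs
    have h1 := hΦ.hasDerivAt_pull hΩ hf hL hφ he x (innerₛₗ ℂ ξ) s
    have h2 := (hc.integral_hasStrictDerivAt 0 s).hasDerivAt.neg.cexp
    have h3 : pull Φ s (prequantOp nab (hamVF Ω f) f e) x =
        (g (φ s x) + Complex.I * f x) • pull Φ s e x := by
      rw [(hI s hs).1, ← hφ.hamiltonian_eq hΩ hf s x]
      simp only [pull, prequantOp]
      rw [nab_eq (hI s hs).2, ← add_smul, map_smul]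
    rw [h3, map_smul] at h1
    refine (h1.mul h2).congr_deriv ?_
    rw [smul_eq_mul]
    ring
  have h1 := isOpen_Ioo.is_const_of_deriv_eq_zero isPreconnected_Ioo
    (fun s hs => (hd s hs).differentiableAt.differentiableWithinAt) (fun s hs => (hd s hs).deriv) ht ht'
  apply eq_of_inner_eq hξ
  rw [inner_smul_right]
  simp only [innerₛₗ_apply_apply] at h1
  rw [sub_eq_add_neg, Complex.exp_add, mul_assoc, mul_comm (Complex.exp (-_)), ← h1, mul_comm, mul_assoc,
    ← Complex.exp_add, neg_add_cancel, Complex.exp_zero, mul_one]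

/-- No regularity of `Φ_t` in `x` is assumed. By `IsExp.exists_pull_eq` smoothness of pull-backs
passes between nearby times, so the set of times at which it holds is open and closed, and it
contains 0. -/
theorem IsExp.smoothSecAt_pull (hΩ : IsSymplectic Ω) (hf : ContMDiff 𝓘(ℝ, Model n) 𝓘(ℝ, ℝ) ∞ f)
    (hL : IsPrequantization Ω nab) (hφ : IsFlow (hamVF Ω f) φ) (hΦ : IsExp nab f φ Φ) {e : ∀ x, L x}
    (he : SmoothSecOn (n := n) L univ e) (t : ℝ) (x : M) : SmoothSecAt n (pull Φ t e) x := by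
  let S : Set ℝ := {t | ∀ e : ∀ x, L x, SmoothSecOn (n := n) L univ e → SmoothSecAt n (pull Φ t e) x}
  have hloc : ∀ t₁, ∃ ε > 0, ∀ t ∈ Ioo (t₁ - ε) (t₁ + ε), ∀ t' ∈ Ioo (t₁ - ε) (t₁ + ε), t' ∈ S → t ∈ S := by
    intro t₁
    obtain ⟨e₁, F, ε, hε, he₁, hF, h⟩ := hΦ.exists_pull_eq hΩ hf hL hφ t₁ x
    refine ⟨ε, hε, fun t ht t' ht' hS e he => ?_⟩
    obtain ⟨g, hg, hge⟩ := exists_eventually_eq_smul (he₁.at (φ t x)) ((h.self_of_nhds t ht).1) (he.at (φ t x))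
    have hG := contMDiff_parametric_primitive hF
    have hGt : ∀ t : ℝ, ContMDiffAt 𝓘(ℝ, Model n) 𝓘(ℝ, ℂ) ∞ (fun x => ∫ s in (0:ℝ)..t, F (s, x)) x :=
      fun t => (hG.comp (contMDiff_const.prodMk contMDiff_id)) x
    refine SmoothSecAt.congr (SmoothSecAt.smul (hS e₁ he₁) (ContMDiffAt.cmul
      (hg.comp x (hφ.contMDiff_map t x)) (ContMDiffAt.cexp' ((hGt t).sub (hGt t'))))) ?_
    filter_upwards [h, ((hφ.contMDiff_map t).continuous.continuousAt (x := x)).eventually hge] with y hy hy'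
    rw [pull, hy', map_smul, mul_smul]
    congr 1
    exact (hy t ht).2.2 t' ht'
  have hclopen : IsClopen S := by
    constructor
    · rw [← isOpen_compl_iff, isOpen_iff_mem_nhds]
      intro t₁ h1
      obtain ⟨ε, hε, h⟩ := hloc t₁
      filter_upwards [Ioo_mem_nhds (by linarith : t₁ - ε < t₁) (by linarith : t₁ < t₁ + ε)] with t ht hS
      exact h1 (h t₁ (by constructor <;> linarith) t ht hS)
    · rw [isOpen_iff_mem_nhds]
      intro t₁ h1
      obtain ⟨ε, hε, h⟩ := hloc t₁
      filter_upwards [Ioo_mem_nhds (by linarith : t₁ - ε < t₁) (by linarith : t₁ < t₁ + ε)] with t ht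
      exact h t ht t₁ (by constructor <;> linarith) h1
  have h0 : (0 : ℝ) ∈ S := by
    intro e he
    refine SmoothSecAt.congr (he.at x) (Filter.Eventually.of_forall fun y => ?_)
    rw [pull, ← hΦ.zero e y, LinearEquiv.symm_apply_apply]
  have : t ∈ S := by rw [hclopen.eq_univ ⟨0, h0⟩]; exact mem_univ t
  exact this e he

/-- The pull-back of a section is smooth in `(t, x)`. -/
theorem IsExp.contMDiffAt_pull (hΩ : IsSymplectic Ω) (hf : ContMDiff 𝓘(ℝ, Model n) 𝓘(ℝ, ℝ) ∞ f)
    (hL : IsPrequantization Ω nab) (hφ : IsFlow (hamVF Ω f) φ) (hΦ : IsExp nab f φ Φ) {e : ∀ x, L x}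
    (he : SmoothSecOn (n := n) L univ e) (t₁ : ℝ) (x₀ : M) {x₁ : M} (hx : x₀ ∈ dom L x₁) :
    ContMDiffAt (𝓘(ℝ, ℝ).prod 𝓘(ℝ, Model n)) 𝓘(ℝ, ℂ) ∞
      (fun p : ℝ × M => lcoord L x₁ p.2 (pull Φ p.1 e p.2)) (t₁, x₀) := by
  obtain ⟨e₁, F, ε, hε, he₁, hF, h⟩ := hΦ.exists_pull_eq hΩ hf hL hφ t₁ x₀
  have ht₁ : t₁ ∈ Ioo (t₁ - ε) (t₁ + ε) := by constructor <;> linarith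
  obtain ⟨g, hg, hge⟩ := exists_eventually_eq_smul (he₁.at (φ t₁ x₀)) ((h.self_of_nhds t₁ ht₁).1)
    (he.at (φ t₁ x₀))
  have hG := contMDiff_parametric_primitive hF
  have h1 := (smoothSecAt_iff hx).1 (hΦ.smoothSecAt_pull hΩ hf hL hφ he₁ t₁ x₀)
  have h2 : ContMDiffAt (𝓘(ℝ, ℝ).prod 𝓘(ℝ, Model n)) 𝓘(ℝ, ℂ) ∞ (fun p : ℝ × M => g (φ p.1 p.2) *
      (Complex.exp ((∫ s in (0:ℝ)..p.1, F (s, p.2)) - ∫ s in (0:ℝ)..t₁, F (s, p.2)) *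
        lcoord L x₁ p.2 (pull Φ t₁ e₁ p.2))) (t₁, x₀) := by
    refine ContMDiffAt.cmul (hg.comp (t₁, x₀) (hφ.smooth (t₁, x₀))) (ContMDiffAt.cmul
      (ContMDiffAt.cexp' ((hG (t₁, x₀)).sub ?_)) (h1.comp (t₁, x₀) contMDiffAt_snd))
    exact (hG.comp (contMDiff_const.prodMk contMDiff_snd)) (t₁, x₀)
  refine h2.congr_of_eventuallyEq ?_
  filter_upwards [(continuousAt_snd (p := (t₁, x₀))).eventually h,
    (continuousAt_fst (p := (t₁, x₀))).eventually (Ioo_mem_nhds ht₁.1 ht₁.2),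
    (hφ.continuous.continuousAt (x := (t₁, x₀))).eventually hge] with p hp hp1 hp2
  rw [pull, hp2, map_smul, map_smul, smul_eq_mul]
  congr 1
  change lcoord L x₁ p.2 (pull Φ p.1 e₁ p.2) = _
  rw [(hp p.1 hp1).2.2 t₁ ht₁, map_smul, smul_eq_mul]

end Lift

/-! ### Mixed derivatives -/

/-- Symmetry of the second derivative of `F`, in the directions `(1, 0)` and `(0, w)`. -/
theorem hasDerivAt_fderiv_comm {E : Type*} [NormedAddCommGroup E] [NormedSpace ℝ E]
    {F : ℝ × E → ℂ} {t : ℝ} {y : E} (hF : ContDiffAt ℝ ∞ F (t, y)) (w : E) :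
    HasDerivAt (fun s => fderiv ℝ (fun z => F (s, z)) y w)
      (fderiv ℝ (fun z => deriv (fun s => F (s, z)) t) y w) t := by
  have h2 : ContDiffAt ℝ 2 F (t, y) := hF.of_le (WithTop.coe_le_coe.2 (le_top : (2 : ℕ∞) ≤ ⊤))
  have hev : ∀ᶠ p in 𝓝 (t, y), DifferentiableAt ℝ F p :=
    (h2.eventually (by simp)).mono fun p hp => hp.differentiableAt (by simp)
  have hdF : DifferentiableAt ℝ (fderiv ℝ F) (t, y) :=
    (h2.fderiv_right (m := 1) (by norm_num)).differentiableAt (by simp)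
  have hsymm : IsSymmSndFDerivAt ℝ F (t, y) := h2.isSymmSndFDerivAt (by simp)
  have h3 : ∀ (s : ℝ) (z : E), DifferentiableAt ℝ F (s, z) →
      fderiv ℝ (fun z => F (s, z)) z w = fderiv ℝ F (s, z) (0, w) ∧
      deriv (fun s => F (s, z)) s = fderiv ℝ F (s, z) (1, 0) := by
    intro s z hd
    constructor
    · have := hd.hasFDerivAt.comp z (hasFDerivAt_prodMk_right s z)
      rw [show (fun z => F (s, z)) = F ∘ fun z => (s, z) from rfl, this.fderiv]
      rfl
    · have := (hd.hasFDerivAt.comp s (hasFDerivAt_prodMk_left s z)).hasDerivAt.deriv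
      rw [show (fun s => F (s, z)) = F ∘ fun s => (s, z) from rfl, this]
      rfl
  have hs : ∀ᶠ s in 𝓝 t, DifferentiableAt ℝ F (s, y) :=
    (Continuous.prodMk_left y).continuousAt.eventually hev
  have hz : ∀ᶠ z in 𝓝 y, DifferentiableAt ℝ F (t, z) :=
    (Continuous.prodMk_right t).continuousAt.eventually hev
  have h4 : (fun z => deriv (fun s => F (s, z)) t) =ᶠ[𝓝 y] fun z => fderiv ℝ F (t, z) (1, 0) :=
    hz.mono fun z hd => (h3 t z hd).2
  have h5 := (hdF.hasFDerivAt.comp y (hasFDerivAt_prodMk_right t y)).clm_apply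
    (hasFDerivAt_const ((1 : ℝ), (0 : E)) y)
  have h6' : HasFDerivAt (fun s => fderiv ℝ F (s, y)) ((fderiv ℝ (fderiv ℝ F) (t, y)).comp
      (ContinuousLinearMap.inl ℝ ℝ E)) t := hdF.hasFDerivAt.comp t (hasFDerivAt_prodMk_left t y)
  have h6 := (h6'.clm_apply (hasFDerivAt_const ((0 : ℝ), w) t)).hasDerivAt
  rw [h4.fderiv_eq]
  have h7 : fderiv ℝ (fun z => fderiv ℝ F (t, z) (1, 0)) y w =
      fderiv ℝ (fderiv ℝ F) (t, y) (0, w) (1, 0) := by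
    rw [show (fun z => fderiv ℝ F (t, z) (1, 0)) = fun z => ((fderiv ℝ F ∘ fun z => (t, z)) z) (1, 0) from rfl,
      h5.fderiv]
    simp
  rw [h7, hsymm]
  refine (h6.congr_deriv ?_).congr_of_eventuallyEq (hs.mono fun s hd => (h3 s y hd).1)
  simp

section Mixed
variable {n : ℕ} {M : Type*} [TopologicalSpace M] [ChartedSpace (Model n) M]

theorem dC_eq_fderiv {g : M → ℂ} {x : M} (hg : MDifferentiableAt 𝓘(ℝ, Model n) 𝓘(ℝ, ℂ) g x)
    (v : Tan n x) : dC g x v =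
      fderiv ℝ (fun z => g ((extChartAt 𝓘(ℝ, Model n) x).symm z)) (extChartAt 𝓘(ℝ, Model n) x x) v := by
  have := hg.mfderiv
  rw [ModelWithCorners.range_eq_univ, fderivWithin_univ] at this
  exact congrArg (fun l : Model n →L[ℝ] ℂ => l v) this

variable [IsManifold 𝓘(ℝ, Model n) ∞ M]

theorem hasDerivAt_dC_comm {F : ℝ × M → ℂ} {t : ℝ} {x : M}
    (hF : ContMDiffAt (𝓘(ℝ, ℝ).prod 𝓘(ℝ, Model n)) 𝓘(ℝ, ℂ) ∞ F (t, x)) (v : Tan n x) :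
    HasDerivAt (fun s => dC (fun y => F (s, y)) x v)
      (dC (fun y => deriv (fun s => F (s, y)) t) x v) t := by
  set e := extChartAt 𝓘(ℝ, Model n) x with he
  have hsymm : ContMDiffAt 𝓘(ℝ, Model n) 𝓘(ℝ, Model n) ∞ e.symm (e x) := by
    have := contMDiffWithinAt_extChartAt_symm_range (I := 𝓘(ℝ, Model n)) (n := ∞) x
      (mem_extChartAt_target x)
    rwa [ModelWithCorners.range_eq_univ, contMDiffWithinAt_univ] at this
  have hx : e.symm (e x) = x := extChartAt_to_inv x
  have h1 : ContMDiffAt (𝓘(ℝ, ℝ).prod 𝓘(ℝ, Model n)) 𝓘(ℝ, ℂ) ∞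
      (fun p : ℝ × Model n => F (p.1, e.symm p.2)) (t, e x) := by
    refine ContMDiffAt.comp (t, e x) (g := F) ?_ (contMDiffAt_fst.prodMk
      (ContMDiffAt.comp (t, e x) hsymm contMDiffAt_snd))
    simpa only [hx] using hF
  rw [← modelWithCornersSelf_prod, chartedSpaceSelf_prod, contMDiffAt_iff_contDiffAt] at h1
  have h2 := hasDerivAt_fderiv_comm h1 v
  have hd : MDifferentiableAt 𝓘(ℝ, Model n) 𝓘(ℝ, ℂ) (fun y => deriv (fun s => F (s, y)) t) x :=
    (ContMDiffAt.deriv_fst (g := fun _ => t) hF contMDiffAt_const).mdifferentiableAt (by simp)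
  rw [dC_eq_fderiv hd]
  refine h2.congr_of_eventuallyEq ?_
  have h3 : ∀ᶠ p in 𝓝 (t, x), ContMDiffAt (𝓘(ℝ, ℝ).prod 𝓘(ℝ, Model n)) 𝓘(ℝ, ℂ) 1 F p :=
    (contMDiffAt_iff_contMDiffAt_nhds (by simp)).1 (hF.of_le (by simp : (1 : ℕ∞ω) ≤ ∞))
  filter_upwards [(Continuous.prodMk_left x).continuousAt.eventually h3] with s hs
  exact dC_eq_fderiv (g := fun y => F (s, y)) ((hs.comp x (f := fun y => (s, y))
    (contMDiffAt_const.prodMk contMDiffAt_id)).mdifferentiableAt (by simp)) v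

end Mixed

/-! ### The lift of the flow preserves the connection -/

section Preserve
variable {n : ℕ} {M : Type*} [TopologicalSpace M] [ChartedSpace (Model n) M]
  [IsManifold 𝓘(ℝ, Model n) ∞ M] [T2Space M] {Ω : ∀ x : M, Tan n x →L[ℝ] Tan n x →L[ℝ] ℝ}
  {L : M → Type*} [TopologicalSpace (TotalSpace ℂ L)] [∀ x, NormedAddCommGroup (L x)]
  [∀ x, InnerProductSpace ℂ (L x)] [FiberBundle ℂ L] [VectorBundle ℂ ℂ L] [VectorBundle ℝ ℂ L]
  [ContMDiffVectorBundle ∞ ℂ L 𝓘(ℝ, Model n)]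
  {nab : CovariantDerivative 𝓘(ℝ, Model n) ℂ L}
  {f : M → ℝ} {φ : ℝ → M → M} {Φ : ∀ t x, L x ≃ₗ[ℂ] L (φ t x)}

/-- A vector is the value of a smooth vector field. -/
theorem exists_smoothVF_apply_eq (x : M) (v : Tan n x) : ∃ V : ∀ x : M, Tan n x, SmoothVF V ∧ V x = v := by
  obtain ⟨X, hX, hXe⟩ := exists_local_frame (n := n) x
  have h1 := hXe.self_of_nhds v
  refine ⟨fun y => ∑ a, (show Model n from
      ((trivializationAt (Model n) (TangentSpace 𝓘(ℝ, Model n) : M → Type _) x) ⟨x, v⟩).2) a • X a y, ?_, h1.symm⟩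
  refine ContMDiff.sum_section fun a _ => ?_
  exact ContMDiff.smul_section contMDiff_const (hX a)

theorem connForm_smul (hL : IsPrequantization Ω nab) {e e' : ∀ x, L x}
    (he : SmoothSecOn (n := n) L univ e) {x : M} (h0 : e x ≠ 0) {g : M → ℂ}
    (hg : ContMDiffAt 𝓘(ℝ, Model n) 𝓘(ℝ, ℂ) ∞ g x) (hg0 : g x ≠ 0)
    (he' : ∀ᶠ y in 𝓝 x, e' y = g y • e y) (v : Tan n x) :
    connForm nab e' x v = connForm nab e x v + dC g x v / g x := by
  have h1 : e' x ≠ 0 := by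
    rw [he'.self_of_nhds]
    exact smul_ne_zero hg0 h0
  apply connForm_eq_of h1
  rw [nab_congr (SmoothSecAt.smul (he.at x) hg) he', nab_smul hL he (hg.mdifferentiableAt (by simp)),
    nab_eq h0, he'.self_of_nhds, smul_smul, smul_smul, ← add_smul]
  congr 1
  field_simp

variable [CovariantDerivative.ContMDiffCovariantDerivative nab ∞]

theorem dC_sum {ι : Type*} {s : Finset ι} {F : ι → M → ℂ} {x : M}
    (hF : ∀ a, ContMDiffAt 𝓘(ℝ, Model n) 𝓘(ℝ, ℂ) ∞ (F a) x) (v : Tan n x) :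
    dC (fun y => ∑ a ∈ s, F a y) x v = ∑ a ∈ s, dC (F a) x v := by
  classical
  induction s using Finset.induction_on with
  | empty => simpa using dC_const (0 : ℂ) x v
  | insert a s ha ih =>
    simp only [Finset.sum_insert ha]
    rw [dC_add ((hF a).mdifferentiableAt (by simp))
      ((contMDiffAt_finsetSum fun a _ => hF a).mdifferentiableAt (by simp)), ih]

/-- The connection form is a combination of differentials of functions. -/
theorem exists_connForm_eq_sum {e : ∀ x, L x} (he : SmoothSecOn (n := n) L univ e) {x : M}
    (h0 : e x ≠ 0) : ∃ g u : (Fin n ⊕ Fin n) → M → ℂ, (∀ a, ContMDiff 𝓘(ℝ, Model n) 𝓘(ℝ, ℂ) ∞ (g a)) ∧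
      (∀ a, ContMDiff 𝓘(ℝ, Model n) 𝓘(ℝ, ℂ) ∞ (u a)) ∧
      ∀ᶠ y in 𝓝 x, ∀ v : Tan n y, connForm nab e y v = ∑ a, g a y * dC (u a) y v := by
  obtain ⟨X, hX, hXe⟩ := exists_local_frame (n := n) x
  obtain ⟨U, hUs, hU, hxU⟩ := mem_nhds_iff.1 ((he.at x).eventually_ne_zero h0)
  have h1 : ∀ a, ∃ g : M → ℂ, ContMDiff 𝓘(ℝ, Model n) 𝓘(ℝ, ℂ) ∞ g ∧
      ∀ᶠ y in 𝓝 x, g y = connForm nab e y (X a y) := fun a =>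
    exists_contMDiff_eq (fun y hy => (contMDiffAt_connForm he (hX a y) (hUs hy)).contMDiffWithinAt) hU hxU
  choose g hg hge using h1
  -- The differentials of the chart coordinates are dual to the frame `X` of the same chart, so the
  -- coefficients are the values of the connection form on the `X a`. All these functions are then
  -- extended to `M`.
  set c := fun (a : Fin n ⊕ Fin n) (y : M) => (((extChartAt 𝓘(ℝ, Model n) x y) a : ℝ) : ℂ) with hc
  have hcL : ∀ a, ∃ l : Model n →L[ℝ] ℂ, ∀ z, l z = ((z a : ℝ) : ℂ) := fun a =>
    ⟨Complex.ofRealCLM.comp (EuclideanSpace.proj a : Model n →L[ℝ] ℝ), fun z => rfl⟩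
  choose l hl using hcL
  have hext : ContMDiffOn 𝓘(ℝ, Model n) 𝓘(ℝ, Model n) ∞ (extChartAt 𝓘(ℝ, Model n) x) (chartAt (Model n) x).source :=
    contMDiffOn_extChartAt
  have h2 : ∀ a, ∃ u : M → ℂ, ContMDiff 𝓘(ℝ, Model n) 𝓘(ℝ, ℂ) ∞ u ∧ ∀ᶠ y in 𝓝 x, u y = c a y := fun a =>
    exists_contMDiff_eq (fun y hy => by
      have h3 := ((l a).contDiff.contMDiff (n := ∞)).contMDiffAt.comp_contMDiffWithinAt y (hext y hy)
      refine h3.congr (fun z _ => (hl a _).symm) (hl a _).symm) (chartAt (Model n) x).open_source (mem_chart_source _ x)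
  choose u hu hue using h2
  refine ⟨g, u, hg, hu, ?_⟩
  filter_upwards [hXe, Filter.eventually_all.2 hge, Filter.eventually_all.2 fun a => (hue a).eventually_nhds,
    (chartAt (Model n) x).open_source.mem_nhds (mem_chart_source _ x), hU.mem_nhds hxU] with y hy hgy huy hys hyU v
  have h3 : ∀ a, dC (u a) y v = (((show Model n from
      ((trivializationAt (Model n) (TangentSpace 𝓘(ℝ, Model n) : M → Type _) x) ⟨y, v⟩).2) a : ℝ) : ℂ) := by
    intro a
    rw [dC_congr (huy a) v]
    have h5 : MDifferentiableAt 𝓘(ℝ, Model n) 𝓘(ℝ, ℂ) (l a) (extChartAt 𝓘(ℝ, Model n) x y) :=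
      (l a).differentiableAt.mdifferentiableAt
    have h4 := mfderiv_comp y h5 (mdifferentiableAt_extChartAt (I := 𝓘(ℝ, Model n)) hys)
    rw [mfderiv_eq_fderiv, ContinuousLinearMap.fderiv,
      ← TangentBundle.continuousLinearMapAt_trivializationAt hys] at h4
    have h6 : c a = l a ∘ extChartAt 𝓘(ℝ, Model n) x := funext fun z => (hl a _).symm
    rw [h6]
    refine (congrArg (fun l : Tan n y →L[ℝ] ℂ => l v) h4).trans ?_
    refine (hl a _).trans ?_
    refine congrArg (fun z : Model n => ((z a : ℝ) : ℂ)) ?_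
    exact congrFun (Trivialization.coe_linearMapAt_of_mem (R := ℝ)
      (trivializationAt (Model n) (TangentSpace 𝓘(ℝ, Model n) : M → Type _) x) (b := y) hys) v
  have h4 : ∀ (c : (Fin n ⊕ Fin n) → ℝ), connForm nab e y (∑ a, c a • X a y) =
      ∑ a, (c a : ℂ) * connForm nab e y (X a y) := by
    intro c
    simp only [connForm, map_sum, map_smul, inner_sum, Finset.sum_div]
    refine Finset.sum_congr rfl fun a _ => ?_
    rw [← Complex.coe_smul, inner_smul_right, mul_div_assoc]
  conv_lhs => rw [hy v]
  rw [h4]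
  refine Finset.sum_congr rfl fun a _ => ?_
  rw [h3, hgy, mul_comm]

theorem IsExp.smoothSecOn_pull (hΩ : IsSymplectic Ω) (hf : ContMDiff 𝓘(ℝ, Model n) 𝓘(ℝ, ℝ) ∞ f)
    (hL : IsPrequantization Ω nab) (hφ : IsFlow (hamVF Ω f) φ) (hΦ : IsExp nab f φ Φ) {e : ∀ x, L x}
    (he : SmoothSecOn (n := n) L univ e) (t : ℝ) : SmoothSecOn (n := n) L univ (pull Φ t e) :=
  smoothSecOn_of_at fun x _ => hΦ.smoothSecAt_pull hΩ hf hL hφ he t x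

theorem pull_ne_zero {e : ∀ x, L x} {t : ℝ} {x : M} (h : e (φ t x) ≠ 0) : pull Φ t e x ≠ 0 := fun h0 =>
  h ((Φ t x).symm.map_eq_zero_iff.1 h0)

/-- The difference of the pull-back of the connection form and the connection form of the pull-back. -/
def connDefect (nab : CovariantDerivative 𝓘(ℝ, Model n) ℂ L) (Φ : ∀ t x, L x ≃ₗ[ℂ] L (φ t x))
    (e : ∀ x, L x) (x : M) (v : Tan n x) (t : ℝ) : ℂ :=
  connForm nab (pull Φ t e) x v - connForm nab e (φ t x) (dφ φ t x v)

/-- Multiplying the frame by `g` adds `dg / g` to the connection form, and by the chain rule both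
terms of the defect change by the same amount. So the frame may be chosen anew at each time. -/
theorem IsExp.connDefect_eq (hΩ : IsSymplectic Ω) (hf : ContMDiff 𝓘(ℝ, Model n) 𝓘(ℝ, ℝ) ∞ f)
    (hL : IsPrequantization Ω nab) (hφ : IsFlow (hamVF Ω f) φ) (hΦ : IsExp nab f φ Φ) {e e' : ∀ x, L x}
    (he : SmoothSecOn (n := n) L univ e) (he' : SmoothSecOn (n := n) L univ e') {t : ℝ} {x : M}
    (h0 : e (φ t x) ≠ 0) (h0' : e' (φ t x) ≠ 0) (v : Tan n x) :
    connDefect nab Φ e' x v t = connDefect nab Φ e x v t := by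
  obtain ⟨g, hg, hge⟩ := exists_eventually_eq_smul (he.at (φ t x)) h0 (he'.at (φ t x))
  have hg0 : g (φ t x) ≠ 0 := fun h => h0' (by rw [hge.self_of_nhds, h, zero_smul])
  have hφt := hφ.contMDiff_map t
  have h1 := connForm_smul hL he h0 hg hg0 hge (dφ φ t x v)
  have h2 := connForm_smul hL (hΦ.smoothSecOn_pull hΩ hf hL hφ he t) (pull_ne_zero h0)
    (e' := pull Φ t e') (hg.comp x (hφt x)) hg0 (by
      filter_upwards [(hφt.continuous.continuousAt (x := x)).eventually hge] with y hy
      rw [pull, hy, map_smul]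
      rfl) v
  rw [connDefect, h1, h2, connDefect]
  have h3 : dC (g ∘ φ t) x v = dC g (φ t x) (dφ φ t x v) :=
    dC_comp (hg.mdifferentiableAt (by simp)) (hφ.mdifferentiableAt t x) v
  rw [h3]
  simp only [Function.comp_apply]
  ring

/-- By `IsExp.exists_pull_eq` the pull-back at time `t` is a function `E` times the one at `t₁`, and
its connection form changes by `dE / E`. As `E = 1` at `t₁`, exchanging the derivatives in time and
space leaves the differential of `F (t₁, ·)`, that is of `α(X) ∘ φ_{t₁} + i f` with `α` the
connection form of `e`. -/
theorem IsExp.exists_hasDerivAt_connForm_pull (hΩ : IsSymplectic Ω)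
    (hf : ContMDiff 𝓘(ℝ, Model n) 𝓘(ℝ, ℝ) ∞ f) (hL : IsPrequantization Ω nab)
    (hφ : IsFlow (hamVF Ω f) φ) (hΦ : IsExp nab f φ Φ) (x : M) (v : Tan n x) (t₁ : ℝ) :
    ∃ e : ∀ x, L x, SmoothSecOn (n := n) L univ e ∧ e (φ t₁ x) ≠ 0 ∧
      HasDerivAt (fun t => connForm nab (pull Φ t e) x v)
        (dC (fun y => connForm nab e y (hamVF Ω f y)) (φ t₁ x) (dφ φ t₁ x v) + Complex.I * dR f x v) t₁ := by
  obtain ⟨e, F, ε, hε, he, hF, hev⟩ := hΦ.exists_pull_eq hΩ hf hL hφ t₁ x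
  have ht₁ : t₁ ∈ Ioo (t₁ - ε) (t₁ + ε) := by constructor <;> linarith
  have h0 : e (φ t₁ x) ≠ 0 := (hev.self_of_nhds t₁ ht₁).1
  refine ⟨e, he, h0, ?_⟩
  have hG := contMDiff_parametric_primitive hF
  set G : ℝ × M → ℂ := fun p => ∫ s in (0:ℝ)..p.1, F (s, p.2) with hGd
  set E : ℝ × M → ℂ := fun p => Complex.exp (G p - G (t₁, p.2)) with hE
  have hEs : ContMDiff (𝓘(ℝ, ℝ).prod 𝓘(ℝ, Model n)) 𝓘(ℝ, ℂ) ∞ E := fun p =>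
    ContMDiffAt.cexp' ((hG p).sub ((hG.comp (contMDiff_const.prodMk contMDiff_snd)) p))
  have hEt : ∀ t, ContMDiff 𝓘(ℝ, Model n) 𝓘(ℝ, ℂ) ∞ (fun y => E (t, y)) := fun t =>
    hEs.comp (contMDiff_const.prodMk contMDiff_id)
  have hE1 : ∀ y, E (t₁, y) = 1 := fun y => by simp [hE]
  have hEd : ∀ y, HasDerivAt (fun t => E (t, y)) (F (t₁, y)) t₁ := by
    intro y
    have hc : Continuous (fun s => F (s, y)) := hF.continuous.comp (Continuous.prodMk_left y)
    have h1 := ((hc.integral_hasStrictDerivAt 0 t₁).hasDerivAt.sub_const (G (t₁, y))).cexp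
    refine h1.congr_deriv ?_
    have h2 : (∫ s in (0:ℝ)..t₁, F (s, y)) - G (t₁, y) = 0 := sub_self _
    rw [h2, Complex.exp_zero, one_mul]
  have hA : ∀ t ∈ Ioo (t₁ - ε) (t₁ + ε), connForm nab (pull Φ t e) x v =
      connForm nab (pull Φ t₁ e) x v + dC (fun y => E (t, y)) x v / E (t, x) := by
    intro t ht
    refine connForm_smul hL (hΦ.smoothSecOn_pull hΩ hf hL hφ he t₁) (pull_ne_zero h0) (hEt t x)
      (Complex.exp_ne_zero _) ?_ v
    filter_upwards [hev] with y hy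
    exact (hy t ht).2.2 t₁ ht₁
  have h1 := hasDerivAt_dC_comm (hEs (t₁, x)) v
  have h2 : dC (fun y => deriv (fun s => E (s, y)) t₁) x v =
      dC (fun y => connForm nab e y (hamVF Ω f y)) (φ t₁ x) (dφ φ t₁ x v) + Complex.I * dR f x v := by
    have hh := contMDiffAt_connForm he (nab := nab) (hφ.smoothVF (φ t₁ x)) h0
    have hd1 : MDifferentiableAt 𝓘(ℝ, Model n) 𝓘(ℝ, ℂ)
        (fun y => connForm nab e (φ t₁ y) (hamVF Ω f (φ t₁ y))) x :=
      (hh.comp x (hφ.contMDiff_map t₁ x)).mdifferentiableAt (by simp)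
    have hd2 : ContMDiffAt 𝓘(ℝ, Model n) 𝓘(ℝ, ℂ) ∞ (fun y => (f y : ℂ)) x := ContMDiffAt.ofRealC (hf x)
    have h3 : dC (fun y => deriv (fun s => E (s, y)) t₁) x v =
        dC (fun y => connForm nab e (φ t₁ y) (hamVF Ω f (φ t₁ y)) + Complex.I * f y) x v := by
      refine dC_congr ?_ v
      filter_upwards [hev] with y hy
      rw [(hEd y).deriv, (hy t₁ ht₁).2.1]
    rw [h3, dC_add hd1 ((ContMDiffAt.cmul contMDiffAt_const hd2).mdifferentiableAt (by simp)),
      dC_mul mdifferentiableAt_const (hd2.mdifferentiableAt (by simp)), dC_const, zero_mul, add_zero,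
      dC_ofReal (hf.mdifferentiableAt (by simp))]
    congr 1
    exact dC_comp (g := fun y => connForm nab e y (hamVF Ω f y)) (hh.mdifferentiableAt (by simp))
      (hφ.mdifferentiableAt t₁ x) v
  rw [h2] at h1
  have h4 : dC (fun y => E (t₁, y)) x v = 0 := by
    rw [dC_congr (h := fun _ => 1) (Filter.Eventually.of_forall hE1), dC_const]
  have h3 := (h1.div (hEd x) (by rw [hE1]; exact one_ne_zero)).const_add (connForm nab (pull Φ t₁ e) x v)
  rw [hE1, h4] at h3
  refine (h3.congr_deriv (by ring)).congr_of_eventuallyEq ?_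
  filter_upwards [Ioo_mem_nhds ht₁.1 ht₁.2] with t ht
  exact hA t ht

/-- Cartan's formula for the connection form `α`: the derivative of `φ_t^* α` is the pull-back of
`d(α(X)) + dα(X, ·)`, and the curvature gives `dα(X, ·) = (1 / i) Ω(X, ·) = i df`. The formula is
checked on an expression `∑ g du` of `α`. -/
theorem IsExp.hasDerivAt_connForm_comp (hΩ : IsSymplectic Ω)
    (hL : IsPrequantization Ω nab) (hφ : IsFlow (hamVF Ω f) φ) {e : ∀ x, L x}
    (he : SmoothSecOn (n := n) L univ e) {x : M} {t₁ : ℝ} (h0 : e (φ t₁ x) ≠ 0) (v : Tan n x) :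
    HasDerivAt (fun t => connForm nab e (φ t x) (dφ φ t x v))
      (dC (fun y => connForm nab e y (hamVF Ω f y)) (φ t₁ x) (dφ φ t₁ x v) +
        Complex.I * dR f (φ t₁ x) (dφ φ t₁ x v)) t₁ := by
  obtain ⟨g, u, hg, hu, hgu⟩ := exists_connForm_eq_sum (nab := nab) he h0
  set z := φ t₁ x with hz
  set w := dφ φ t₁ x v with hw
  set X := hamVF Ω f with hX
  have hXs : SmoothVF X := hφ.smoothVF
  have hgd : ∀ a y, MDifferentiableAt 𝓘(ℝ, Model n) 𝓘(ℝ, ℂ) (g a) y := fun a y =>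
    (hg a).mdifferentiableAt (by simp)
  have hud : ∀ a y, MDifferentiableAt 𝓘(ℝ, Model n) 𝓘(ℝ, ℂ) (u a) y := fun a y =>
    (hu a).mdifferentiableAt (by simp)
  have hXu : ∀ a, ContMDiff 𝓘(ℝ, Model n) 𝓘(ℝ, ℂ) ∞ (fun y => dC (u a) y (X y)) := fun a =>
    hXs.contMDiff_dC (hu a)
  have hsum : ∀ (Y : ∀ x : M, Tan n x), SmoothVF Y → ∀ v : Tan n z,
      dC (fun y => connForm nab e y (Y y)) z v =
        ∑ a, (g a z * dC (fun y => dC (u a) y (Y y)) z v + dC (g a) z v * dC (u a) z (Y z)) := by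
    intro Y hY v
    have h1 : dC (fun y => connForm nab e y (Y y)) z v =
        dC (fun y => ∑ a, g a y * dC (u a) y (Y y)) z v := dC_congr (hgu.mono fun y hy => hy (Y y)) v
    rw [h1]
    have h3 : dC (fun y => ∑ a, g a y * dC (u a) y (Y y)) z v =
        ∑ a, dC (fun y => g a y * dC (u a) y (Y y)) z v :=
      dC_sum (fun a => ContMDiffAt.cmul (hg a z) (hY.contMDiff_dC (hu a) z)) v
    rw [h3]
    exact Finset.sum_congr rfl fun a _ => dC_mul (hgd a z) ((hY.contMDiff_dC (hu a)).mdifferentiableAt (by simp)) v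
  obtain ⟨W, hW, hWz⟩ := exists_smoothVF_apply_eq (n := n) z w
  have hcurv := connForm_curvature hL he hXs hW h0
  rw [hsum W hW, hsum X hXs, hgu.self_of_nhds, hΩ.hamVF_apply, ← Finset.sum_sub_distrib,
    ← Finset.sum_sub_distrib] at hcurv
  simp only [dC_mlieBracket hXs hW (hu _), hWz] at hcurv
  have hterm : ∀ a, HasDerivAt (fun t => g a (φ t x) * dC (u a) (φ t x) (dφ φ t x v))
      (g a z * dC (fun y => dC (u a) y (X y)) z w + dC (g a) z (X z) * dC (u a) z w) t₁ := by
    intro a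
    have h1 := hasDerivAt_dC_comp (hgd a z) (hφ.hasMFDerivAt x t₁)
    have h2 := hasDerivAt_dC_comm (F := fun p => u a (φ p.1 p.2)) (((hu a).comp hφ.smooth) (t₁, x)) v
    have h3 : ∀ t, dC (fun y => u a (φ t y)) x v = dC (u a) (φ t x) (dφ φ t x v) := fun t =>
      dC_comp (hud a _) (hφ.mdifferentiableAt t x) v
    have h4 : (fun y => deriv (fun s => u a (φ s y)) t₁) = fun y => dC (u a) (φ t₁ y) (X (φ t₁ y)) :=
      funext fun y => (hasDerivAt_dC_comp (hud a _) (hφ.hasMFDerivAt y t₁)).deriv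
    rw [h4, dC_comp (g := fun y => dC (u a) y (X y)) ((hXu a).mdifferentiableAt (by simp))
      (hφ.mdifferentiableAt t₁ x)] at h2
    simp only [h3] at h2
    refine (h1.mul h2).congr_deriv ?_
    ring
  have hder := HasDerivAt.fun_sum (u := Finset.univ) fun a _ => hterm a
  have hev : (fun t => connForm nab e (φ t x) (dφ φ t x v)) =ᶠ[𝓝 t₁]
      fun t => ∑ a, g a (φ t x) * dC (u a) (φ t x) (dφ φ t x v) :=
    ((hφ.hasMFDerivAt x t₁).continuousAt.eventually hgu).mono fun t ht => ht _
  refine (hder.congr_deriv ?_).congr_of_eventuallyEq hev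
  rw [hsum X hXs, ← sub_eq_iff_eq_add', ← Finset.sum_sub_distrib]
  have hI : Complex.I * (dR f z w : ℂ) = 1 / Complex.I * ((-dR f z w : ℝ) : ℂ) := by
    rw [Complex.ofReal_neg, one_div, Complex.inv_I]
    ring
  rw [hI, ← hcurv]
  refine Finset.sum_congr rfl fun a _ => ?_
  ring

theorem connForm_transport {e : ∀ x, L x} {x y : M} (h : y = x) {v : Tan n x} {w : Tan n y}
    (hw : (show Model n from w) = v) : connForm nab e y w = connForm nab e x v := by
  subst h
  exact congrArg (fun w : Tan n y => connForm nab e y w) hw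

/-- The lift of the Hamiltonian flow preserves the connection form. -/
theorem IsExp.connForm_pull (hΩ : IsSymplectic Ω) (hf : ContMDiff 𝓘(ℝ, Model n) 𝓘(ℝ, ℝ) ∞ f)
    (hL : IsPrequantization Ω nab) (hφ : IsFlow (hamVF Ω f) φ) (hΦ : IsExp nab f φ Φ) {e : ∀ x, L x}
    (he : SmoothSecOn (n := n) L univ e) {t : ℝ} {x : M} (h0 : e (φ t x) ≠ 0) (v : Tan n x) :
    connForm nab (pull Φ t e) x v = connForm nab e (φ t x) (dφ φ t x v) := by
  choose E hE _ hE0 using fun y : M => exists_smoothSec_eq_frame (n := n) (E := L) y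
  -- The chosen frame depends on `t` without any regularity; near each time the defect is computed
  -- in a fixed frame instead.
  set β : ℝ → ℂ := fun t => connDefect nab Φ (E (φ t x)) x v t with hβ
  have hfφ : ∀ t, dR f (φ t x) (dφ φ t x v) = dR f x v := by
    intro t
    have h1 : (fun y => ((f (φ t y) : ℝ) : ℂ)) = fun y => (f y : ℂ) :=
      funext fun y => by rw [hφ.hamiltonian_eq hΩ hf t y]
    have h2 := dC_comp (g := fun y => ((f y : ℝ) : ℂ)) (F := φ t) (x := x)
      ((ContMDiffAt.ofRealC (hf (φ t x))).mdifferentiableAt (by simp)) (hφ.mdifferentiableAt t x) v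
    rw [dC_ofReal (hf.mdifferentiableAt (by simp))] at h2
    have h3 : dC (fun y => ((f (φ t y) : ℝ) : ℂ)) x v = dR f x v := by
      rw [h1, dC_ofReal (hf.mdifferentiableAt (by simp))]
    exact_mod_cast h2.symm.trans h3
  have hd : ∀ t₁, HasDerivAt β 0 t₁ := by
    intro t₁
    obtain ⟨e, he, h0, h1⟩ := hΦ.exists_hasDerivAt_connForm_pull hΩ hf hL hφ x v t₁
    have h2 := IsExp.hasDerivAt_connForm_comp hΩ hL hφ he h0 v
    refine ((h1.sub h2).congr_deriv (by rw [hfφ]; ring)).congr_of_eventuallyEq ?_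
    filter_upwards [(hφ.hasMFDerivAt x t₁).continuousAt.eventually ((he.at (φ t₁ x)).eventually_ne_zero h0)]
      with t ht
    exact hΦ.connDefect_eq hΩ hf hL hφ he (hE _) ht (hE0 _) v
  have hβ0 : β 0 = 0 := by
    have h1 : pull Φ 0 (E (φ 0 x)) = E (φ 0 x) := funext fun y => by
      rw [pull, ← hΦ.zero (E (φ 0 x)) y, LinearEquiv.symm_apply_apply]
    simp only [hβ, connDefect, h1, sub_eq_zero]
    exact (connForm_transport (hφ.zero x) (hφ.mfderiv_zero x v)).symm
  have hc : β t = 0 := by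
    rw [← hβ0]
    exact is_const_of_deriv_eq_zero (fun t => (hd t).differentiableAt) (fun t => (hd t).deriv) t 0
  rw [← sub_eq_zero, ← hc]
  exact hΦ.connDefect_eq hΩ hf hL hφ (hE _) he (hE0 _) h0 v

/-- The lift of the Hamiltonian flow preserves the connection. -/
theorem IsExp.nab_pull (hΩ : IsSymplectic Ω) (hf : ContMDiff 𝓘(ℝ, Model n) 𝓘(ℝ, ℝ) ∞ f)
    (hL : IsPrequantization Ω nab) (hφ : IsFlow (hamVF Ω f) φ) (hΦ : IsExp nab f φ Φ) {e : ∀ x, L x}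
    (he : SmoothSecOn (n := n) L univ e) (t : ℝ) (x : M) (v : Tan n x) :
    nab (pull Φ t e) x v = (Φ t x).symm (nab e (φ t x) (dφ φ t x v)) := by
  obtain ⟨e', he', -, h0⟩ := exists_smoothSec_eq_frame (n := n) (E := L) (φ t x)
  obtain ⟨g, hg, hge⟩ := exists_eventually_eq_smul (he'.at (φ t x)) h0 (he.at (φ t x))
  have hφt := hφ.contMDiff_map t
  have hgφ : ContMDiffAt 𝓘(ℝ, Model n) 𝓘(ℝ, ℂ) ∞ (g ∘ φ t) x := hg.comp x (hφt x)
  have hp := hΦ.smoothSecOn_pull hΩ hf hL hφ he' t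
  have h1 : nab (pull Φ t e) x v = nab (fun y => (g ∘ φ t) y • pull Φ t e' y) x v := by
    refine congrArg (fun l : Tan n x →L[ℝ] L x => l v) (nab_congr (SmoothSecAt.smul (hp.at x) hgφ) ?_)
    filter_upwards [(hφt.continuous.continuousAt (x := x)).eventually hge] with y hy
    rw [pull, hy, map_smul]
    rfl
  have h2 : nab e (φ t x) (dφ φ t x v) = nab (fun y => g y • e' y) (φ t x) (dφ φ t x v) :=
    congrArg (fun l : Tan n (φ t x) →L[ℝ] L (φ t x) => l (dφ φ t x v))
      (nab_congr (SmoothSecAt.smul (he'.at _) hg) hge)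
  rw [h1, h2, nab_smul hL hp (hgφ.mdifferentiableAt (by simp)), nab_smul hL he' (hg.mdifferentiableAt (by simp)),
    nab_eq h0, nab_eq (pull_ne_zero h0), hΦ.connForm_pull hΩ hf hL hφ he' h0,
    show dC (g ∘ φ t) x v = dC g (φ t x) (dφ φ t x v) from
      dC_comp (hg.mdifferentiableAt (by simp)) (hφ.mdifferentiableAt t x) v]
  simp only [map_add, map_smul]
  rfl

end Preserve

/-! ### Hamiltonian flows are symplectic -/

section SymplecticFlow
variable {n : ℕ} {M : Type*} [TopologicalSpace M] [ChartedSpace (Model n) M]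
  [IsManifold 𝓘(ℝ, Model n) ∞ M] [T2Space M] {Ω : ∀ x : M, Tan n x →L[ℝ] Tan n x →L[ℝ] ℝ}
  {L : M → Type*} [TopologicalSpace (TotalSpace ℂ L)] [∀ x, NormedAddCommGroup (L x)]
  [∀ x, InnerProductSpace ℂ (L x)] [FiberBundle ℂ L] [VectorBundle ℂ ℂ L] [VectorBundle ℝ ℂ L]
  [ContMDiffVectorBundle ∞ ℂ L 𝓘(ℝ, Model n)]
  {nab : CovariantDerivative 𝓘(ℝ, Model n) ℂ L} [CovariantDerivative.ContMDiffCovariantDerivative nab ∞]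
  {f : M → ℝ} {φ : ℝ → M → M} {Φ : ∀ t x, L x ≃ₗ[ℂ] L (φ t x)}

/-- The curvature in terms of an expression `∑ g du` of the connection form. -/
theorem omega_eq_sum (hL : IsPrequantization Ω nab) {e : ∀ x, L x}
    (he : SmoothSecOn (n := n) L univ e) {x : M} (h0 : e x ≠ 0) {ι : Type*} [Fintype ι]
    {g u : ι → M → ℂ} (hg : ∀ a, ContMDiff 𝓘(ℝ, Model n) 𝓘(ℝ, ℂ) ∞ (g a))
    (hu : ∀ a, ContMDiff 𝓘(ℝ, Model n) 𝓘(ℝ, ℂ) ∞ (u a))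
    (hgu : ∀ᶠ y in 𝓝 x, ∀ v : Tan n y, connForm nab e y v = ∑ a, g a y * dC (u a) y v)
    (v w : Tan n x) : (1 / Complex.I) * (Ω x v w : ℂ) =
      ∑ a, (dC (g a) x v * dC (u a) x w - dC (g a) x w * dC (u a) x v) := by
  have hgd : ∀ a, MDifferentiableAt 𝓘(ℝ, Model n) 𝓘(ℝ, ℂ) (g a) x := fun a =>
    (hg a).mdifferentiableAt (by simp)
  obtain ⟨V, hV, rfl⟩ := exists_smoothVF_apply_eq (n := n) x v
  obtain ⟨W, hW, rfl⟩ := exists_smoothVF_apply_eq (n := n) x w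
  have hsum : ∀ (Y : ∀ x : M, Tan n x), SmoothVF Y → ∀ v : Tan n x,
      dC (fun y => connForm nab e y (Y y)) x v =
        ∑ a, (g a x * dC (fun y => dC (u a) y (Y y)) x v + dC (g a) x v * dC (u a) x (Y x)) := by
    intro Y hY v
    rw [dC_congr (h := fun y => ∑ a, g a y * dC (u a) y (Y y)) (hgu.mono fun y hy => hy (Y y)) v]
    refine (dC_sum (fun a => ContMDiffAt.cmul (hg a x) (hY.contMDiff_dC (hu a) x)) v).trans ?_
    exact Finset.sum_congr rfl fun a _ => dC_mul (hgd a) ((hY.contMDiff_dC (hu a)).mdifferentiableAt (by simp)) v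
  rw [← connForm_curvature hL he hV hW h0, hsum W hW, hsum V hV, hgu.self_of_nhds, ← Finset.sum_sub_distrib,
    ← Finset.sum_sub_distrib]
  refine Finset.sum_congr rfl fun a _ => ?_
  rw [dC_mlieBracket hV hW (hu _)]
  ring

/-- The flow of a Hamiltonian vector field preserves the symplectic form. -/
theorem IsExp.omega_mfderiv (hΩ : IsSymplectic Ω) (hf : ContMDiff 𝓘(ℝ, Model n) 𝓘(ℝ, ℝ) ∞ f)
    (hL : IsPrequantization Ω nab) (hφ : IsFlow (hamVF Ω f) φ) (hΦ : IsExp nab f φ Φ) (t : ℝ) (x : M)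
    (v w : Tan n x) : Ω (φ t x) (dφ φ t x v) (dφ φ t x w) = Ω x v w := by
  obtain ⟨e, he, -, h0⟩ := exists_smoothSec_eq_frame (n := n) (E := L) (φ t x)
  obtain ⟨g, u, hg, hu, hgu⟩ := exists_connForm_eq_sum (nab := nab) he h0
  have hφt := hφ.contMDiff_map t
  have hchain : ∀ {h : M → ℂ}, ContMDiff 𝓘(ℝ, Model n) 𝓘(ℝ, ℂ) ∞ h → ∀ y (v : Tan n y),
      dC (fun y => h (φ t y)) y v = dC h (φ t y) (dφ φ t y v) := fun hh y v =>
    dC_comp (hh.mdifferentiableAt (by simp)) (hφ.mdifferentiableAt t y) v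
  -- Since the connection form is preserved, composing `g` and `u` with the flow gives an expression
  -- of the connection form of the pulled back frame. The curvature computed from it at `x` is the
  -- one at `φ t x` applied to the images of the vectors.
  have h1 := omega_eq_sum hL (hΦ.smoothSecOn_pull hΩ hf hL hφ he t) (pull_ne_zero h0)
    (g := fun a y => g a (φ t y)) (u := fun a y => u a (φ t y))
    (fun a => (hg a).comp hφt) (fun a => (hu a).comp hφt) (by
      filter_upwards [(hφt.continuous.continuousAt (x := x)).eventually (hgu.and ((he.at (φ t x)).eventually_ne_zero h0))]
        with y hy v
      rw [hΦ.connForm_pull hΩ hf hL hφ he hy.2, hy.1]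
      exact Finset.sum_congr rfl fun a _ => by rw [hchain (hu a)]) v w
  have h2 := omega_eq_sum hL he h0 hg hu hgu (dφ φ t x v) (dφ φ t x w)
  simp only [hchain (hg _), hchain (hu _)] at h1
  have h3 := mul_left_cancel₀ (by simp) (h2.trans h1.symm)
  exact_mod_cast h3

end SymplecticFlow

/-! ### Fields of endomorphisms -/

section Endomorphisms
variable {n : ℕ} {M : Type*} [TopologicalSpace M] [ChartedSpace (Model n) M]
  [IsManifold 𝓘(ℝ, Model n) ∞ M] [T2Space M]
  {E' H' N : Type*} [NormedAddCommGroup E'] [NormedSpace ℝ E'] [TopologicalSpace H']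
  {J : ModelWithCorners ℝ E' H'} [TopologicalSpace N] [ChartedSpace H' N] {b : N → M} {p₀ : N}

theorem contMDiffAt_end_apply {c : ∀ p, Tan n (b p) →L[ℝ] Tan n (b p)} {V : ∀ p, Tan n (b p)}
    (hc : ContMDiffAt J (𝓘(ℝ, Model n).prod 𝓘(ℝ, Model n →L[ℝ] Model n)) ∞
      (fun p => TotalSpace.mk' (Model n →L[ℝ] Model n)
        (E := fun x : M => Tan n x →L[ℝ] Tan n x) (b p) (c p)) p₀)
    (hV : ContMDiffAt J 𝓘(ℝ, Model n).tangent ∞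
      (fun p => (⟨b p, V p⟩ : TangentBundle 𝓘(ℝ, Model n) M)) p₀) :
    ContMDiffAt J 𝓘(ℝ, Model n).tangent ∞
      (fun p => (⟨b p, c p (V p)⟩ : TangentBundle 𝓘(ℝ, Model n) M)) p₀ :=
  ContMDiffAt.clm_bundle_apply (F₁ := Model n) (F₂ := Model n)
    (E₁ := (TangentSpace 𝓘(ℝ, Model n) : M → Type _)) (E₂ := (TangentSpace 𝓘(ℝ, Model n) : M → Type _)) hc hV

/-- In local frames a field of endomorphisms is a matrix whose columns are the images of the frame
fields. -/
theorem contMDiffAt_end_of_apply {c : ∀ p, Tan n (b p) →L[ℝ] Tan n (b p)}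
    (hb : ContMDiffAt J 𝓘(ℝ, Model n) ∞ b p₀)
    (hc : ∀ V : ∀ x : M, Tan n x, SmoothVF V → ContMDiffAt J 𝓘(ℝ, Model n).tangent ∞
      (fun p => (⟨b p, c p (V (b p))⟩ : TangentBundle 𝓘(ℝ, Model n) M)) p₀) :
    ContMDiffAt J (𝓘(ℝ, Model n).prod 𝓘(ℝ, Model n →L[ℝ] Model n)) ∞
      (fun p => TotalSpace.mk' (Model n →L[ℝ] Model n)
        (E := fun x : M => Tan n x →L[ℝ] Tan n x) (b p) (c p)) p₀ := by
  refine contMDiffAt_hom_bundle _ |>.2 ⟨hb, ?_⟩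
  set e := trivializationAt (Model n) (TangentSpace 𝓘(ℝ, Model n) : M → Type _) (b p₀) with he
  set B := (EuclideanSpace.basisFun (Fin n ⊕ Fin n) ℝ).toBasis
  have h1 : ∀ a, ∃ X' : ∀ x : M, Tan n x, SmoothVF X' ∧ ∀ᶠ y in 𝓝 (b p₀), X' y = e.localFrame B a y :=
    fun a => exists_smoothVF_eq (e.contMDiffOn_localFrame_baseSet ∞ B a) e.open_baseSet
      (FiberBundle.mem_baseSet_trivializationAt' (b p₀))
  choose X hX hXe using h1
  have h2 : ∀ a, ContMDiffAt J 𝓘(ℝ, Model n) ∞ (fun p => (show Model n from (e ⟨b p, c p (X a (b p))⟩).2)) p₀ :=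
    fun a => ((contMDiffAt_totalSpace (f := fun p => (⟨b p, c p (X a (b p))⟩ : TangentBundle 𝓘(ℝ, Model n) M))).1
      (hc (X a) (hX a))).2
  have h3 : ContMDiffAt J 𝓘(ℝ, Model n →L[ℝ] Model n) ∞ (fun p => ∑ a : Fin n ⊕ Fin n,
      ContinuousLinearMap.smulRightL ℝ (Model n) (Model n) (EuclideanSpace.proj a : Model n →L[ℝ] ℝ)
        (show Model n from (e ⟨b p, c p (X a (b p))⟩).2)) p₀ :=
    contMDiffAt_finsetSum fun a _ =>
      (ContinuousLinearMap.smulRightL ℝ (Model n) (Model n) (EuclideanSpace.proj a : Model n →L[ℝ] ℝ)).contMDiff.contMDiffAt.comp p₀ (h2 a)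
  refine h3.congr_of_eventuallyEq ?_
  have hbc := hb.continuousAt
  filter_upwards [hbc.eventually (Filter.eventually_all.2 hXe),
    hbc.eventually (e.open_baseSet.mem_nhds (FiberBundle.mem_baseSet_trivializationAt' (b p₀)))] with p hp hpe
  refine ContinuousLinearMap.coe_injective (B.ext fun a => ?_)
  have h4 : X a (b p) = e.symmL ℝ (b p) (B a) := by
    rw [hp a, e.localFrame_apply_of_mem_baseSet B hpe]
    simp only [Trivialization.basisAt, Module.Basis.map_apply]
    exact (e.symmL_apply hpe _).symm
  have h5 : ∀ c' : Fin n ⊕ Fin n, (B a : Model n) c' = if c' = a then 1 else 0 := by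
    intro c'
    simp [B]
  simp only [ContinuousLinearMap.coe_coe, ContinuousLinearMap.toLinearMap_sum,
    LinearMap.sum_apply, ContinuousLinearMap.smulRightL_apply_apply, ContinuousLinearMap.smulRight_apply]
  rw [Finset.sum_eq_single a]
  · have h6 : (EuclideanSpace.proj a : Model n →L[ℝ] ℝ) (B a) = 1 := (h5 a).trans (if_pos rfl)
    rw [h6, one_smul]
    refine Eq.trans ?_ (congrFun (Trivialization.coe_linearMapAt_of_mem (R := ℝ) e (b := b p) hpe) (c p (X a (b p))))
    rw [h4]
    rfl
  · intro d _ hd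
    have h6 : (EuclideanSpace.proj d : Model n →L[ℝ] ℝ) (B a) = 0 := (h5 d).trans (if_neg hd)
    rw [h6, zero_smul]
  · simp

end Endomorphisms

/-! ### The pulled back complex structures -/

section Pullback
variable {n : ℕ} {M : Type*} [TopologicalSpace M] [ChartedSpace (Model n) M]
  [IsManifold 𝓘(ℝ, Model n) ∞ M] [T2Space M] {Ω : ∀ x : M, Tan n x →L[ℝ] Tan n x →L[ℝ] ℝ}
  {X : ∀ x : M, Tan n x} {φ : ℝ → M → M} {j : EndField n M}

theorem IsFlow.mfderiv_injective (hφ : IsFlow X φ) (t : ℝ) (x : M) :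
    Function.Injective (dφ (n := n) φ t x) := by
  obtain ⟨e, he⟩ := hφ.mfderiv_isInvertible t x
  rw [← he]
  exact e.injective

theorem IsFlow.mfderiv_pullbackEnd (hφ : IsFlow X φ) (t : ℝ) (x : M) (v : Tan n x) :
    dφ φ t x (pullbackEnd (φ t) j x v) = j (φ t x) (dφ φ t x v) := by
  obtain ⟨e, he⟩ := hφ.mfderiv_isInvertible t x
  have h1 : pullbackEnd (φ t) j x v = e.symm (j (φ t x) (dφ φ t x v)) := by
    change (dφ (n := n) φ t x).inverse (j (φ t x) (dφ φ t x v)) = _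
    generalize j (φ t x) (dφ φ t x v) = w
    rw [← he, ContinuousLinearMap.inverse_equiv]
    rfl
  rw [h1, ← he]
  exact e.apply_symm_apply _

/-- The inverse in the definition of `pullbackEnd` is replaced by the differential of `φ_{-t}`,
whose smooth dependence on `(t, x)` is known. -/
theorem IsFlow.pullbackEnd_eq (hφ : IsFlow X φ) (t : ℝ) (x : M) (v : Tan n x) :
    pullbackEnd (φ t) j x v =
      (show Model n from dφ φ (-t) (φ t x) (j (φ t x) (dφ φ t x v))) := by
  have h1 := hφ.mfderiv_comp (-t) t x (pullbackEnd (φ t) j x v)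
  rw [neg_add_cancel] at h1
  have h2 := (hφ.mfderiv_zero x (pullbackEnd (φ t) j x v)).symm.trans h1
  rw [hφ.mfderiv_pullbackEnd] at h2
  exact h2

theorem IsFlow.pullbackEnd_zero (hφ : IsFlow X φ) : pullbackEnd (φ 0) j = j := by
  have h1 : φ 0 = id := funext hφ.zero
  have h2 : ∀ x, mfderiv 𝓘(ℝ, Model n) 𝓘(ℝ, Model n) (id : M → M) x = ContinuousLinearMap.id ℝ _ :=
    fun x => mfderiv_id
  rw [h1]
  ext1 x
  rw [pullbackEnd, h2 x]
  ext1 v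
  change (ContinuousLinearMap.id ℝ (Tan n x)).inverse (j x v) = _
  rw [ContinuousLinearMap.inverse_id]
  rfl

theorem tangentBundle_mk_eq {x y : M} (h : y = x) {v : Tan n x} {w : Tan n y}
    (hw : (show Model n from w) = v) :
    (⟨y, w⟩ : TangentBundle 𝓘(ℝ, Model n) M) = ⟨x, v⟩ := by
  subst h
  exact congrArg (fun w : Tan n y => (⟨y, w⟩ : TangentBundle 𝓘(ℝ, Model n) M)) hw

/-- The pull-backs of a compatible almost complex structure by a symplectic flow form a smooth curve. -/
theorem IsFlow.isSmoothCurve_pullbackEnd (hφ : IsFlow X φ)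
    (hΩ : ∀ t x v w, Ω (φ t x) (dφ φ t x v) (dφ φ t x w) = Ω x v w) (hj : IsCompatible Ω j) :
    IsSmoothCurve Ω (fun t => pullbackEnd (φ t) j) := by
  have hs : ContMDiff (𝓘(ℝ, ℝ).prod 𝓘(ℝ, Model n))
      (𝓘(ℝ, Model n).prod 𝓘(ℝ, Model n →L[ℝ] Model n)) ∞
      (fun p : ℝ × M => TotalSpace.mk' (Model n →L[ℝ] Model n)
        (E := fun x : M => Tan n x →L[ℝ] Tan n x) p.2 (pullbackEnd (φ p.1) j p.2)) := by
    intro p₀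
    refine contMDiffAt_end_of_apply contMDiffAt_snd fun V hV => ?_
    have h1 : ContMDiffAt (𝓘(ℝ, ℝ).prod 𝓘(ℝ, Model n)) 𝓘(ℝ, Model n).tangent ∞
        (fun p : ℝ × M => (⟨p.2, V p.2⟩ : TangentBundle 𝓘(ℝ, Model n) M)) p₀ :=
      hV.contMDiffAt.comp p₀ contMDiffAt_snd
    have h2 := hφ.contMDiffAt_mfderiv contMDiffAt_fst h1
    have h3 := contMDiffAt_end_apply (b := fun p : ℝ × M => φ p.1 p.2) (c := fun p => j (φ p.1 p.2))
      (hj.smooth.contMDiffAt.comp p₀ (hφ.smooth p₀)) h2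
    have h4 := hφ.contMDiffAt_mfderiv (contMDiffAt_fst (I := 𝓘(ℝ, ℝ)) (J := 𝓘(ℝ, Model n)) (M := ℝ) (N := M)).neg h3
    refine h4.congr_of_eventuallyEq (Filter.Eventually.of_forall fun p => ?_)
    exact (tangentBundle_mk_eq (hφ.neg_apply _ _) (hφ.pullbackEnd_eq _ _ _).symm).symm
  refine ⟨fun t => ⟨hs.comp (contMDiff_const.prodMk contMDiff_id), fun x v => ?_, fun x v w => ?_,
    fun x v hv => ?_⟩, hs⟩
  · apply hφ.mfderiv_injective t x
    rw [hφ.mfderiv_pullbackEnd, hφ.mfderiv_pullbackEnd, hj.sq, map_neg]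
  · rw [← hΩ t, hφ.mfderiv_pullbackEnd, hφ.mfderiv_pullbackEnd, hj.compatible, hΩ]
  · rw [← hΩ t, hφ.mfderiv_pullbackEnd]
    exact hj.positive _ _ fun h => hv (hφ.mfderiv_injective t x (by rw [h, map_zero]))

end Pullback

/-! ### Parallel transport of half-forms along a curve -/

section Curve
variable {n : ℕ} {M : Type*} [TopologicalSpace M] [ChartedSpace (Model n) M]
  [IsManifold 𝓘(ℝ, Model n) ∞ M] [T2Space M] {Ω : ∀ x : M, Tan n x →L[ℝ] Tan n x →L[ℝ] ℝ}
  {δ : M → Type*} [TopologicalSpace (TotalSpace ℂ δ)] [∀ x, AddCommGroup (δ x)]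
  [∀ x, Module ℂ (δ x)] [∀ x, TopologicalSpace (δ x)] [FiberBundle ℂ δ] [VectorBundle ℂ ℂ δ]
  [VectorBundle ℝ ℂ δ] [ContMDiffVectorBundle ∞ ℂ δ 𝓘(ℝ, Model n)]
  (H : HalfFormFamily Ω δ) {c : ℝ → EndField n M}

/-- Evaluated on vector fields where the form of the target structure does not vanish, `kappa` is a
quotient of smooth functions. The two times are independent variables, so that the derivative in one
of them can afterwards be restricted to the diagonal. -/
theorem contMDiff_kappa (hc : IsSmoothCurve Ω c) :
    ContMDiff (𝓘(ℝ, ℝ).prod (𝓘(ℝ, ℝ).prod 𝓘(ℝ, Model n))) 𝓘(ℝ, ℂ) ∞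
      (fun p : ℝ × (ℝ × M) => kappa H (c p.2.1) (c p.1) p.2.2) := by
  rintro ⟨r₀, t₀, x₀⟩
  obtain ⟨e, he, -, he0⟩ := exists_smoothSec_eq_frame (n := n) (E := δ) x₀
  obtain ⟨v, hv⟩ := H.exists_apply_ne_zero (hc.compatible t₀) he0
  choose Y hY hYv using fun i => exists_smoothVF_apply_eq (n := n) x₀ (v i)
  obtain rfl : v = fun i => Y i x₀ := funext fun i => (hYv i).symm
  set J := 𝓘(ℝ, ℝ).prod (𝓘(ℝ, ℝ).prod 𝓘(ℝ, Model n))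
  have hfst : ContMDiff J (𝓘(ℝ, ℝ).prod 𝓘(ℝ, Model n)) ∞ (fun p : ℝ × (ℝ × M) => (p.1, p.2.2)) :=
    contMDiff_fst.prodMk (contMDiff_snd.comp contMDiff_snd)
  have hsnd : ContMDiff J (𝓘(ℝ, ℝ).prod 𝓘(ℝ, Model n)) ∞ (fun p : ℝ × (ℝ × M) => p.2) := contMDiff_snd
  have hx : ContMDiff J 𝓘(ℝ, Model n) ∞ (fun p : ℝ × (ℝ × M) => p.2.2) := contMDiff_snd.comp contMDiff_snd
  have hYs : ∀ i, ContMDiffAt J 𝓘(ℝ, Model n).tangent ∞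
      (fun p : ℝ × (ℝ × M) => (⟨p.2.2, Y i p.2.2⟩ : TangentBundle 𝓘(ℝ, Model n) M)) (r₀, t₀, x₀) :=
    fun i => ((hY i).comp hx) _
  have hB : ContMDiffAt J 𝓘(ℝ, ℂ) ∞ (fun p : ℝ × (ℝ × M) =>
      H.form (c p.2.1) p.2.2 (e p.2.2 ⊗ₜ[ℂ] e p.2.2) (fun i => Y i p.2.2)) (r₀, t₀, x₀) :=
    ((H.smooth c hc e e Y he he hY).comp hsnd) _
  have hA : ContMDiffAt J 𝓘(ℝ, ℂ) ∞ (fun p : ℝ × (ℝ × M) => (1 / 2) ^ n * ∑ S : Finset (Fin n),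
      (-Complex.I) ^ S.card * H.form (c p.1) p.2.2 (e p.2.2 ⊗ₜ[ℂ] e p.2.2)
        (fun i => if i ∈ S then c p.2.1 p.2.2 (Y i p.2.2) else Y i p.2.2)) (r₀, t₀, x₀) := by
    refine ContMDiffAt.cmul contMDiffAt_const (contMDiffAt_finsetSum fun S _ =>
      ContMDiffAt.cmul contMDiffAt_const ?_)
    refine contMDiffAt_form_apply (b := fun p : ℝ × (ℝ × M) => p.2.2)
      (α := fun p => H.form (c p.1) p.2.2 (e p.2.2 ⊗ₜ[ℂ] e p.2.2)) (fun Z hZ =>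
        ((H.smooth c hc e e Z he he hZ).comp hfst) _) (fun i => ?_) (hx.continuous.continuousAt)
    by_cases hi : i ∈ S
    · simp only [hi, if_true]
      exact contMDiffAt_end_apply (b := fun p : ℝ × (ℝ × M) => p.2.2) (c := fun p => c p.2.1 p.2.2)
        ((hc.smooth.comp hsnd) _) (hYs i)
    · simp only [hi, if_false]
      exact hYs i
  refine (ContMDiffAt.cdiv hA hB hv).congr_of_eventuallyEq ?_
  filter_upwards [hB.continuousAt.eventually_ne hv] with p hp
  rw [eq_div_iff hp, ← projN0_form H (hc.compatible _) (hc.compatible _)]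
  rfl

/-- The derivative of the factor `kappa` along a curve, on the diagonal. -/
def kappaDeriv (c : ℝ → EndField n M) (t : ℝ) (x : M) : ℂ := deriv (fun r => kappa H (c t) (c r) x) t

theorem contMDiff_kappaDeriv (hc : IsSmoothCurve Ω c) :
    ContMDiff (𝓘(ℝ, ℝ).prod 𝓘(ℝ, Model n)) 𝓘(ℝ, ℂ) ∞ (fun p : ℝ × M => kappaDeriv H c p.1 p.2) := fun _ =>
  ContMDiffAt.deriv_fst (J := 𝓘(ℝ, ℝ).prod 𝓘(ℝ, Model n)) (F := fun q : ℝ × (ℝ × M) => kappa H (c q.2.1) (c q.1) q.2.2)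
    (g := Prod.fst) (contMDiff_kappa H hc _) contMDiffAt_fst

theorem contMDiff_kappa_right (hc : IsSmoothCurve Ω c) (t : ℝ) :
    ContMDiff (𝓘(ℝ, ℝ).prod 𝓘(ℝ, Model n)) 𝓘(ℝ, ℂ) ∞ (fun p : ℝ × M => kappa H (c t) (c p.1) p.2) :=
  (contMDiff_kappa H hc).comp (contMDiff_fst.prodMk (contMDiff_const.prodMk contMDiff_snd))

theorem hasDerivAt_of_contMDiff {F : ℝ × M → ℂ} (hF : ContMDiff (𝓘(ℝ, ℝ).prod 𝓘(ℝ, Model n)) 𝓘(ℝ, ℂ) ∞ F)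
    (t : ℝ) (x : M) : HasDerivAt (fun s => F (s, x)) (deriv (fun s => F (s, x)) t) t := by
  have h1 : ContMDiff 𝓘(ℝ, ℝ) 𝓘(ℝ, ℂ) ∞ (fun s => F (s, x)) := hF.comp (contMDiff_id.prodMk contMDiff_const)
  exact (h1.contDiff.differentiable (by simp) t).hasDerivAt

theorem hasDerivAt_kappa (hc : IsSmoothCurve Ω c) (t : ℝ) (x : M) :
    HasDerivAt (fun r => kappa H (c t) (c r) x) (kappaDeriv H c t x) t :=
  hasDerivAt_of_contMDiff (contMDiff_kappa_right H hc t) t x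

/-- Existence of the continuous families of half-form bundle morphisms. -/
theorem exists_isMorphism (hc : IsSmoothCurve Ω c) (t : ℝ) : ∃ ψ : ℝ → M → ℂ,
    Continuous (fun p : ℝ × M => ψ p.1 p.2) ∧ (∀ x, ψ t x = 1) ∧
      ∀ r, IsMorphism H (c t) (c r) (ψ r) := by
  set K : ℝ × M → ℂ := fun p => kappa H (c t) (c p.1) p.2 with hK
  have hKs : ContMDiff (𝓘(ℝ, ℝ).prod 𝓘(ℝ, Model n)) 𝓘(ℝ, ℂ) ∞ K := contMDiff_kappa_right H hc t
  have hK0 : ∀ p, K p ≠ 0 := fun p => kappa_ne_zero H (hc.compatible _) (hc.compatible _) _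
  set F : ℝ × M → ℂ := fun p => deriv (fun s => K (s, p.2)) p.1 / K p with hF
  have hFs : ContMDiff (𝓘(ℝ, ℝ).prod 𝓘(ℝ, Model n)) 𝓘(ℝ, ℂ) ∞ F := fun p =>
    ContMDiffAt.cdiv (ContMDiff.deriv_fst' hKs p) (hKs p) (hK0 p)
  have hG := contMDiff_parametric_primitive hFs
  set G : ℝ × M → ℂ := fun p => ∫ s in (0:ℝ)..p.1, F (s, p.2) with hGd
  -- This is `exp (-½ ∫ K' / K)` over the interval from `t` to `r`, the square root of `1 / K`
  -- continued from the value 1 at `r = t`.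
  refine ⟨fun r x => Complex.exp (-(1 / 2) * (G (r, x) - G (t, x))), ?_, fun x => by simp, fun r => ?_⟩
  · have h1 := hG.continuous
    have h2 : Continuous fun p : ℝ × M => G (t, p.2) := h1.comp (continuous_const.prodMk continuous_snd)
    fun_prop
  · rw [isMorphism_iff H (hc.compatible _) (hc.compatible _)]
    intro x
    have hd : ∀ r, HasDerivAt (fun r => Complex.exp (-(1 / 2) * (G (r, x) - G (t, x))) ^ 2 * K (r, x)) 0 r := by
      intro r
      have h1 : HasDerivAt (fun r => G (r, x)) (F (r, x)) r := by
        have hcx : Continuous (fun s => F (s, x)) := hFs.continuous.comp (Continuous.prodMk_left x)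
        exact (hcx.integral_hasStrictDerivAt 0 r).hasDerivAt
      have h2 := ((h1.sub_const (G (t, x))).const_mul (-(1 / 2) : ℂ)).cexp
      refine ((h2.fun_pow 2).mul (hasDerivAt_of_contMDiff hKs r x)).congr_deriv ?_
      have h3 : deriv (fun s => K (s, x)) r = F (r, x) * K (r, x) := by
        rw [hF]
        field_simp [hK0]
      rw [h3]
      push_cast
      ring
    have h2 := is_const_of_deriv_eq_zero (fun r => (hd r).differentiableAt) (fun r => (hd r).deriv) r t
    refine h2.trans ?_
    simp [hK, kappa_self H (hc.compatible t)]

/-- A continuous family of half-form bundle morphisms starting at the identity is differentiable. -/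
theorem hasDerivAt_isMorphism (hc : IsSmoothCurve Ω c) {t : ℝ} {ψ : ℝ → M → ℂ}
    (hψ : Continuous (fun p : ℝ × M => ψ p.1 p.2)) (h1 : ∀ x, ψ t x = 1)
    (hm : ∀ r, IsMorphism H (c t) (c r) (ψ r)) (x : M) :
    HasDerivAt (fun r => ψ r x) (-(kappaDeriv H c t x / 2)) t := by
  -- The square is the inverse of `kappa`, hence smooth in `r`; continuity of `ψ` then makes `ψ`
  -- itself differentiable.
  have hsq : ∀ r, ψ r x ^ 2 = (kappa H (c t) (c r) x)⁻¹ := fun r =>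
    eq_inv_of_mul_eq_one_left ((isMorphism_iff H (hc.compatible _) (hc.compatible _)).1 (hm r) x)
  have hk := hasDerivAt_kappa H hc t x
  have hs : ContMDiffAt 𝓘(ℝ, ℝ) 𝓘(ℝ, ℂ) ∞ (fun r => ψ r x) t := by
    refine contMDiffAt_of_sq (hψ.comp (Continuous.prodMk_left x)).continuousAt (by rw [h1]; exact one_ne_zero) ?_
    simp only [hsq]
    exact ContMDiffAt.cinv ((contMDiff_kappa_right H hc t).comp (contMDiff_id.prodMk contMDiff_const) t)
      (kappa_ne_zero H (hc.compatible _) (hc.compatible _) _)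
  have hd : HasDerivAt (fun r => ψ r x) (deriv (fun r => ψ r x) t) t :=
    ((contMDiffAt_iff_contDiffAt.1 hs).differentiableAt (by simp)).hasDerivAt
  have h2 := hd.pow 2
  have h3 : HasDerivAt (fun r => ψ r x ^ 2) (-kappaDeriv H c t x) t := by
    simp only [hsq]
    refine (hk.fun_inv (kappa_ne_zero H (hc.compatible _) (hc.compatible _) _)).congr_deriv ?_
    rw [kappa_self H (hc.compatible t)]
    simp
  have h4 := h2.unique h3
  rw [h1] at h4
  refine hd.congr_deriv ?_
  norm_num at h4
  linear_combination h4 / 2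

/-- The solution of `m' = -m kappaDeriv / 2`, `m_0 = 1`. -/
def transportFactor (c : ℝ → EndField n M) (t : ℝ) (x : M) : ℂ :=
  Complex.exp (∫ s in (0:ℝ)..t, -(kappaDeriv H c s x / 2))

theorem transportFactor_ne_zero (t : ℝ) (x : M) : transportFactor H c t x ≠ 0 := Complex.exp_ne_zero _

theorem transportFactor_zero (x : M) : transportFactor H c 0 x = 1 := by simp [transportFactor]

theorem contMDiff_transportFactor (hc : IsSmoothCurve Ω c) :
    ContMDiff (𝓘(ℝ, ℝ).prod 𝓘(ℝ, Model n)) 𝓘(ℝ, ℂ) ∞ (fun p : ℝ × M => transportFactor H c p.1 p.2) := fun p =>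
  ContMDiffAt.cexp' (contMDiff_parametric_primitive (F := fun p : ℝ × M => -(kappaDeriv H c p.1 p.2 / 2))
    (fun q => (ContMDiffAt.cdiv (contMDiff_kappaDeriv H hc q) contMDiffAt_const two_ne_zero).neg) p)

theorem hasDerivAt_transportFactor (hc : IsSmoothCurve Ω c) (t : ℝ) (x : M) :
    HasDerivAt (fun t => transportFactor H c t x) (-(kappaDeriv H c t x / 2) * transportFactor H c t x) t := by
  have hcx : Continuous (fun s => -(kappaDeriv H c s x / 2)) :=
    (((contMDiff_kappaDeriv H hc).continuous.comp (Continuous.prodMk_left x)).div_const 2).neg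
  exact ((hcx.integral_hasStrictDerivAt 0 t).hasDerivAt.cexp).congr_deriv (mul_comm _ _)

end Curve

/-! ### Parallel transport of the prequantum spaces -/

section TransportP
variable {n : ℕ} {M : Type*} [TopologicalSpace M] [ChartedSpace (Model n) M]
  [IsManifold 𝓘(ℝ, Model n) ∞ M] [T2Space M] {Ω : ∀ x : M, Tan n x →L[ℝ] Tan n x →L[ℝ] ℝ}
  {L : M → Type*} [TopologicalSpace (TotalSpace ℂ L)] [∀ x, NormedAddCommGroup (L x)]
  [∀ x, InnerProductSpace ℂ (L x)] [FiberBundle ℂ L] [VectorBundle ℂ ℂ L]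
  {δ : M → Type*} [TopologicalSpace (TotalSpace ℂ δ)] [∀ x, AddCommGroup (δ x)]
  [∀ x, Module ℂ (δ x)] [∀ x, TopologicalSpace (δ x)] [FiberBundle ℂ δ] [VectorBundle ℂ ℂ δ]
  [VectorBundle ℝ ℂ δ] [ContMDiffVectorBundle ∞ ℂ δ 𝓘(ℝ, Model n)]
  (H : HalfFormFamily Ω δ) {c : ℝ → EndField n M} {k : ℕ}

theorem HasTimeDeriv.smul {g : ℝ → M → ℂ} {g' : M → ℂ} {s : ℝ → Sec L δ k} {s' : Sec L δ k} {t : ℝ}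
    (hg : ∀ x, HasDerivAt (fun r => g r x) (g' x) t) (hs : HasTimeDeriv s s' t) :
    HasTimeDeriv (fun r x => g r x • s r x) (fun x => g t x • s' x + g' x • s t x) t := by
  intro x l
  simp only [map_smul, map_add, smul_eq_mul]
  refine ((hg x).mul (hs x l)).congr_deriv ?_
  ring

/-- The covariant derivative in terms of the time derivative. -/
theorem hasCovDerivP_iff (hc : IsSmoothCurve Ω c) {s : ℝ → Sec L δ k} {w : Sec L δ k} {t : ℝ} :
    HasCovDerivP H c s w t ↔ HasTimeDeriv s (fun x => w x - (kappaDeriv H c t x / 2) • s t x) t := by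
  constructor
  · rintro ⟨ψ, hψ, h1, hm, hd⟩
    have h2 := HasTimeDeriv.smul (hasDerivAt_isMorphism H hc hψ h1 hm) hd
    have h0 : ∀ r x, ψ r x ≠ 0 := fun r x h => by
      have := (isMorphism_iff H (hc.compatible _) (hc.compatible _)).1 (hm r) x
      rw [h] at this
      simp at this
    convert h2 using 1
    · ext r x
      rw [smul_inv_smul₀ (h0 r x)]
    · ext x
      rw [h1, inv_one, one_smul, one_smul]
      module
  · intro h
    obtain ⟨ψ, hψ, h1, hm⟩ := exists_isMorphism H hc t
    refine ⟨ψ, hψ, h1, hm, ?_⟩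
    have h0 : ∀ r x, ψ r x ≠ 0 := fun r x h => by
      have := (isMorphism_iff H (hc.compatible _) (hc.compatible _)).1 (hm r) x
      rw [h] at this
      simp at this
    have h2 := HasTimeDeriv.smul (fun x => (hasDerivAt_isMorphism H hc hψ h1 hm x).fun_inv (h0 t x)) h
    convert h2 using 1
    ext x
    rw [h1, inv_one, one_smul]
    simp

theorem smoothFamilyOn_smul {g : ℝ → M → ℂ} {s₀ : Sec L δ k}
    (hg : ContMDiff (𝓘(ℝ, ℝ).prod 𝓘(ℝ, Model n)) 𝓘(ℝ, ℂ) ∞ (fun p : ℝ × M => g p.1 p.2))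
    (hs : s₀ ∈ preQ n L δ k) : SmoothFamilyOn (n := n) univ (fun t x => g t x • s₀ x) := by
  intro t₀ _ x₀
  simp only [map_smul, smul_eq_mul]
  exact ContMDiffAt.cmul (hg _) (ContMDiffAt.comp (t₀, x₀)
    (g := fun x => coef k x₀ x (s₀ x)) (f := fun p : ℝ × M => p.2) (hs x₀) contMDiffAt_snd)

theorem smul_mem_preQ {g : M → ℂ} {s₀ : Sec L δ k} (hg : ContMDiff 𝓘(ℝ, Model n) 𝓘(ℝ, ℂ) ∞ g)
    (hs : s₀ ∈ preQ n L δ k) : (fun x => g x • s₀ x) ∈ preQ n L δ k := by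
  intro x₀
  simp only [map_smul, smul_eq_mul]
  exact ContMDiffAt.cmul (hg x₀) (hs x₀)

theorem contMDiff_transportFactor_right (hc : IsSmoothCurve Ω c) (t : ℝ) :
    ContMDiff 𝓘(ℝ, Model n) 𝓘(ℝ, ℂ) ∞ (fun x : M => transportFactor H c t x) :=
  ContMDiff.comp (g := fun p : ℝ × M => transportFactor H c p.1 p.2) (f := fun x => (t, x))
    (contMDiff_transportFactor H hc) (contMDiff_const.prodMk contMDiff_id)

theorem isParallelP_transportFactor (hc : IsSmoothCurve Ω c) {s₀ : Sec L δ k} (hs : s₀ ∈ preQ n L δ k) :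
    IsParallelP H c (fun t x => transportFactor H c t x • s₀ x) := by
  refine ⟨smoothFamilyOn_smul (contMDiff_transportFactor H hc) hs, fun t => ?_⟩
  rw [hasCovDerivP_iff H hc]
  refine hasTimeDeriv_of_smul fun x => ⟨s₀ x, _, _, hasDerivAt_transportFactor H hc t x,
    Filter.Eventually.of_forall fun r => rfl, ?_⟩
  simp only [Pi.zero_apply]
  module

/-- After division by the transport factor a parallel section has zero time derivative. This is the
uniqueness of parallel transport. -/
theorem IsParallelP.eq_transportFactor_smul (hc : IsSmoothCurve Ω c) {s : ℝ → Sec L δ k}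
    (hs : IsParallelP H c s) (t : ℝ) : s t = fun x => transportFactor H c t x • s 0 x := by
  have hd : ∀ t, HasTimeDeriv (fun r x => (transportFactor H c r x)⁻¹ • s r x) 0 t := by
    intro t
    have h1 := HasTimeDeriv.smul (fun x => (hasDerivAt_transportFactor H hc t x).fun_inv
      (transportFactor_ne_zero H t x)) ((hasCovDerivP_iff H hc).1 (hs.2 t))
    convert h1 using 1
    ext x
    have := transportFactor_ne_zero H (c := c) t x
    simp only [Pi.zero_apply, zero_sub, smul_neg, smul_smul, ← neg_smul, ← add_smul]
    refine (zero_smul ℂ (s t x)).symm.trans ?_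
    congr 1
    field_simp
    ring
  ext x
  apply coef_injective (k := k) (mem_dom x) (mem_dom x)
  have h2 := is_const_of_deriv_eq_zero (fun t => ((hd t).coef x x).differentiableAt)
    (fun t => by rw [((hd t).coef x x).deriv]; simp) t 0
  simp only [transportFactor_zero, inv_one, map_smul, smul_eq_mul, one_mul] at h2 ⊢
  rw [← h2, mul_inv_cancel_left₀ (transportFactor_ne_zero H t x)]

/-- Existence and uniqueness of the parallel transport of the prequantum spaces. -/
theorem exists_isParallelTransportP (hc : IsSmoothCurve Ω c) :
    ∃ T : ∀ _ : ℝ, preQ n L δ k ≃ preQ n L δ k,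
      IsParallelTransport (fun _ => preQ n L δ k) (IsParallelP H c) T ∧
      (∀ T', IsParallelTransport (fun _ => preQ n L δ k) (IsParallelP H c) T' → T' = T) ∧
      ∀ t (s : preQ n L δ k), (T t s : Sec L δ k) = fun x => transportFactor H c t x • (s : Sec L δ k) x := by
  refine ⟨fun t =>
    { toFun := fun s => ⟨_, smul_mem_preQ (contMDiff_transportFactor_right H hc t) s.2⟩
      invFun := fun s => ⟨_, smul_mem_preQ (g := fun x => (transportFactor H c t x)⁻¹) (fun x =>
        ContMDiffAt.cinv (contMDiff_transportFactor_right H hc t x) (transportFactor_ne_zero H t x)) s.2⟩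
      left_inv := fun s => Subtype.ext (funext fun x => inv_smul_smul₀ (transportFactor_ne_zero H t x) _)
      right_inv := fun s => Subtype.ext (funext fun x => smul_inv_smul₀ (transportFactor_ne_zero H t x) _) },
    fun s₀ => ⟨isParallelP_transportFactor H hc s₀.2, ?_⟩, fun T' hT' => ?_, fun t s => rfl⟩
  · ext x
    simp [transportFactor_zero]
  · ext t s : 3
    have h1 := (hT' s).1.eq_transportFactor_smul H hc t
    simp only [(hT' s).2] at h1
    exact h1

end TransportP

theorem end_transport {n : ℕ} {M : Type*} [TopologicalSpace M] [ChartedSpace (Model n) M]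
    {j : EndField n M} {x y : M} (h : y = x) {v : Tan n x} {w : Tan n y}
    (hw : (show Model n from w) = v) : (show Model n from j y w) = j x v := by
  subst h
  exact congrArg (fun w : Tan n y => (show Model n from j y w)) hw

theorem SmoothSecOn.atPoint {n : ℕ} {M : Type*} [TopologicalSpace M] [ChartedSpace (Model n) M]
    {E : M → Type*} [TopologicalSpace (TotalSpace ℂ E)] [∀ x, TopologicalSpace (E x)] [FiberBundle ℂ E]
    {s : ∀ x, E x} (hs : SmoothSecOn (n := n) E univ s) (x : M) :
    ContMDiffAt 𝓘(ℝ, Model n) (𝓘(ℝ, Model n).prod 𝓘(ℝ, ℂ)) ∞ (fun x => TotalSpace.mk' ℂ x (s x)) x :=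
  (hs x (mem_univ x)).contMDiffAt Filter.univ_mem

/-! ### The lift of the flow to the half-form bundle -/

section Lift
variable {n : ℕ} {M : Type*} [TopologicalSpace M] [ChartedSpace (Model n) M]
  [IsManifold 𝓘(ℝ, Model n) ∞ M] [T2Space M] {Ω : ∀ x : M, Tan n x →L[ℝ] Tan n x →L[ℝ] ℝ}
  {δ : M → Type*} [TopologicalSpace (TotalSpace ℂ δ)] [∀ x, AddCommGroup (δ x)]
  [∀ x, Module ℂ (δ x)] [∀ x, TopologicalSpace (δ x)] [FiberBundle ℂ δ] [VectorBundle ℂ ℂ δ]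
  [VectorBundle ℝ ℂ δ] [ContMDiffVectorBundle ∞ ℂ δ 𝓘(ℝ, Model n)]
  {H : HalfFormFamily Ω δ} {X : ∀ x : M, Tan n x} {φ : ℝ → M → M} {j₀ : EndField n M}
  {θ : ∀ t x, δ (φ t x) →ₗ[ℂ] δ x}

theorem IsCompatible.isSmoothCurve_const (hj : IsCompatible Ω j₀) : IsSmoothCurve Ω (fun _ => j₀) :=
  ⟨fun _ => hj, hj.smooth.comp contMDiff_snd⟩

theorem IsHalfFormLift.continuousAt_lcoord (hθ : IsHalfFormLift H φ j₀ θ) {u : ∀ x, δ x}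
    (hu : SmoothSecOn (n := n) δ univ u) (p₀ : ℝ × M) :
    ContinuousAt (fun p : ℝ × M => lcoord δ p₀.2 p.2 (θ p.1 p.2 (u (φ p.1 p.2)))) p₀ := by
  have h1 := ((FiberBundle.continuousAt_totalSpace ℂ _).1 ((hθ.continuous u hu).continuousAt (x := p₀))).2
  refine h1.congr ?_
  filter_upwards [(continuous_snd.continuousAt (x := p₀)).eventually (dom_mem_nhds (E := δ) p₀.2)] with p hp
  exact (lcoord_apply hp _).symm

/-- In local frames the lift of the flow is the multiplication by a smooth function. -/
theorem IsHalfFormLift.exists_smul_frame (hφ : IsFlow X φ)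
    (hΩ : ∀ t x v w, Ω (φ t x) (dφ φ t x v) (dφ φ t x w) = Ω x v w) (hj : IsCompatible Ω j₀)
    (hθ : IsHalfFormLift H φ j₀ θ) {u e : ∀ x, δ x} (hu : SmoothSecOn (n := n) δ univ u)
    (he : SmoothSecOn (n := n) δ univ e) {t₁ : ℝ} {x₁ : M} (hu0 : u (φ t₁ x₁) ≠ 0) (he0 : e x₁ ≠ 0) :
    ∃ q : ℝ × M → ℂ, ContMDiffAt (𝓘(ℝ, ℝ).prod 𝓘(ℝ, Model n)) 𝓘(ℝ, ℂ) ∞ q (t₁, x₁) ∧ q (t₁, x₁) ≠ 0 ∧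
      ∀ᶠ p in 𝓝 (t₁, x₁), θ p.1 p.2 (u (φ p.1 p.2)) = q p • e p.2 := by
  have hc := hφ.isSmoothCurve_pullbackEnd hΩ hj
  set q : ℝ × M → ℂ := fun p => lcoord δ x₁ p.2 (θ p.1 p.2 (u (φ p.1 p.2))) / lcoord δ x₁ p.2 (e p.2) with hq
  have hsnd : Filter.Tendsto (fun p : ℝ × M => p.2) (𝓝 (t₁, x₁)) (𝓝 x₁) :=
    continuous_snd.continuousAt (x := (t₁, x₁))
  have hqe : ∀ᶠ p in 𝓝 (t₁, x₁), θ p.1 p.2 (u (φ p.1 p.2)) = q p • e p.2 := by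
    filter_upwards [hsnd.eventually (dom_mem_nhds (E := δ) x₁),
      hsnd.eventually (SmoothSecAt.eventually_ne_zero (he.atPoint x₁) he0)] with p hp hpe
    apply lcoord_injective hp
    rw [map_smul, smul_eq_mul, div_mul_cancel₀ _ (lcoord_ne_zero hp hpe)]
  have hle : ContMDiffAt (𝓘(ℝ, ℝ).prod 𝓘(ℝ, Model n)) 𝓘(ℝ, ℂ) ∞ (fun p : ℝ × M => lcoord δ x₁ p.2 (e p.2)) (t₁, x₁) :=
    ContMDiffAt.comp (t₁, x₁) (g := fun x => lcoord δ x₁ x (e x)) (f := fun p : ℝ × M => p.2)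
      ((smoothSecAt_iff (mem_dom x₁)).1 (he.atPoint x₁)) contMDiffAt_snd
  have hqc : ContinuousAt q (t₁, x₁) :=
    (hθ.continuousAt_lcoord hu (t₁, x₁)).div hle.continuousAt (lcoord_ne_zero (mem_dom x₁) he0)
  -- The lift is only known to be continuous, but its square is a pull-back of forms: this
  -- determines `q ^ 2` as a quotient of smooth functions, and `contMDiffAt_of_sq` applies.
  have hsq : ∀ p : ℝ × M, θ p.1 p.2 (u (φ p.1 p.2)) = q p • e p.2 → ∀ v,
      q p ^ 2 * H.form (pullbackEnd (φ p.1) j₀) p.2 (e p.2 ⊗ₜ[ℂ] e p.2) v =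
      H.form j₀ (φ p.1 p.2) (u (φ p.1 p.2) ⊗ₜ[ℂ] u (φ p.1 p.2)) (fun i => dφ φ p.1 p.2 (v i)) := by
    intro p hp v
    rw [← hθ.square p.1 p.2 (u (φ p.1 p.2)) v, hp, TensorProduct.smul_tmul_smul, map_smul,
      ContinuousAlternatingMap.smul_apply, smul_eq_mul]
    ring
  obtain ⟨v, hv⟩ := H.exists_apply_ne_zero (hc.compatible t₁) he0
  choose Y hY hYv using fun i => exists_smoothVF_apply_eq (n := n) x₁ (v i)
  obtain rfl : v = fun i => Y i x₁ := funext fun i => (hYv i).symm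
  have hB := H.smooth _ hc e e Y he he hY (t₁, x₁)
  have hA : ContMDiffAt (𝓘(ℝ, ℝ).prod 𝓘(ℝ, Model n)) 𝓘(ℝ, ℂ) ∞ (fun p : ℝ × M =>
      H.form j₀ (φ p.1 p.2) (u (φ p.1 p.2) ⊗ₜ[ℂ] u (φ p.1 p.2)) (fun i => dφ φ p.1 p.2 (Y i p.2))) (t₁, x₁) := by
    refine contMDiffAt_form_apply (b := fun p : ℝ × M => φ p.1 p.2)
      (α := fun p => H.form j₀ (φ p.1 p.2) (u (φ p.1 p.2) ⊗ₜ[ℂ] u (φ p.1 p.2))) (fun Z hZ => ?_) (fun i => ?_)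
      hφ.continuous.continuousAt
    · exact ContMDiffAt.comp (t₁, x₁) (f := fun p : ℝ × M => ((0 : ℝ), φ p.1 p.2))
        (g := fun p : ℝ × M => H.form j₀ p.2 (u p.2 ⊗ₜ[ℂ] u p.2) (fun i => Z i p.2))
        (H.smooth _ hj.isSmoothCurve_const u u Z hu hu hZ _) (contMDiffAt_const.prodMk (hφ.smooth _))
    · exact hφ.contMDiffAt_mfderiv contMDiffAt_fst (((hY i) x₁).comp (t₁, x₁) contMDiffAt_snd)
  have hq0 : q (t₁, x₁) ≠ 0 := by
    intro h0
    obtain ⟨w, hw⟩ := H.exists_apply_ne_zero hj hu0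
    obtain ⟨E, hE⟩ := hφ.mfderiv_isInvertible t₁ x₁
    have h1 := hsq _ hqe.self_of_nhds (fun i => E.symm (w i))
    rw [h0, ← hE] at h1
    simp only [ContinuousLinearEquiv.coe_coe, ContinuousLinearEquiv.apply_symm_apply] at h1
    exact hw (h1.symm.trans (by simp))
  refine ⟨q, contMDiffAt_of_sq hqc hq0 ((ContMDiffAt.cdiv hA hB hv).congr_of_eventuallyEq ?_), hq0, hqe⟩
  filter_upwards [hqe, hB.continuousAt.eventually_ne hv] with p hp hp0
  rw [eq_div_iff hp0]
  exact hsq p hp _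

/-- The lift of the flow is smooth. -/
theorem IsHalfFormLift.contMDiffAt_lcoord (hφ : IsFlow X φ)
    (hΩ : ∀ t x v w, Ω (φ t x) (dφ φ t x v) (dφ φ t x w) = Ω x v w) (hj : IsCompatible Ω j₀)
    (hθ : IsHalfFormLift H φ j₀ θ) {u : ∀ x, δ x} (hu : SmoothSecOn (n := n) δ univ u)
    {t₁ : ℝ} {x₁ x₂ : M} (hx : x₁ ∈ dom δ x₂) :
    ContMDiffAt (𝓘(ℝ, ℝ).prod 𝓘(ℝ, Model n)) 𝓘(ℝ, ℂ) ∞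
      (fun p : ℝ × M => lcoord δ x₂ p.2 (θ p.1 p.2 (u (φ p.1 p.2)))) (t₁, x₁) := by
  obtain ⟨e, he, -, he0⟩ := exists_smoothSec_eq_frame (n := n) (E := δ) x₁
  obtain ⟨u', hu', -, hu0⟩ := exists_smoothSec_eq_frame (n := n) (E := δ) (φ t₁ x₁)
  obtain ⟨g, hg, hge⟩ := exists_eventually_eq_smul (hu'.atPoint (φ t₁ x₁)) hu0 (hu.atPoint (φ t₁ x₁))
  obtain ⟨q, hq, -, hqe⟩ := hθ.exists_smul_frame hφ hΩ hj hu' he hu0 he0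
  have hle : ContMDiffAt (𝓘(ℝ, ℝ).prod 𝓘(ℝ, Model n)) 𝓘(ℝ, ℂ) ∞ (fun p : ℝ × M => lcoord δ x₂ p.2 (e p.2)) (t₁, x₁) :=
    ContMDiffAt.comp (t₁, x₁) (g := fun x => lcoord δ x₂ x (e x)) (f := fun p : ℝ × M => p.2)
      ((smoothSecAt_iff hx).1 (he.atPoint x₁)) contMDiffAt_snd
  refine (ContMDiffAt.cmul (ContMDiffAt.comp (t₁, x₁) (f := fun p : ℝ × M => φ p.1 p.2) hg (hφ.smooth _))
    (ContMDiffAt.cmul hq hle)).congr_of_eventuallyEq ?_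
  filter_upwards [hqe, (hφ.continuous.continuousAt (x := (t₁, x₁))).eventually hge] with p hp hpg
  rw [hpg, map_smul, hp, map_smul, map_smul]
  rfl


/-! ### The group law -/

/-- The structure at time `r + s` is the pull-back by `φ s` of the one at time `r`, because `φ (r +
s)` is `φ r` after `φ s`. -/
theorem IsFlow.mfderiv_pullbackEnd_add (hφ : IsFlow X φ) (r s : ℝ) (x : M) (v : Tan n x) :
    dφ φ s x (pullbackEnd (φ (r + s)) j₀ x v) = pullbackEnd (φ r) j₀ (φ s x) (dφ φ s x v) := by
  apply hφ.mfderiv_injective r (φ s x)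
  rw [hφ.mfderiv_pullbackEnd]
  have h1 := (hφ.mfderiv_comp r s x (pullbackEnd (φ (r + s)) j₀ x v)).symm
  refine h1.trans ?_
  rw [hφ.mfderiv_pullbackEnd]
  exact end_transport (hφ.add r s x) (hφ.mfderiv_comp r s x v)

theorem mem_Lam_comp (hφ : IsFlow X φ) (r s : ℝ) (x : M) {α : NForm n (φ s x)}
    (hα : α ∈ Lam (pullbackEnd (φ r) j₀) (φ s x)) :
    α.compContinuousLinearMap (dφ φ s x) ∈ Lam (pullbackEnd (φ (r + s)) j₀) x := by
  intro v i
  have h1 := hα (fun l => dφ φ s x (v l)) i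
  refine Eq.trans (congrArg α (funext fun l => ?_)) h1
  by_cases hl : l = i
  · subst hl
    simp only [Function.update_self]
    exact hφ.mfderiv_pullbackEnd_add r s x (v l)
  · simp [hl]

theorem differentiable_form {c : ℝ → EndField n M} (hc : IsSmoothCurve Ω c) (y : M) (w : δ y)
    (v : Fin n → Tan n y) : Differentiable ℝ (fun r => H.form (c r) y (w ⊗ₜ[ℂ] w) v) := by
  choose Y hY hYv using fun i => exists_smoothVF_apply_eq (n := n) y (v i)
  obtain rfl : v = fun i => Y i y := funext fun i => (hYv i).symm
  obtain ⟨e, he, -, he0⟩ := exists_smoothSec_eq_frame (n := n) (E := δ) y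
  obtain ⟨a, rfl⟩ := exists_eq_smul he0 w
  have h3 := (H.smooth _ hc e e Y he he hY).comp (contMDiff_id.prodMk (contMDiff_const (c := y)))
  have h4 := (h3.contDiff.differentiable (by simp)).const_mul (a * a)
  simp only [TensorProduct.smul_tmul_smul, map_smul]
  exact h4

/-- The factor between the pull-back by `φ_s` of the half-forms at time `r` and the half-forms at
time `r + s`. -/
theorem exists_naturality (hφ : IsFlow X φ)
    (hΩ : ∀ t x v w, Ω (φ t x) (dφ φ t x v) (dφ φ t x w) = Ω x v w) (hj : IsCompatible Ω j₀)
    (s : ℝ) (x : M) {w : δ (φ s x)} {w' : δ x} (hw : w ≠ 0) (hw' : w' ≠ 0) :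
    ∃ B : ℝ → ℂ, (∀ r, B r ≠ 0) ∧ Differentiable ℝ B ∧ ∀ r v,
      H.form (pullbackEnd (φ r) j₀) (φ s x) (w ⊗ₜ[ℂ] w) (fun i => dφ φ s x (v i)) =
        B r * H.form (pullbackEnd (φ (r + s)) j₀) x (w' ⊗ₜ[ℂ] w') v := by
  have hc := hφ.isSmoothCurve_pullbackEnd hΩ hj
  have h1 : ∀ r, ∃ b : ℂ, (H.form (pullbackEnd (φ r) j₀) (φ s x) (w ⊗ₜ[ℂ] w)).compContinuousLinearMap (dφ φ s x) =
      b • H.form (pullbackEnd (φ (r + s)) j₀) x (w' ⊗ₜ[ℂ] w') := fun r =>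
    H.exists_eq_mul (hc.compatible (r + s)) hw' (mem_Lam_comp hφ r s x (H.mem_Lam (hc.compatible r) _ _))
  choose B hB using h1
  have hB' : ∀ r v, H.form (pullbackEnd (φ r) j₀) (φ s x) (w ⊗ₜ[ℂ] w) (fun i => dφ φ s x (v i)) =
        B r * H.form (pullbackEnd (φ (r + s)) j₀) x (w' ⊗ₜ[ℂ] w') v := fun r v =>
    congrArg (fun η : NForm n x => η v) (hB r)
  refine ⟨B, fun r h0 => ?_, fun r => ?_, hB'⟩
  · obtain ⟨v, hv⟩ := H.exists_apply_ne_zero (hc.compatible r) hw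
    obtain ⟨E, hE⟩ := hφ.mfderiv_isInvertible s x
    have h1 := hB' r (fun i => E.symm (v i))
    rw [h0, ← hE] at h1
    simp only [ContinuousLinearEquiv.coe_coe, ContinuousLinearEquiv.apply_symm_apply, zero_mul] at h1
    exact hv h1
  · obtain ⟨v, hv⟩ := H.exists_apply_ne_zero (hc.compatible (r + s)) hw'
    have h2 : ∀ (y : M) (w : δ y) (v : Fin n → Tan n y),
        Differentiable ℝ (fun r => H.form (pullbackEnd (φ r) j₀) y (w ⊗ₜ[ℂ] w) v) := fun y w v =>
      differentiable_form hc y w v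
    have h3 := (h2 (φ s x) w (fun i => dφ φ s x (v i)) r).div
      (((h2 x w' v).comp (differentiable_id.add_const s)) r) hv
    refine h3.congr_of_eventuallyEq ?_
    have hev : ∀ᶠ r in 𝓝 r, H.form (pullbackEnd (φ (r + s)) j₀) x (w' ⊗ₜ[ℂ] w') v ≠ 0 :=
      (((h2 x w' v).comp (differentiable_id.add_const s)).continuous.continuousAt (x := r)).eventually_ne hv
    filter_upwards [hev] with r hr
    exact (eq_div_iff hr).2 (hB' r v).symm

/-- The differential of `φ s` intertwines the structures at times `t + s` and `t`, so the pull-back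
by `φ s` commutes with the projections to (n, 0)-forms. Comparing the two orders gives the relation.
-/
theorem kappa_naturality (hφ : IsFlow X φ)
    (hΩ : ∀ t x v w, Ω (φ t x) (dφ φ t x v) (dφ φ t x w) = Ω x v w) (hj : IsCompatible Ω j₀)
    {s : ℝ} {x : M} {w : δ (φ s x)} {w' : δ x} (hw' : w' ≠ 0) {B : ℝ → ℂ} (hB : ∀ r v,
      H.form (pullbackEnd (φ r) j₀) (φ s x) (w ⊗ₜ[ℂ] w) (fun i => dφ φ s x (v i)) =
        B r * H.form (pullbackEnd (φ (r + s)) j₀) x (w' ⊗ₜ[ℂ] w') v) (t r : ℝ) :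
    B r * kappa H (pullbackEnd (φ (t + s)) j₀) (pullbackEnd (φ (r + s)) j₀) x =
      kappa H (pullbackEnd (φ t) j₀) (pullbackEnd (φ r) j₀) (φ s x) * B t := by
  have hc := hφ.isSmoothCurve_pullbackEnd hΩ hj
  obtain ⟨v, hv⟩ := H.exists_apply_ne_zero (hc.compatible (t + s)) hw'
  apply mul_right_cancel₀ hv
  have h1 := projN0_form H (hc.compatible (t + s)) (hc.compatible (r + s)) x (w' ⊗ₜ[ℂ] w') v
  have h2 := projN0_form H (hc.compatible t) (hc.compatible r) (φ s x) (w ⊗ₜ[ℂ] w) (fun i => dφ φ s x (v i))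
  rw [mul_assoc, ← h1, mul_assoc, ← hB, ← h2]
  simp only [projN0]
  rw [mul_left_comm, Finset.mul_sum]
  congr 1
  refine Finset.sum_congr rfl fun S _ => ?_
  rw [mul_left_comm, ← hB]
  congr 2
  ext1 i
  split_ifs
  · exact hφ.mfderiv_pullbackEnd_add t s x (v i)
  · rfl

/-- Differentiating `kappa_naturality` on the diagonal expresses `B' / B` by the values of
`kappaDeriv` at `φ s x` and at `x`. As functions of `r` the two sides then have the same logarithmic
derivative, and they agree at `r = 0`. Squares are needed because only squares of half-forms are
forms. -/
theorem transportFactor_sq_naturality (hφ : IsFlow X φ)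
    (hΩ : ∀ t x v w, Ω (φ t x) (dφ φ t x v) (dφ φ t x w) = Ω x v w) (hj : IsCompatible Ω j₀)
    {s : ℝ} {x : M} {w : δ (φ s x)} {w' : δ x} (hw' : w' ≠ 0) {B : ℝ → ℂ} (hB0 : ∀ r, B r ≠ 0)
    (hBd : Differentiable ℝ B) (hB : ∀ r v,
      H.form (pullbackEnd (φ r) j₀) (φ s x) (w ⊗ₜ[ℂ] w) (fun i => dφ φ s x (v i)) =
        B r * H.form (pullbackEnd (φ (r + s)) j₀) x (w' ⊗ₜ[ℂ] w') v) (r : ℝ) :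
    transportFactor H (fun t => pullbackEnd (φ t) j₀) (r + s) x ^ 2 * B 0 =
      transportFactor H (fun t => pullbackEnd (φ t) j₀) s x ^ 2 *
        transportFactor H (fun t => pullbackEnd (φ t) j₀) r (φ s x) ^ 2 * B r := by
  set c := fun t => pullbackEnd (φ t) j₀ with hcd
  have hc : IsSmoothCurve Ω c := hφ.isSmoothCurve_pullbackEnd hΩ hj
  have hk : ∀ t, deriv B t + B t * kappaDeriv H c (t + s) x = kappaDeriv H c t (φ s x) * B t := by
    intro t
    have h1 := ((hBd t).hasDerivAt).mul ((hasDerivAt_kappa H hc (t + s) x).comp_add_const t s)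
    have h2 := (hasDerivAt_kappa H hc t (φ s x)).mul_const (B t)
    have h3 := h1.unique (h2.congr_of_eventuallyEq (Filter.Eventually.of_forall fun r =>
      kappa_naturality hφ hΩ hj hw' hB t r))
    rw [kappa_self H (hc.compatible _), mul_one] at h3
    exact h3
  have hd : ∀ r, HasDerivAt (fun r => transportFactor H c (r + s) x ^ 2 *
      (transportFactor H c r (φ s x) ^ 2 * B r)⁻¹) 0 r := by
    intro r
    have h0 := transportFactor_ne_zero H (c := c) r (φ s x)
    have h1 := ((hasDerivAt_transportFactor H hc (r + s) x).comp_add_const r s).fun_pow 2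
    have h2 := ((hasDerivAt_transportFactor H hc r (φ s x)).fun_pow 2).mul (hBd r).hasDerivAt
    refine (h1.mul (h2.fun_inv (mul_ne_zero (pow_ne_zero 2 h0) (hB0 r)))).congr_deriv ?_
    have h3 : deriv B r = kappaDeriv H c r (φ s x) * B r - B r * kappaDeriv H c (r + s) x := by
      rw [← hk r]
      ring
    have h4 := hB0 r
    simp only [Pi.mul_apply]
    rw [h3]
    field_simp
    push_cast
    ring
  have h1 := is_const_of_deriv_eq_zero (fun r => (hd r).differentiableAt) (fun r => (hd r).deriv) r 0
  simp only [transportFactor_zero, zero_add, one_pow, one_mul] at h1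
  have h0 := transportFactor_ne_zero H (c := c) r (φ s x)
  have h4 := hB0 r
  have h5 := hB0 0
  field_simp at h1
  rw [h1]
  ring

theorem HalfFormFamily.form_transport (H : HalfFormFamily Ω δ) {j : EndField n M} (u : ∀ x, δ x) {x y : M}
    (h : y = x) {v : Fin n → Tan n x} {w : Fin n → Tan n y} (hw : ∀ i, (show Model n from w i) = v i) :
    H.form j y (u y ⊗ₜ[ℂ] u y) w = H.form j x (u x ⊗ₜ[ℂ] u x) v := by
  subst h
  exact congrArg (H.form j y (u y ⊗ₜ[ℂ] u y)) (funext hw)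

theorem section_smul_transport {u u' : ∀ x, δ x} {a : ℂ} {x y : M} (h : y = x) (hu : u x = a • u' x) :
    u y = a • u' y := by
  subst h
  exact hu

/-- The lifts of the flow, corrected by the parallel transport, form a one parameter group up to sign. -/
theorem IsHalfFormLift.exists_sign (hφ : IsFlow X φ)
    (hΩ : ∀ t x v w, Ω (φ t x) (dφ φ t x v) (dφ φ t x w) = Ω x v w) (hj : IsCompatible Ω j₀)
    (hθ : IsHalfFormLift H φ j₀ θ) (s : ℝ) (x : M) (r : ℝ) : ∃ R : ℂ, R ^ 2 = 1 ∧ ∀ u : ∀ x, δ x,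
      θ (r + s) x (u (φ (r + s) x)) = (R * (transportFactor H (fun t => pullbackEnd (φ t) j₀) (r + s) x /
        (transportFactor H (fun t => pullbackEnd (φ t) j₀) s x *
          transportFactor H (fun t => pullbackEnd (φ t) j₀) r (φ s x)))) •
        θ s x (θ r (φ s x) (u (φ r (φ s x)))) := by
  set c := fun t => pullbackEnd (φ t) j₀ with hcd
  have hc : IsSmoothCurve Ω c := hφ.isSmoothCurve_pullbackEnd hΩ hj
  have hw := frame_ne_zero (mem_dom (E := δ) (φ s x))
  have hw' := frame_ne_zero (mem_dom (E := δ) x)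
  set w := frame δ (φ s x) (φ s x)
  set w' := frame δ x x
  obtain ⟨B, hB0, hBd, hB⟩ := exists_naturality (H := H) hφ hΩ hj s x hw hw'
  obtain ⟨h, hh⟩ := exists_eq_smul hw' (θ s x w)
  have hsq : ∀ t y (u : δ (φ t y)) (e : δ y) (a : ℂ), θ t y u = a • e → ∀ v,
      H.form j₀ (φ t y) (u ⊗ₜ[ℂ] u) (fun i => dφ φ t y (v i)) = a ^ 2 * H.form (c t) y (e ⊗ₜ[ℂ] e) v := by
    intro t y u e a ha v
    rw [← hθ.square t y u v, ha, TensorProduct.smul_tmul_smul, map_smul,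
      ContinuousAlternatingMap.smul_apply, smul_eq_mul, sq]
  have hcz : c 0 = j₀ := hφ.pullbackEnd_zero
  have hh2 : h ^ 2 = B 0 := by
    obtain ⟨v, hv⟩ := H.exists_apply_ne_zero (hc.compatible s) hw'
    have h1 := hsq s x w w' h hh v
    have h2 := hB 0 v
    rw [show pullbackEnd (φ 0) j₀ = j₀ from hcz, h1, zero_add] at h2
    exact mul_right_cancel₀ hv h2
  have hh0 : h ≠ 0 := fun h0 => hB0 0 (by rw [← hh2, h0]; simp)
  obtain ⟨E, -, -, hE0⟩ := exists_smoothSec_eq_frame (n := n) (E := δ) (φ r (φ s x))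
  obtain ⟨p, hp⟩ := exists_eq_smul hw (θ r (φ s x) (E (φ r (φ s x))))
  obtain ⟨q, hq⟩ := exists_eq_smul hw' (θ (r + s) x (E (φ (r + s) x)))
  have hqp : q ^ 2 = p ^ 2 * B r := by
    obtain ⟨v, hv⟩ := H.exists_apply_ne_zero (hc.compatible (r + s)) hw'
    have h1 := hsq _ _ _ _ _ hq v
    have h2 := hsq _ _ _ _ _ hp (fun i => dφ φ s x (v i))
    rw [hB, ← H.form_transport E (hφ.add r s x) (fun i => hφ.mfderiv_comp r s x (v i)), h1] at h2
    exact mul_right_cancel₀ hv (by rw [h2]; ring)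
  have hp0 : p ≠ 0 := by
    intro h0
    obtain ⟨v, hv⟩ := H.exists_apply_ne_zero hj hE0
    obtain ⟨D, hD⟩ := hφ.mfderiv_isInvertible r (φ s x)
    have h1 := hsq _ _ _ _ _ hp (fun i => D.symm (v i))
    rw [h0, ← hD] at h1
    simp only [ContinuousLinearEquiv.coe_coe, ContinuousLinearEquiv.apply_symm_apply] at h1
    exact hv (h1.trans (by simp))
  have hm := transportFactor_sq_naturality hφ hΩ hj hw' hB0 hBd hB r
  have hm1 := transportFactor_ne_zero H (c := c) (r + s) x
  have hm2 := transportFactor_ne_zero H (c := c) s x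
  have hm3 := transportFactor_ne_zero H (c := c) r (φ s x)
  set m1 := transportFactor H c (r + s) x
  set m2 := transportFactor H c s x
  set m3 := transportFactor H c r (φ s x)
  -- The value of `R` is forced by the coordinates in the chosen frames; its square is 1 by `hm`,
  -- because `h ^ 2 = B 0` and `q ^ 2 = p ^ 2 * B r`.
  refine ⟨q * (m2 * m3) / (m1 * (p * h)), ?_, fun u => ?_⟩
  · have : q ^ 2 * (m2 * m3) ^ 2 = (m1 * (p * h)) ^ 2 := by
      rw [hqp, mul_pow m1, mul_pow p, hh2]
      linear_combination (-p ^ 2) * hm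
    rw [div_pow, mul_pow, this]
    exact div_self (pow_ne_zero 2 (mul_ne_zero hm1 (mul_ne_zero hp0 hh0)))
  · obtain ⟨a, ha⟩ := exists_eq_smul hE0 (u (φ r (φ s x)))
    rw [section_smul_transport (hφ.add r s x) ha, ha]
    simp only [map_smul, hp, hq, hh, smul_smul]
    congr 1
    field_simp

/-- The pull-back of half-forms by the flow, followed by the parallel transport to time zero. -/
def halfPull (H : HalfFormFamily Ω δ) (j₀ : EndField n M) (θ : ∀ t x, δ (φ t x) →ₗ[ℂ] δ x) (t : ℝ)
    (β : ∀ x, δ x) (x : M) : δ x :=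
  (transportFactor H (fun t => pullbackEnd (φ t) j₀) t x)⁻¹ • θ t x (β (φ t x))

theorem halfPull_zero (hθ : IsHalfFormLift H φ j₀ θ) (β : ∀ x, δ x) (x : M) :
    halfPull H j₀ θ 0 β x = β x := by
  rw [halfPull, transportFactor_zero, hθ.zero, inv_one, one_smul]

/-- The group law. -/
theorem IsHalfFormLift.halfPull_add (hφ : IsFlow X φ)
    (hΩ : ∀ t x v w, Ω (φ t x) (dφ φ t x v) (dφ φ t x w) = Ω x v w) (hj : IsCompatible Ω j₀)
    (hθ : IsHalfFormLift H φ j₀ θ) (r s : ℝ) (β : ∀ x, δ x) (x : M) :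
    halfPull H j₀ θ (r + s) β x = halfPull H j₀ θ s (halfPull H j₀ θ r β) x := by
  have hc := hφ.isSmoothCurve_pullbackEnd hΩ hj
  set c := fun t => pullbackEnd (φ t) j₀ with hcd
  choose R hR2 hR using hθ.exists_sign hφ hΩ hj s x
  have hm : ∀ t y, transportFactor H c t y ≠ 0 := fun t y => transportFactor_ne_zero H t y
  have hmc : ∀ y, Continuous (fun t => transportFactor H c t y) := fun y =>
    (contMDiff_transportFactor H hc).continuous.comp (Continuous.prodMk_left y)
  have hinj : ∀ t y (u : δ (φ t y)), θ t y u = 0 → u = 0 := by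
    intro t y u hu
    by_contra h0
    obtain ⟨v, hv⟩ := H.exists_apply_ne_zero hj h0
    obtain ⟨D, hD⟩ := hφ.mfderiv_isInvertible t y
    have h1 := hθ.square t y u (fun i => D.symm (v i))
    rw [hu] at h1
    change _ = H.form j₀ (φ t y) (u ⊗ₜ[ℂ] u) (fun i => dφ φ t y (D.symm (v i))) at h1
    rw [← hD] at h1
    simp only [ContinuousLinearEquiv.coe_coe, ContinuousLinearEquiv.apply_symm_apply] at h1
    exact hv (h1.symm.trans (by simp))
  -- Near a given time `R` is a quotient of continuous coordinates of one section, with nonzero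
  -- denominator.
  have hRc : Continuous R := by
    rw [continuous_iff_continuousAt]
    intro r₁
    obtain ⟨E, hEs, -, hE0⟩ := exists_smoothSec_eq_frame (n := n) (E := δ) (φ r₁ (φ s x))
    have h1 : ContinuousAt (fun r => lcoord δ x x (θ (r + s) x (E (φ (r + s) x)))) r₁ :=
      ContinuousAt.comp (f := fun r => (r + s, x)) (g := fun p : ℝ × M => lcoord δ x p.2 (θ p.1 p.2 (E (φ p.1 p.2))))
        (hθ.continuousAt_lcoord hEs (r₁ + s, x)) (by fun_prop)
    have h2 : ContinuousAt (fun r => lcoord δ x x (θ s x (θ r (φ s x) (E (φ r (φ s x)))))) r₁ := by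
      have h3 : ContinuousAt (fun r => lcoord δ (φ s x) (φ s x) (θ r (φ s x) (E (φ r (φ s x)))) *
          lcoord δ x x (θ s x (frame δ (φ s x) (φ s x)))) r₁ :=
        (ContinuousAt.comp (f := fun r => (r, φ s x))
          (g := fun p : ℝ × M => lcoord δ (φ s x) p.2 (θ p.1 p.2 (E (φ p.1 p.2))))
          (hθ.continuousAt_lcoord hEs (r₁, φ s x)) (by fun_prop)).mul continuousAt_const
      refine h3.congr (Filter.Eventually.of_forall fun r => ?_)
      dsimp only
      conv_rhs => rw [eq_lcoord_smul_frame (mem_dom (E := δ) (φ s x)) (θ r (φ s x) (E (φ r (φ s x))))]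
      simp
    have h4 : lcoord δ x x (θ s x (θ r₁ (φ s x) (E (φ r₁ (φ s x))))) ≠ 0 :=
      lcoord_ne_zero (mem_dom x) fun h => hE0 (hinj _ _ _ (hinj _ _ _ h))
    have h5 : ContinuousAt (fun r => transportFactor H c (r + s) x /
        (transportFactor H c s x * transportFactor H c r (φ s x))) r₁ :=
      ((hmc x).comp (continuous_id.add continuous_const)).continuousAt.div
        (continuous_const.mul (hmc (φ s x))).continuousAt (mul_ne_zero (hm _ _) (hm _ _))
    refine (h1.div (h5.mul h2) (mul_ne_zero (div_ne_zero (hm _ _) (mul_ne_zero (hm _ _) (hm _ _))) h4)).congr ?_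
    filter_upwards [h2.eventually_ne h4] with r hr
    simp only [Pi.div_apply, Pi.mul_apply]
    rw [hR r E, map_smul, smul_eq_mul, div_eq_iff (mul_ne_zero (div_ne_zero (hm _ _) (mul_ne_zero (hm _ _) (hm _ _))) hr)]
    ring
  -- A continuous function on `ℝ` with square 1 is constant; the value -1 is excluded at `r = 0`,
  -- where both lifts coincide and are nonzero.
  have hR1 : ∀ r, R r = 1 := by
    have h1 := isPreconnected_univ.eq_or_eq_neg_of_sq_eq (f := R) (g := fun _ => 1) hRc.continuousOn
      continuousOn_const (fun r _ => by simpa using hR2 r) (fun _ => one_ne_zero)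
    rcases h1 with h1 | h1
    · exact fun r => h1 (mem_univ r)
    · exfalso
      obtain ⟨E, hEs, -, hE0⟩ := exists_smoothSec_eq_frame (n := n) (E := δ) (φ s x)
      have h2 := hR 0 E
      rw [hθ.zero, h1 (mem_univ 0), transportFactor_zero, mul_one, zero_add, div_self (hm s x)] at h2
      have h3 : θ s x (E (φ s x)) = -θ s x (E (φ s x)) := by simpa using h2
      have h4 : (2 : ℂ) • θ s x (E (φ s x)) = 0 := by
        rw [two_smul]
        exact eq_neg_iff_add_eq_zero.1 h3
      exact hE0 (hinj _ _ _ ((smul_eq_zero_iff_right two_ne_zero).1 h4))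
  simp only [halfPull]
  rw [hR r β, hR1, map_smul, smul_smul, smul_smul]
  congr 1
  have h1 := hm (r + s) x
  have h2 := hm s x
  have h3 := hm r (φ s x)
  simp only [hcd] at h1 h2 h3
  field_simp

end Lift

/-! ### The infinitesimal generator of the corrected half-form lifts -/

section HalfPull
variable {n : ℕ} {M : Type*} [TopologicalSpace M] [ChartedSpace (Model n) M]
  [IsManifold 𝓘(ℝ, Model n) ∞ M] [T2Space M] {Ω : ∀ x : M, Tan n x →L[ℝ] Tan n x →L[ℝ] ℝ}
  {δ : M → Type*} [TopologicalSpace (TotalSpace ℂ δ)] [∀ x, AddCommGroup (δ x)]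
  [∀ x, Module ℂ (δ x)] [∀ x, TopologicalSpace (δ x)] [FiberBundle ℂ δ] [VectorBundle ℂ ℂ δ]
  [VectorBundle ℝ ℂ δ] [ContMDiffVectorBundle ∞ ℂ δ 𝓘(ℝ, Model n)]
  {H : HalfFormFamily Ω δ} {X : ∀ x : M, Tan n x} {φ : ℝ → M → M} {j₀ : EndField n M}
  {θ : ∀ t x, δ (φ t x) →ₗ[ℂ] δ x}

theorem IsHalfFormLift.eq_zero (hφ : IsFlow X φ) (hj : IsCompatible Ω j₀)
    (hθ : IsHalfFormLift H φ j₀ θ) {t : ℝ} {y : M} {u : δ (φ t y)} (hu : θ t y u = 0) : u = 0 := by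
  by_contra h0
  obtain ⟨v, hv⟩ := H.exists_apply_ne_zero hj h0
  obtain ⟨D, hD⟩ := hφ.mfderiv_isInvertible t y
  have h1 := hθ.square t y u (fun i => D.symm (v i))
  rw [hu] at h1
  change _ = H.form j₀ (φ t y) (u ⊗ₜ[ℂ] u) (fun i => dφ φ t y (D.symm (v i))) at h1
  rw [← hD] at h1
  simp only [ContinuousLinearEquiv.coe_coe, ContinuousLinearEquiv.apply_symm_apply] at h1
  exact hv (h1.symm.trans (by simp))

theorem IsHalfFormLift.halfPull_ne_zero (hφ : IsFlow X φ) (hj : IsCompatible Ω j₀)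
    (hθ : IsHalfFormLift H φ j₀ θ) {t : ℝ} {β : ∀ x, δ x} {x : M} (h : β (φ t x) ≠ 0) :
    halfPull H j₀ θ t β x ≠ 0 :=
  smul_ne_zero (inv_ne_zero (transportFactor_ne_zero H t x)) fun h0 => h (hθ.eq_zero hφ hj h0)

theorem IsHalfFormLift.contMDiffAt_halfPull (hφ : IsFlow X φ)
    (hΩ : ∀ t x v w, Ω (φ t x) (dφ φ t x v) (dφ φ t x w) = Ω x v w) (hj : IsCompatible Ω j₀)
    (hθ : IsHalfFormLift H φ j₀ θ) {β : ∀ x, δ x} (hβ : SmoothSecOn (n := n) δ univ β)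
    {t₁ : ℝ} {x₁ x₂ : M} (hx : x₁ ∈ dom δ x₂) :
    ContMDiffAt (𝓘(ℝ, ℝ).prod 𝓘(ℝ, Model n)) 𝓘(ℝ, ℂ) ∞
      (fun p : ℝ × M => lcoord δ x₂ p.2 (halfPull H j₀ θ p.1 β p.2)) (t₁, x₁) := by
  simp only [halfPull, map_smul, smul_eq_mul]
  exact ContMDiffAt.cmul (ContMDiffAt.cinv (contMDiff_transportFactor H (hφ.isSmoothCurve_pullbackEnd hΩ hj) _)
    (transportFactor_ne_zero H _ _)) (hθ.contMDiffAt_lcoord hφ hΩ hj hβ hx)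

theorem IsHalfFormLift.smoothSecOn_halfPull (hφ : IsFlow X φ)
    (hΩ : ∀ t x v w, Ω (φ t x) (dφ φ t x v) (dφ φ t x w) = Ω x v w) (hj : IsCompatible Ω j₀)
    (hθ : IsHalfFormLift H φ j₀ θ) {β : ∀ x, δ x} (hβ : SmoothSecOn (n := n) δ univ β) (t : ℝ) :
    SmoothSecOn (n := n) δ univ (halfPull H j₀ θ t β) :=
  smoothSecOn_of_at fun x _ => (smoothSecAt_iff (mem_dom x)).2
    (ContMDiffAt.comp x (f := fun y => (t, y)) (g := fun p : ℝ × M => lcoord δ x p.2 (halfPull H j₀ θ p.1 β p.2))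
      (hθ.contMDiffAt_halfPull hφ hΩ hj hβ (mem_dom x)) (contMDiffAt_const.prodMk contMDiffAt_id))

/-- The infinitesimal generator of the corrected lifts is the operator `D_X`. -/
theorem IsHalfFormLift.isDX_of_hasDerivAt (hφ : IsFlow X φ)
    (hΩ : ∀ t x v w, Ω (φ t x) (dφ φ t x v) (dφ φ t x w) = Ω x v w) (hj : IsCompatible Ω j₀)
    (hθ : IsHalfFormLift H φ j₀ θ) {β : ∀ x, δ x} {x : M} (h0 : β x ≠ 0) {g : ℝ → ℂ} {g' : ℂ}
    (hg : HasDerivAt g g' 0) (hβ : ∀ s, halfPull H j₀ θ s β x = g s • β x) :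
    IsDX H φ j₀ β x (g' • β x) := by
  have hc := hφ.isSmoothCurve_pullbackEnd hΩ hj
  set c := fun t => pullbackEnd (φ t) j₀ with hcd
  have hcz : c 0 = j₀ := hφ.pullbackEnd_zero
  have hg0 : g 0 = 1 := by
    have h1 := hβ 0
    rw [halfPull_zero hθ] at h1
    exact smul_left_injective ℂ h0 (h1.symm.trans (one_smul ℂ (β x)).symm)
  -- `y s` is the ratio between the pulled back form of `β²` and the form of `β²` for the structure
  -- at time `s`; the transport factor reappears because `halfPull` divides by it.
  set y : ℝ → ℂ := fun s => (transportFactor H c s x * g s) ^ 2 with hy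
  have hyd : HasDerivAt y (2 * g' - kappaDeriv H c 0 x) 0 := by
    refine (((hasDerivAt_transportFactor H hc 0 x).mul hg).fun_pow 2).congr_deriv ?_
    simp only [Pi.mul_apply]
    rw [transportFactor_zero, hg0]
    push_cast
    ring
  have hlift : ∀ s w, H.form j₀ (φ s x) (β (φ s x) ⊗ₜ[ℂ] β (φ s x)) (fun i => dφ φ s x (w i)) =
      y s * H.form (c s) x (β x ⊗ₜ[ℂ] β x) w := by
    intro s w
    have h1 : θ s x (β (φ s x)) = (transportFactor H c s x * g s) • β x := by
      rw [mul_smul, ← hβ s, halfPull, smul_inv_smul₀ (transportFactor_ne_zero H s x)]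
    rw [← hθ.square s x _ w, h1, TensorProduct.smul_tmul_smul, map_smul,
      ContinuousAlternatingMap.smul_apply, smul_eq_mul, hy, ← sq]
  have hd : ∀ w, HasDerivAt (fun s => y s * H.form (c s) x (β x ⊗ₜ[ℂ] β x) w)
      (lieDeriv φ (fun y => H.form j₀ y (β y ⊗ₜ[ℂ] β y)) x w) 0 := by
    intro w
    have h1 := (hyd.differentiableAt.mul (differentiable_form (H := H) hc x (β x) w 0)).hasDerivAt
    refine h1.congr_deriv ?_
    rw [lieDeriv]
    exact congrArg (fun F : ℝ → ℂ => deriv F 0) (funext fun s => (hlift s w).symm)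
  refine ⟨h0, fun v => ?_⟩
  have h1 : HasDerivAt (fun s => y s * (kappa H j₀ (c s) x * H.form j₀ x (β x ⊗ₜ[ℂ] β x) v))
      (projN0 j₀ (lieDeriv φ (fun y => H.form j₀ y (β y ⊗ₜ[ℂ] β y)) x) v) 0 := by
    have h2 := (HasDerivAt.fun_sum (u := Finset.univ) fun (S : Finset (Fin n)) _ =>
      (hd (fun i => if i ∈ S then j₀ x (v i) else v i)).const_mul ((-Complex.I) ^ S.card)).const_mul ((1 / 2 : ℂ) ^ n)
    refine h2.congr_of_eventuallyEq (Filter.Eventually.of_forall fun s => ?_)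
    dsimp only
    rw [← projN0_form H hj (hc.compatible s), projN0, mul_left_comm, Finset.mul_sum]
    congr 1
    refine Finset.sum_congr rfl fun S _ => ?_
    rw [mul_left_comm]
  have hk := hasDerivAt_kappa H hc 0 x
  rw [hcz] at hk
  -- The derivative of `y` is `2 g' - κ'` and the projection contributes `κ'`: the parallel
  -- transport cancels exactly the variation of the projection, leaving `2 g'`.
  have h3 := (hyd.mul (hk.mul_const (H.form j₀ x (β x ⊗ₜ[ℂ] β x) v))).unique h1
  rw [← h3, hcz, kappa_self H hj, hy]
  dsimp only
  rw [transportFactor_zero, hg0, TensorProduct.tmul_smul, map_smul, ContinuousAlternatingMap.smul_apply, smul_eq_mul]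
  ring

/-- The time derivative of the corrected lifts. -/
theorem IsHalfFormLift.exists_hasDerivAt_halfPull (hφ : IsFlow X φ)
    (hΩ : ∀ t x v w, Ω (φ t x) (dφ φ t x v) (dφ φ t x w) = Ω x v w) (hj : IsCompatible Ω j₀)
    (hθ : IsHalfFormLift H φ j₀ θ) {β : ∀ x, δ x} (hβ : SmoothSecOn (n := n) δ univ β) {t : ℝ} {x : M}
    (h0 : β (φ t x) ≠ 0) : ∃ (b : ℝ → ℂ) (b' : ℂ), (∀ r, halfPull H j₀ θ r β x = b r • halfPull H j₀ θ t β x) ∧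
      b t = 1 ∧ HasDerivAt b b' t ∧ IsDX H φ j₀ (halfPull H j₀ θ t β) x (b' • halfPull H j₀ θ t β x) := by
  have hne := hθ.halfPull_ne_zero hφ hj h0
  have hl := lcoord_ne_zero (mem_dom (E := δ) x) hne
  set b : ℝ → ℂ := fun r => lcoord δ x x (halfPull H j₀ θ r β x) / lcoord δ x x (halfPull H j₀ θ t β x) with hb
  have hbr : ∀ r, halfPull H j₀ θ r β x = b r • halfPull H j₀ θ t β x := fun r =>
    lcoord_injective (mem_dom x) (by rw [map_smul, smul_eq_mul, div_mul_cancel₀ _ hl])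
  have hbs : ContMDiffAt 𝓘(ℝ, ℝ) 𝓘(ℝ, ℂ) ∞ (fun r => lcoord δ x x (halfPull H j₀ θ r β x)) t :=
    ContMDiffAt.comp t (f := fun r => (r, x)) (g := fun p : ℝ × M => lcoord δ x p.2 (halfPull H j₀ θ p.1 β p.2))
      (hθ.contMDiffAt_halfPull hφ hΩ hj hβ (mem_dom x)) (contMDiffAt_id.prodMk contMDiffAt_const)
  have hbd : HasDerivAt b (deriv b t) t :=
    (((contMDiffAt_iff_contDiffAt.1 hbs).differentiableAt (by simp)).div_const _).hasDerivAt
  refine ⟨b, deriv b t, hbr, div_self hl, hbd, ?_⟩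
  -- By the group law, the lift of `β` near time `t` is the lift near time 0 of the section already
  -- pulled back to time `t`.
  refine hθ.isDX_of_hasDerivAt hφ hΩ hj hne (g := fun s => b (t + s)) ?_ fun s => ?_
  · have := HasDerivAt.comp_const_add (f := b) (f' := deriv b t) t 0 (by rwa [add_zero])
    exact this
  · rw [← hθ.halfPull_add hφ hΩ hj, hbr]

end HalfPull

/-! ### The Schrödinger equation in the prequantum space -/

section PrequantumEvolution
variable {n : ℕ} {M : Type*} [TopologicalSpace M] [ChartedSpace (Model n) M]
  [IsManifold 𝓘(ℝ, Model n) ∞ M] [T2Space M] {Ω : ∀ x : M, Tan n x →L[ℝ] Tan n x →L[ℝ] ℝ}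
  {L : M → Type*} [TopologicalSpace (TotalSpace ℂ L)] [∀ x, NormedAddCommGroup (L x)]
  [∀ x, InnerProductSpace ℂ (L x)] [FiberBundle ℂ L] [VectorBundle ℂ ℂ L] [VectorBundle ℝ ℂ L]
  [ContMDiffVectorBundle ∞ ℂ L 𝓘(ℝ, Model n)]
  {nab : CovariantDerivative 𝓘(ℝ, Model n) ℂ L} [CovariantDerivative.ContMDiffCovariantDerivative nab ∞]
  {δ : M → Type*} [TopologicalSpace (TotalSpace ℂ δ)] [∀ x, AddCommGroup (δ x)]
  [∀ x, Module ℂ (δ x)] [∀ x, TopologicalSpace (δ x)] [FiberBundle ℂ δ] [VectorBundle ℂ ℂ δ]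
  [VectorBundle ℝ ℂ δ] [ContMDiffVectorBundle ∞ ℂ δ 𝓘(ℝ, Model n)]
  {H : HalfFormFamily Ω δ} {k : ℕ} {f : M → ℝ} {φ : ℝ → M → M} {Φ : ∀ t x, L x ≃ₗ[ℂ] L (φ t x)}
  {j₀ : EndField n M} {θ : ∀ t x, δ (φ t x) →ₗ[ℂ] δ x}

/-- Each of the `k` tensor factors contributes `c`. -/
theorem tpowDeriv_smul {x : M} (u : L x) (c : ℂ) : tpowDeriv k u (c • u) = (k * c) • tpow k u := by
  have h1 : ∀ i : Fin k, PiTensorProduct.tprod ℂ (Function.update (fun _ : Fin k => u) i (c • u)) =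
      c • tpow k u := by
    intro i
    rw [MultilinearMap.map_update_smul]
    simp [tpow, Function.update_eq_self]
  rw [tpowDeriv, Finset.sum_congr rfl fun i _ => h1 i]
  simp [mul_smul, Nat.cast_smul_eq_nsmul]

/-- Local expression of smooth sections of `L^k ⊗ δ` in a common frame. -/
theorem exists_frame_form (L δ : M → Type*) [TopologicalSpace (TotalSpace ℂ L)] [∀ x, NormedAddCommGroup (L x)]
    [∀ x, InnerProductSpace ℂ (L x)] [FiberBundle ℂ L] [VectorBundle ℂ ℂ L] [VectorBundle ℝ ℂ L]
    [ContMDiffVectorBundle ∞ ℂ L 𝓘(ℝ, Model n)] [TopologicalSpace (TotalSpace ℂ δ)] [∀ x, AddCommGroup (δ x)]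
    [∀ x, Module ℂ (δ x)] [∀ x, TopologicalSpace (δ x)] [FiberBundle ℂ δ] [VectorBundle ℂ ℂ δ]
    [VectorBundle ℝ ℂ δ] [ContMDiffVectorBundle ∞ ℂ δ 𝓘(ℝ, Model n)] (k : ℕ) (x : M) :
    ∃ (a : ∀ x, L x) (β : ∀ x, δ x), SmoothSecOn (n := n) L univ a ∧ SmoothSecOn (n := n) δ univ β ∧
      ∀ s ∈ preQ n L δ k, ∃ (U : Set M) (g : M → ℂ), IsOpen U ∧ x ∈ U ∧ ContMDiff 𝓘(ℝ, Model n) 𝓘(ℝ, ℂ) ∞ g ∧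
        (∀ y ∈ U, a y ≠ 0 ∧ β y ≠ 0) ∧ ∀ y ∈ U, s y = g y • (tpow k (a y) ⊗ₜ[ℂ] β y) := by
  obtain ⟨a, ha, -, ha0⟩ := exists_smoothSec_eq_frame (n := n) (E := L) x
  obtain ⟨β, hβ, -, hβ0⟩ := exists_smoothSec_eq_frame (n := n) (E := δ) x
  refine ⟨a, β, ha, hβ, fun s hs => ?_⟩
  have hdL : ∀ᶠ y in 𝓝 x, y ∈ dom L x := dom_mem_nhds x
  have hdδ : ∀ᶠ y in 𝓝 x, y ∈ dom δ x := dom_mem_nhds x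
  have haev : ∀ᶠ y in 𝓝 x, a y ≠ 0 := SmoothSecAt.eventually_ne_zero (ha.atPoint x) ha0
  have hβev : ∀ᶠ y in 𝓝 x, β y ≠ 0 := SmoothSecAt.eventually_ne_zero (hβ.atPoint x) hβ0
  obtain ⟨V, hVs, hV, hxV⟩ := mem_nhds_iff.1 (haev.and (hβev.and (hdL.and hdδ)))
  have hg : ContMDiffOn 𝓘(ℝ, Model n) 𝓘(ℝ, ℂ) ∞ (fun y => coef k x y (s y) /
      (lcoord L x y (a y) ^ k * lcoord δ x y (β y))) V := by
    intro y hy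
    obtain ⟨h1, h2, h3, h4⟩ := hVs hy
    have h5 := contMDiffAt_coef_change (k := k) (b := fun y => y) (p₀ := y) (x₀ := y) (x₁ := x)
      contMDiffAt_id (mem_dom y) (mem_dom y) h3 h4 (hs y)
    exact (contMDiffAt_coef_div (b := fun y => y) (p₀ := y) h3 h4 ((smoothSecAt_iff h3).1 (ha.atPoint y)) h1
      ((smoothSecAt_iff h4).1 (hβ.atPoint y)) h2 h5).contMDiffWithinAt
  obtain ⟨g, hgs, hge⟩ := exists_contMDiff_eq hg hV hxV
  obtain ⟨W, hWs, hW, hxW⟩ := mem_nhds_iff.1 hge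
  refine ⟨V ∩ W, g, hV.inter hW, ⟨hxV, hxW⟩, hgs, fun y hy => ?_, fun y hy => ?_⟩
  · exact ⟨(hVs hy.1).1, (hVs hy.1).2.1⟩
  · rw [hWs hy.2]
    exact eq_coef_smul (hVs hy.1).2.2.1 (hVs hy.1).2.2.2 (hVs hy.1).1 (hVs hy.1).2.1 _

theorem exists_local_form {s : Sec L δ k} (hs : s ∈ preQ n L δ k) (x : M) :
    ∃ (U : Set M) (a : ∀ x, L x) (β : ∀ x, δ x) (g : M → ℂ), IsOpen U ∧ x ∈ U ∧
      SmoothSecOn (n := n) L univ a ∧ SmoothSecOn (n := n) δ univ β ∧ ContMDiff 𝓘(ℝ, Model n) 𝓘(ℝ, ℂ) ∞ g ∧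
      (∀ y ∈ U, a y ≠ 0 ∧ β y ≠ 0) ∧ ∀ y ∈ U, s y = g y • (tpow k (a y) ⊗ₜ[ℂ] β y) := by
  obtain ⟨a, β, ha, hβ, h⟩ := exists_frame_form (n := n) L δ k x
  obtain ⟨U, g, hU, hx, hg, h0, hsg⟩ := h s hs
  exact ⟨U, a, β, g, hU, hx, ha, hβ, hg, h0, hsg⟩

theorem action_eq {t : ℝ} {x : M} {s : Sec L δ k} {g : ℂ} {a : ∀ x, L x} {β : ∀ x, δ x}
    (h : s (φ t x) = g • (tpow k (a (φ t x)) ⊗ₜ[ℂ] β (φ t x))) :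
    action Φ θ t s x = g • (tpow k (pull Φ t a x) ⊗ₜ[ℂ] θ t x (β (φ t x))) := by
  rw [action, h, map_smul, TensorProduct.map_tmul]
  congr 2
  simp [tpow, pull, PiTensorProduct.map_tprod]

/-- The action, followed by the parallel transport to time zero. -/
def evolution (H : HalfFormFamily Ω δ) (j₀ : EndField n M) (Φ : ∀ t x, L x ≃ₗ[ℂ] L (φ t x))
    (θ : ∀ t x, δ (φ t x) →ₗ[ℂ] δ x) (t : ℝ) (s : Sec L δ k) : Sec L δ k := fun x =>
  (transportFactor H (fun t => pullbackEnd (φ t) j₀) t x)⁻¹ • action Φ θ t s x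

theorem evolution_eq {t : ℝ} {x : M} {s : Sec L δ k} {g : ℂ} {a : ∀ x, L x} {β : ∀ x, δ x}
    (h : s (φ t x) = g • (tpow k (a (φ t x)) ⊗ₜ[ℂ] β (φ t x))) :
    evolution H j₀ Φ θ t s x = g • (tpow k (pull Φ t a x) ⊗ₜ[ℂ] halfPull H j₀ θ t β x) := by
  rw [evolution, action_eq h, halfPull, TensorProduct.tmul_smul, smul_comm]

theorem smoothFamilyOn_evolution (hΩ : IsSymplectic Ω) (hf : ContMDiff 𝓘(ℝ, Model n) 𝓘(ℝ, ℝ) ∞ f)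
    (hL : IsPrequantization Ω nab) (hφ : IsFlow (hamVF Ω f) φ) (hΦ : IsExp nab f φ Φ)
    (hj : IsCompatible Ω j₀) (hθ : IsHalfFormLift H φ j₀ θ) {s : Sec L δ k} (hs : s ∈ preQ n L δ k) :
    SmoothFamilyOn (n := n) univ (fun t => evolution H j₀ Φ θ t s) := by
  intro t₁ _ x₁
  have hinv := hΦ.omega_mfderiv hΩ hf hL hφ
  obtain ⟨U, a, β, g, hU, hx, ha, hβ, hg, -, hsg⟩ := exists_local_form hs (φ t₁ x₁)
  refine contMDiffAt_coef (b := fun p : ℝ × M => p.2) (p₀ := (t₁, x₁)) (x₀ := x₁)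
    (g := fun p => g (φ p.1 p.2)) (a := fun p => pull Φ p.1 a p.2) (β := fun p => halfPull H j₀ θ p.1 β p.2)
    ((hg.comp hφ.smooth) _) (hΦ.contMDiffAt_pull hΩ hf hL hφ ha t₁ x₁ (mem_dom x₁))
    (hθ.contMDiffAt_halfPull hφ hinv hj hβ (mem_dom x₁)) ?_
  filter_upwards [(hφ.continuous.continuousAt (x := (t₁, x₁))).eventually (hU.mem_nhds hx)] with p hp
  exact evolution_eq (hsg _ hp)

/-- The derivative is the pull-back of `∇_X a + i f a`. As the lift preserves the connection and the
flow preserves `X` and `f`, it is also `∇_X + i f` applied to the pulled back section, so the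
equation at time `t` only involves the section at time `t`. -/
theorem exists_hasDerivAt_pull (hΩ : IsSymplectic Ω) (hf : ContMDiff 𝓘(ℝ, Model n) 𝓘(ℝ, ℝ) ∞ f)
    (hL : IsPrequantization Ω nab) (hφ : IsFlow (hamVF Ω f) φ) (hΦ : IsExp nab f φ Φ) {a : ∀ x, L x}
    (ha : SmoothSecOn (n := n) L univ a) {t : ℝ} {x : M} (h0 : a (φ t x) ≠ 0) :
    ∃ A : ℝ → ℂ, (∀ r, pull Φ r a x = A r • pull Φ t a x) ∧ A t = 1 ∧
      HasDerivAt A (connForm nab (pull Φ t a) x (hamVF Ω f x) + Complex.I * f x) t := by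
  have h1 := pull_ne_zero (Φ := Φ) h0
  have hl := lcoord_ne_zero (mem_dom (E := L) x) h1
  refine ⟨fun r => lcoord L x x (pull Φ r a x) / lcoord L x x (pull Φ t a x), fun r => ?_, div_self hl, ?_⟩
  · exact lcoord_injective (mem_dom x) (by rw [map_smul, smul_eq_mul, div_mul_cancel₀ _ hl])
  · refine ((hΦ.hasDerivAt_pull hΩ hf hL hφ ha x (lcoord L x x) t).div_const _).congr_deriv ?_
    have h2 : pull Φ t (prequantOp nab (hamVF Ω f) f a) x =
        (connForm nab (pull Φ t a) x (hamVF Ω f x) + Complex.I * f x) • pull Φ t a x := by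
      rw [add_smul, ← nab_eq h1, hΦ.nab_pull hΩ hf hL hφ ha, hφ.mfderiv_apply_self, pull, prequantOp, map_add,
        map_smul, hφ.hamiltonian_eq hΩ hf]
      rfl
    rw [h2, map_smul, smul_eq_mul, mul_div_cancel_right₀ _ hl]

/-- Near `(t, x)` the evolved section is `g(φ_r x) A(r)^k b(r)` times a fixed vector. The product
rule gives the derivative of `g` along `X`, `k` times the connection form on `X` plus `i f`, and
`D_X`. After division by `i k` the contribution `k i f` is the term `f`, and the others are the
Leibniz terms of the operator. -/
theorem exists_hasTimeDeriv_evolution (hk : 1 ≤ k) (hΩ : IsSymplectic Ω)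
    (hf : ContMDiff 𝓘(ℝ, Model n) 𝓘(ℝ, ℝ) ∞ f)
    (hL : IsPrequantization Ω nab) (hφ : IsFlow (hamVF Ω f) φ) (hΦ : IsExp nab f φ Φ)
    (hj : IsCompatible Ω j₀) (hθ : IsHalfFormLift H φ j₀ θ) {s : Sec L δ k} (hs : s ∈ preQ n L δ k) (t : ℝ) :
    ∃ s' : Sec L δ k, HasTimeDeriv (fun r => evolution H j₀ Φ θ r s) s' t ∧
      IsOp nab H f φ j₀ (evolution H j₀ Φ θ t s) ((1 / (Complex.I * k)) • s') := by
  have hinv := hΦ.omega_mfderiv hΩ hf hL hφ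
  have hφt := hφ.contMDiff_map t
  have key : ∀ x, ∃ s'x : (⨂[ℂ]^k (L x)) ⊗[ℂ] (δ x),
      (∃ (z : (⨂[ℂ]^k (L x)) ⊗[ℂ] (δ x)) (G : ℝ → ℂ) (G' : ℂ), HasDerivAt G G' t ∧
        (∀ᶠ r in 𝓝 t, evolution H j₀ Φ θ r s x = G r • z) ∧ s'x = G' • z) ∧
      ∃ (U : Set M) (a : ∀ x, L x) (β : ∀ x, δ x) (g : M → ℂ) (b : δ x),
        IsOpen U ∧ x ∈ U ∧ SmoothSecOn (n := n) L U a ∧ SmoothSecOn (n := n) δ U β ∧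
        ContMDiffOn 𝓘(ℝ, Model n) 𝓘(ℝ, ℂ) ∞ g U ∧
        (∀ y ∈ U, evolution H j₀ Φ θ t s y = g y • (tpow k (a y) ⊗ₜ[ℂ] β y)) ∧ IsDX H φ j₀ β x b ∧
        (1 / (Complex.I * k)) • s'x = (f x : ℂ) • evolution H j₀ Φ θ t s x + (1 / (Complex.I * k)) •
          (dC g x (hamVF Ω f x) • (tpow k (a x) ⊗ₜ[ℂ] β x)
            + g x • (tpowDeriv k (a x) (nab a x (hamVF Ω f x)) ⊗ₜ[ℂ] β x)
            + g x • (tpow k (a x) ⊗ₜ[ℂ] b)) := by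
    intro x
    obtain ⟨U, a, β, g, hU, hx, ha, hβ, hg, h0, hsg⟩ := exists_local_form hs (φ t x)
    obtain ⟨A, hA, hA1, hAd⟩ := exists_hasDerivAt_pull hΩ hf hL hφ hΦ ha (h0 _ hx).1
    obtain ⟨b, b', hb, hb1, hbd, hDX⟩ := hθ.exists_hasDerivAt_halfPull hφ hinv hj hβ (h0 _ hx).2
    have hgd : MDifferentiableAt 𝓘(ℝ, Model n) 𝓘(ℝ, ℂ) g (φ t x) := hg.mdifferentiableAt (by simp)
    have hG := ((hasDerivAt_dC_comp hgd (hφ.hasMFDerivAt x t)).mul (hAd.fun_pow k)).mul hbd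
    have hev : ∀ t x, φ t x ∈ U → evolution H j₀ Φ θ t s x =
        g (φ t x) • (tpow k (pull Φ t a x) ⊗ₜ[ℂ] halfPull H j₀ θ t β x) := fun t x h => evolution_eq (hsg _ h)
    refine ⟨_, ⟨tpow k (pull Φ t a x) ⊗ₜ[ℂ] halfPull H j₀ θ t β x, _, _, hG, ?_, rfl⟩,
      φ t ⁻¹' U, pull Φ t a, halfPull H j₀ θ t β, fun y => g (φ t y), b' • halfPull H j₀ θ t β x,
      hU.preimage hφt.continuous, hx, ?_, ?_, (hg.comp hφt).contMDiffOn, fun y hy => hev t y hy, hDX, ?_⟩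
    · filter_upwards [((hφ.hasMFDerivAt x t).continuousAt).eventually (hU.mem_nhds hx)] with r hr
      rw [hev r x hr, hA, hb, tpow_smul, TensorProduct.smul_tmul_smul, smul_smul]
      simp only [Pi.mul_apply]
      congr 1
      ring
    · exact (hΦ.smoothSecOn_pull hΩ hf hL hφ ha t).mono (subset_univ _)
    · exact (hθ.smoothSecOn_halfPull hφ hinv hj hβ t).mono (subset_univ _)
    · rw [hev t x hx, nab_eq (pull_ne_zero (h0 _ hx).1), tpowDeriv_smul, TensorProduct.tmul_smul]
      have h1 : dC (fun y => g (φ t y)) x (hamVF Ω f x) = dC g (φ t x) (hamVF Ω f (φ t x)) := by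
        rw [dC_comp hgd (hφ.mdifferentiableAt t x), hφ.mfderiv_apply_self]
      rw [h1]
      have hk0 : (k : ℂ) ≠ 0 := by exact_mod_cast (by omega : k ≠ 0)
      have hI := Complex.I_ne_zero
      simp only [← TensorProduct.smul_tmul', Pi.mul_apply, hA1, hb1, one_pow, mul_one]
      generalize (tpow k (pull Φ t a x) ⊗ₜ[ℂ] halfPull H j₀ θ t β x) = z
      simp only [smul_smul, ← add_smul]
      congr 1
      field_simp
      ring
  choose s' h1 h2 using key
  exact ⟨s', hasTimeDeriv_of_smul h1, h2⟩

theorem evolution_mem_preQ (hΩ : IsSymplectic Ω) (hf : ContMDiff 𝓘(ℝ, Model n) 𝓘(ℝ, ℝ) ∞ f)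
    (hL : IsPrequantization Ω nab) (hφ : IsFlow (hamVF Ω f) φ) (hΦ : IsExp nab f φ Φ)
    (hj : IsCompatible Ω j₀) (hθ : IsHalfFormLift H φ j₀ θ) {s : Sec L δ k} (hs : s ∈ preQ n L δ k) (t : ℝ) :
    evolution H j₀ Φ θ t s ∈ preQ n L δ k := fun x =>
  ContMDiffAt.comp x (f := fun y => (t, y)) (g := fun p : ℝ × M => coef k x p.2 (evolution H j₀ Φ θ p.1 s p.2))
    (smoothFamilyOn_evolution hΩ hf hL hφ hΦ hj hθ hs t (mem_univ t) x) (contMDiffAt_const.prodMk contMDiffAt_id)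

end PrequantumEvolution

/-! ### The Liouville measure -/

section Liouville
variable {n : ℕ} {M : Type*} [TopologicalSpace M] [ChartedSpace (Model n) M]
  [IsManifold 𝓘(ℝ, Model n) ∞ M] {Ω : ∀ x : M, Tan n x →L[ℝ] Tan n x →L[ℝ] ℝ}

/-- The differential of the inverse of a chart. -/
def dSymm (x₀ : M) (y : Model n) : Model n →L[ℝ] Tan n ((extChartAt 𝓘(ℝ, Model n) x₀).symm y) :=
  mfderiv 𝓘(ℝ, Model n) 𝓘(ℝ, Model n) (extChartAt 𝓘(ℝ, Model n) x₀).symm y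

/-- The matrix of the symplectic form in a chart. -/
def chartGram (Ω : ∀ x : M, Tan n x →L[ℝ] Tan n x →L[ℝ] ℝ) (x₀ : M) (y : Model n) :
    Matrix (Fin n ⊕ Fin n) (Fin n ⊕ Fin n) ℝ :=
  Matrix.of fun a b => Ω ((extChartAt 𝓘(ℝ, Model n) x₀).symm y)
    (dSymm x₀ y (EuclideanSpace.single a 1 : Model n)) (dSymm x₀ y (EuclideanSpace.single b 1 : Model n))

/-- The density of the Liouville measure in a chart. -/
def chartDensity (Ω : ∀ x : M, Tan n x →L[ℝ] Tan n x →L[ℝ] ℝ) (x₀ : M) (y : Model n) : ℝ :=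
  Real.sqrt |(chartGram Ω x₀ y).det|

/-- The Liouville measure of a chart. -/
def chartMeasure [MeasurableSpace M] (Ω : ∀ x : M, Tan n x →L[ℝ] Tan n x →L[ℝ] ℝ) (x₀ : M) : Measure M :=
  Measure.map (extChartAt 𝓘(ℝ, Model n) x₀).symm
    (((volume : Measure (Model n)).restrict (extChartAt 𝓘(ℝ, Model n) x₀).target).withDensity
      (fun y => ENNReal.ofReal (chartDensity Ω x₀ y)))

theorem liouville_eq [MeasurableSpace M] : liouville Ω = ⨆ x₀ : M, chartMeasure Ω x₀ := rfl

/-- The inverse of a chart is only known to be continuous on its target, so measurability is first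
obtained in the subtype. -/
theorem measurableSet_target_inter [MeasurableSpace M] [BorelSpace M] (x₀ : M) {B : Set M}
    (hB : MeasurableSet B) : MeasurableSet ((extChartAt 𝓘(ℝ, Model n) x₀).target ∩
      (extChartAt 𝓘(ℝ, Model n) x₀).symm ⁻¹' B) := by
  have h1 := (continuousOn_iff_continuous_domRestrict.1
    (continuousOn_extChartAt_symm (I := 𝓘(ℝ, Model n)) x₀)).measurable hB
  have h2 := MeasurableSet.subtype_image (isOpen_extChartAt_target (I := 𝓘(ℝ, Model n)) x₀).measurableSet h1
  convert h2 using 1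
  ext y
  simp [and_comm]

theorem chartMeasure_apply [MeasurableSpace M] [BorelSpace M] (x₀ : M) {B : Set M} (hB : MeasurableSet B) :
    chartMeasure Ω x₀ B = ∫⁻ y in (extChartAt 𝓘(ℝ, Model n) x₀).target ∩
      (extChartAt 𝓘(ℝ, Model n) x₀).symm ⁻¹' B, ENNReal.ofReal (chartDensity Ω x₀ y) := by
  have hT := (isOpen_extChartAt_target (I := 𝓘(ℝ, Model n)) x₀).measurableSet
  rw [chartMeasure, Measure.map_apply_of_aemeasurable
    (((continuousOn_extChartAt_symm (I := 𝓘(ℝ, Model n)) x₀).aemeasurable hT).mono_ac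
      (withDensity_absolutelyContinuous _ _)) hB, withDensity_apply', Measure.restrict_restrict' hT, inter_comm]

theorem hasMFDerivAt_symm (x₀ : M) {y : Model n} (hy : y ∈ (extChartAt 𝓘(ℝ, Model n) x₀).target) :
    HasMFDerivAt 𝓘(ℝ, Model n) 𝓘(ℝ, Model n) (extChartAt 𝓘(ℝ, Model n) x₀).symm y (dSymm x₀ y) := by
  have h := mdifferentiableWithinAt_extChartAt_symm (I := 𝓘(ℝ, Model n)) hy
  rw [ModelWithCorners.range_eq_univ, mdifferentiableWithinAt_univ] at h
  exact h.hasMFDerivAt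

theorem dSymm_mfderiv (x₀ : M) {z : M} (hz : z ∈ (extChartAt 𝓘(ℝ, Model n) x₀).source) (v : Tan n z) :
    (show Model n from dSymm x₀ (extChartAt 𝓘(ℝ, Model n) x₀ z)
      (mfderiv 𝓘(ℝ, Model n) 𝓘(ℝ, Model n) (extChartAt 𝓘(ℝ, Model n) x₀) z v)) = v := by
  have h := mfderivWithin_extChartAt_symm_comp_mfderiv_extChartAt' (I := 𝓘(ℝ, Model n)) hz
  rw [ModelWithCorners.range_eq_univ, mfderivWithin_univ] at h
  exact DFunLike.congr_fun h v

theorem isInvertible_dSymm (x₀ : M) {y : Model n} (hy : y ∈ (extChartAt 𝓘(ℝ, Model n) x₀).target) :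
    (dSymm x₀ y).IsInvertible := by
  have h := isInvertible_mfderivWithin_extChartAt_symm (I := 𝓘(ℝ, Model n)) hy
  rwa [ModelWithCorners.range_eq_univ, mfderivWithin_univ] at h

/-- The matrix of the symplectic form after a symplectic map. -/
theorem omega_transport {x x' : M} (h : x' = x) (v w : Tan n x) :
    Ω x v w = Ω x' (show Model n from v) (show Model n from w) := by subst h; rfl

/-- A change of variables: for a symplectic map the Gram matrix of `Ω` in charts changes by
congruence with the Jacobian matrix, so the square root of its determinant is multiplied by the
absolute value of the Jacobian determinant. -/
theorem chartMeasure_preimage_le [MeasurableSpace M] [BorelSpace M] {φ : M → M}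
    (hφ : ContMDiff 𝓘(ℝ, Model n) 𝓘(ℝ, Model n) ∞ φ) (hinj : Function.Injective φ)
    (hΩ : ∀ x v w, Ω (φ x) (mfderiv 𝓘(ℝ, Model n) 𝓘(ℝ, Model n) φ x v)
      (mfderiv 𝓘(ℝ, Model n) 𝓘(ℝ, Model n) φ x w) = Ω x v w) (x x' : M) {B : Set M}
    (hB : MeasurableSet B) (hBs : B ⊆ (extChartAt 𝓘(ℝ, Model n) x').source) :
    chartMeasure Ω x (φ ⁻¹' B) ≤ chartMeasure Ω x' B := by
  have hφB : MeasurableSet (φ ⁻¹' B) := hφ.continuous.measurable hB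
  rw [chartMeasure_apply x hφB, chartMeasure_apply x' hB]
  set e := extChartAt 𝓘(ℝ, Model n) x with he
  set e' := extChartAt 𝓘(ℝ, Model n) x' with he'
  set T := e.target ∩ e.symm ⁻¹' (φ ⁻¹' B) with hT
  set F : Model n → Model n := fun y => e' (φ (e.symm y)) with hF
  set F' : Model n → Model n →L[ℝ] Model n := fun y =>
    (mfderiv 𝓘(ℝ, Model n) 𝓘(ℝ, Model n) e' (φ (e.symm y))).comp
      ((mfderiv 𝓘(ℝ, Model n) 𝓘(ℝ, Model n) φ (e.symm y)).comp (dSymm x y)) with hF'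
  have hsrc : ∀ y ∈ T, φ (e.symm y) ∈ e'.source := fun y hy => hBs hy.2
  have hder : ∀ y ∈ T, HasFDerivAt F (F' y) y := by
    intro y hy
    have h1 := hasMFDerivAt_symm (n := n) x hy.1
    have h2 := (hφ.mdifferentiableAt (x := e.symm y) (by simp)).hasMFDerivAt
    have h3 := (mdifferentiableAt_extChartAt (I := 𝓘(ℝ, Model n)) (x := x') (y := φ (e.symm y))
      (by have := hsrc y hy; rwa [he', extChartAt_source] at this)).hasMFDerivAt
    exact (HasMFDerivAt.comp y h3 (HasMFDerivAt.comp y h2 h1)).hasFDerivAt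
  have hFinj : InjOn F T := by
    intro y hy z hz hyz
    exact e.symm.injOn hy.1 hz.1 (hinj (e'.injOn (hsrc y hy) (hsrc z hz) hyz))
  have himg : F '' T ⊆ e'.target ∩ e'.symm ⁻¹' B := by
    rintro _ ⟨y, hy, rfl⟩
    refine ⟨e'.map_source (hsrc y hy), ?_⟩
    change e'.symm (e' (φ (e.symm y))) ∈ B
    rw [e'.left_inv (hsrc y hy)]
    exact hy.2
  -- Only an inequality can be expected: the chart at `x` need not contain all of the preimage, so
  -- its image need not fill `B`.
  refine le_trans (le_of_eq ?_) (lintegral_mono_set himg)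
  rw [lintegral_image_eq_lintegral_abs_det_fderiv_mul volume (measurableSet_target_inter x hφB)
    (fun y hy => (hder y hy).hasFDerivWithinAt) hFinj]
  refine setLIntegral_congr_fun (measurableSet_target_inter x hφB) fun y hy => ?_
  have hgram : chartGram Ω x y = (LinearMap.toMatrix (EuclideanSpace.basisFun (Fin n ⊕ Fin n) ℝ).toBasis
      (EuclideanSpace.basisFun (Fin n ⊕ Fin n) ℝ).toBasis (F' y)).transpose * chartGram Ω x' (F y) *
      LinearMap.toMatrix (EuclideanSpace.basisFun (Fin n ⊕ Fin n) ℝ).toBasis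
      (EuclideanSpace.basisFun (Fin n ⊕ Fin n) ℝ).toBasis (F' y) := by
    have h1 : ∀ v : Model n, (show Model n from dSymm x' (F y) (F' y v)) =
        mfderiv 𝓘(ℝ, Model n) 𝓘(ℝ, Model n) φ (e.symm y) (dSymm x y v) := fun v =>
      dSymm_mfderiv x' (hsrc y hy) _
    have h2 : ∀ v w : Model n, Ω (e.symm y) (dSymm x y v) (dSymm x y w) =
        Ω (e'.symm (F y)) (dSymm x' (F y) (F' y v)) (dSymm x' (F y) (F' y w)) := by
      intro v w
      rw [← hΩ (e.symm y), omega_transport (e'.left_inv (hsrc y hy)), ← h1, ← h1]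
    have h3 : ∀ a, F' y (EuclideanSpace.single a 1) = ∑ c, LinearMap.toMatrix
        (EuclideanSpace.basisFun (Fin n ⊕ Fin n) ℝ).toBasis
        (EuclideanSpace.basisFun (Fin n ⊕ Fin n) ℝ).toBasis (F' y).toLinearMap c a •
        (EuclideanSpace.single c 1 : Model n) := by
      intro a
      have := ((EuclideanSpace.basisFun (Fin n ⊕ Fin n) ℝ).toBasis.sum_repr (F' y (EuclideanSpace.single a 1))).symm
      simpa [LinearMap.toMatrix_apply] using this
    have hG : ∀ c d, chartGram Ω x' (F y) c d = Ω (e'.symm (F y)) (dSymm x' (F y) (EuclideanSpace.single c 1 : Model n))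
        (dSymm x' (F y) (EuclideanSpace.single d 1 : Model n)) := fun c d => rfl
    ext a b
    rw [chartGram, Matrix.of_apply, h2, h3, h3]
    simp only [map_sum, map_smul, Matrix.mul_apply, Matrix.transpose_apply, hG,
      sum_apply, smul_apply, smul_eq_mul, Finset.sum_mul, Finset.mul_sum]
    refine Finset.sum_congr rfl fun c _ => Finset.sum_congr rfl fun d _ => by ring
  have hdet : (F' y).det = (LinearMap.toMatrix (EuclideanSpace.basisFun (Fin n ⊕ Fin n) ℝ).toBasis
      (EuclideanSpace.basisFun (Fin n ⊕ Fin n) ℝ).toBasis (F' y).toLinearMap).det :=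
    (LinearMap.det_toMatrix _ _).symm
  change ENNReal.ofReal (chartDensity Ω x y) = ENNReal.ofReal |(F' y).det| * ENNReal.ofReal (chartDensity Ω x' (F y))
  rw [← ENNReal.ofReal_mul (abs_nonneg _), chartDensity, hgram, Matrix.det_mul, Matrix.det_mul,
    Matrix.det_transpose, ← hdet, chartDensity, mul_right_comm, abs_mul, ← sq, abs_of_nonneg (sq_nonneg _),
    Real.sqrt_mul (sq_nonneg _), Real.sqrt_sq_eq_abs]

/-- Inequalities of measures pass to the union of two sets by splitting along one of them, and by
compactness finitely many sets suffice. -/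
theorem le_of_locally_le [CompactSpace M] [MeasurableSpace M] {μ ν : Measure M}
    (h : ∀ x : M, ∃ U ∈ 𝓝 x, MeasurableSet U ∧ ∀ B ⊆ U, MeasurableSet B → μ B ≤ ν B) : μ ≤ ν := by
  have key := isCompact_univ (X := M).induction_on
    (p := fun s => ∃ U, s ⊆ U ∧ MeasurableSet U ∧ ∀ B ⊆ U, MeasurableSet B → μ B ≤ ν B) ?_ ?_ ?_ ?_
  · obtain ⟨U, hU, -, hle⟩ := key
    exact Measure.le_iff.2 fun B hB => hle B ((subset_univ B).trans hU) hB
  · exact ⟨∅, subset_rfl, MeasurableSet.empty, fun B hB _ => by rw [subset_empty_iff.1 hB]; simp⟩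
  · rintro s t hst ⟨U, hU, h'⟩
    exact ⟨U, hst.trans hU, h'⟩
  · rintro s t ⟨U, hU, hUm, hUle⟩ ⟨V, hV, hVm, hVle⟩
    refine ⟨U ∪ V, union_subset_union hU hV, hUm.union hVm, fun B hB hBm => ?_⟩
    rw [← measure_inter_add_sdiff B hUm, ← measure_inter_add_sdiff (μ := ν) B hUm]
    refine add_le_add (hUle _ inter_subset_right (hBm.inter hUm)) (hVle _ (fun x hx => ?_) (hBm.diff hUm))
    exact (hB hx.1).resolve_left hx.2
  · intro x _
    obtain ⟨U, hU, h'⟩ := h x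
    exact ⟨U, mem_nhdsWithin_of_mem_nhds hU, U, subset_rfl, h'⟩

/-- On the source of the chart at `x`, every chart measure is bounded by the one of this chart, by
`chartMeasure_preimage_le` for the identity. So the supremum is bounded by a measure that agrees
with `chartMeasure Ω x` there. -/
theorem liouville_apply_of_subset [MeasurableSpace M] [BorelSpace M] (x : M) {B : Set M} (hB : MeasurableSet B)
    (hBs : B ⊆ (extChartAt 𝓘(ℝ, Model n) x).source) : liouville Ω B = chartMeasure Ω x B := by
  refine le_antisymm ?_ (by rw [liouville_eq]; exact le_iSup (chartMeasure Ω) x B)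
  set S := (extChartAt 𝓘(ℝ, Model n) x).source with hS
  have hSm : MeasurableSet S := (isOpen_extChartAt_source x).measurableSet
  have h : liouville Ω ≤ (liouville Ω).restrict Sᶜ + chartMeasure Ω x := by
    rw [liouville_eq]
    refine iSup_le fun x' => Measure.le_iff.2 fun A hA => ?_
    rw [← measure_inter_add_sdiff A hSm, add_comm, Measure.add_apply, Measure.restrict_apply hA]
    refine add_le_add (le_iSup (chartMeasure Ω) x' (A ∩ Sᶜ)) ?_
    refine le_trans ?_ (measure_mono (inter_subset_left (t := S)))
    exact chartMeasure_preimage_le (φ := id) contMDiff_id Function.injective_id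
      (fun y v w => by simp [mfderiv_id]) x' x (hA.inter hSm) inter_subset_right
  refine (h B).trans (le_of_eq ?_)
  rw [Measure.add_apply, Measure.restrict_apply hB, ← sdiff_eq, sdiff_eq_empty.2 hBs, measure_empty, zero_add]

theorem map_liouville_ge [CompactSpace M] [MeasurableSpace M] [BorelSpace M] {φ ψ : M → M}
    (hφ : ContMDiff 𝓘(ℝ, Model n) 𝓘(ℝ, Model n) ∞ φ) (hψ : Continuous ψ) (hψφ : ∀ x, ψ (φ x) = x)
    (hΩ : ∀ x v w, Ω (φ x) (mfderiv 𝓘(ℝ, Model n) 𝓘(ℝ, Model n) φ x v)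
      (mfderiv 𝓘(ℝ, Model n) 𝓘(ℝ, Model n) φ x w) = Ω x v w) :
    liouville Ω ≤ Measure.map ψ (liouville Ω) := by
  have h1 : ∀ x, Measure.map φ (chartMeasure Ω x) ≤ liouville Ω := by
    intro x
    refine le_of_locally_le fun y => ⟨_, extChartAt_source_mem_nhds (I := 𝓘(ℝ, Model n)) y,
      (isOpen_extChartAt_source y).measurableSet, fun B hBs hB => ?_⟩
    rw [Measure.map_apply hφ.continuous.measurable hB, liouville_apply_of_subset y hB hBs]
    exact chartMeasure_preimage_le hφ (Function.LeftInverse.injective hψφ) hΩ x y hB hBs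
  conv_lhs => rw [liouville_eq]
  refine iSup_le fun x => ?_
  have h2 := Measure.map_mono (h1 x) hψ.measurable
  rwa [Measure.map_map hψ.measurable hφ.continuous.measurable, (funext hψφ : ψ ∘ φ = id), Measure.map_id] at h2

/-- Each of the two mutually inverse symplectic maps gives one inequality. -/
theorem map_liouville_eq [CompactSpace M] [MeasurableSpace M] [BorelSpace M] {φ ψ : M → M}
    (hφ : ContMDiff 𝓘(ℝ, Model n) 𝓘(ℝ, Model n) ∞ φ) (hψ : ContMDiff 𝓘(ℝ, Model n) 𝓘(ℝ, Model n) ∞ ψ)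
    (hψφ : ∀ x, ψ (φ x) = x) (hφψ : ∀ x, φ (ψ x) = x)
    (hΩ : ∀ x v w, Ω (φ x) (mfderiv 𝓘(ℝ, Model n) 𝓘(ℝ, Model n) φ x v)
      (mfderiv 𝓘(ℝ, Model n) 𝓘(ℝ, Model n) φ x w) = Ω x v w)
    (hΩ' : ∀ x v w, Ω (ψ x) (mfderiv 𝓘(ℝ, Model n) 𝓘(ℝ, Model n) ψ x v)
      (mfderiv 𝓘(ℝ, Model n) 𝓘(ℝ, Model n) ψ x w) = Ω x v w) :
    Measure.map φ (liouville Ω) = liouville Ω := by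
  refine le_antisymm ?_ (map_liouville_ge hψ hφ.continuous hφψ hΩ')
  have h2 := Measure.map_mono (map_liouville_ge hφ hψ.continuous hψφ hΩ) hφ.continuous.measurable
  rwa [Measure.map_map hφ.continuous.measurable hψ.continuous.measurable, (funext hφψ : φ ∘ ψ = id),
    Measure.map_id] at h2

theorem IsSymplectic.contMDiffAt_apply (hΩ : IsSymplectic Ω) {E' H' N : Type*} [NormedAddCommGroup E']
    [NormedSpace ℝ E'] [TopologicalSpace H'] {J : ModelWithCorners ℝ E' H'} [TopologicalSpace N]
    [ChartedSpace H' N] {b : N → M} {V W : ∀ p, Tan n (b p)} {p₀ : N}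
    (hV : ContMDiffAt J 𝓘(ℝ, Model n).tangent ∞ (fun p => (⟨b p, V p⟩ : TangentBundle 𝓘(ℝ, Model n) M)) p₀)
    (hW : ContMDiffAt J 𝓘(ℝ, Model n).tangent ∞ (fun p => (⟨b p, W p⟩ : TangentBundle 𝓘(ℝ, Model n) M)) p₀) :
    ContMDiffAt J 𝓘(ℝ, ℝ) ∞ (fun p => Ω (b p) (V p) (W p)) p₀ := by
  have hb : ContMDiffAt J 𝓘(ℝ, Model n) ∞ b p₀ := (contMDiffAt_totalSpace.1 hV).1
  have h1 : ContMDiffAt J (𝓘(ℝ, Model n).prod 𝓘(ℝ, Model n →L[ℝ] Model n →L[ℝ] ℝ)) ∞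
      (fun p => TotalSpace.mk' (Model n →L[ℝ] Model n →L[ℝ] ℝ)
        (E := fun x : M => Tan n x →L[ℝ] Tan n x →L[ℝ] ℝ) (b p) (Ω (b p))) p₀ :=
    ContMDiffAt.comp p₀ (f := b) (hΩ.smooth (b p₀)) hb
  have h2 := ContMDiffAt.clm_bundle_apply₂ (F₁ := Model n) (F₂ := Model n) (F₃ := ℝ)
    (E₁ := fun x : M => Tan n x) (E₂ := fun x : M => Tan n x) (E₃ := Bundle.Trivial M ℝ) h1 hV hW
  exact (contMDiffAt_totalSpace.1 h2).2

theorem IsSymplectic.continuousAt_chartDensity (hΩ : IsSymplectic Ω) (x₀ : M) {y : Model n}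
    (hy : y ∈ (extChartAt 𝓘(ℝ, Model n) x₀).target) : ContinuousAt (chartDensity Ω x₀) y := by
  have hV : ∀ a, ContMDiffAt 𝓘(ℝ, Model n) 𝓘(ℝ, Model n).tangent ∞
      (fun y => (⟨(extChartAt 𝓘(ℝ, Model n) x₀).symm y, dSymm x₀ y (EuclideanSpace.single a 1 : Model n)⟩ :
        TangentBundle 𝓘(ℝ, Model n) M)) y := by
    intro a
    have hT := isOpen_extChartAt_target (I := 𝓘(ℝ, Model n)) x₀
    have h1 := (contMDiffOn_extChartAt_symm (I := 𝓘(ℝ, Model n)) (n := ∞) x₀).contMDiffOn_tangentMapWithin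
      (m := ∞) (by simp) hT.uniqueMDiffOn
    have h2 : ContMDiff 𝓘(ℝ, Model n) 𝓘(ℝ, Model n).tangent ∞
        (fun y => (⟨y, (EuclideanSpace.single a 1 : Model n)⟩ : TangentBundle 𝓘(ℝ, Model n) (Model n))) :=
      fun y => contMDiffAt_vectorSpace_iff_contDiffAt.2 contDiffAt_const
    have h3 := h1.comp (s := (extChartAt 𝓘(ℝ, Model n) x₀).target) h2.contMDiffOn fun z hz => hz
    have h4 := h3.contMDiffAt (hT.mem_nhds hy)
    refine h4.congr_of_eventuallyEq ?_
    filter_upwards [hT.mem_nhds hy] with z hz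
    simp only [Function.comp_apply, tangentMapWithin, dSymm]
    rw [mfderivWithin_of_isOpen hT hz]
    rfl
  have hdet : ContinuousAt (fun z => (chartGram Ω x₀ z).det) y := by
    simp only [Matrix.det_apply, chartGram, Matrix.of_apply]
    refine tendsto_finsetSum _ fun σ _ => Filter.Tendsto.const_smul (tendsto_finsetProd _ fun i _ => ?_) _
    exact (hΩ.contMDiffAt_apply (hV _) (hV _)).continuousAt
  exact hdet.abs.sqrt

/-- The differential of the inverse chart is invertible, so a vector in the kernel of the Gram
matrix would give a tangent vector orthogonal to all others. -/
theorem IsSymplectic.chartDensity_pos (hΩ : IsSymplectic Ω) (x₀ : M) {y : Model n}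
    (hy : y ∈ (extChartAt 𝓘(ℝ, Model n) x₀).target) : 0 < chartDensity Ω x₀ y := by
  refine Real.sqrt_pos.2 (abs_pos.2 fun h0 => ?_)
  obtain ⟨c, hc, hc0⟩ := Matrix.exists_mulVec_eq_zero_iff.2 h0
  obtain ⟨D, hD⟩ := isInvertible_dSymm x₀ hy
  have hsum : ∀ c : Fin n ⊕ Fin n → ℝ, ((WithLp.toLp 2 c : Model n)) = ∑ a, c a • (EuclideanSpace.single a 1 : Model n) := by
    intro c
    simpa using ((EuclideanSpace.basisFun (Fin n ⊕ Fin n) ℝ).sum_repr (WithLp.toLp 2 c)).symm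
  have h1 : dSymm x₀ y (WithLp.toLp 2 c : Model n) = 0 := by
    have hcl : ∀ w, Ω _ w (dSymm x₀ y (WithLp.toLp 2 c : Model n)) = 0 := by
      intro w
      obtain ⟨u, rfl⟩ : ∃ u, dSymm x₀ y u = w := ⟨D.symm w, by rw [← hD]; exact D.apply_symm_apply w⟩
      have hu : u = WithLp.toLp 2 (fun a => u a) := rfl
      rw [hu, hsum, hsum]
      simp only [map_sum, map_smul, sum_apply, smul_apply, smul_eq_mul, Finset.mul_sum]
      rw [Finset.sum_comm]
      refine Finset.sum_eq_zero fun b _ => ?_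
      have h3 : ∑ a, chartGram Ω x₀ y b a * c a = 0 := congrFun hc0 b
      calc _ = u b * ∑ a, chartGram Ω x₀ y b a * c a := by
            rw [Finset.mul_sum]
            exact Finset.sum_congr rfl fun a _ => by rw [chartGram, Matrix.of_apply]; ring
        _ = 0 := by rw [h3, mul_zero]
    refine hΩ.nondegenerate _ _ fun w => ?_
    have h2 := hΩ.alternating _ (w + dSymm x₀ y (WithLp.toLp 2 c : Model n))
    simp only [map_add, add_apply, hΩ.alternating, hcl] at h2
    linarith
  rw [← hD] at h1
  exact hc (by simpa using congrArg (fun v : Model n => (v : Fin n ⊕ Fin n → ℝ)) ((map_eq_zero_iff D D.injective).1 h1))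

/-- Needed for the definiteness of the scalar product of sections. -/
theorem IsSymplectic.isOpenPosMeasure_liouville [MeasurableSpace M] [BorelSpace M] (hΩ : IsSymplectic Ω) :
    (liouville Ω).IsOpenPosMeasure := by
  refine ⟨fun U hU hne h0 => ?_⟩
  obtain ⟨x, hx⟩ := hne
  have h1 : chartMeasure Ω x U = 0 := le_antisymm
    ((by rw [liouville_eq]; exact le_iSup (chartMeasure Ω) x U : chartMeasure Ω x U ≤ liouville Ω U).trans h0.le) bot_le
  rw [chartMeasure_apply x hU.measurableSet] at h1
  set y := extChartAt 𝓘(ℝ, Model n) x x with hy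
  have hyT : y ∈ (extChartAt 𝓘(ℝ, Model n) x).target := mem_extChartAt_target x
  have hO : IsOpen ((extChartAt 𝓘(ℝ, Model n) x).target ∩ (extChartAt 𝓘(ℝ, Model n) x).symm ⁻¹' U) :=
    (continuousOn_extChartAt_symm x).isOpen_inter_preimage (isOpen_extChartAt_target x) hU
  have hpos := hΩ.chartDensity_pos x hyT
  obtain ⟨V, hV, hVo, hyV⟩ := mem_nhds_iff.1 ((hΩ.continuousAt_chartDensity x hyT).eventually
    (lt_mem_nhds (half_lt_self hpos)))
  have h2 : ENNReal.ofReal (chartDensity Ω x y / 2) * volume (((extChartAt 𝓘(ℝ, Model n) x).target ∩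
      (extChartAt 𝓘(ℝ, Model n) x).symm ⁻¹' U) ∩ V) ≤ 0 := by
    rw [← h1, ← setLIntegral_const]
    refine (setLIntegral_mono' (hO.inter hVo).measurableSet fun z hz => ?_).trans (lintegral_mono_set inter_subset_left)
    exact ENNReal.ofReal_le_ofReal (hV hz.2).le
  have h3 := (hO.inter hVo).measure_pos volume ⟨y, ⟨hyT, by
    change (extChartAt 𝓘(ℝ, Model n) x).symm y ∈ U; rwa [hy, extChartAt_to_inv]⟩, hyV⟩
  exact absurd h2 (not_le.2 (ENNReal.mul_pos (by simpa using hpos) h3.ne'))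

/-- The density is locally bounded and `M` is compact. It follows that continuous functions are
integrable. -/
theorem IsSymplectic.isFiniteMeasure_liouville [CompactSpace M] [MeasurableSpace M] [BorelSpace M]
    (hΩ : IsSymplectic Ω) : IsFiniteMeasure (liouville Ω) := by
  have : IsLocallyFiniteMeasure (liouville Ω) := by
    refine ⟨fun x => ?_⟩
    set e := extChartAt 𝓘(ℝ, Model n) x with he
    set y := e x with hy
    have hyT : y ∈ e.target := mem_extChartAt_target x
    obtain ⟨V, hV, hVo, hyV⟩ := mem_nhds_iff.1 ((hΩ.continuousAt_chartDensity x hyT).eventually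
      (gt_mem_nhds (lt_add_one (chartDensity Ω x y))))
    have hO : IsOpen (e.source ∩ e ⁻¹' (V ∩ Metric.ball y 1)) :=
      (continuousOn_extChartAt x).isOpen_inter_preimage (isOpen_extChartAt_source x) (hVo.inter Metric.isOpen_ball)
    refine ⟨_, hO.mem_nhds ⟨mem_extChartAt_source x, hyV, Metric.mem_ball_self one_pos⟩, ?_⟩
    rw [liouville_apply_of_subset x hO.measurableSet inter_subset_left, chartMeasure_apply x hO.measurableSet]
    have hsub : e.target ∩ e.symm ⁻¹' (e.source ∩ e ⁻¹' (V ∩ Metric.ball y 1)) ⊆ V ∩ Metric.ball y 1 := by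
      intro z hz
      have := hz.2.2
      rwa [mem_preimage, e.right_inv hz.1] at this
    refine lt_of_le_of_lt (lintegral_mono_set hsub) (lt_of_le_of_lt (setLIntegral_mono'
      (hVo.inter Metric.isOpen_ball).measurableSet
      (g := fun _ => ENNReal.ofReal (chartDensity Ω x y + 1)) fun z hz => ENNReal.ofReal_le_ofReal (hV hz.1).le) ?_)
    rw [setLIntegral_const]
    exact ENNReal.mul_lt_top ENNReal.ofReal_lt_top
      (lt_of_le_of_lt (measure_mono inter_subset_right) measure_ball_lt_top)
  infer_instance

end Liouville

/-! ### The scalar products -/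

section FormInner
variable {n : ℕ} {V : Type*} [AddCommGroup V] [Module ℝ V]

/-- A quotient of two forms of top degree does not depend on the basis. The standard basis used in
`formInner` comes from the preferred chart at each point and need not vary continuously; this lemma
allows a smooth or transported frame instead. -/
theorem wedge_self_div_formPow_eq (B : V →ₗ[ℝ] V →ₗ[ℝ] ℝ) (J : V →ₗ[ℝ] V) [FiniteDimensional ℝ V]
    (hJ : ∀ v, J (J v) = -v) (hB : ∀ v, B v v = 0) (hc : ∀ v w, B (J v) (J w) = B v w)
    (hpos : ∀ v, v ≠ 0 → 0 < B v (J v)) (b b' : Module.Basis (Fin n ⊕ Fin n) ℝ V)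
    {α : V [⋀^Fin n]→ₗ[ℝ] ℂ} (hα : IsN0 J α) :
    wedge α α b / (formPow n B b : ℂ) = wedge α α b' / (formPow n B b' : ℂ) := by
  by_cases h0 : α = 0
  · subst h0
    have h : ∀ w, wedge (0 : V [⋀^Fin n]→ₗ[ℝ] ℂ) 0 w = 0 := fun w => by
      have := wedge_smul_left 0 (0 : V [⋀^Fin n]→ₗ[ℝ] ℂ) 0 w
      rwa [zero_smul, zero_mul] at this
    rw [h, h, zero_div, zero_div]
  have hne : ∀ b : Module.Basis (Fin n ⊕ Fin n) ℝ V, (formPow n B b : ℂ) ≠ 0 := by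
    intro b hb
    obtain ⟨r, hr, h⟩ := wedge_self_div_formPow_pos B J hJ hB hc hpos b hα h0
    rw [hb, div_zero] at h
    exact hr.ne (by exact_mod_cast h)
  have h := AlternatingMap.eq_mul_of_basis (wedge α α)
    (((-1) ^ (n * (n - 1) / 2) * (1 / 2) ^ n : ℂ) • MultilinearMap.alternatization (pairProd B)) b
    (wedge α α b / (formPow n B b : ℂ)) (by
      rw [AlternatingMap.smul_apply, smul_eq_mul, ← alternatization_pairProd, div_mul_cancel₀ _ (hne b)]) b'
  rw [AlternatingMap.smul_apply, smul_eq_mul, ← alternatization_pairProd] at h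
  rw [h, mul_div_cancel_right₀ _ (hne b')]

end FormInner

section FormInnerTan
variable {n : ℕ} {M : Type*} [TopologicalSpace M] [ChartedSpace (Model n) M]
  [IsManifold 𝓘(ℝ, Model n) ∞ M] {Ω : ∀ x : M, Tan n x →L[ℝ] Tan n x →L[ℝ] ℝ} {j : EndField n M}

/-- The symplectic form at a point. -/
def omegaLin (Ω : ∀ x : M, Tan n x →L[ℝ] Tan n x →L[ℝ] ℝ) (x : M) : Tan n x →ₗ[ℝ] Tan n x →ₗ[ℝ] ℝ :=
  (ContinuousLinearMap.coeLM ℝ).comp (Ω x).toLinearMap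

theorem formInner_self_eq (hΩ : IsSymplectic Ω) (hj : IsCompatible Ω j) {x : M} {α : NForm n x}
    (hα : α ∈ Lam j x) (b : Module.Basis (Fin n ⊕ Fin n) ℝ (Tan n x)) :
    formInner Ω α α = Complex.I ^ ((n : ℤ) * (2 - n)) * (wedgeConj α α b / (omegaPow Ω b : ℂ)) := by
  rw [formInner, ← tanBasis_coe, mul_div_assoc]
  congr 1
  exact wedge_self_div_formPow_eq (omegaLin Ω x) (j x).toLinearMap (hj.sq x) (hΩ.alternating x)
    (hj.compatible x) (hj.positive x) (tanBasis x) b (mem_Lam_iff.1 hα)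

theorem exists_formInner_self_eq (hΩ : IsSymplectic Ω) (hj : IsCompatible Ω j) {x : M} {α : NForm n x}
    (hα : α ∈ Lam j x) (h0 : α ≠ 0) (b : Module.Basis (Fin n ⊕ Fin n) ℝ (Tan n x)) :
    ∃ r : ℝ, 0 < r ∧ Complex.I ^ ((n : ℤ) * (2 - n)) * wedgeConj α α b / (omegaPow Ω b : ℂ) = r :=
  wedge_self_div_formPow_pos (omegaLin Ω x) (j x).toLinearMap (hj.sq x) (hΩ.alternating x)
    (hj.compatible x) (hj.positive x) b (mem_Lam_iff.1 hα)
    fun h => h0 (ContinuousAlternatingMap.toAlternatingMap_injective h)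

theorem formInner_self_re_pos (hΩ : IsSymplectic Ω) (hj : IsCompatible Ω j) {x : M} {α : NForm n x}
    (hα : α ∈ Lam j x) (h0 : α ≠ 0) : 0 < (formInner Ω α α).re := by
  obtain ⟨r, hr, h⟩ := exists_formInner_self_eq hΩ hj hα h0 (tanBasis x)
  rw [formInner, ← tanBasis_coe, h]
  exact hr

theorem omegaPow_ne_zero (hΩ : IsSymplectic Ω) (hj : IsCompatible Ω j) {x : M} {α : NForm n x}
    (hα : α ∈ Lam j x) (h0 : α ≠ 0) (b : Module.Basis (Fin n ⊕ Fin n) ℝ (Tan n x)) : omegaPow Ω b ≠ 0 := by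
  intro hb
  obtain ⟨r, hr, h⟩ := exists_formInner_self_eq hΩ hj hα h0 b
  rw [hb, Complex.ofReal_zero, div_zero] at h
  exact hr.ne (by exact_mod_cast h)

theorem formInner_smul_self {x : M} (c : ℂ) (α : NForm n x) :
    formInner Ω (c • α) (c • α) = ((Complex.normSq c : ℝ) : ℂ) * formInner Ω α α := by
  have h1 := wedge_smul_left c α.toAlternatingMap (c • α).toAlternatingMap (stdBasis x)
  have h2 := wedge_smul_right c α.toAlternatingMap α.toAlternatingMap (stdBasis x)
  have h3 : wedgeConj (c • α) (c • α) (stdBasis x) = c * (conj c * wedgeConj α α (stdBasis x)) :=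
    h1.trans (congrArg (c * ·) h2)
  rw [formInner, h3, formInner, ← Complex.mul_conj]
  ring

/-- The scalar products of forms are preserved by symplectic maps. -/
theorem formInner_comp (hΩ : IsSymplectic Ω) (hj : IsCompatible Ω j) {x y : M}
    (D : Tan n x ≃L[ℝ] Tan n y) (hD : ∀ v w, Ω y (D v) (D w) = Ω x v w) {α : NForm n y} (hα : α ∈ Lam j y) :
    formInner Ω (α.compContinuousLinearMap (D : Tan n x →L[ℝ] Tan n y))
      (α.compContinuousLinearMap (D : Tan n x →L[ℝ] Tan n y)) = formInner Ω α α := by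
  rw [formInner_self_eq hΩ hj hα ((tanBasis x).map D.toLinearEquiv), formInner, mul_div_assoc]
  have h1 : ⇑((tanBasis x).map D.toLinearEquiv) = fun a => D (stdBasis x a) := by
    ext1 a
    rw [Module.Basis.map_apply, tanBasis_coe]
    rfl
  rw [h1]
  congr 2
  · have hf : ((n.factorial * n.factorial : ℕ) : ℂ) ≠ 0 := by
      exact_mod_cast Nat.mul_ne_zero n.factorial_ne_zero n.factorial_ne_zero
    apply mul_left_cancel₀ hf
    rw [wedgeConj_eq, wedgeConj_eq, factorial_mul_wedge, factorial_mul_wedge]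
    rfl
  · simp only [omegaPow, hD]

end FormInnerTan

/-! ### The pointwise scalar product of L^k ⊗ δ -/

section FibreInner
variable {n : ℕ} {M : Type*} [TopologicalSpace M] [ChartedSpace (Model n) M]
  [IsManifold 𝓘(ℝ, Model n) ∞ M] [T2Space M] {Ω : ∀ x : M, Tan n x →L[ℝ] Tan n x →L[ℝ] ℝ}
  {L : M → Type*} [TopologicalSpace (TotalSpace ℂ L)] [∀ x, NormedAddCommGroup (L x)]
  [∀ x, InnerProductSpace ℂ (L x)] [FiberBundle ℂ L] [VectorBundle ℂ ℂ L] [VectorBundle ℝ ℂ L]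
  [ContMDiffVectorBundle ∞ ℂ L 𝓘(ℝ, Model n)]
  {nab : CovariantDerivative 𝓘(ℝ, Model n) ℂ L} [CovariantDerivative.ContMDiffCovariantDerivative nab ∞]
  {δ : M → Type*} [TopologicalSpace (TotalSpace ℂ δ)] [∀ x, AddCommGroup (δ x)]
  [∀ x, Module ℂ (δ x)] [∀ x, TopologicalSpace (δ x)] [FiberBundle ℂ δ] [VectorBundle ℂ ℂ δ]
  [VectorBundle ℝ ℂ δ] [ContMDiffVectorBundle ∞ ℂ δ 𝓘(ℝ, Model n)]
  {H : HalfFormFamily Ω δ} {k : ℕ} {f : M → ℝ} {φ : ℝ → M → M} {Φ : ∀ t x, L x ≃ₗ[ℂ] L (φ t x)}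
  {j j₀ : EndField n M} {θ : ∀ t x, δ (φ t x) →ₗ[ℂ] δ x}

/-- The square of the norm of an element of `δ_j`. -/
def deltaNormSq (H : HalfFormFamily Ω δ) (j : EndField n M) {x : M} (u : δ x) : ℝ :=
  Real.sqrt (formInner Ω (H.form j x (u ⊗ₜ[ℂ] u)) (H.form j x (u ⊗ₜ[ℂ] u))).re

theorem deltaNormSq_smul {x : M} (c : ℂ) (u : δ x) :
    deltaNormSq H j (c • u) = ‖c‖ ^ 2 * deltaNormSq H j u := by
  rw [deltaNormSq, TensorProduct.smul_tmul_smul, map_smul, formInner_smul_self, Complex.re_ofReal_mul,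
    Real.sqrt_mul (Complex.normSq_nonneg _), deltaNormSq, map_mul, Real.sqrt_mul_self (Complex.normSq_nonneg _),
    Complex.normSq_eq_norm_sq]

/-- The definition uses the preferred frames at `x`; here any vectors of the two lines may be used,
because both sides scale alike. -/
theorem fibreInner_smul {x : M} (c c' : ℂ) (a : L x) (u : δ x) :
    fibreInner H j x (c • (tpow k a ⊗ₜ[ℂ] u)) (c' • (tpow k a ⊗ₜ[ℂ] u)) =
      c * conj c' * ((‖a‖ ^ (2 * k) * deltaNormSq H j u : ℝ) : ℂ) := by
  have ha := eq_lcoord_smul_frame (mem_dom (E := L) x) a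
  have hu := eq_lcoord_smul_frame (mem_dom (E := δ) x) u
  have h1 : ‖a‖ ^ (2 * k) = ‖lcoord L x x a‖ ^ (2 * k) * ‖frame L x x‖ ^ (2 * k) := by
    conv_lhs => rw [ha]
    rw [norm_smul, mul_pow]
  have h2 : deltaNormSq H j u = ‖lcoord δ x x u‖ ^ 2 * deltaNormSq H j (frame δ x x) := by
    conv_lhs => rw [hu]
    rw [deltaNormSq_smul]
  change coef k x x _ * conj (coef k x x _) * ((‖frame L x x‖ ^ (2 * k) : ℝ) : ℂ) *
    ((deltaNormSq H j (frame δ x x) : ℝ) : ℂ) = _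
  rw [map_smul, map_smul, coef_tmul, smul_eq_mul, smul_eq_mul, h1, h2]
  have h3 : ∀ z : ℂ, z * conj z = ((‖z‖ ^ 2 : ℝ) : ℂ) := fun z => by
    rw [Complex.mul_conj, Complex.normSq_eq_norm_sq]
  have h4 : lcoord L x x a ^ k * conj (lcoord L x x a) ^ k = ((‖lcoord L x x a‖ ^ (2 * k) : ℝ) : ℂ) := by
    rw [← mul_pow, h3, ← Complex.ofReal_pow, ← pow_mul]
  push_cast at h4 ⊢
  rw [map_mul, map_mul, map_pow, ← h4]
  have h5 := h3 (lcoord δ x x u)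
  push_cast at h5
  rw [← h5]
  ring

theorem deltaNormSq_pos (hΩ : IsSymplectic Ω) (hj : IsCompatible Ω j) {x : M} {u : δ x} (hu : u ≠ 0) :
    0 < deltaNormSq H j u :=
  Real.sqrt_pos.2 (formInner_self_re_pos hΩ hj (H.mem_Lam hj x _) (H.ne_zero hj hu))

theorem deltaNormSq_lift (hΩ : IsSymplectic Ω) {X : ∀ x : M, Tan n x} (hφ : IsFlow X φ)
    (hinv : ∀ t x v w, Ω (φ t x) (dφ φ t x v) (dφ φ t x w) = Ω x v w) (hj : IsCompatible Ω j₀)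
    (hθ : IsHalfFormLift H φ j₀ θ) (t : ℝ) (x : M) (u : δ (φ t x)) :
    deltaNormSq H (pullbackEnd (φ t) j₀) (θ t x u) = deltaNormSq H j₀ u := by
  obtain ⟨D, hD⟩ := hφ.mfderiv_isInvertible t x
  have h1 : H.form (pullbackEnd (φ t) j₀) x (θ t x u ⊗ₜ[ℂ] θ t x u) =
      (H.form j₀ (φ t x) (u ⊗ₜ[ℂ] u)).compContinuousLinearMap (D : Tan n x →L[ℝ] Tan n (φ t x)) := by
    ext v
    rw [hθ.square t x u v, hD]
    rfl
  rw [deltaNormSq, h1, formInner_comp hΩ hj D (fun v w => ?_) (H.mem_Lam hj _ _), deltaNormSq]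
  have := hinv t x v w
  rwa [← hD] at this

/-- The lift to `L` is unitary, and the norm of a half-form is read on its square, which the lift
carries over by a symplectic linear map. -/
theorem fibreInner_action (hΩ : IsSymplectic Ω) (hf : ContMDiff 𝓘(ℝ, Model n) 𝓘(ℝ, ℝ) ∞ f)
    (hL : IsPrequantization Ω nab) (hφ : IsFlow (hamVF Ω f) φ) (hΦ : IsExp nab f φ Φ)
    (hj : IsCompatible Ω j₀) (hθ : IsHalfFormLift H φ j₀ θ) (t : ℝ) (s r : Sec L δ k) (x : M) :
    fibreInner H (pullbackEnd (φ t) j₀) x (action Φ θ t s x) (action Φ θ t r x) =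
      fibreInner H j₀ (φ t x) (s (φ t x)) (r (φ t x)) := by
  obtain ⟨a, -, -, ha⟩ := exists_smoothSec_eq_frame (n := n) (E := L) (φ t x)
  obtain ⟨β, -, -, hβ⟩ := exists_smoothSec_eq_frame (n := n) (E := δ) (φ t x)
  obtain ⟨c, hc⟩ := exists_eq_smul_tpow_tmul (k := k) ha hβ (s (φ t x))
  obtain ⟨c', hc'⟩ := exists_eq_smul_tpow_tmul (k := k) ha hβ (r (φ t x))
  rw [action_eq hc, action_eq hc', fibreInner_smul, hc, hc', fibreInner_smul,
    deltaNormSq_lift hΩ hφ (hΦ.omega_mfderiv hΩ hf hL hφ) hj hθ]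
  have h1 : ‖pull Φ t a x‖ = ‖a (φ t x)‖ := by
    have h2 := hΦ.inner_map hL hφ t x (pull Φ t a x) (pull Φ t a x)
    rw [pull, LinearEquiv.apply_symm_apply, inner_self_eq_norm_sq_to_K, inner_self_eq_norm_sq_to_K] at h2
    have h3 : ‖a (φ t x)‖ ^ 2 = ‖pull Φ t a x‖ ^ 2 := by exact_mod_cast h2
    exact (sq_eq_sq₀ (norm_nonneg _) (norm_nonneg _)).1 h3.symm
  rw [h1]

/-- By `formInner_self_eq` the norm may be computed on a smooth local frame of vector fields, where
every ingredient is continuous. -/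
theorem continuousAt_deltaNormSq (hΩ : IsSymplectic Ω) (hj : IsCompatible Ω j) {β : ∀ x, δ x}
    (hβ : SmoothSecOn (n := n) δ univ β) {x : M} (h0 : β x ≠ 0) :
    ContinuousAt (fun y => deltaNormSq H j (β y)) x := by
  obtain ⟨Y, hY, hYb⟩ := exists_local_frame (n := n) x
  have hbasis : ∀ᶠ y in 𝓝 x, ∃ b : Module.Basis (Fin n ⊕ Fin n) ℝ (Tan n y), ⇑b = fun a => Y a y := by
    filter_upwards [hYb] with y hy
    have hsp : (⊤ : Submodule ℝ (Tan n y)) ≤ Submodule.span ℝ (range fun a => Y a y) := by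
      intro v _
      rw [hy v]
      exact Submodule.sum_mem _ fun a _ => Submodule.smul_mem _ _ (Submodule.subset_span ⟨a, rfl⟩)
    exact ⟨basisOfTopLeSpanOfCardEqFinrank _ hsp (Module.finrank_eq_card_basis (tanBasis y)).symm,
      coe_basisOfTopLeSpanOfCardEqFinrank _ hsp _⟩
  set F : M → ℂ := fun y => Complex.I ^ ((n : ℤ) * (2 - n)) *
    (wedgeConj (H.form j y (β y ⊗ₜ[ℂ] β y)) (H.form j y (β y ⊗ₜ[ℂ] β y)) (fun a => Y a y) /
      (omegaPow Ω (fun a => Y a y) : ℂ)) with hF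
  have hform : ∀ Z : Fin n → Fin n ⊕ Fin n,
      ContinuousAt (fun y => H.form j y (β y ⊗ₜ[ℂ] β y) (fun i => Y (Z i) y)) x := fun Z =>
    ((H.smooth _ hj.isSmoothCurve_const β β (fun i => Y (Z i)) hβ hβ fun i => hY _).continuous.comp
      (Continuous.prodMk_right (0 : ℝ))).continuousAt
  have hf0 : ((n.factorial * n.factorial : ℕ) : ℂ) ≠ 0 := by
    exact_mod_cast Nat.mul_ne_zero n.factorial_ne_zero n.factorial_ne_zero
  have hFc : ContinuousAt F x := by
    refine continuousAt_const.mul (ContinuousAt.div ?_ ?_ ?_)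
    · have h1 : ∀ y, wedgeConj (H.form j y (β y ⊗ₜ[ℂ] β y)) (H.form j y (β y ⊗ₜ[ℂ] β y)) (fun a => Y a y) =
          ((n.factorial * n.factorial : ℕ) : ℂ)⁻¹ *
            ∑ σ : Equiv.Perm (Fin n ⊕ Fin n), ((Equiv.Perm.sign σ : ℤ) : ℂ) *
              (H.form j y (β y ⊗ₜ[ℂ] β y) (fun i => Y (σ (Sum.inl i)) y) *
                conj (H.form j y (β y ⊗ₜ[ℂ] β y) (fun i => Y (σ (Sum.inr i)) y))) := by
        intro y
        rw [eq_inv_mul_iff_mul_eq₀ hf0]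
        exact factorial_mul_wedge _ _ _
      simp only [h1]
      refine continuousAt_const.mul (tendsto_finsetSum _ fun σ _ => continuousAt_const.mul ((hform _).mul ?_))
      exact (hform _).star
    · refine Complex.continuous_ofReal.continuousAt.comp ?_
      refine continuousAt_const.mul (tendsto_finsetSum _ fun σ _ => continuousAt_const.mul
        (tendsto_finsetProd _ fun i _ => ?_))
      exact (hΩ.contMDiffAt_apply (b := fun y => y) (hY _ x) (hY _ x)).continuousAt
    · obtain ⟨b, hb⟩ := hbasis.self_of_nhds
      rw [← hb]
      exact_mod_cast omegaPow_ne_zero hΩ hj (H.mem_Lam hj x _) (H.ne_zero hj h0) b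
  have h2 : ContinuousAt (fun y => Real.sqrt (F y).re) x := (Complex.continuous_re.continuousAt.comp hFc).sqrt
  refine h2.congr ?_
  filter_upwards [hbasis] with y ⟨b, hb⟩
  rw [deltaNormSq, formInner_self_eq hΩ hj (H.mem_Lam hj y _) b, hb]

theorem continuous_fibreInner (hΩ : IsSymplectic Ω) (hL : IsPrequantization Ω nab) (hj : IsCompatible Ω j)
    {s r : Sec L δ k} (hs : s ∈ preQ n L δ k) (hr : r ∈ preQ n L δ k) :
    Continuous fun x => fibreInner H j x (s x) (r x) := by
  refine continuous_iff_continuousAt.2 fun x => ?_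
  obtain ⟨a, β, ha, hβ, h⟩ := exists_frame_form (n := n) L δ k x
  obtain ⟨U, g, hU, hx, hg, h0, hsg⟩ := h s hs
  obtain ⟨W, g', hW, hx', hg', -, hrg⟩ := h r hr
  have h1 : ContinuousAt (fun y => ‖a y‖ ^ (2 * k)) x := by
    have h2 : ∀ y, ‖a y‖ ^ (2 * k) = (⟪a y, a y⟫_ℂ).re ^ k := fun y => by
      rw [pow_mul, ← inner_self_eq_norm_sq (𝕜 := ℂ)]; rfl
    simp only [h2]
    exact ((Complex.continuous_re.comp (hL.smooth_inner a a ha ha).continuous).pow k).continuousAt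
  have h3 : ContinuousAt (fun y => g y * conj (g' y) * ((‖a y‖ ^ (2 * k) * deltaNormSq H j (β y) : ℝ) : ℂ)) x :=
    (hg.continuous.continuousAt.mul hg'.continuous.continuousAt.star).mul
      (Complex.continuous_ofReal.continuousAt.comp (h1.mul (continuousAt_deltaNormSq hΩ hj hβ (h0 x hx).2)))
  refine h3.congr ?_
  filter_upwards [hU.mem_nhds hx, hW.mem_nhds hx'] with y hy hy'
  rw [hsg y hy, hrg y hy', fibreInner_smul]

end FibreInner

/-! ### The scalar product of sections and orthogonal projections -/

section SecInner
variable {n : ℕ} {M : Type*} [TopologicalSpace M] [ChartedSpace (Model n) M]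
  [IsManifold 𝓘(ℝ, Model n) ∞ M] [T2Space M] {Ω : ∀ x : M, Tan n x →L[ℝ] Tan n x →L[ℝ] ℝ}
  {L : M → Type*} [TopologicalSpace (TotalSpace ℂ L)] [∀ x, NormedAddCommGroup (L x)]
  [∀ x, InnerProductSpace ℂ (L x)] [FiberBundle ℂ L] [VectorBundle ℂ ℂ L] [VectorBundle ℝ ℂ L]
  [ContMDiffVectorBundle ∞ ℂ L 𝓘(ℝ, Model n)]
  {nab : CovariantDerivative 𝓘(ℝ, Model n) ℂ L} [CovariantDerivative.ContMDiffCovariantDerivative nab ∞]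
  {δ : M → Type*} [TopologicalSpace (TotalSpace ℂ δ)] [∀ x, AddCommGroup (δ x)]
  [∀ x, Module ℂ (δ x)] [∀ x, TopologicalSpace (δ x)] [FiberBundle ℂ δ] [VectorBundle ℂ ℂ δ]
  [VectorBundle ℝ ℂ δ] [ContMDiffVectorBundle ∞ ℂ δ 𝓘(ℝ, Model n)]
  {H : HalfFormFamily Ω δ} {k : ℕ} {f : M → ℝ} {φ : ℝ → M → M} {Φ : ∀ t x, L x ≃ₗ[ℂ] L (φ t x)}
  {j j₀ : EndField n M} {θ : ∀ t x, δ (φ t x) →ₗ[ℂ] δ x}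
variable [CompactSpace M] [MeasurableSpace M] [BorelSpace M]

variable (n L δ k) in
/-- The prequantum space as a subspace of the space of all sections. -/
def preQSubmodule : Submodule ℂ (Sec L δ k) where
  carrier := preQ n L δ k
  add_mem' := fun {s r} hs hr x₀ => by
    have h := (hs x₀).add (hr x₀)
    exact h.congr_of_eventuallyEq (Filter.Eventually.of_forall fun x => map_add (coef k x₀ x) (s x) (r x))
  zero_mem' := fun x₀ => by
    have h : ContMDiffAt 𝓘(ℝ, Model n) 𝓘(ℝ, ℂ) ∞ (fun _ : M => (0 : ℂ)) x₀ := contMDiffAt_const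
    exact h.congr_of_eventuallyEq (Filter.Eventually.of_forall fun x => map_zero (coef k x₀ x))
  smul_mem' := fun c s hs x₀ => by
    have h := ContMDiffAt.cmul (contMDiffAt_const (c := c)) (hs x₀)
    exact h.congr_of_eventuallyEq (Filter.Eventually.of_forall fun x => map_smul (coef k x₀ x) c (s x))

theorem integrable_fibreInner (hΩ : IsSymplectic Ω) (hL : IsPrequantization Ω nab) (hj : IsCompatible Ω j)
    {s r : Sec L δ k} (hs : s ∈ preQ n L δ k) (hr : r ∈ preQ n L δ k) :
    Integrable (fun x => fibreInner H j x (s x) (r x)) (liouville Ω) := by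
  have := hΩ.isFiniteMeasure_liouville
  exact (continuous_fibreInner hΩ hL hj hs hr).integrable_of_hasCompactSupport (HasCompactSupport.of_compactSpace _)

theorem secInner_add_left (hΩ : IsSymplectic Ω) (hL : IsPrequantization Ω nab) (hj : IsCompatible Ω j)
    {s s' r : Sec L δ k} (hs : s ∈ preQ n L δ k) (hs' : s' ∈ preQ n L δ k) (hr : r ∈ preQ n L δ k) :
    secInner H j (s + s') r = secInner H j s r + secInner H j s' r := by
  rw [secInner, secInner, secInner, ← integral_add (integrable_fibreInner hΩ hL hj hs hr)
    (integrable_fibreInner hΩ hL hj hs' hr)]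
  congr 1
  ext x
  simp only [fibreInner, Pi.add_apply, map_add]
  ring

theorem secInner_smul_left (c : ℂ) (s r : Sec L δ k) :
    secInner H j (c • s) r = c * secInner H j s r := by
  rw [secInner, secInner, ← integral_const_mul]
  congr 1
  ext x
  simp only [fibreInner, Pi.smul_apply, map_smul, smul_eq_mul]
  ring

theorem secInner_add_right (hΩ : IsSymplectic Ω) (hL : IsPrequantization Ω nab) (hj : IsCompatible Ω j)
    {s r r' : Sec L δ k} (hs : s ∈ preQ n L δ k) (hr : r ∈ preQ n L δ k) (hr' : r' ∈ preQ n L δ k) :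
    secInner H j s (r + r') = secInner H j s r + secInner H j s r' := by
  rw [secInner, secInner, secInner, ← integral_add (integrable_fibreInner hΩ hL hj hs hr)
    (integrable_fibreInner hΩ hL hj hs hr')]
  congr 1
  ext x
  simp only [fibreInner, Pi.add_apply, map_add]
  ring

theorem secInner_smul_right (c : ℂ) (s r : Sec L δ k) :
    secInner H j s (c • r) = conj c * secInner H j s r := by
  rw [secInner, secInner, ← integral_const_mul]
  congr 1
  ext x
  simp only [fibreInner, Pi.smul_apply, map_smul, smul_eq_mul, map_mul]
  ring

/-- The integrand is continuous and nonnegative, and the Liouville measure charges every nonempty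
open set, so a zero integral forces it to vanish everywhere. -/
theorem eq_zero_of_secInner_self (hΩ : IsSymplectic Ω) (hL : IsPrequantization Ω nab) (hj : IsCompatible Ω j)
    {s : Sec L δ k} (hs : s ∈ preQ n L δ k) (h : secInner H j s s = 0) : s = 0 := by
  have := hΩ.isOpenPosMeasure_liouville
  set N : M → ℝ := fun x => Complex.normSq (coef k x x (s x)) * (‖frame L x x‖ ^ (2 * k) * deltaNormSq H j (frame δ x x))
    with hN
  have h1 : ∀ x, fibreInner H j x (s x) (s x) = (N x : ℂ) := by
    intro x
    rw [hN]
    push_cast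
    rw [← Complex.mul_conj, ← mul_assoc, ← Complex.ofReal_pow]
    rfl
  have hNn : ∀ x, 0 ≤ N x := fun x => mul_nonneg (Complex.normSq_nonneg _)
    (mul_nonneg (pow_nonneg (norm_nonneg _) _) (Real.sqrt_nonneg _))
  have hNc : Continuous N := by
    have := Complex.continuous_re.comp (continuous_fibreInner (H := H) hΩ hL hj hs hs)
    exact this.congr fun x => by rw [Function.comp_apply, h1, Complex.ofReal_re]
  have hNi : Integrable N (liouville Ω) := by
    have := hΩ.isFiniteMeasure_liouville
    exact hNc.integrable_of_hasCompactSupport (HasCompactSupport.of_compactSpace _)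
  rw [secInner, integral_congr_ae (Filter.Eventually.of_forall h1), integral_complex_ofReal,
    Complex.ofReal_eq_zero, integral_eq_zero_iff_of_nonneg hNn hNi, hNc.ae_eq_iff_eq _ continuous_zero] at h
  ext x
  have h2 := congrFun h x
  have h3 : 0 < ‖frame L x x‖ ^ (2 * k) * deltaNormSq H j (frame δ x x) :=
    mul_pos (pow_pos (norm_pos_iff.2 (frame_ne_zero (mem_dom x))) _)
      (deltaNormSq_pos hΩ hj (frame_ne_zero (mem_dom x)))
  refine coef_injective (k := k) (mem_dom x) (mem_dom x) ?_
  rw [Pi.zero_apply, map_zero]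
  exact Complex.normSq_eq_zero.1 ((mul_eq_zero.1 h2).resolve_right h3.ne')

/-- The action is unitary: the pointwise identity is integrated, using that the flow preserves the
Liouville measure. -/
theorem secInner_action (hΩ : IsSymplectic Ω) (hf : ContMDiff 𝓘(ℝ, Model n) 𝓘(ℝ, ℝ) ∞ f)
    (hL : IsPrequantization Ω nab) (hφ : IsFlow (hamVF Ω f) φ) (hΦ : IsExp nab f φ Φ)
    (hj : IsCompatible Ω j₀) (hθ : IsHalfFormLift H φ j₀ θ) (t : ℝ) (s r : Sec L δ k) :
    secInner H (pullbackEnd (φ t) j₀) (action Φ θ t s) (action Φ θ t r) = secInner H j₀ s r := by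
  have hinv := hΦ.omega_mfderiv hΩ hf hL hφ
  have h1 := map_liouville_eq (hφ.contMDiff_map t) (hφ.contMDiff_map (-t)) (hφ.neg_apply t) (hφ.apply_neg t)
    (hinv t) (hinv (-t))
  let e : M ≃ₜ M := ⟨⟨φ t, φ (-t), hφ.neg_apply t, hφ.apply_neg t⟩, (hφ.contMDiff_map t).continuous,
    (hφ.contMDiff_map (-t)).continuous⟩
  have h2 := integral_map_equiv (μ := liouville Ω) e.toMeasurableEquiv (fun y => fibreInner H j₀ y (s y) (r y))
  have h3 : Measure.map e.toMeasurableEquiv (liouville Ω) = liouville Ω := h1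
  rw [h3] at h2
  rw [secInner, secInner, h2]
  refine integral_congr_ae (Filter.Eventually.of_forall fun x => ?_)
  exact fibreInner_action hΩ hf hL hφ hΦ hj hθ t s r x

theorem sub_mem_preQ {s r : Sec L δ k} (hs : s ∈ preQ n L δ k) (hr : r ∈ preQ n L δ k) : s - r ∈ preQ n L δ k := by
  intro x₀
  have h := (hs x₀).sub (hr x₀)
  exact h.congr_of_eventuallyEq (Filter.Eventually.of_forall fun x => map_sub (coef k x₀ x) (s x) (r x))

theorem sum_mem_preQ {d : ℕ} {e : Fin d → Sec L δ k} (he : ∀ i, e i ∈ preQ n L δ k) (c : Fin d → ℂ) :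
    ∑ i, c i • e i ∈ preQ n L δ k :=
  (preQSubmodule n L δ k).sum_mem fun i _ => (preQSubmodule n L δ k).smul_mem (c i) (he i)

theorem secInner_sum_right (hΩ : IsSymplectic Ω) (hL : IsPrequantization Ω nab) (hj : IsCompatible Ω j) {d : ℕ}
    {e : Fin d → Sec L δ k} (he : ∀ i, e i ∈ preQ n L δ k) {s : Sec L δ k} (hs : s ∈ preQ n L δ k)
    (h : ∀ i, secInner H j s (e i) = 0) (c : Fin d → ℂ) : secInner H j s (∑ i, c i • e i) = 0 := by
  have key : ∀ T : Finset (Fin d), secInner H j s (∑ i ∈ T, c i • e i) = 0 ∧ ∑ i ∈ T, c i • e i ∈ preQ n L δ k := by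
    intro T
    induction T using Finset.induction_on with
    | empty =>
      refine ⟨?_, (preQSubmodule n L δ k).zero_mem⟩
      rw [Finset.sum_empty]
      simp [secInner, fibreInner]
    | insert i T hi ih =>
      have hm : c i • e i ∈ preQ n L δ k := (preQSubmodule n L δ k).smul_mem (c i) (he i)
      rw [Finset.sum_insert hi]
      refine ⟨?_, (preQSubmodule n L δ k).add_mem hm ih.2⟩
      rw [secInner_add_right hΩ hL hj hs hm ih.2, secInner_smul_right, h i, ih.1, mul_zero, add_zero]
  exact (key Finset.univ).1

/-- The orthogonal projection onto a space with a finite basis. -/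
theorem exists_orthogonal_projection (hΩ : IsSymplectic Ω) (hL : IsPrequantization Ω nab) (hj : IsCompatible Ω j) {d : ℕ}
    {e : Fin d → Sec L δ k} (he : ∀ i, e i ∈ preQ n L δ k) (hli : ∀ c : Fin d → ℂ, ∑ i, c i • e i = 0 → c = 0)
    {s : Sec L δ k} (hs : s ∈ preQ n L δ k) :
    ∃ c : Fin d → ℂ, ∀ c' : Fin d → ℂ, secInner H j (s - ∑ i, c i • e i) (∑ i, c' i • e i) = 0 := by
  have hmem := fun c => sum_mem_preQ (n := n) he c
  let A : (Fin d → ℂ) →ₗ[ℂ] (Fin d → ℂ) :=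
    { toFun := fun c l => secInner H j (∑ i, c i • e i) (e l)
      map_add' := fun c c' => funext fun l => by
        rw [Pi.add_apply, ← secInner_add_left hΩ hL hj (hmem c) (hmem c') (he l), ← Finset.sum_add_distrib]
        simp only [Pi.add_apply, add_smul]
      map_smul' := fun a c => funext fun l => by
        rw [Pi.smul_apply, RingHom.id_apply, smul_eq_mul, ← secInner_smul_left, Finset.smul_sum]
        simp only [Pi.smul_apply, smul_eq_mul, mul_smul] }
  -- A combination of the `e i` that is orthogonal to each of them is orthogonal to itself, hence
  -- zero. So the Gram map is injective, and surjective by dimension.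
  have hinj : Function.Injective A := (injective_iff_map_eq_zero A).2 fun c hc =>
    hli c (eq_zero_of_secInner_self hΩ hL hj (hmem c)
      (secInner_sum_right hΩ hL hj he (hmem c) (fun i => congrFun hc i) c))
  obtain ⟨c, hc⟩ := LinearMap.injective_iff_surjective.1 hinj (fun i => secInner H j s (e i))
  have hsq : s - ∑ i, c i • e i ∈ preQ n L δ k := sub_mem_preQ hs (hmem c)
  refine ⟨c, secInner_sum_right hΩ hL hj he hsq fun i => ?_⟩
  have h1 := secInner_add_left (H := H) hΩ hL hj hsq (hmem c) (he i)
  rw [sub_add_cancel, ← congrFun hc i] at h1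
  exact (right_eq_add.1 h1)

end SecInner

/-! ### Comparison of finite frames -/

section LinearFrames
variable {E : Type*} [AddCommMonoid E] [Module ℂ E]

theorem exists_linearMap_of_range_subset {d d' : ℕ} {e : Fin d → E} {e' : Fin d' → E}
    (he : Function.Injective (Fintype.linearCombination ℂ e))
    (h : range (Fintype.linearCombination ℂ e) ⊆ range (Fintype.linearCombination ℂ e')) :
    ∃ A : (Fin d → ℂ) →ₗ[ℂ] (Fin d' → ℂ), Function.Injective A ∧
      ∀ c, Fintype.linearCombination ℂ e' (A c) = Fintype.linearCombination ℂ e c := by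
  have h1 : ∀ i, ∃ m, Fintype.linearCombination ℂ e' m = e i := fun i => h ⟨Pi.single i 1, by simp⟩
  choose m hm using h1
  have h2 : ∀ c, Fintype.linearCombination ℂ e' (Fintype.linearCombination ℂ m c) = Fintype.linearCombination ℂ e c := by
    intro c
    rw [Fintype.linearCombination_apply ℂ m c, map_sum, Fintype.linearCombination_apply ℂ e c]
    exact Finset.sum_congr rfl fun i _ => by rw [map_smul, hm]
  refine ⟨_, fun c c' hc => he ?_, h2⟩
  rw [← h2, ← h2, hc]

theorem card_le_of_range_subset {d d' : ℕ} {e : Fin d → E} {e' : Fin d' → E}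
    (he : Function.Injective (Fintype.linearCombination ℂ e))
    (h : range (Fintype.linearCombination ℂ e) ⊆ range (Fintype.linearCombination ℂ e')) : d ≤ d' := by
  obtain ⟨A, hA, -⟩ := exists_linearMap_of_range_subset he h
  simpa using LinearMap.finrank_le_finrank_of_injective hA

theorem range_eq_of_range_subset {d : ℕ} {e e' : Fin d → E}
    (he : Function.Injective (Fintype.linearCombination ℂ e))
    (h : range (Fintype.linearCombination ℂ e) ⊆ range (Fintype.linearCombination ℂ e')) :
    range (Fintype.linearCombination ℂ e) = range (Fintype.linearCombination ℂ e') := by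
  obtain ⟨A, hA, hA'⟩ := exists_linearMap_of_range_subset he h
  refine h.antisymm ?_
  rintro _ ⟨c, rfl⟩
  obtain ⟨c', rfl⟩ := LinearMap.injective_iff_surjective.1 hA c
  exact ⟨c', (hA' c').symm⟩

end LinearFrames

/-! ### The action on holomorphic sections -/

section ActionQuant
variable {n : ℕ} {M : Type*} [TopologicalSpace M] [ChartedSpace (Model n) M]
  [IsManifold 𝓘(ℝ, Model n) ∞ M] [T2Space M] {Ω : ∀ x : M, Tan n x →L[ℝ] Tan n x →L[ℝ] ℝ}
  {L : M → Type*} [TopologicalSpace (TotalSpace ℂ L)] [∀ x, NormedAddCommGroup (L x)]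
  [∀ x, InnerProductSpace ℂ (L x)] [FiberBundle ℂ L] [VectorBundle ℂ ℂ L] [VectorBundle ℝ ℂ L]
  [ContMDiffVectorBundle ∞ ℂ L 𝓘(ℝ, Model n)]
  {nab : CovariantDerivative 𝓘(ℝ, Model n) ℂ L} [CovariantDerivative.ContMDiffCovariantDerivative nab ∞]
  {δ : M → Type*} [TopologicalSpace (TotalSpace ℂ δ)] [∀ x, AddCommGroup (δ x)]
  [∀ x, Module ℂ (δ x)] [∀ x, TopologicalSpace (δ x)] [FiberBundle ℂ δ] [VectorBundle ℂ ℂ δ]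
  [VectorBundle ℝ ℂ δ] [ContMDiffVectorBundle ∞ ℂ δ 𝓘(ℝ, Model n)]
  {H : HalfFormFamily Ω δ} {k : ℕ} {f : M → ℝ} {φ : ℝ → M → M} {Φ : ∀ t x, L x ≃ₗ[ℂ] L (φ t x)}
  {j j₀ : EndField n M} {θ : ∀ t x, δ (φ t x) →ₗ[ℂ] δ x}

/-- The lift preserves the connection and the differential of the flow intertwines the complex
structures, so the Cauchy–Riemann equations are carried over. The results on pull-backs need global
sections, whence the replacement of `a` by one with the same germ. -/
theorem IsExp.holSecL_pull (hΩ : IsSymplectic Ω) (hf : ContMDiff 𝓘(ℝ, Model n) 𝓘(ℝ, ℝ) ∞ f)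
    (hL : IsPrequantization Ω nab) (hφ : IsFlow (hamVF Ω f) φ) (hΦ : IsExp nab f φ Φ) {U : Set M}
    (hU : IsOpen U) {a : ∀ x, L x} (ha : HolSecL nab j₀ U a) (t : ℝ) :
    HolSecL nab (pullbackEnd (φ t) j₀) (φ t ⁻¹' U) (pull Φ t a) := by
  have key : ∀ x ∈ φ t ⁻¹' U, SmoothSecAt n (pull Φ t a) x ∧
      ∀ v, nab (pull Φ t a) x v = (Φ t x).symm (nab a (φ t x) (dφ φ t x v)) := by
    intro x hx
    obtain ⟨e, he, hea⟩ := exists_smoothSec_eq ha.1 hU hx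
    have h1 : ∀ᶠ y in 𝓝 x, pull Φ t a y = pull Φ t e y := by
      filter_upwards [(hφ.contMDiff_map t).continuous.continuousAt.eventually hea] with y hy
      rw [pull, pull, hy]
    have h2 := hΦ.smoothSecAt_pull hΩ hf hL hφ he t x
    refine ⟨h2.congr h1, fun v => ?_⟩
    rw [nab_congr h2 h1, hΦ.nab_pull hΩ hf hL hφ he, nab_congr (ha.1.smoothSecAt hU hx) hea]
  refine ⟨smoothSecOn_of_at fun x hx => (key x hx).1, fun x hx v => ?_⟩
  rw [(key x hx).2, (key x hx).2, hφ.mfderiv_pullbackEnd, ha.2 _ hx, map_smul]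

theorem HolFun.comp_flow {X : ∀ x : M, Tan n x} (hφ : IsFlow X φ) {U : Set M} (hU : IsOpen U) {g : M → ℂ}
    (hg : HolFun j₀ U g) (t : ℝ) :
    HolFun (pullbackEnd (φ t) j₀) (φ t ⁻¹' U) (fun x => g (φ t x)) := by
  refine ⟨hg.1.comp (hφ.contMDiff_map t).contMDiffOn subset_rfl, fun x hx v => ?_⟩
  have h1 : MDifferentiableAt 𝓘(ℝ, Model n) 𝓘(ℝ, ℂ) g (φ t x) :=
    ((hg.1 _ hx).contMDiffAt (hU.mem_nhds hx)).mdifferentiableAt (by simp)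
  rw [dC_comp h1 (hφ.mdifferentiableAt t x), dC_comp h1 (hφ.mdifferentiableAt t x)]
  exact (congrArg (dC g (φ t x)) (hφ.mfderiv_pullbackEnd t x v)).trans (hg.2 _ hx _)

theorem HolCoord.comp_flow {X : ∀ x : M, Tan n x} (hφ : IsFlow X φ) {U : Set M} (hU : IsOpen U) {z : Fin n → M → ℂ}
    (hz : HolCoord j₀ U z) (t : ℝ) :
    HolCoord (pullbackEnd (φ t) j₀) (φ t ⁻¹' U) (fun i x => z i (φ t x)) := by
  refine ⟨fun i => (hz.1 i).comp_flow hφ hU t, fun x hx v hv => ?_⟩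
  refine hφ.mfderiv_injective t x (((hz.2 _ hx) _ fun i => ?_).trans (map_zero _).symm)
  have h1 : MDifferentiableAt 𝓘(ℝ, Model n) 𝓘(ℝ, ℂ) (z i) (φ t x) :=
    (((hz.1 i).1 _ hx).contMDiffAt (hU.mem_nhds hx)).mdifferentiableAt (by simp)
  exact (dC_comp h1 (hφ.mdifferentiableAt t x) v).symm.trans (hv i)

theorem IsHalfFormLift.holSecDelta {X : ∀ x : M, Tan n x} (hφ : IsFlow X φ)
    (hinv : ∀ t x v w, Ω (φ t x) (dφ φ t x v) (dφ φ t x w) = Ω x v w) (hj : IsCompatible Ω j₀)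
    (hθ : IsHalfFormLift H φ j₀ θ) {U : Set M} (hU : IsOpen U) {β : ∀ x, δ x} (hβ : HolSecDelta H j₀ U β) (t : ℝ) :
    HolSecDelta H (pullbackEnd (φ t) j₀) (φ t ⁻¹' U) (fun x => θ t x (β (φ t x))) := by
  refine ⟨smoothSecOn_of_at fun x hx => ?_, fun x hx => ?_⟩
  · obtain ⟨e, he, hea⟩ := exists_smoothSec_eq hβ.1 hU hx
    have h1 := SmoothSecAt.smul ((hθ.smoothSecOn_halfPull hφ hinv hj he t).atPoint x)
      (contMDiff_transportFactor_right H (hφ.isSmoothCurve_pullbackEnd hinv hj) t x)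
    refine h1.congr ?_
    filter_upwards [(hφ.contMDiff_map t).continuous.continuousAt.eventually hea] with y hy
    rw [halfPull, smul_inv_smul₀ (transportFactor_ne_zero H t y), hy]
  · obtain ⟨W, z, h, hW, hxW, hz, hh, hform⟩ := hβ.2 _ hx
    have hφt := (hφ.contMDiff_map t).continuous
    refine ⟨φ t ⁻¹' W, fun i x => z i (φ t x), fun x => h (φ t x), hW.preimage hφt, hxW, hz.comp_flow hφ hW t,
      hh.comp_flow hφ hW t, fun y hy v => ?_⟩
    rw [hθ.square]
    refine (hform _ hy _).trans ?_
    congr 2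
    ext a b
    have h1 : MDifferentiableAt 𝓘(ℝ, Model n) 𝓘(ℝ, ℂ) (z a) (φ t y) :=
      (((hz.1 a).1 _ hy).contMDiffAt (hW.mem_nhds hy)).mdifferentiableAt (by simp)
    exact (dC_comp h1 (hφ.mdifferentiableAt t y) (v b)).symm

theorem action_eq_smul_evolution (t : ℝ) (s : Sec L δ k) (x : M) : action Φ θ t s x =
    transportFactor H (fun t => pullbackEnd (φ t) j₀) t x • evolution H j₀ Φ θ t s x := by
  rw [evolution, smul_inv_smul₀ (transportFactor_ne_zero H t x)]

theorem action_mem_preQ (hΩ : IsSymplectic Ω) (hf : ContMDiff 𝓘(ℝ, Model n) 𝓘(ℝ, ℝ) ∞ f)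
    (hL : IsPrequantization Ω nab) (hφ : IsFlow (hamVF Ω f) φ) (hΦ : IsExp nab f φ Φ)
    (hj : IsCompatible Ω j₀) (hθ : IsHalfFormLift H φ j₀ θ) {s : Sec L δ k} (hs : s ∈ preQ n L δ k) (t : ℝ) :
    action Φ θ t s ∈ preQ n L δ k := by
  have hc := hφ.isSmoothCurve_pullbackEnd (hΦ.omega_mfderiv hΩ hf hL hφ) hj
  have h1 := smul_mem_preQ (contMDiff_transportFactor_right H hc t) (evolution_mem_preQ hΩ hf hL hφ hΦ hj hθ hs t)
  rwa [← funext (action_eq_smul_evolution (H := H) (j₀ := j₀) (Φ := Φ) (θ := θ) t s)] at h1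

/-- The action maps holomorphic sections to holomorphic sections. -/
theorem action_mem_quant (hΩ : IsSymplectic Ω) (hf : ContMDiff 𝓘(ℝ, Model n) 𝓘(ℝ, ℝ) ∞ f)
    (hL : IsPrequantization Ω nab) (hφ : IsFlow (hamVF Ω f) φ) (hΦ : IsExp nab f φ Φ)
    (hj : IsCompatible Ω j₀) (hθ : IsHalfFormLift H φ j₀ θ) {s : Sec L δ k} (hs : s ∈ quant nab H k j₀) (t : ℝ) :
    action Φ θ t s ∈ quant nab H k (pullbackEnd (φ t) j₀) := by
  have hinv := hΦ.omega_mfderiv hΩ hf hL hφ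
  refine ⟨action_mem_preQ hΩ hf hL hφ hΦ hj hθ hs.1 t, fun x => ?_⟩
  obtain ⟨U, a, β, g, hU, hx, ha, hβ, hg, h0, hsg⟩ := hs.2 (φ t x)
  refine ⟨φ t ⁻¹' U, pull Φ t a, fun x => θ t x (β (φ t x)), fun x => g (φ t x),
    hU.preimage (hφ.contMDiff_map t).continuous, hx, hΦ.holSecL_pull hΩ hf hL hφ hU ha t,
    hθ.holSecDelta hφ hinv hj hU hβ t, hg.comp_flow hφ hU t, fun y hy => ⟨pull_ne_zero (h0 _ hy).1, fun h => ?_⟩,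
    fun y hy => action_eq (hsg _ hy)⟩
  exact (h0 _ hy).2 (hθ.eq_zero hφ hj h)

/-- The action as a linear map. -/
def actionLin (Φ : ∀ t x, L x ≃ₗ[ℂ] L (φ t x)) (θ : ∀ t x, δ (φ t x) →ₗ[ℂ] δ x) (t : ℝ) :
    Sec L δ k →ₗ[ℂ] Sec L δ k where
  toFun := action Φ θ t
  map_add' s r := funext fun x => map_add _ (s (φ t x)) (r (φ t x))
  map_smul' c s := funext fun x => map_smul _ c (s (φ t x))

theorem action_linearCombination (t : ℝ) {d : ℕ} (e : Fin d → Sec L δ k) (c : Fin d → ℂ) :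
    action Φ θ t (Fintype.linearCombination ℂ e c) =
      Fintype.linearCombination ℂ (fun i => action Φ θ t (e i)) c := by
  change actionLin Φ θ t _ = _
  simp only [Fintype.linearCombination_apply, map_sum, map_smul]
  rfl

theorem action_injective (hφ : IsFlow (hamVF Ω f) φ) (hj : IsCompatible Ω j₀) (hθ : IsHalfFormLift H φ j₀ θ) (t : ℝ) :
    Function.Injective (action (k := k) Φ θ t : Sec L δ k → Sec L δ k) := by
  intro s r h
  ext y
  obtain ⟨x, rfl⟩ : ∃ x, φ t x = y := ⟨φ (-t) y, hφ.apply_neg t y⟩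
  obtain ⟨a, -, -, ha⟩ := exists_smoothSec_eq_frame (n := n) (E := L) (φ t x)
  obtain ⟨β, -, -, hβ⟩ := exists_smoothSec_eq_frame (n := n) (E := δ) (φ t x)
  obtain ⟨c, hc⟩ := exists_eq_smul_tpow_tmul (k := k) ha hβ (s (φ t x))
  obtain ⟨c', hc'⟩ := exists_eq_smul_tpow_tmul (k := k) ha hβ (r (φ t x))
  have h1 := congrFun h x
  rw [action_eq hc, action_eq hc'] at h1
  rw [hc, hc', smul_tmul_injective (pull_ne_zero ha) (fun h0 => hβ (hθ.eq_zero hφ hj h0)) h1]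

/-- A frame of the bundle of quantum spaces given by the action. -/
theorem exists_action_frame (hΩ : IsSymplectic Ω) (hf : ContMDiff 𝓘(ℝ, Model n) 𝓘(ℝ, ℝ) ∞ f)
    (hL : IsPrequantization Ω nab) (hφ : IsFlow (hamVF Ω f) φ) (hΦ : IsExp nab f φ Φ)
    (hj : IsCompatible Ω j₀) (hθ : IsHalfFormLift H φ j₀ θ)
    (hsub : IsSubbundle nab H k (fun t => pullbackEnd (φ t) j₀)) :
    ∃ (d : ℕ) (e : Fin d → Sec L δ k), range (Fintype.linearCombination ℂ e) = quant nab H k j₀ ∧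
      Function.Injective (Fintype.linearCombination ℂ e) ∧
      ∀ t, Function.Injective (Fintype.linearCombination ℂ fun i => action Φ θ t (e i)) ∧
        range (Fintype.linearCombination ℂ fun i => action Φ θ t (e i)) = quant nab H k (pullbackEnd (φ t) j₀) := by
  -- `S d` is the set of times at which the quantum space has dimension `d`. The local frames make
  -- it open and closed, so the dimension does not depend on time.
  let S : ℕ → Set ℝ := fun d => {t | ∃ e : Fin d → Sec L δ k, Function.Injective (Fintype.linearCombination ℂ e) ∧
    range (Fintype.linearCombination ℂ e) = quant nab H k (pullbackEnd (φ t) j₀)}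
  have hloc : ∀ t₀, ∃ d, ∀ᶠ t in 𝓝 t₀, t ∈ S d := by
    intro t₀
    obtain ⟨ε, d, e, hε, -, he⟩ := hsub t₀
    refine ⟨d, ?_⟩
    filter_upwards [Ioo_mem_nhds (a := t₀ - ε) (b := t₀ + ε) (by linarith) (by linarith)] with t ht
    refine ⟨fun i => e i t, linearIndependent_iff_injective_fintypeLinearCombination.1 (he t ht).1, ?_⟩
    rw [← (he t ht).2, ← Fintype.range_linearCombination]
    rfl
  have huniq : ∀ t d d', t ∈ S d → t ∈ S d' → d = d' := by
    rintro t d d' ⟨e, he, her⟩ ⟨e', he', her'⟩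
    exact le_antisymm (card_le_of_range_subset he (by rw [her, her'])) (card_le_of_range_subset he' (by rw [her, her']))
  obtain ⟨d, hd⟩ := hloc 0
  have hclopen : IsClopen (S d) := by
    refine ⟨⟨isOpen_iff_mem_nhds.2 fun t ht => ?_⟩, isOpen_iff_mem_nhds.2 fun t ht => ?_⟩
    · obtain ⟨d', hd'⟩ := hloc t
      filter_upwards [hd'] with r hr hr'
      exact ht (huniq r d d' hr' hr ▸ hd'.self_of_nhds)
    · obtain ⟨d', hd'⟩ := hloc t
      have := huniq t d d' ht hd'.self_of_nhds
      subst this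
      exact hd'
  have huniv := hclopen.eq_univ ⟨0, hd.self_of_nhds⟩
  obtain ⟨e, he, her⟩ := hd.self_of_nhds
  rw [hφ.pullbackEnd_zero] at her
  refine ⟨d, e, her, he, fun t => ?_⟩
  have hinj : Function.Injective (Fintype.linearCombination ℂ fun i => action Φ θ t (e i)) := by
    intro c c' h
    rw [← action_linearCombination, ← action_linearCombination] at h
    exact he (action_injective hφ hj hθ t h)
  obtain ⟨e', he', her'⟩ := huniv.symm ▸ mem_univ t
  -- The action maps into the quantum space at time `t`; equality of the dimensions turns this
  -- inclusion into an equality.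
  refine ⟨hinj, (range_eq_of_range_subset hinj (e' := e') ?_).trans her'⟩
  rw [her']
  rintro _ ⟨c, rfl⟩
  rw [← action_linearCombination]
  exact action_mem_quant hΩ hf hL hφ hΦ hj hθ (her ▸ mem_range_self c) t

end ActionQuant

/-! ### The group law of the evolution -/

section EvolutionGroup
variable {n : ℕ} {M : Type*} [TopologicalSpace M] [ChartedSpace (Model n) M]
  [IsManifold 𝓘(ℝ, Model n) ∞ M] [T2Space M] {Ω : ∀ x : M, Tan n x →L[ℝ] Tan n x →L[ℝ] ℝ}
  {L : M → Type*} [TopologicalSpace (TotalSpace ℂ L)] [∀ x, NormedAddCommGroup (L x)]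
  [∀ x, InnerProductSpace ℂ (L x)] [FiberBundle ℂ L] [VectorBundle ℂ ℂ L] [VectorBundle ℝ ℂ L]
  [ContMDiffVectorBundle ∞ ℂ L 𝓘(ℝ, Model n)]
  {nab : CovariantDerivative 𝓘(ℝ, Model n) ℂ L} [CovariantDerivative.ContMDiffCovariantDerivative nab ∞]
  {δ : M → Type*} [TopologicalSpace (TotalSpace ℂ δ)] [∀ x, AddCommGroup (δ x)]
  [∀ x, Module ℂ (δ x)] [∀ x, TopologicalSpace (δ x)] [FiberBundle ℂ δ] [VectorBundle ℂ ℂ δ]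
  [VectorBundle ℝ ℂ δ] [ContMDiffVectorBundle ∞ ℂ δ 𝓘(ℝ, Model n)]
  {H : HalfFormFamily Ω δ} {k : ℕ} {f : M → ℝ} {φ : ℝ → M → M} {Φ : ∀ t x, L x ≃ₗ[ℂ] L (φ t x)}
  {j j₀ : EndField n M} {θ : ∀ t x, δ (φ t x) →ₗ[ℂ] δ x}

theorem IsExp.pull_zero (hΦ : IsExp nab f φ Φ) (e : ∀ x, L x) : pull Φ 0 e = e := funext fun x => by
  rw [pull, ← hΦ.zero e x, LinearEquiv.symm_apply_apply]

/-- The group law of the lift of the flow. -/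
theorem IsExp.pull_add (hΩ : IsSymplectic Ω) (hf : ContMDiff 𝓘(ℝ, Model n) 𝓘(ℝ, ℝ) ∞ f)
    (hL : IsPrequantization Ω nab) (hφ : IsFlow (hamVF Ω f) φ) (hΦ : IsExp nab f φ Φ) (r s : ℝ) (e : ∀ x, L x) (x : M) :
    pull Φ (r + s) e x = pull Φ s (pull Φ r e) x := by
  -- Both lifts are isomorphisms between the same two lines, so they differ by a scalar that does
  -- not depend on the section.
  have hC : ∀ r, ∃ C : ℂ, ∀ e : ∀ x, L x, pull Φ (r + s) e x = C • pull Φ s (pull Φ r e) x := by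
    intro r
    obtain ⟨E, -, -, hE⟩ := exists_smoothSec_eq_frame (n := n) (E := L) (φ r (φ s x))
    have h1 : pull Φ s (pull Φ r E) x ≠ 0 := pull_ne_zero (pull_ne_zero hE)
    obtain ⟨C, hC⟩ := exists_eq_smul h1 (pull Φ (r + s) E x)
    refine ⟨C, fun e => ?_⟩
    obtain ⟨c, hc⟩ := exists_eq_smul hE (e (φ r (φ s x)))
    have h2 := section_smul_transport (hφ.add r s x) hc
    rw [pull, h2, map_smul]
    change c • pull Φ (r + s) E x = _
    have h3 : pull Φ s (pull Φ r e) x = c • pull Φ s (pull Φ r E) x := by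
      change (Φ s x).symm ((Φ r (φ s x)).symm (e (φ r (φ s x)))) = _
      rw [hc, map_smul, map_smul]
      rfl
    rw [hC, h3, smul_comm]
  choose C hC using hC
  have hd : ∀ r, HasDerivAt C 0 r := by
    intro r
    obtain ⟨E, hE, -, hE0⟩ := exists_smoothSec_eq_frame (n := n) (E := L) (φ r (φ s x))
    have hE0' : E (φ (r + s) x) ≠ 0 := by rwa [hφ.add]
    obtain ⟨A, hA, hA1, hAd⟩ := exists_hasDerivAt_pull hΩ hf hL hφ hΦ hE hE0'
    obtain ⟨B, hB, hB1, hBd⟩ := exists_hasDerivAt_pull hΩ hf hL hφ hΦ hE hE0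
    have hne : pull Φ s (pull Φ r E) x ≠ 0 := pull_ne_zero (pull_ne_zero hE0)
    have h1 : ∀ r', C r' * B r' = A (r' + s) * C r := by
      intro r'
      have h2 := hC r' E
      have h3 : pull Φ s (pull Φ r' E) x = B r' • pull Φ s (pull Φ r E) x := by
        rw [pull, hB r', map_smul]
        rfl
      rw [hA (r' + s), h3, hC r E, smul_smul, smul_smul] at h2
      exact (smul_left_injective ℂ hne h2).symm
    -- Both logarithmic derivatives are the connection form of `E` on `X` at `φ (r + s) x`, plus `i
    -- f`; hence `C` is constant.
    have hconn : connForm nab (pull Φ (r + s) E) x (hamVF Ω f x) + Complex.I * f x =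
        connForm nab (pull Φ r E) (φ s x) (hamVF Ω f (φ s x)) + Complex.I * f (φ s x) := by
      rw [hΦ.connForm_pull hΩ hf hL hφ hE hE0', hΦ.connForm_pull hΩ hf hL hφ hE hE0, hφ.mfderiv_apply_self,
        hφ.mfderiv_apply_self, hφ.hamiltonian_eq hΩ hf]
      congr 1
      exact connForm_transport (hφ.add r s x) (by rw [hφ.add])
    have hq := ((hAd.comp_add_const r s).mul_const (C r)).div hBd (by rw [hB1]; exact one_ne_zero)
    refine (hq.congr_of_eventuallyEq ?_).congr_deriv ?_
    · filter_upwards [hBd.continuousAt.eventually_ne (by rw [hB1]; exact one_ne_zero)] with r' hr'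
      exact (eq_div_iff hr').2 (h1 r')
    · rw [hA1, hB1, hconn]
      ring
  have hC0 : C r = 1 := by
    have h1 := is_const_of_deriv_eq_zero (fun r => (hd r).differentiableAt) (fun r => (hd r).deriv) r 0
    obtain ⟨E, -, -, hE⟩ := exists_smoothSec_eq_frame (n := n) (E := L) (φ s x)
    have h2 := hC 0 E
    rw [hΦ.pull_zero, zero_add, ← h1] at h2
    exact smul_left_injective ℂ (pull_ne_zero (Φ := Φ) hE) (h2.symm.trans (one_smul ℂ _).symm)
  rw [hC r e, hC0, one_smul]

theorem exists_section_eq (L : M → Type*) [TopologicalSpace (TotalSpace ℂ L)] [∀ x, AddCommGroup (L x)]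
    [∀ x, Module ℂ (L x)] [∀ x, TopologicalSpace (L x)] [FiberBundle ℂ L] [VectorBundle ℂ ℂ L] :
    ∃ a : ∀ x, L x, ∀ x, a x ≠ 0 :=
  ⟨fun x => frame L x x, fun x => frame_ne_zero (mem_dom x)⟩

theorem evolution_zero (hΦ : IsExp nab f φ Φ) (hφ : IsFlow (hamVF Ω f) φ) (hθ : IsHalfFormLift H φ j₀ θ) (s : Sec L δ k) :
    evolution H j₀ Φ θ 0 s = s := by
  obtain ⟨a, ha⟩ := exists_section_eq L
  obtain ⟨β, hβ⟩ := exists_section_eq δ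
  choose g hg using fun x => exists_eq_smul_tpow_tmul (k := k) (ha x) (hβ x) (s x)
  ext x
  have h1 : g (φ 0 x) = g x := by rw [hφ.zero]
  rw [evolution_eq (hg (φ 0 x)), hΦ.pull_zero, halfPull_zero hθ, h1, ← hg]

/-- The group law of the evolution. -/
theorem evolution_add (hΩ : IsSymplectic Ω) (hf : ContMDiff 𝓘(ℝ, Model n) 𝓘(ℝ, ℝ) ∞ f)
    (hL : IsPrequantization Ω nab) (hφ : IsFlow (hamVF Ω f) φ) (hΦ : IsExp nab f φ Φ)
    (hj : IsCompatible Ω j₀) (hθ : IsHalfFormLift H φ j₀ θ) (r t : ℝ) (s : Sec L δ k) :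
    evolution H j₀ Φ θ (r + t) s = evolution H j₀ Φ θ t (evolution H j₀ Φ θ r s) := by
  have hinv := hΦ.omega_mfderiv hΩ hf hL hφ
  obtain ⟨a, ha⟩ := exists_section_eq L
  obtain ⟨β, hβ⟩ := exists_section_eq δ
  choose g hg using fun x => exists_eq_smul_tpow_tmul (k := k) (ha x) (hβ x) (s x)
  ext x
  have h1 : g (φ (r + t) x) = g (φ r (φ t x)) := by rw [hφ.add]
  rw [evolution_eq (hg (φ (r + t) x)), hΦ.pull_add hΩ hf hL hφ, hθ.halfPull_add hφ hinv hj, h1,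
    evolution_eq (s := evolution H j₀ Φ θ r s) (evolution_eq (hg (φ r (φ t x))))]

/-- The evolution at a time, as a linear map of the fibres. -/
theorem HasTimeDeriv.evolution {s : ℝ → Sec L δ k} {s' : Sec L δ k} {r : ℝ} (h : HasTimeDeriv s s' r) (t : ℝ) :
    HasTimeDeriv (fun r => evolution H j₀ Φ θ t (s r)) (evolution H j₀ Φ θ t s') r := by
  intro x l
  have h1 := (h (φ t x) (l ∘ₗ TensorProduct.map (PiTensorProduct.map fun _ : Fin k => (Φ t x).symm.toLinearMap)
    (θ t x))).const_mul (transportFactor H (fun t => pullbackEnd (φ t) j₀) t x)⁻¹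
  simpa only [HalfFormQuantization.evolution, action, LinearMap.comp_apply, map_smul, smul_eq_mul] using h1

/-- The time derivative of the evolution at any time is the evolution of the time derivative at time zero. -/
theorem hasTimeDeriv_evolution (hΩ : IsSymplectic Ω) (hf : ContMDiff 𝓘(ℝ, Model n) 𝓘(ℝ, ℝ) ∞ f)
    (hL : IsPrequantization Ω nab) (hφ : IsFlow (hamVF Ω f) φ) (hΦ : IsExp nab f φ Φ)
    (hj : IsCompatible Ω j₀) (hθ : IsHalfFormLift H φ j₀ θ) {s s' : Sec L δ k}
    (h : HasTimeDeriv (fun r => evolution H j₀ Φ θ r s) s' 0) (t : ℝ) :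
    HasTimeDeriv (fun r => evolution H j₀ Φ θ r s) (evolution H j₀ Φ θ t s') t := by
  intro x l
  have h1 := (h.evolution (H := H) (j₀ := j₀) (Φ := Φ) (θ := θ) t) x l
  have h2 := HasDerivAt.comp_sub_const t t (by rwa [sub_self])
  refine h2.congr_of_eventuallyEq (Filter.Eventually.of_forall fun r => ?_)
  dsimp only
  rw [← evolution_add hΩ hf hL hφ hΦ hj hθ, sub_add_cancel]

theorem HasTimeDeriv.mem_preQ {s : ℝ → Sec L δ k} {s' : Sec L δ k} {t : ℝ} (hs : SmoothFamilyOn (n := n) univ s)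
    (h : HasTimeDeriv s s' t) : s' ∈ preQ n L δ k := by
  intro x₀
  refine (ContMDiffAt.deriv_fst (hs t (mem_univ t) x₀) contMDiffAt_const).congr_of_eventuallyEq
    (Filter.Eventually.of_forall fun x => ((h.coef x₀ x).deriv).symm)

end EvolutionGroup

/-! ### Linear systems and linear flows -/

/-- A linear form vanishing on all vectors `(a i x)_i` would be a relation between the functions, so
these vectors span. A basis taken among them provides the points. -/
theorem exists_det_ne_zero {M : Type*} {d : ℕ} (a : Fin d → M → ℂ)
    (h : ∀ c : Fin d → ℂ, (∀ x, ∑ i, c i * a i x = 0) → c = 0) :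
    ∃ x : Fin d → M, (Matrix.of fun p i => a i (x p)).det ≠ 0 := by
  have hspan : Submodule.span ℂ (range fun x i => a i x) = ⊤ := by
    by_contra hne
    obtain ⟨f, hf, hle⟩ := Submodule.exists_le_ker_of_lt_top _ (lt_top_iff_ne_top.2 hne)
    refine hf (LinearMap.pi_ext' fun i => LinearMap.ext_ring ?_)
    refine congrFun (h (fun i => f (Pi.single i 1)) fun x => ?_) i
    have h1 : f (fun i => a i x) = 0 := hle (Submodule.subset_span ⟨x, rfl⟩)
    rw [LinearMap.pi_apply_eq_sum_univ f] at h1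
    rw [← h1]
    refine Finset.sum_congr rfl fun i _ => ?_
    rw [smul_eq_mul, mul_comm]
    congr 2
    ext j
    simp [Pi.single_apply, eq_comm]
  obtain ⟨w, hw, -, hli⟩ := Submodule.exists_fun_fin_finrank_span_eq ℂ (range fun x i => a i x)
  have hd : Module.finrank ℂ (Submodule.span ℂ (range fun x i => a i x)) = d := by
    rw [hspan, finrank_top, Module.finrank_fin_fun]
  choose x hx using hw
  refine ⟨fun p => x (Fin.cast hd.symm p), ?_⟩
  have h2 : LinearIndependent ℂ (Matrix.of fun p i => a i (x (Fin.cast hd.symm p))).row := by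
    have h3 := hli.comp (Fin.cast hd.symm) (Fin.cast_injective _)
    have h4 : w ∘ Fin.cast hd.symm = (Matrix.of fun p i => a i (x (Fin.cast hd.symm p))).row :=
      funext fun p => (hx _).symm
    exact h4 ▸ h3
  exact ((Matrix.isUnit_iff_isUnit_det _).1 (Matrix.linearIndependent_rows_iff_isUnit.1 h2)).ne_zero

theorem DifferentiableAt.matrix_det {d : ℕ} {A : ℝ → Matrix (Fin d) (Fin d) ℂ} {t : ℝ}
    (hA : ∀ p i, DifferentiableAt ℝ (fun r => A r p i) t) : DifferentiableAt ℝ (fun r => (A r).det) t := by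
  simp only [Matrix.det_apply]
  refine DifferentiableAt.fun_sum fun σ _ => ?_
  simp only [Units.smul_def, zsmul_eq_mul]
  exact (DifferentiableAt.fun_finsetProd fun i _ => hA _ _).const_mul _

/-- Cramer's rule: the solution of a differentiable regular linear system is differentiable. -/
theorem differentiableAt_of_mulVec {d : ℕ} {A : ℝ → Matrix (Fin d) (Fin d) ℂ} {c : ℝ → Fin d → ℂ} {t : ℝ}
    (hA : ∀ p i, DifferentiableAt ℝ (fun r => A r p i) t) (hdet : (A t).det ≠ 0)
    (hy : ∀ p, DifferentiableAt ℝ (fun r => (A r).mulVec (c r) p) t) : DifferentiableAt ℝ c t := by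
  refine differentiableAt_pi.2 fun i => ?_
  have h1 := DifferentiableAt.matrix_det hA
  have h2 : DifferentiableAt ℝ (fun r => ((A r).updateCol i ((A r).mulVec (c r))).det) t := by
    refine DifferentiableAt.matrix_det fun p q => ?_
    simp only [Matrix.updateCol_apply]
    split_ifs
    · exact hy p
    · exact hA p q
  refine (h2.fun_div h1 hdet).congr_of_eventuallyEq ?_
  filter_upwards [h1.continuousAt.eventually_ne hdet] with r hr
  rw [eq_div_iff hr, ← Matrix.cramer_apply, Matrix.cramer_eq_adjugate_mulVec, Matrix.mulVec_mulVec,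
    Matrix.adjugate_mul, Matrix.smul_mulVec, Matrix.one_mulVec, Pi.smul_apply, smul_eq_mul, mul_comm]

/-- The flow of a bounded linear vector field. -/
theorem exists_linear_flow {W : Type*} [NormedAddCommGroup W] [NormedSpace ℝ W] [CompleteSpace W] (F : W →L[ℝ] W) :
    ∃ g : ℝ → W ≃ W, (∀ c, g 0 c = c) ∧
      (∀ c t, HasDerivAt (fun t => g t c) (-F (g t c)) t) ∧
      (∀ c t, HasDerivAt (fun t => (g t).symm c) (F ((g t).symm c)) t) ∧
      (∀ c, ContDiff ℝ ∞ (fun t => g t c)) ∧ (∀ c, ContDiff ℝ ∞ (fun t => (g t).symm c)) ∧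
      ∀ γ : ℝ → W, (∀ t, HasDerivAt γ (-F (γ t)) t) → ∀ t, γ t = g t (γ 0) := by
  let E : ℝ → W →L[ℝ] W := fun t => NormedSpace.exp (t • F)
  have hE0 : E 0 = 1 := by simp [E]
  have hE : ∀ t, E (-t) * E t = 1 := fun t => by
    let _ : NormedAlgebra ℚ (W →L[ℝ] W) := NormedAlgebra.restrictScalars ℚ ℝ _
    have h : Commute ((-t) • F) (t • F) := by
      rw [Commute, SemiconjBy, smul_mul_smul_comm, smul_mul_smul_comm, mul_comm]
    change NormedSpace.exp ((-t) • F) * NormedSpace.exp (t • F) = 1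
    rw [← NormedSpace.exp_add_of_commute h, ← add_smul, neg_add_cancel, zero_smul, NormedSpace.exp_zero]
  have hE' : ∀ t, E t * E (-t) = 1 := fun t => by simpa using hE (-t)
  have hd : ∀ t, HasDerivAt E (F * E t) t := fun t => hasDerivAt_exp_smul_const' F t
  have hd' : ∀ t, HasDerivAt E (E t * F) t := fun t => hasDerivAt_exp_smul_const F t
  have hsm : ContDiff ℝ ∞ E := by
    have h1 : ContDiff ℝ ∞ (NormedSpace.exp : (W →L[ℝ] W) → _) := contDiff_iff_contDiffAt.2 fun x => by
      let _ : NormedAlgebra ℚ (W →L[ℝ] W) := NormedAlgebra.restrictScalars ℚ ℝ _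
      exact (NormedSpace.exp_analytic (𝕂 := ℝ) x).contDiffAt
    exact h1.comp (contDiff_id.smul contDiff_const)
  have hdc : ∀ c t, HasDerivAt (fun t => E t c) (F (E t c)) t := fun c t => by
    simpa using (hd t).clm_apply (hasDerivAt_const t c)
  -- The equation of parallel sections carries the sign `-F`, so the flow is `exp (-t F)` and its
  -- inverse `exp (t F)`.
  refine ⟨fun t => ⟨E (-t), E t, fun c => congrArg (fun K : W →L[ℝ] W => K c) (hE' t),
      fun c => congrArg (fun K : W →L[ℝ] W => K c) (hE t)⟩,
    fun c => ?_, fun c t => ?_, hdc, fun c => (hsm.comp contDiff_neg).clm_apply contDiff_const,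
    fun c => hsm.clm_apply contDiff_const, fun γ hγ t => ?_⟩
  · change E (-0) c = c
    rw [neg_zero, hE0, one_apply_eq_self]
  · have := (hdc c (-t)).scomp t (hasDerivAt_neg t)
    exact this.congr_deriv (neg_one_smul ℝ _)
  -- For every solution `γ`, the curve `exp (t F) (γ t)` is constant.
  · have h1 : ∀ t, HasDerivAt (fun t => E t (γ t)) 0 t := fun t => by
      have h2 := (hd' t).clm_apply (hγ t)
      refine h2.congr_deriv ?_
      rw [map_neg]
      exact add_neg_cancel _
    have h3 := is_const_of_deriv_eq_zero (fun t => (h1 t).differentiableAt) (fun t => (h1 t).deriv) t 0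
    change _ = E (-t) (γ 0)
    rw [hE0, one_apply_eq_self] at h3
    rw [← h3]
    exact (congrArg (fun K : W →L[ℝ] W => K (γ t)) (hE t)).symm

/-! ### Time-dependent frames and coefficients of sections -/

section TimeDependentFrames
variable {n : ℕ} {M : Type*} [TopologicalSpace M] [ChartedSpace (Model n) M]
  [IsManifold 𝓘(ℝ, Model n) ∞ M] [T2Space M] {Ω : ∀ x : M, Tan n x →L[ℝ] Tan n x →L[ℝ] ℝ}
  {L : M → Type*} [TopologicalSpace (TotalSpace ℂ L)] [∀ x, NormedAddCommGroup (L x)]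
  [∀ x, InnerProductSpace ℂ (L x)] [FiberBundle ℂ L] [VectorBundle ℂ ℂ L] [VectorBundle ℝ ℂ L]
  [ContMDiffVectorBundle ∞ ℂ L 𝓘(ℝ, Model n)]
  {nab : CovariantDerivative 𝓘(ℝ, Model n) ℂ L} [CovariantDerivative.ContMDiffCovariantDerivative nab ∞]
  {δ : M → Type*} [TopologicalSpace (TotalSpace ℂ δ)] [∀ x, AddCommGroup (δ x)]
  [∀ x, Module ℂ (δ x)] [∀ x, TopologicalSpace (δ x)] [FiberBundle ℂ δ] [VectorBundle ℂ ℂ δ]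
  [VectorBundle ℝ ℂ δ] [ContMDiffVectorBundle ∞ ℂ δ 𝓘(ℝ, Model n)]
  {H : HalfFormFamily Ω δ} {k : ℕ} {f : M → ℝ} {φ : ℝ → M → M} {Φ : ∀ t x, L x ≃ₗ[ℂ] L (φ t x)}
  {j j₀ : EndField n M} {θ : ∀ t x, δ (φ t x) →ₗ[ℂ] δ x}

theorem linearCombination_sec_apply {d : ℕ} (u : Fin d → Sec L δ k) (c : Fin d → ℂ) (x : M) :
    Fintype.linearCombination ℂ u c x = ∑ i, c i • u i x := by
  rw [Fintype.linearCombination_apply, Finset.sum_apply]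
  rfl

theorem linearCombination_mem_preQ {d : ℕ} {u : Fin d → Sec L δ k} (hu : ∀ i, u i ∈ preQ n L δ k) (c : Fin d → ℂ) :
    Fintype.linearCombination ℂ u c ∈ preQ n L δ k := by
  rw [Fintype.linearCombination_apply]
  exact (preQSubmodule n L δ k).sum_mem fun i _ => (preQSubmodule n L δ k).smul_mem (c i) (hu i)

theorem HasTimeDeriv.linearCombination {d : ℕ} {u : ℝ → Fin d → Sec L δ k} {u' : Fin d → Sec L δ k}
    {c : ℝ → Fin d → ℂ} {c' : Fin d → ℂ} {t : ℝ} (hu : ∀ i, HasTimeDeriv (fun r => u r i) (u' i) t)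
    (hc : HasDerivAt c c' t) :
    HasTimeDeriv (fun r => Fintype.linearCombination ℂ (u r) (c r))
      (Fintype.linearCombination ℂ u' (c t) + Fintype.linearCombination ℂ (u t) c') t := by
  intro x l
  rw [Pi.add_apply]
  simp only [linearCombination_sec_apply, map_add, map_sum, map_smul, smul_eq_mul]
  refine (HasDerivAt.fun_sum fun i _ => (hasDerivAt_pi.1 hc i).mul (hu i x l)).congr_deriv ?_
  rw [← Finset.sum_add_distrib]
  exact Finset.sum_congr rfl fun i _ => add_comm _ _

theorem smoothFamilyOn_linearCombination {d : ℕ} {u : ℝ → Fin d → Sec L δ k} {c : ℝ → Fin d → ℂ}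
    (hu : ∀ i, SmoothFamilyOn (n := n) univ (fun r => u r i)) (hc : ContDiff ℝ ∞ c) :
    SmoothFamilyOn (n := n) univ (fun r => Fintype.linearCombination ℂ (u r) (c r)) := by
  intro t _ x₀
  simp only [linearCombination_sec_apply, map_sum, map_smul, smul_eq_mul]
  refine ContMDiffAt.sum fun i _ => ContMDiffAt.cmul ?_ (hu i t (mem_univ t) x₀)
  have h1 : ContMDiff 𝓘(ℝ, ℝ) 𝓘(ℝ, ℂ) ∞ (fun r => c r i) := (contDiff_pi.1 hc i).contMDiff
  exact ContMDiffAt.comp (t, x₀) (g := fun r => c r i) (f := fun p : ℝ × M => p.1) (h1 _) contMDiffAt_fst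

theorem smoothFamilyOn_const {s : Sec L δ k} (hs : s ∈ preQ n L δ k) : SmoothFamilyOn (n := n) univ (fun _ => s) := by
  simpa using smoothFamilyOn_smul (g := fun _ (_ : M) => 1) contMDiff_const hs

theorem hasTimeDeriv_const (s : Sec L δ k) (t : ℝ) : HasTimeDeriv (fun _ => s) 0 t := fun x l => by
  simpa using hasDerivAt_const t (l (s x))

theorem SmoothFamilyOn.differentiableAt_coef {s : ℝ → Sec L δ k} (hs : SmoothFamilyOn (n := n) univ s) (x : M) (t : ℝ) :
    DifferentiableAt ℝ (fun r => coef k x x (s r x)) t := by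
  have h1 : ContMDiffAt 𝓘(ℝ, ℝ) 𝓘(ℝ, ℂ) ∞ (fun r : ℝ => coef k x x (s r x)) t :=
    ContMDiffAt.comp t (g := fun p : ℝ × M => coef k x p.2 (s p.1 p.2)) (f := fun r : ℝ => (r, x))
      (hs t (mem_univ t) x) (contMDiffAt_id.prodMk contMDiffAt_const)
  exact h1.contDiffAt.differentiableAt (by simp)

/-- The coefficients of a smooth family of sections in a smooth frame are differentiable. -/
theorem differentiableAt_frame_coefficients {d : ℕ} {u : ℝ → Fin d → Sec L δ k} {c : ℝ → Fin d → ℂ} {t : ℝ}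
    (hu : ∀ i, SmoothFamilyOn (n := n) univ (fun r => u r i))
    (hinj : Function.Injective (Fintype.linearCombination ℂ (u t)))
    (hs : SmoothFamilyOn (n := n) univ (fun r => Fintype.linearCombination ℂ (u r) (c r))) :
    DifferentiableAt ℝ c t := by
  -- At these points the coordinates of the frame form an invertible matrix, so the coefficients
  -- solve a regular linear system with differentiable data.
  obtain ⟨x, hx⟩ := exists_det_ne_zero (fun i x => coef k x x (u t i x)) fun c hc => by
    refine hinj ?_
    rw [map_zero]
    ext x
    apply coef_injective (k := k) (mem_dom x) (mem_dom x)
    rw [linearCombination_sec_apply, map_sum]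
    simpa using hc x
  refine differentiableAt_of_mulVec (A := fun r => Matrix.of fun p i => coef k (x p) (x p) (u r i (x p)))
    (fun p i => (hu i).differentiableAt_coef (x p) t) hx fun p => ?_
  refine (hs.differentiableAt_coef (x p) t).congr_of_eventuallyEq (Filter.Eventually.of_forall fun r => ?_)
  dsimp only
  rw [linearCombination_sec_apply]
  simp only [Matrix.mulVec, dotProduct, Matrix.of_apply, map_sum, map_smul, smul_eq_mul]
  exact Finset.sum_congr rfl fun i _ => mul_comm _ _

variable (H) in
/-- The covariant derivative in terms of the parallel transport. -/
theorem hasCovDerivP_iff_transportFactor {c : ℝ → EndField n M} (hc : IsSmoothCurve Ω c) {s : ℝ → Sec L δ k}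
    {w : Sec L δ k} {t : ℝ} : HasCovDerivP H c s w t ↔
      HasTimeDeriv (fun r x => (transportFactor H c r x)⁻¹ • s r x) (fun x => (transportFactor H c t x)⁻¹ • w x) t := by
  have h0 : ∀ r x, transportFactor H c r x ≠ 0 := fun r x => transportFactor_ne_zero H r x
  rw [hasCovDerivP_iff H hc]
  constructor
  · intro h
    convert HasTimeDeriv.smul (fun x => (hasDerivAt_transportFactor H hc t x).fun_inv (h0 t x)) h using 1
    ext x
    rw [smul_sub, smul_smul]
    have : -(-(kappaDeriv H c t x / 2) * transportFactor H c t x) / transportFactor H c t x ^ 2 =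
        (transportFactor H c t x)⁻¹ * (kappaDeriv H c t x / 2) := by
      have := h0 t x
      field_simp
    rw [this]
    module
  · intro h
    convert HasTimeDeriv.smul (fun x => hasDerivAt_transportFactor H hc t x) h using 1
    · ext r x
      rw [smul_inv_smul₀ (h0 r x)]
    · ext x
      rw [smul_inv_smul₀ (h0 t x), smul_smul, mul_inv_cancel_right₀ (h0 t x)]
      module

theorem evolution_linearCombination (t : ℝ) {d : ℕ} (e : Fin d → Sec L δ k) (c : Fin d → ℂ) :
    evolution H j₀ Φ θ t (Fintype.linearCombination ℂ e c) =
      Fintype.linearCombination ℂ (fun i => evolution H j₀ Φ θ t (e i)) c := by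
  ext x
  rw [evolution, action_linearCombination, linearCombination_sec_apply, linearCombination_sec_apply, Finset.smul_sum]
  exact Finset.sum_congr rfl fun i _ => smul_comm _ _ _

theorem action_zero (hΦ : IsExp nab f φ Φ) (hφ : IsFlow (hamVF Ω f) φ) (hθ : IsHalfFormLift H φ j₀ θ) (s : Sec L δ k) :
    action Φ θ 0 s = s := by
  ext x
  rw [action_eq_smul_evolution (H := H) (j₀ := j₀), evolution_zero hΦ hφ hθ, transportFactor_zero, one_smul]

theorem smoothFamilyOn_action (hΩ : IsSymplectic Ω) (hf : ContMDiff 𝓘(ℝ, Model n) 𝓘(ℝ, ℝ) ∞ f)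
    (hL : IsPrequantization Ω nab) (hφ : IsFlow (hamVF Ω f) φ) (hΦ : IsExp nab f φ Φ)
    (hj : IsCompatible Ω j₀) (hθ : IsHalfFormLift H φ j₀ θ) {s : Sec L δ k} (hs : s ∈ preQ n L δ k) :
    SmoothFamilyOn (n := n) univ (fun t => action Φ θ t s) := by
  have hc := hφ.isSmoothCurve_pullbackEnd (hΦ.omega_mfderiv hΩ hf hL hφ) hj
  intro t₀ ht₀ x₀
  have h1 := ContMDiffAt.cmul (contMDiff_transportFactor H hc (t₀, x₀))
    (smoothFamilyOn_evolution hΩ hf hL hφ hΦ hj hθ hs t₀ ht₀ x₀)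
  simpa only [action_eq_smul_evolution (H := H) (j₀ := j₀), map_smul, smul_eq_mul] using h1

end TimeDependentFrames

/-! ### Parallel transport of the quantum spaces -/

section TransportQ
variable {n : ℕ} {M : Type*} [TopologicalSpace M] [ChartedSpace (Model n) M]
  [IsManifold 𝓘(ℝ, Model n) ∞ M] [T2Space M] {Ω : ∀ x : M, Tan n x →L[ℝ] Tan n x →L[ℝ] ℝ}
  {L : M → Type*} [TopologicalSpace (TotalSpace ℂ L)] [∀ x, NormedAddCommGroup (L x)]
  [∀ x, InnerProductSpace ℂ (L x)] [FiberBundle ℂ L] [VectorBundle ℂ ℂ L] [VectorBundle ℝ ℂ L]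
  [ContMDiffVectorBundle ∞ ℂ L 𝓘(ℝ, Model n)]
  {nab : CovariantDerivative 𝓘(ℝ, Model n) ℂ L} [CovariantDerivative.ContMDiffCovariantDerivative nab ∞]
  {δ : M → Type*} [TopologicalSpace (TotalSpace ℂ δ)] [∀ x, AddCommGroup (δ x)]
  [∀ x, Module ℂ (δ x)] [∀ x, TopologicalSpace (δ x)] [FiberBundle ℂ δ] [VectorBundle ℂ ℂ δ]
  [VectorBundle ℝ ℂ δ] [ContMDiffVectorBundle ∞ ℂ δ 𝓘(ℝ, Model n)]
  {H : HalfFormFamily Ω δ} {k : ℕ} {f : M → ℝ} {φ : ℝ → M → M} {Φ : ∀ t x, L x ≃ₗ[ℂ] L (φ t x)}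
  {j j₀ : EndField n M} {θ : ∀ t x, δ (φ t x) →ₗ[ℂ] δ x}
variable [CompactSpace M] [MeasurableSpace M] [BorelSpace M]

theorem secInner_linearCombination_left (hΩ : IsSymplectic Ω) (hL : IsPrequantization Ω nab) (hj : IsCompatible Ω j) {d : ℕ}
    {u : Fin d → Sec L δ k} (hu : ∀ i, u i ∈ preQ n L δ k) {r : Sec L δ k} (hr : r ∈ preQ n L δ k)
    (h : ∀ i, secInner H j (u i) r = 0) (c : Fin d → ℂ) : secInner H j (Fintype.linearCombination ℂ u c) r = 0 := by
  have key : ∀ S : Finset (Fin d), (∑ i ∈ S, c i • u i) ∈ preQ n L δ k ∧ secInner H j (∑ i ∈ S, c i • u i) r = 0 := by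
    intro S
    induction S using Finset.induction_on with
    | empty =>
      refine ⟨(preQSubmodule n L δ k).zero_mem, ?_⟩
      simpa using secInner_smul_left (H := H) (j := j) 0 (0 : Sec L δ k) r
    | insert i S hi ih =>
      have hm : c i • u i ∈ preQ n L δ k := (preQSubmodule n L δ k).smul_mem (c i) (hu i)
      rw [Finset.sum_insert hi]
      refine ⟨(preQSubmodule n L δ k).add_mem hm ih.1, ?_⟩
      rw [secInner_add_left hΩ hL hj hm ih.1 hr, ih.2, secInner_smul_left, h, mul_zero, add_zero]
  rw [Fintype.linearCombination_apply]
  exact (key Finset.univ).2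

/-- The generator of the evolution on a frame, with its compression to the span of the frame. -/
theorem exists_generator (hk : 1 ≤ k) (hΩ : IsSymplectic Ω) (hf : ContMDiff 𝓘(ℝ, Model n) 𝓘(ℝ, ℝ) ∞ f)
    (hL : IsPrequantization Ω nab) (hφ : IsFlow (hamVF Ω f) φ) (hΦ : IsExp nab f φ Φ)
    (hj : IsCompatible Ω j₀) (hθ : IsHalfFormLift H φ j₀ θ) {d : ℕ} {e : Fin d → Sec L δ k}
    (he : ∀ i, e i ∈ preQ n L δ k) (hinj : Function.Injective (Fintype.linearCombination ℂ e)) :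
    ∃ (σ : Fin d → Sec L δ k) (A : (Fin d → ℂ) →ₗ[ℂ] (Fin d → ℂ)), (∀ i, σ i ∈ preQ n L δ k) ∧
      (∀ i t, HasTimeDeriv (fun r => evolution H j₀ Φ θ r (e i)) (evolution H j₀ Φ θ t (σ i)) t) ∧
      (∀ c, IsOp nab H f φ j₀ (Fintype.linearCombination ℂ e c)
        ((1 / (Complex.I * k)) • Fintype.linearCombination ℂ σ c)) ∧
      ∀ c c', secInner H j₀ (Fintype.linearCombination ℂ σ c - Fintype.linearCombination ℂ e (A c))
        (Fintype.linearCombination ℂ e c') = 0 := by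
  have h1 : ∀ i, ∃ s', HasTimeDeriv (fun r => evolution H j₀ Φ θ r (e i)) s' 0 := fun i =>
    (exists_hasTimeDeriv_evolution hk hΩ hf hL hφ hΦ hj hθ (he i) 0).imp fun _ h => h.1
  choose σ hσ using h1
  have hσm : ∀ i, σ i ∈ preQ n L δ k := fun i =>
    (hσ i).mem_preQ (smoothFamilyOn_evolution hΩ hf hL hφ hΦ hj hθ (he i))
  have h2 : ∀ i, ∃ b : Fin d → ℂ, ∀ c', secInner H j₀ (σ i - Fintype.linearCombination ℂ e b)
      (Fintype.linearCombination ℂ e c') = 0 := fun i => by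
    simpa only [Fintype.linearCombination_apply] using
      exists_orthogonal_projection (H := H) hΩ hL hj he (fun c hc => hinj (by
        rw [map_zero, Fintype.linearCombination_apply, hc])) (hσm i)
  choose b hb using h2
  -- `σ i` is the derivative of the evolution of `e i` at time 0 and `b i` holds the coordinates of
  -- its orthogonal projection, which are the columns of `A`.
  refine ⟨σ, Fintype.linearCombination ℂ b, hσm, fun i t => hasTimeDeriv_evolution hΩ hf hL hφ hΦ hj hθ (hσ i) t,
    fun c => ?_, fun c c' => ?_⟩
  -- At time 0 the evolution is the identity, so the Schrödinger equation identifies the generator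
  -- with `i k Op_k(f)`.
  · obtain ⟨s', hs', hop⟩ := exists_hasTimeDeriv_evolution (H := H) (θ := θ) hk hΩ hf hL hφ hΦ hj hθ
      (linearCombination_mem_preQ he c) 0
    have h3 := HasTimeDeriv.linearCombination hσ (hasDerivAt_const 0 c)
    rw [map_zero, add_zero] at h3
    simp only [evolution_linearCombination] at hs'
    rw [evolution_zero hΦ hφ hθ, hs'.unique h3] at hop
    exact hop
  · have h3 : Fintype.linearCombination ℂ σ c - Fintype.linearCombination ℂ e (Fintype.linearCombination ℂ b c) =
        Fintype.linearCombination ℂ (fun i => σ i - Fintype.linearCombination ℂ e (b i)) c := by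
      rw [Fintype.linearCombination_apply ℂ b c, map_sum]
      simp only [map_smul]
      rw [Fintype.linearCombination_apply, Fintype.linearCombination_apply, ← Finset.sum_sub_distrib]
      exact Finset.sum_congr rfl fun i _ => (smul_sub _ _ _).symm
    rw [h3]
    exact secInner_linearCombination_left hΩ hL hj (fun i => sub_mem_preQ (hσm i) (linearCombination_mem_preQ he _))
      (linearCombination_mem_preQ he c') (fun i => hb i c') c

/-- The equation of parallel sections in a frame given by the action. -/
theorem hasCovDerivQ_zero_iff (hΩ : IsSymplectic Ω) (hf : ContMDiff 𝓘(ℝ, Model n) 𝓘(ℝ, ℝ) ∞ f)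
    (hL : IsPrequantization Ω nab) (hφ : IsFlow (hamVF Ω f) φ) (hΦ : IsExp nab f φ Φ)
    (hj : IsCompatible Ω j₀) (hθ : IsHalfFormLift H φ j₀ θ) {d : ℕ} {e σ : Fin d → Sec L δ k}
    (hem : ∀ i, e i ∈ preQ n L δ k) (hinj : Function.Injective (Fintype.linearCombination ℂ e))
    {t : ℝ} (hrange : range (Fintype.linearCombination ℂ fun i => action Φ θ t (e i)) = quant nab H k (pullbackEnd (φ t) j₀))
    {A : (Fin d → ℂ) →ₗ[ℂ] (Fin d → ℂ)} (hσm : ∀ i, σ i ∈ preQ n L δ k)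
    (hσ : ∀ i t, HasTimeDeriv (fun r => evolution H j₀ Φ θ r (e i)) (evolution H j₀ Φ θ t (σ i)) t)
    (hA : ∀ c c', secInner H j₀ (Fintype.linearCombination ℂ σ c - Fintype.linearCombination ℂ e (A c))
        (Fintype.linearCombination ℂ e c') = 0) {c : ℝ → Fin d → ℂ} {c' : Fin d → ℂ} (hc : HasDerivAt c c' t) :
    HasCovDerivQ nab H (fun t => pullbackEnd (φ t) j₀)
      (fun r => Fintype.linearCombination ℂ (fun i => action Φ θ r (e i)) (c r)) 0 t ↔ c' = -A (c t) := by
  have hcs := hφ.isSmoothCurve_pullbackEnd (hΦ.omega_mfderiv hΩ hf hL hφ) hj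
  have hd := HasTimeDeriv.linearCombination (fun i => hσ i t) hc
  rw [← evolution_linearCombination, ← evolution_linearCombination] at hd
  have hadd : evolution H j₀ Φ θ t (Fintype.linearCombination ℂ σ (c t)) +
      evolution H j₀ Φ θ t (Fintype.linearCombination ℂ e c') = evolution H j₀ Φ θ t
        (Fintype.linearCombination ℂ σ (c t) + Fintype.linearCombination ℂ e c') := by
    ext x
    simp only [evolution, Pi.add_apply, action, map_add, smul_add]
  rw [hadd] at hd
  -- Dividing by the transport factor turns the action into the evolution, whose derivative is the
  -- evolution of the generator. The covariant derivative is therefore the action applied to a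
  -- combination of the `σ i` and `e i`.
  have hcov : ∀ w, HasCovDerivP H (fun t => pullbackEnd (φ t) j₀)
      (fun r => Fintype.linearCombination ℂ (fun i => action Φ θ r (e i)) (c r)) w t ↔
      w = action Φ θ t (Fintype.linearCombination ℂ σ (c t) + Fintype.linearCombination ℂ e c') := by
    intro w
    rw [hasCovDerivP_iff_transportFactor H hcs]
    have h1 : (fun r x => (transportFactor H (fun t => pullbackEnd (φ t) j₀) r x)⁻¹ •
        Fintype.linearCombination ℂ (fun i => action Φ θ r (e i)) (c r) x) =
        fun r => Fintype.linearCombination ℂ (fun i => evolution H j₀ Φ θ r (e i)) (c r) := by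
      ext r x
      rw [← evolution_linearCombination, ← action_linearCombination]
      rfl
    rw [h1]
    constructor
    · intro h
      have h2 := h.unique hd
      ext x
      rw [action_eq_smul_evolution (H := H) (j₀ := j₀), ← h2, smul_inv_smul₀ (transportFactor_ne_zero H t x)]
    · rintro rfl
      exact hd
  have hmem := fun c => linearCombination_mem_preQ (n := n) hem c
  have hsplit : ∀ c'', secInner H j₀ (Fintype.linearCombination ℂ σ (c t) + Fintype.linearCombination ℂ e c')
      (Fintype.linearCombination ℂ e c'') =
      secInner H j₀ (Fintype.linearCombination ℂ e (A (c t) + c')) (Fintype.linearCombination ℂ e c'') := by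
    intro c''
    have h1 : Fintype.linearCombination ℂ σ (c t) + Fintype.linearCombination ℂ e c' =
        (Fintype.linearCombination ℂ σ (c t) - Fintype.linearCombination ℂ e (A (c t))) +
          Fintype.linearCombination ℂ e (A (c t) + c') := by
      rw [map_add]
      abel
    rw [h1, secInner_add_left hΩ hL hj (sub_mem_preQ (linearCombination_mem_preQ hσm _) (hmem _)) (hmem _) (hmem _),
      hA, zero_add]
  -- The action is unitary and carries the quantum space at `j₀` onto the one at time `t`, so
  -- orthogonality may be tested at `j₀`, where the coefficients no longer depend on time.
  have hproj : IsProj nab H (pullbackEnd (φ t) j₀) (action Φ θ t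
      (Fintype.linearCombination ℂ σ (c t) + Fintype.linearCombination ℂ e c')) 0 ↔
      ∀ c'', secInner H j₀ (Fintype.linearCombination ℂ e (A (c t) + c')) (Fintype.linearCombination ℂ e c'') = 0 := by
    constructor
    · intro h c''
      have h1 := h.2 (action Φ θ t (Fintype.linearCombination ℂ e c'')) (by
        rw [action_linearCombination, ← hrange]
        exact mem_range_self _)
      rwa [sub_zero, secInner_action hΩ hf hL hφ hΦ hj hθ, hsplit] at h1
    · intro h
      refine ⟨hrange ▸ ⟨0, map_zero _⟩, fun r hr => ?_⟩
      rw [← hrange] at hr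
      obtain ⟨c'', rfl⟩ := hr
      rw [← action_linearCombination, sub_zero, secInner_action hΩ hf hL hφ hΦ hj hθ, hsplit, h]
  have hzero : (∀ c'', secInner H j₀ (Fintype.linearCombination ℂ e (A (c t) + c'))
      (Fintype.linearCombination ℂ e c'') = 0) ↔ A (c t) + c' = 0 := by
    constructor
    · intro h
      refine hinj ?_
      rw [map_zero]
      exact eq_zero_of_secInner_self hΩ hL hj (hmem _) (h _)
    · intro h c''
      rw [h, map_zero]
      simpa using secInner_smul_left (H := H) (j := j₀) 0 (0 : Sec L δ k) (Fintype.linearCombination ℂ e c'')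
  rw [eq_neg_iff_add_eq_zero, add_comm c', ← hzero, ← hproj]
  constructor
  · rintro ⟨w, hw, h⟩
    rwa [(hcov w).1 hw] at h
  · intro h
    exact ⟨_, (hcov _).2 rfl, h⟩

end TransportQ

/-! ### Parallel transport and the Schrödinger equation -/

section Main
variable {n : ℕ} {M : Type*} [TopologicalSpace M] [ChartedSpace (Model n) M]
  [IsManifold 𝓘(ℝ, Model n) ∞ M] [T2Space M] {Ω : ∀ x : M, Tan n x →L[ℝ] Tan n x →L[ℝ] ℝ}
  {L : M → Type*} [TopologicalSpace (TotalSpace ℂ L)] [∀ x, NormedAddCommGroup (L x)]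
  [∀ x, InnerProductSpace ℂ (L x)] [FiberBundle ℂ L] [VectorBundle ℂ ℂ L] [VectorBundle ℝ ℂ L]
  [ContMDiffVectorBundle ∞ ℂ L 𝓘(ℝ, Model n)]
  {nab : CovariantDerivative 𝓘(ℝ, Model n) ℂ L} [CovariantDerivative.ContMDiffCovariantDerivative nab ∞]
  {δ : M → Type*} [TopologicalSpace (TotalSpace ℂ δ)] [∀ x, AddCommGroup (δ x)]
  [∀ x, Module ℂ (δ x)] [∀ x, TopologicalSpace (δ x)] [FiberBundle ℂ δ] [VectorBundle ℂ ℂ δ]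
  [VectorBundle ℝ ℂ δ] [ContMDiffVectorBundle ∞ ℂ δ 𝓘(ℝ, Model n)]
  {H : HalfFormFamily Ω δ} {k : ℕ} {f : M → ℝ} {φ : ℝ → M → M} {Φ : ∀ t x, L x ≃ₗ[ℂ] L (φ t x)}
  {j j₀ : EndField n M} {θ : ∀ t x, δ (φ t x) →ₗ[ℂ] δ x}
variable [CompactSpace M] [MeasurableSpace M] [BorelSpace M]

/-- The frame of a quantum space given by the action. -/
def frameEquiv {Φ : ∀ t x, L x ≃ₗ[ℂ] L (φ t x)} {t : ℝ} {d : ℕ} {e : Fin d → Sec L δ k}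
    (hinj : Function.Injective (Fintype.linearCombination ℂ fun i => action Φ θ t (e i)))
    (hrange : range (Fintype.linearCombination ℂ fun i => action Φ θ t (e i)) = quant nab H k (pullbackEnd (φ t) j₀)) :
    (Fin d → ℂ) ≃ quant nab H k (pullbackEnd (φ t) j₀) :=
  Equiv.ofBijective (fun c => ⟨Fintype.linearCombination ℂ (fun i => action Φ θ t (e i)) c, hrange ▸ mem_range_self c⟩)
    ⟨fun _ _ h => hinj (congrArg Subtype.val h), fun q => by
      obtain ⟨c, hc⟩ := hrange.symm.subset q.2
      exact ⟨c, Subtype.ext hc⟩⟩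

/-- Parallel transport of the prequantum spaces and the evolution. -/
theorem prequantum_transport (hk : 1 ≤ k) (hΩ : IsSymplectic Ω) (hf : ContMDiff 𝓘(ℝ, Model n) 𝓘(ℝ, ℝ) ∞ f)
    (hL : IsPrequantization Ω nab) (hφ : IsFlow (hamVF Ω f) φ) (hΦ : IsExp nab f φ Φ)
    (hj : IsCompatible Ω j₀) (hθ : IsHalfFormLift H φ j₀ θ) :
    ∃ T : ∀ _ : ℝ, preQ n L δ k ≃ preQ n L δ k,
      IsParallelTransport (fun _ => preQ n L δ k)
        (IsParallelP H (fun t => pullbackEnd (φ t) j₀)) T ∧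
      (∀ T', IsParallelTransport (fun _ => preQ n L δ k)
        (IsParallelP H (fun t => pullbackEnd (φ t) j₀)) T' → T' = T) ∧
      ∀ s₀ ∈ preQ n L δ k, ∃ P : ℝ → preQ n L δ k,
        (∀ t, (T t (P t) : Sec L δ k) = action Φ θ t s₀) ∧
        SmoothFamilyOn (n := n) univ (fun t => (P t : Sec L δ k)) ∧
        ∀ t, ∃ s' : Sec L δ k, HasTimeDeriv (fun r => (P r : Sec L δ k)) s' t ∧
          IsOp nab H f φ j₀ (P t) ((1 / (Complex.I * k)) • s') := by
  have hc := hφ.isSmoothCurve_pullbackEnd (hΦ.omega_mfderiv hΩ hf hL hφ) hj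
  obtain ⟨T, hT, huniq, hTm⟩ := exists_isParallelTransportP (L := L) (k := k) H hc
  refine ⟨T, hT, huniq, fun s₀ hs₀ =>
    ⟨fun t => ⟨evolution H j₀ Φ θ t s₀, evolution_mem_preQ hΩ hf hL hφ hΦ hj hθ hs₀ t⟩, fun t => ?_,
      smoothFamilyOn_evolution hΩ hf hL hφ hΦ hj hθ hs₀, exists_hasTimeDeriv_evolution hk hΩ hf hL hφ hΦ hj hθ hs₀⟩⟩
  rw [hTm]
  exact funext fun x => (action_eq_smul_evolution t s₀ x).symm

/-- Parallel transport of the quantum spaces and the evolution. -/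
theorem quantum_transport (hk : 1 ≤ k) (hΩ : IsSymplectic Ω) (hf : ContMDiff 𝓘(ℝ, Model n) 𝓘(ℝ, ℝ) ∞ f)
    (hL : IsPrequantization Ω nab) (hφ : IsFlow (hamVF Ω f) φ) (hΦ : IsExp nab f φ Φ)
    (hj : IsCompatible Ω j₀) (hθ : IsHalfFormLift H φ j₀ θ)
    (hsub : IsSubbundle nab H k (fun t => pullbackEnd (φ t) j₀)) :
    ∃ T : ∀ t, quant nab H k (pullbackEnd (φ 0) j₀) ≃ quant nab H k (pullbackEnd (φ t) j₀),
      IsParallelTransport (fun t => quant nab H k (pullbackEnd (φ t) j₀))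
        (IsParallelQ nab H (fun t => pullbackEnd (φ t) j₀)) T ∧
      (∀ T', IsParallelTransport (fun t => quant nab H k (pullbackEnd (φ t) j₀))
        (IsParallelQ nab H (fun t => pullbackEnd (φ t) j₀)) T' → T' = T) ∧
      ∀ s₀ ∈ quant nab H k j₀, ∃ P : ℝ → quant nab H k (pullbackEnd (φ 0) j₀),
        (∀ t, (T t (P t) : Sec L δ k) = action Φ θ t s₀) ∧
        SmoothFamilyOn (n := n) univ (fun t => (P t : Sec L δ k)) ∧
        ∀ t, ∃ s' w : Sec L δ k, HasTimeDeriv (fun r => (P r : Sec L δ k)) s' t ∧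
          IsOp nab H f φ j₀ (P t) w ∧ IsProj nab H j₀ w ((1 / (Complex.I * k)) • s') := by
  obtain ⟨d, e, her, hinj, hact⟩ := exists_action_frame hΩ hf hL hφ hΦ hj hθ hsub
  have hem : ∀ i, e i ∈ preQ n L δ k := fun i => by
    have h1 : e i ∈ quant nab H k j₀ := her ▸ ⟨Pi.single i 1, by simp⟩
    exact h1.1
  obtain ⟨σ, A, hσm, hσ, hop, hA⟩ := exists_generator (H := H) (θ := θ) hk hΩ hf hL hφ hΦ hj hθ hem hinj
  obtain ⟨g, hg0, hgd, hgd', hgs, hgs', hgu⟩ :=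
    exists_linear_flow ((LinearMap.toContinuousLinearMap A).restrictScalars ℝ)
  let ι := fun t => frameEquiv (hact t).1 (hact t).2
  have hι : ∀ t c, (ι t c : Sec L δ k) = Fintype.linearCombination ℂ (fun i => action Φ θ t (e i)) c := fun _ _ => rfl
  have hι0 : ∀ c, (ι 0 c : Sec L δ k) = Fintype.linearCombination ℂ e c := fun c => by
    rw [hι, ← action_linearCombination, action_zero (H := H) (j₀ := j₀) hΦ hφ hθ]
  have hsm : ∀ i, SmoothFamilyOn (n := n) univ (fun t => action Φ θ t (e i)) := fun i =>
    smoothFamilyOn_action hΩ hf hL hφ hΦ hj hθ (hem i)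
  -- In the frames given by the action, the parallel transport is `exp (-t A)`.
  refine ⟨fun t => (ι 0).symm.trans ((g t).trans (ι t)), fun s₀ => ⟨⟨?_, fun t => Subtype.coe_prop _, fun t => ?_⟩, ?_⟩,
    fun T' hT' => ?_, fun s₀ hs₀ => ?_⟩
  · exact smoothFamilyOn_linearCombination hsm (hgs ((ι 0).symm s₀))
  · exact (hasCovDerivQ_zero_iff hΩ hf hL hφ hΦ hj hθ hem hinj (hact t).2 hσm hσ hA (hgd ((ι 0).symm s₀) t)).2 rfl
  · simp [hg0]
  · ext t s₀ : 2
    -- The coordinates of another parallel family. The smoothness of the family makes them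
    -- differentiable, by Cramer's rule, and they then solve the same linear equation.
    let γ : ℝ → Fin d → ℂ := fun t => (ι t).symm (T' t s₀)
    have hγ : ∀ t, Fintype.linearCombination ℂ (fun i => action Φ θ t (e i)) (γ t) = T' t s₀ := fun t => by
      rw [← hι, Equiv.apply_symm_apply]
    obtain ⟨⟨h1, h2, h3⟩, h4⟩ := hT' s₀
    simp only [← hγ] at h1 h3
    have hγd : ∀ t, HasDerivAt γ (-A (γ t)) t := fun t => by
      have h5 := (differentiableAt_frame_coefficients hsm (hact t).1 h1).hasDerivAt
      rw [(hasCovDerivQ_zero_iff hΩ hf hL hφ hΦ hj hθ hem hinj (hact t).2 hσm hσ hA h5).1 (h3 t)] at h5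
      exact h5
    have h6 : γ 0 = (ι 0).symm s₀ := congrArg (ι 0).symm (Subtype.ext h4)
    have h7 := hgu γ hγd t
    rw [h6] at h7
    exact (Equiv.symm_apply_eq (ι t)).1 h7
  · obtain ⟨c₀, rfl⟩ := her.symm.subset hs₀
    -- The action keeps the coordinates `c₀` fixed, so undoing the transport leaves `exp (t A) c₀`,
    -- whose derivative is `A` applied to it. The operator gives the combination of the `σ i`
    -- divided by `i k`, and by the choice of `A` its projection has coordinates given by `A`
    -- divided by `i k`.
    refine ⟨fun t => ι 0 ((g t).symm c₀), fun t => ?_, ?_, fun t =>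
      ⟨Fintype.linearCombination ℂ e (A ((g t).symm c₀)),
        (1 / (Complex.I * k)) • Fintype.linearCombination ℂ σ ((g t).symm c₀), ?_, ?_, ?_, fun r hr => ?_⟩⟩
    · simp only [Equiv.trans_apply, Equiv.symm_apply_apply, Equiv.apply_symm_apply]
      rw [hι, action_linearCombination]
    · simp only [hι0]
      exact smoothFamilyOn_linearCombination (fun i => smoothFamilyOn_const (hem i)) (hgs' c₀)
    · simp only [hι0]
      have h1 := HasTimeDeriv.linearCombination (fun i => hasTimeDeriv_const (e i) t) (hgd' c₀ t)
      have h2 : Fintype.linearCombination ℂ (fun _ : Fin d => (0 : Sec L δ k)) ((g t).symm c₀) = 0 := by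
        simp [Fintype.linearCombination_apply]
      exact (zero_add (Fintype.linearCombination ℂ e (A ((g t).symm c₀)))) ▸ h2 ▸ h1
    · rw [hι0]
      exact hop _
    · rw [← map_smul, ← her]
      exact mem_range_self _
    · rw [← her] at hr
      obtain ⟨c', rfl⟩ := hr
      have h1 : ∀ (a : ℂ) (s r : Sec L δ k), a • s - a • r = a • (s - r) := fun a s r =>
        funext fun x => (smul_sub a (s x) (r x)).symm
      rw [h1, secInner_smul_left, hA, mul_zero]

end Main

end HalfFormQuantization

end

/-- The fibre at time 0 appears as the one of `pullbackEnd (φ 0) j₀`, the value at 0 of the family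
of fibres; this structure equals `j₀` by `IsFlow.pullbackEnd_zero`. The relation `T t (P t) = U_t
s₀` determines `P t` because `T t` is bijective, and the derivative `s'` is unique by
`HasTimeDeriv.unique`. -/
theorem mainTheorem11 {n : ℕ} {M : Type*} [TopologicalSpace M] [ChartedSpace (Model n) M]
    [IsManifold 𝓘(ℝ, Model n) ∞ M] [T2Space M] [CompactSpace M] [ConnectedSpace M]
    [MeasurableSpace M] [BorelSpace M]
    (Ω : ∀ x : M, Tan n x →L[ℝ] Tan n x →L[ℝ] ℝ) (hΩ : IsSymplectic Ω)
    {L : M → Type*} [TopologicalSpace (TotalSpace ℂ L)] [∀ x, NormedAddCommGroup (L x)]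
    [∀ x, InnerProductSpace ℂ (L x)] [FiberBundle ℂ L] [VectorBundle ℂ ℂ L] [VectorBundle ℝ ℂ L]
    [ContMDiffVectorBundle ∞ ℂ L 𝓘(ℝ, Model n)]
    (nab : CovariantDerivative 𝓘(ℝ, Model n) ℂ L) [CovariantDerivative.ContMDiffCovariantDerivative nab ∞]
    (hL : IsPrequantization Ω nab)
    {δ : M → Type*} [TopologicalSpace (TotalSpace ℂ δ)] [∀ x, AddCommGroup (δ x)]
    [∀ x, Module ℂ (δ x)] [∀ x, TopologicalSpace (δ x)] [FiberBundle ℂ δ] [VectorBundle ℂ ℂ δ]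
    [VectorBundle ℝ ℂ δ] [ContMDiffVectorBundle ∞ ℂ δ 𝓘(ℝ, Model n)]
    (H : HalfFormFamily Ω δ) (k : ℕ) (hk : 1 ≤ k)
    (f : M → ℝ) (hf : ContMDiff 𝓘(ℝ, Model n) 𝓘(ℝ, ℝ) ∞ f)
    (φ : ℝ → M → M) (hφ : IsFlow (hamVF Ω f) φ)
    (Φ : ∀ t x, L x ≃ₗ[ℂ] L (φ t x)) (hΦ : IsExp nab f φ Φ)
    (j₀ : EndField n M) (hj₀ : IsCompatible Ω j₀)
    (θ : ∀ t x, δ (φ t x) →ₗ[ℂ] δ x) (hθ : IsHalfFormLift H φ j₀ θ) :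
    (∃ T : ∀ _ : ℝ, preQ n L δ k ≃ preQ n L δ k,
      IsParallelTransport (fun _ => preQ n L δ k)
        (IsParallelP H (fun t => pullbackEnd (φ t) j₀)) T ∧
      (∀ T', IsParallelTransport (fun _ => preQ n L δ k)
        (IsParallelP H (fun t => pullbackEnd (φ t) j₀)) T' → T' = T) ∧
      ∀ s₀ ∈ preQ n L δ k, ∃ P : ℝ → preQ n L δ k,
        (∀ t, (T t (P t) : Sec L δ k) = action Φ θ t s₀) ∧
        SmoothFamilyOn (n := n) univ (fun t => (P t : Sec L δ k)) ∧
        ∀ t, ∃ s' : Sec L δ k, HasTimeDeriv (fun r => (P r : Sec L δ k)) s' t ∧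
          IsOp nab H f φ j₀ (P t) ((1 / (Complex.I * k)) • s')) ∧
    (IsIntegrable j₀ → IsSubbundle nab H k (fun t => pullbackEnd (φ t) j₀) →
      ∃ T : ∀ t, quant nab H k (pullbackEnd (φ 0) j₀) ≃ quant nab H k (pullbackEnd (φ t) j₀),
        IsParallelTransport (fun t => quant nab H k (pullbackEnd (φ t) j₀))
          (IsParallelQ nab H (fun t => pullbackEnd (φ t) j₀)) T ∧
        (∀ T', IsParallelTransport (fun t => quant nab H k (pullbackEnd (φ t) j₀))
          (IsParallelQ nab H (fun t => pullbackEnd (φ t) j₀)) T' → T' = T) ∧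
        ∀ s₀ ∈ quant nab H k j₀, ∃ P : ℝ → quant nab H k (pullbackEnd (φ 0) j₀),
          (∀ t, (T t (P t) : Sec L δ k) = action Φ θ t s₀) ∧
          SmoothFamilyOn (n := n) univ (fun t => (P t : Sec L δ k)) ∧
          ∀ t, ∃ s' w : Sec L δ k, HasTimeDeriv (fun r => (P r : Sec L δ k)) s' t ∧
            IsOp nab H f φ j₀ (P t) w ∧ IsProj nab H j₀ w ((1 / (Complex.I * k)) • s')) := by
  exact ⟨prequantum_transport hk hΩ hf hL hφ hΦ hj₀ hθ, fun _ hsub => quantum_transport hk hΩ hf hL hφ hΦ hj₀ hθ hsub⟩
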